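/- Let $M$ be a smooth manifold and let $\mathcal F$ be a singular foliation on $M$, i.e. a locally finitely generated sheaf of $C^\infty_M$-submodules of the sheaf of vector fields, closed under the Lie bracket. A map $\phi$ from a subset $U$ of a Euclidean space to $\mathcal F(M)$ is called smooth if near each $(u_0,x_0)\in U\times M$ it has the form $\phi(u)_x=\sum_{i=1}^n c_i(u,x)(G_i)_x$ with smooth $c_i$ and local sections $G_i$ of $\mathcal F$. Write $I_x$ for the ideal of functions vanishing at $x$, $T_xL_x=\{X_x : X\in\mathcal F(M)\}$ for the tangent space at $x$ of the leaf $L_x$ through $x$, and $\Phi^t_X$ for the (local) flow of a time-dependent vector field $X$. *$\mathcal F$-paths.* An $\mathcal F$-path is a pair $(X,p)$ of a smooth $X\colon[0,1]\to\mathcal F(M)$ and an integral curve $p\colon[0,1]\to M$ of $X$; its source is $p(0)$ and its target $p(1)$. Let $\mathcal P(\mathcal F)$ be the set of $\mathcal F$-paths, with the diffeology in which a family $(X_u,p_u)$ is a plot iff $(u,t)\mapsto X_u(t)$ and $(u,t)\mapsto p_u(t)$ are smooth. Fix a smooth $r\colon[0,1]\to[0,1]$ equal to $0$ near $0$ and to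 $1$ near $1$; if $p(1)=q(0)$, the concatenation $(Y,q)\odot(X,p)$ is $(2r'(2t)X(r(2t)),\,p(r(2t)))$ for $t\le\frac12$ and $(2r'(2t-1)Y(r(2t-1)),\,q(r(2t-1)))$ for $t>\frac12$. *$\mathcal F$-homotopy.* $(X_0,p_0)$ and $(X_1,p_1)$ are $\mathcal F$-homotopic if there are smooth $X\colon[0,1]^2\to\mathcal F(M)$ and $p\colon[0,1]^2\to M$ such that $(X(\cdot,s),p(\cdot,s))$ is an $\mathcal F$-path for every $s$, equal to $(X_i,p_i)$ for $s=i\in\{0,1\}$, such that $p(0,s)$ is independent of $s$, and such that the complement $Y$, defined by $Y(t,s)|_{\Phi^{t,s}_X(x)}=\frac{d}{du}\big|_{u=s}\Phi^{t,u}_X(x)$ with $\Phi^{t,s}_X$ the time-$t$ flow of $X(\cdot,s)$, satisfies, near $p(1,s)$, $Y(1,s)\in I_{p(1,s)}\mathcal F$ for all $s\in[0,1]$. The fundamental groupoid $\Pi_1(\mathcal F)$ is the set of $\mathcal F$-homotopy classes of $\mathcal F$-paths, with the quotient diffeology. *Holonomy.* For each $x\in M$ choose a slice $S_x$ through $x$: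 an embedded submanifold containing $x$ with $T_yM=T_yS_x+T_yL_y$ for all $y\in S_x$ and $T_xS_x\cap T_xL_x=0$. Let $\mathcal F_{S_x}$ be the pullback of $\mathcal F$ to $S_x$ (the vector fields on $S_x$ that are locally $C^\infty(S_x)$-combinations of restrictions of elements of $\mathcal F$), let $\mathrm{Diff}_{\mathcal F}(S_x,S_y)$ be the set of germs at $x$ of foliation-preserving diffeomorphisms $S_x\to S_y$ taking $x$ to $y$, let $\exp(I_y\mathcal F_{S_y})$ be the group of germs at $y$ of diffeomorphisms of $S_y$ generated by the time-one flows of time-dependent elements of $I_y\mathcal F_{S_y}$, and let $\mathrm{HT}=\bigsqcup_{x,y}\mathrm{Diff}_{\mathcal F}(S_x,S_y)/\exp(I_y\mathcal F_{S_y})$. The holonomy $\mathrm{Hol}(X,p)\in\mathrm{HT}$ of an $\mathcal F$-path is the class of $\Phi^1_Z\circ\Phi^1_X|_{S_{p(0)}}$, where $Z$ is any time-dependent element of $I_{p(1)}\mathcal F$ for which this maps a neighbourhood of $p(0)$ in $S_{p(0)}$ into $S_{p(1)}$. The holonomy groupoid $\mathcal H(\mathcal F)$ is the quotient of $\mathcal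 P(\mathcal F)$ by the equivalence relation generated by having the same holonomy, with the quotient diffeology. **Theorem.** The holonomy of every $\mathcal F$-path exists and is unique, and $\mathcal F$-homotopic $\mathcal F$-paths have the same holonomy. Hence the holonomy groupoid is a quotient of the fundamental groupoid: source, target and concatenation of $\mathcal F$-paths induce groupoid structures over $M$ on $\Pi_1(\mathcal F)$ and on $\mathcal H(\mathcal F)$, and the identity of $\mathcal P(\mathcal F)$ induces a surjective morphism of groupoids $\Pi_1(\mathcal F)\to\mathcal H(\mathcal F)$ over the identity of $M$, for which the diffeology of $\mathcal H(\mathcal F)$ is the quotient diffeology. -/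

import Mathlib

open Set Filter Topology TopologicalSpace
open scoped Manifold ContDiff

noncomputable section

namespace SingFol

/-! ### Subsheaves of modules of vector fields, singular foliations -/

section Sheaf

variable (E : Type*) [NormedAddCommGroup E] [NormedSpace ℝ E]
  (N : Type*) [TopologicalSpace N] [ChartedSpace E N] [IsManifold 𝓘(ℝ, E) ∞ N]

/-- Set-theoretic vector fields on `N`. A vector field on an open set `U` is represented by any
field on `N` with the prescribed values on `U`; the values outside `U` are irrelevant. -/
abbrev VF : Type _ := ∀ x : N, TangentSpace 𝓘(ℝ, E) x

/-- Smoothness of a vector field on a set. -/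
def SmoothVFOn (X : VF E N) (U : Set N) : Prop :=
  ContMDiffOn 𝓘(ℝ, E) 𝓘(ℝ, E).tangent ∞ (fun x => (⟨x, X x⟩ : TangentBundle 𝓘(ℝ, E) N)) U

/-- A sheaf of `C^∞`-submodules of the sheaf of smooth vector fields on `N`;
`Sec U X` says that `X` restricted to `U` is a section over `U`. -/
structure VFModule where
  Sec : Opens N → VF E N → Prop
  congr : ∀ {U : Opens N} {X Y : VF E N}, (∀ x ∈ U, X x = Y x) → Sec U X → Sec U Y
  smooth : ∀ {U : Opens N} {X : VF E N}, Sec U X → SmoothVFOn E N X U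
  zero : ∀ U : Opens N, Sec U 0
  add : ∀ {U : Opens N} {X Y : VF E N}, Sec U X → Sec U Y → Sec U (X + Y)
  smul : ∀ {U : Opens N} {f : N → ℝ} {X : VF E N}, ContMDiffOn 𝓘(ℝ, E) 𝓘(ℝ, ℝ) ∞ f U →
    Sec U X → Sec U (fun x => f x • X x)
  restrict : ∀ {U V : Opens N} {X : VF E N}, V ≤ U → Sec U X → Sec V X
  glue : ∀ {U : Opens N} {X : VF E N},
    (∀ x ∈ U, ∃ V : Opens N, x ∈ V ∧ V ≤ U ∧ Sec V X) → Sec U X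

/-- A singular foliation: a locally finitely generated, involutive `C^∞`-submodule of the sheaf of
vector fields. -/
structure SingularFoliation extends VFModule E N where
  involutive : ∀ {U : Opens N} {X Y : VF E N}, Sec U X → Sec U Y →
    Sec U (VectorField.mlieBracket 𝓘(ℝ, E) X Y)
  locallyFinitelyGenerated : ∀ x : N, ∃ U : Opens N, x ∈ U ∧ ∃ (n : ℕ) (G : Fin n → VF E N),
    (∀ i, Sec U (G i)) ∧ ∀ Y : VF E N, Sec U Y → ∃ c : Fin n → N → ℝ,
      (∀ i, ContMDiffOn 𝓘(ℝ, E) 𝓘(ℝ, ℝ) ∞ (c i) U) ∧ ∀ y ∈ U, Y y = ∑ i, c i y • G i y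

end Sheaf

section Basic

variable {E : Type*} [NormedAddCommGroup E] [NormedSpace ℝ E]
  {N : Type*} [TopologicalSpace N] [ChartedSpace E N] [IsManifold 𝓘(ℝ, E) ∞ N]

/-- `X` (restricted to `U`) lies in `I_x 𝓕(U)`, where `I_x` is the ideal of functions vanishing at
`x`. -/
def VFModule.IdealSec (F : VFModule E N) (x : N) (U : Opens N) (X : VF E N) : Prop :=
  ∃ (n : ℕ) (f : Fin n → N → ℝ) (G : Fin n → VF E N),
    (∀ i, ContMDiffOn 𝓘(ℝ, E) 𝓘(ℝ, ℝ) ∞ (f i) U ∧ f i x = 0 ∧ F.Sec U (G i)) ∧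
    ∀ y ∈ U, X y = ∑ i, f i y • G i y

/-- The characteristic distribution at `x`, i.e. the tangent space at `x` of the leaf through `x`:
the values at `x` of the global sections. -/
def VFModule.leafTangent (F : VFModule E N) (x : N) : Submodule ℝ (TangentSpace 𝓘(ℝ, E) x) where
  carrier := {v | ∃ X : VF E N, F.Sec ⊤ X ∧ X x = v}
  add_mem' := by
    rintro _ _ ⟨X, hX, rfl⟩ ⟨Y, hY, rfl⟩
    exact ⟨X + Y, F.add hX hY, rfl⟩
  zero_mem' := ⟨0, F.zero ⊤, rfl⟩
  smul_mem' := by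
    rintro c _ ⟨X, hX, rfl⟩
    exact ⟨fun y => c • X y, F.smul (f := fun _ => c) contMDiffOn_const hX, rfl⟩

/-- Smooth maps `φ : U → 𝓕(N)` from a subset `U` of a normed space, for the coefficient
diffeology: locally on `U` and on `N`, the map `φ` factors through smooth families of sections of a
(trivial) vector bundle, that is, `φ(u)_x = ∑ i, c_i(u, x) (G_i)_x` with smooth coefficients `c_i`
and sections `G_i` of `𝓕`. -/
def VFModule.IsPlotOn (F : VFModule E N) {W : Type*} [NormedAddCommGroup W] [NormedSpace ℝ W]
    (U : Set W) (φ : W → VF E N) : Prop :=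
  (∀ u ∈ U, F.Sec ⊤ (φ u)) ∧
  ∀ u₀ ∈ U, ∀ x₀ : N, ∃ (U' : Set W) (V : Opens N), IsOpen U' ∧ u₀ ∈ U' ∧ x₀ ∈ V ∧
    ∃ (n : ℕ) (c : Fin n → W × N → ℝ) (G : Fin n → VF E N),
      (∀ i, ContMDiffOn (𝓘(ℝ, W).prod 𝓘(ℝ, E)) 𝓘(ℝ, ℝ) ∞ (c i) ((U ∩ U') ×ˢ (V : Set N))) ∧
      (∀ i, F.Sec V (G i)) ∧
      ∀ u ∈ U ∩ U', ∀ x ∈ V, φ u x = ∑ i, c i (u, x) • G i x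

/-- `γ` is an integral curve on `[0, T]` of the time-dependent vector field `X`. -/
def IsIntegralCurve (X : ℝ → VF E N) (γ : ℝ → N) (T : ℝ) : Prop :=
  ∀ t ∈ Icc 0 T, HasMFDerivWithinAt 𝓘(ℝ, ℝ) 𝓘(ℝ, E) γ (Icc 0 T) t
    ((1 : ℝ →L[ℝ] ℝ).smulRight (X t (γ t)))

/-- The graph of the (partially defined) flow: `Φ_X^t` is defined at `x`, with value `y`. -/
def FlowsTo (X : ℝ → VF E N) (t : ℝ) (x y : N) : Prop :=
  ∃ γ : ℝ → N, IsIntegralCurve X γ t ∧ γ 0 = x ∧ γ t = y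

open Classical in
/-- The flow `Φ_X^t` as a function (with value `x` at the points `x` where it is not defined). -/
def flow (X : ℝ → VF E N) (t : ℝ) (x : N) : N :=
  if h : ∃ y, FlowsTo X t x y then h.choose else x

/-- The pullback `ι⁻¹𝓕` to `N'` of a module of vector fields along a map `ι : N' → N`: the smooth
vector fields `Y` on `N'` such that `dι(Y)` is locally a `C^∞(N')`-linear combination of fields
`G ∘ ι` with `G` in `𝓕`. -/
def VFModule.pullback (F : VFModule E N) {E' : Type*} [NormedAddCommGroup E'] [NormedSpace ℝ E']
    {N' : Type*} [TopologicalSpace N'] [ChartedSpace E' N'] [IsManifold 𝓘(ℝ, E') ∞ N']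
    (ι : N' → N) : VFModule E' N' where
  Sec U Y := SmoothVFOn E' N' Y U ∧ ∀ y ∈ U, ∃ V : Opens N', y ∈ V ∧ V ≤ U ∧
    ∃ (n : ℕ) (f : Fin n → N' → ℝ) (G : Fin n → VF E N),
      (∀ i, ContMDiffOn 𝓘(ℝ, E') 𝓘(ℝ, ℝ) ∞ (f i) V ∧ F.Sec ⊤ (G i)) ∧
      ∀ z ∈ V, mfderiv 𝓘(ℝ, E') 𝓘(ℝ, E) ι z (Y z) = ∑ i, f i z • G i (ι z)
  congr := by
    rintro U X Y h ⟨h1, h2⟩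
    refine ⟨ContMDiffOn.congr h1 fun x hx => by rw [h x hx], fun y hy => ?_⟩
    obtain ⟨V, hyV, hVU, n, f, G, hf, hG⟩ := h2 y hy
    exact ⟨V, hyV, hVU, n, f, G, hf, fun z hz => by rw [← h z (hVU hz)]; exact hG z hz⟩
  smooth h := h.1
  zero U := by
    refine ⟨?_, fun y hy => ⟨U, hy, le_rfl, 0, Fin.elim0, Fin.elim0, fun i => i.elim0, ?_⟩⟩
    · exact (Bundle.contMDiff_zeroSection ℝ (TangentSpace 𝓘(ℝ, E') : N' → Type _)).contMDiffOn
    · intro z _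
      simp only [Pi.zero_apply, map_zero, Finset.univ_eq_empty, Finset.sum_empty]
  add := by
    rintro U X Y ⟨hX, hX'⟩ ⟨hY, hY'⟩
    refine ⟨ContMDiffOn.add_section hX hY, fun y hy => ?_⟩
    obtain ⟨V, hyV, hVU, n, f, G, hf, hG⟩ := hX' y hy
    obtain ⟨V', hyV', hVU', n', f', G', hf', hG'⟩ := hY' y hy
    refine ⟨V ⊓ V', ⟨hyV, hyV'⟩, inf_le_left.trans hVU, n + n', Fin.append f f',
      Fin.append G G', fun i => ?_, fun z hz => ?_⟩
    · refine Fin.addCases (fun i => ?_) (fun i => ?_) i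
      · simpa using ⟨(hf i).1.mono inter_subset_left, (hf i).2⟩
      · simpa using ⟨(hf' i).1.mono inter_subset_right, (hf' i).2⟩
    · simp only [Pi.add_apply, map_add, Fin.sum_univ_add, Fin.append_left, Fin.append_right,
        hG z hz.1, hG' z hz.2]
  smul := by
    rintro U g X hg ⟨hX, hX'⟩
    refine ⟨ContMDiffOn.smul_section hg hX, fun y hy => ?_⟩
    obtain ⟨V, hyV, hVU, n, f, G, hf, hG⟩ := hX' y hy
    refine ⟨V, hyV, hVU, n, fun i z => g z * f i z, G,
      fun i => ⟨(hg.mono hVU).mul (hf i).1, (hf i).2⟩, fun z hz => ?_⟩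
    simp only [map_smul, hG z hz, Finset.smul_sum, mul_smul]
  restrict := by
    rintro U V X hVU ⟨hX, hX'⟩
    refine ⟨ContMDiffOn.mono hX hVU, fun y hy => ?_⟩
    obtain ⟨V', hyV, -, n, f, G, hf, hG⟩ := hX' y (hVU hy)
    exact ⟨V' ⊓ V, ⟨hyV, hy⟩, inf_le_right, n, f, G,
      fun i => ⟨(hf i).1.mono inter_subset_left, (hf i).2⟩, fun z hz => hG z hz.1⟩
  glue := by
    intro U X h
    refine ⟨fun x hx => ?_, fun y hy => ?_⟩
    · obtain ⟨V, hxV, -, hV, -⟩ := h x hx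
      exact ((hV x hxV).contMDiffAt (V.isOpen.mem_nhds hxV)).contMDiffWithinAt
    · obtain ⟨V, hyV, hVU, -, hV⟩ := h y hy
      obtain ⟨V', h1, h2, h3⟩ := hV y hyV
      exact ⟨V', h1, h2.trans hVU, h3⟩

/-- The group `exp(I_y 𝓕)` of germs at `y` of diffeomorphisms generated by the time-one flows of
time-dependent elements of `I_y 𝓕` (a function stands for its germ at `y`). -/
inductive VFModule.InExp (F : VFModule E N) (y : N) : (N → N) → Prop
  | flow (Z : ℝ → VF E N) (hZ : F.IsPlotOn (Icc 0 1) Z)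
      (hI : ∀ t ∈ Icc (0 : ℝ) 1, F.IdealSec y ⊤ (Z t)) (f : N → N)
      (hf : ∀ᶠ x in 𝓝 y, FlowsTo Z 1 x (f x)) : InExp F y f
  | comp (f g : N → N) (hf : InExp F y f) (hg : InExp F y g) : InExp F y (f ∘ g)
  | inv (f g : N → N) (hf : InExp F y f) (hfg : ∀ᶠ x in 𝓝 y, g (f x) = x) : InExp F y g

end Basic

/-! ### `𝓕`-paths and their diffeology -/

section Paths

variable {E : Type*} [NormedAddCommGroup E] [NormedSpace ℝ E]
  {M : Type*} [TopologicalSpace M] [ChartedSpace E M] [IsManifold 𝓘(ℝ, E) ∞ M]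

/-- An `𝓕`-path: a time-dependent element `X : [0,1] → 𝓕(M)` with an integral curve `p`.
Functions on `[0,1]` are represented by their extensions to `ℝ` that are constant on `(-∞,0]` and
on `[1,∞)`. -/
@[ext]
structure FPath (F : SingularFoliation E M) where
  X : ℝ → VF E M
  p : ℝ → M
  plot : F.IsPlotOn (Icc 0 1) X
  smooth : ContMDiffOn 𝓘(ℝ, ℝ) 𝓘(ℝ, E) ∞ p (Icc 0 1)
  integral : IsIntegralCurve X p 1
  X_left : ∀ t ≤ 0, X t = X 0
  X_right : ∀ t, 1 ≤ t → X t = X 1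
  p_left : ∀ t ≤ 0, p t = p 0
  p_right : ∀ t, 1 ≤ t → p t = p 1

theorem VFModule.IsPlotOn.congr {F : VFModule E M} {W : Type*} [NormedAddCommGroup W]
    [NormedSpace ℝ W] {U : Set W} {φ ψ : W → VF E M} (h : F.IsPlotOn U φ) (e : EqOn φ ψ U) :
    F.IsPlotOn U ψ := by
  refine ⟨fun u hu => e hu ▸ h.1 u hu, fun u₀ hu₀ x₀ => ?_⟩
  obtain ⟨U', V, h1, h2, h3, n, c, G, h4, h5, h6⟩ := h.2 u₀ hu₀ x₀
  exact ⟨U', V, h1, h2, h3, n, c, G, h4, h5, fun u hu x hx => by rw [← e hu.1, h6 u hu x hx]⟩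

theorem VFModule.IsPlotOn.of_local {F : VFModule E M} {W : Type*} [NormedAddCommGroup W]
    [NormedSpace ℝ W] {U : Set W} {φ : W → VF E M}
    (h : ∀ u ∈ U, ∃ O : Set W, IsOpen O ∧ u ∈ O ∧ F.IsPlotOn (U ∩ O) φ) :
    F.IsPlotOn U φ := by
  refine ⟨fun u hu => ?_, fun u₀ hu₀ x₀ => ?_⟩
  · obtain ⟨O, -, hO, h⟩ := h u hu
    exact h.1 u ⟨hu, hO⟩
  · obtain ⟨O, hO, huO, h⟩ := h u₀ hu₀
    obtain ⟨U', V, h1, h2, h3, n, c, G, h4, h5, h6⟩ := h.2 u₀ ⟨hu₀, huO⟩ x₀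
    refine ⟨O ∩ U', V, hO.inter h1, ⟨huO, h2⟩, h3, n, c, G, ?_, h5, ?_⟩
    · simpa only [inter_assoc] using h4
    · simpa only [inter_assoc] using h6

theorem VFModule.IsPlotOn.comp {F : VFModule E M} {W W' : Type*} [NormedAddCommGroup W]
    [NormedSpace ℝ W] [NormedAddCommGroup W'] [NormedSpace ℝ W'] {U : Set W} {U₁ : Set W'}
    {φ : W → VF E M} (h : F.IsPlotOn U φ) {g : W' → W} (hg : ContDiffOn ℝ ∞ g U₁)
    (hm : MapsTo g U₁ U) : F.IsPlotOn U₁ (φ ∘ g) := by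
  refine ⟨fun u hu => h.1 _ (hm hu), fun u₀ hu₀ x₀ => ?_⟩
  obtain ⟨U', V, h1, h2, h3, n, c, G, h4, h5, h6⟩ := h.2 _ (hm hu₀) x₀
  obtain ⟨O, hO, hO'⟩ := (continuousOn_iff'.1 hg.continuousOn) U' h1
  have key : ∀ u ∈ U₁ ∩ O, g u ∈ U ∩ U' := fun u hu =>
    ⟨hm hu.1, (hO'.symm.subset ⟨hu.2, hu.1⟩).1⟩
  refine ⟨O, V, hO, (hO'.subset ⟨h2, hu₀⟩).1, h3, n, fun i z => c i (g z.1, z.2), G, fun i => ?_,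
    h5, fun u hu x hx => h6 _ (key u hu) x hx⟩
  refine (h4 i).comp (t := (U ∩ U') ×ˢ (V : Set M)) (f := fun z : W' × M => (g z.1, z.2)) ?_ ?_
  · refine ContMDiffOn.prodMk ?_ contMDiffOn_snd
    exact (hg.contMDiffOn.mono inter_subset_left).comp contMDiffOn_fst fun z hz => hz.1
  · exact fun z hz => ⟨key _ hz.1, hz.2⟩

/-- The diffeology on the set of `𝓕`-paths, as a subset of
`C^∞([0,1], 𝓕(M)) × C^∞([0,1], M)`: a family of paths is a plot iff the adjoint maps
`(u, t) ↦ X_u(t)` and `(u, t) ↦ p_u(t)` are smooth. -/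
instance FPath.diffeology (F : SingularFoliation E M) : DiffeologicalSpace (FPath F) :=
  DiffeologicalSpace.ofCorePlotsOn
    { isPlotOn := fun {n u} _ φ =>
        F.IsPlotOn (u ×ˢ Icc (0 : ℝ) 1)
          (fun z : EuclideanSpace ℝ (Fin n) × ℝ => (φ z.1).X z.2) ∧
        ContMDiffOn 𝓘(ℝ, EuclideanSpace ℝ (Fin n) × ℝ) 𝓘(ℝ, E) ∞
          (fun z : EuclideanSpace ℝ (Fin n) × ℝ => (φ z.1).p z.2) (u ×ˢ Icc (0 : ℝ) 1)
      isPlotOn_congr := by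
        intro n u hu φ ψ e
        constructor
        · rintro ⟨h1, h2⟩
          exact ⟨h1.congr fun z hz => by simp only [e hz.1],
            h2.congr fun z hz => by simp only [e hz.1]⟩
        · rintro ⟨h1, h2⟩
          exact ⟨h1.congr fun z hz => by simp only [e hz.1],
            h2.congr fun z hz => by simp only [e hz.1]⟩
      isPlot_const := by
        intro n P
        exact ⟨P.plot.comp (g := Prod.snd) contDiff_snd.contDiffOn fun z hz => hz.2,
          P.smooth.comp (f := Prod.snd) contDiff_snd.contDiffOn.contMDiffOn fun z hz => hz.2⟩
      isPlotOn_reparam := by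
        rintro n m u v hu hv φ f hm ⟨h1, h2⟩ hf
        have hg : ContDiffOn ℝ ∞ (fun z : EuclideanSpace ℝ (Fin m) × ℝ => (f z.1, z.2))
            (v ×ˢ Icc (0 : ℝ) 1) :=
          (hf.comp contDiffOn_fst fun z hz => hz.1).prodMk contDiffOn_snd
        have hmt : MapsTo (fun z : EuclideanSpace ℝ (Fin m) × ℝ => (f z.1, z.2))
            (v ×ˢ Icc (0 : ℝ) 1) (u ×ˢ Icc (0 : ℝ) 1) := fun z hz => ⟨hm hz.1, hz.2⟩
        exact ⟨h1.comp hg hmt, h2.comp hg.contMDiffOn hmt⟩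
      locality := by
        intro n u hu φ h
        constructor
        · refine VFModule.IsPlotOn.of_local fun z hz => ?_
          obtain ⟨v, hv, hzv, h1, -⟩ := h z.1 hz.1
          refine ⟨v ×ˢ univ, hv.prod isOpen_univ, ⟨hzv, trivial⟩, ?_⟩
          exact h1.comp (g := id) contDiffOn_id fun w hw => ⟨hw.2.1, hw.1.2⟩
        · intro z hz
          obtain ⟨v, hv, hzv, -, h2⟩ := h z.1 hz.1
          refine (h2 z ⟨hzv, hz.2⟩).mono_of_mem_nhdsWithin ?_
          filter_upwards [self_mem_nhdsWithin,
            mem_nhdsWithin_of_mem_nhds ((hv.prod isOpen_univ).mem_nhds ⟨hzv, trivial⟩)]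
            with w hw hw'
          exact ⟨hw'.1, hw.2⟩ }

/-- The quotient diffeology along `π`: the intersection of all diffeologies on `B` for which `π` is
smooth. -/
abbrev quotientDiffeology {A B : Type*} [DiffeologicalSpace A] (π : A → B) : DiffeologicalSpace B :=
  sInf {d | @Diffeology.DSmooth A B _ d π}

/-! ### Concatenation -/

/-- A smooth reparametrization of `[0,1]` that is constant near both end points (extended to `ℝ` by
constants). -/
structure Reparam where
  toFun : ℝ → ℝ
  smooth : ContDiff ℝ ∞ toFun
  mem : ∀ t, toFun t ∈ Icc (0 : ℝ) 1
  const : ∃ ε > 0, (∀ t ≤ ε, toFun t = 0) ∧ ∀ t, 1 - ε ≤ t → toFun t = 1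

variable {F : SingularFoliation E M}

theorem FPath.plot_reparam (P : FPath F) {ψ : ℝ → ℝ} (hψ : ContDiff ℝ ∞ ψ)
    (hm : ∀ t, ψ t ∈ Icc (0 : ℝ) 1) (U : Set ℝ) :
    F.IsPlotOn U (fun t => deriv ψ t • P.X (ψ t)) := by
  have hd : ContDiff ℝ ∞ (deriv ψ) := (contDiff_infty_iff_deriv.1 hψ).2
  have h := P.plot.comp (U₁ := U) hψ.contDiffOn fun t _ => hm t
  refine ⟨fun u hu => F.smul (f := fun _ => deriv ψ u) contMDiffOn_const (h.1 u hu),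
    fun u₀ hu₀ x₀ => ?_⟩
  obtain ⟨U', V, h1, h2, h3, n, c, G, h4, h5, h6⟩ := h.2 u₀ hu₀ x₀
  refine ⟨U', V, h1, h2, h3, n, fun i z => deriv ψ z.1 * c i z, G, fun i => ?_, h5,
    fun u hu x hx => ?_⟩
  · exact (hd.contMDiff.comp contMDiff_fst).contMDiffOn.mul (h4 i)
  · have := h6 u hu x hx
    simp only [Function.comp_apply] at this
    simp only [Pi.smul_apply, this, Finset.smul_sum, mul_smul]

theorem FPath.smooth_reparam (P : FPath F) {ψ : ℝ → ℝ} (hψ : ContDiff ℝ ∞ ψ)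
    (hm : ∀ t, ψ t ∈ Icc (0 : ℝ) 1) : ContMDiff 𝓘(ℝ, ℝ) 𝓘(ℝ, E) ∞ (fun t => P.p (ψ t)) :=
  contMDiffOn_univ.1 (P.smooth.comp hψ.contMDiff.contMDiffOn fun t _ => hm t)

theorem FPath.deriv_reparam (P : FPath F) {ψ : ℝ → ℝ} (hψ : ContDiff ℝ ∞ ψ)
    (hm : ∀ t, ψ t ∈ Icc (0 : ℝ) 1) (t : ℝ) :
    HasMFDerivAt 𝓘(ℝ, ℝ) 𝓘(ℝ, E) (fun t => P.p (ψ t)) t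
      ((1 : ℝ →L[ℝ] ℝ).smulRight ((deriv ψ t • P.X (ψ t)) (P.p (ψ t)))) := by
  have h1 := P.integral (ψ t) (hm t)
  have h2 : HasMFDerivWithinAt 𝓘(ℝ, ℝ) 𝓘(ℝ, ℝ) ψ univ t
      ((1 : ℝ →L[ℝ] ℝ).smulRight (deriv ψ t)) :=
    ((hψ.differentiable (by simp)) t).hasDerivAt.hasFDerivAt.hasMFDerivAt.hasMFDerivWithinAt
  have h3 := h1.comp t h2 (fun τ _ => hm τ)
  rw [hasMFDerivWithinAt_univ] at h3
  have e : ((1 : ℝ →L[ℝ] ℝ).smulRight (P.X (ψ t) (P.p (ψ t)))).comp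
      ((1 : ℝ →L[ℝ] ℝ).smulRight (deriv ψ t)) =
      (1 : ℝ →L[ℝ] ℝ).smulRight ((deriv ψ t • P.X (ψ t)) (P.p (ψ t))) := by
    ext
    simp
  exact e ▸ h3

/-- The time-dependent element of the concatenation. -/
def FPath.concatX (r : Reparam) (Q P : FPath F) (t : ℝ) : VF E M :=
  if t ≤ 1 / 2 then (2 * deriv r.toFun (2 * t)) • P.X (r.toFun (2 * t))
  else (2 * deriv r.toFun (2 * t - 1)) • Q.X (r.toFun (2 * t - 1))

/-- The curve of the concatenation. -/
def FPath.concatCurve (r : Reparam) (Q P : FPath F) (t : ℝ) : M :=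
  if t ≤ 1 / 2 then P.p (r.toFun (2 * t)) else Q.p (r.toFun (2 * t - 1))

theorem Reparam.deriv_zero (r : Reparam) : ∃ ε > 0, (∀ t < ε, deriv r.toFun t = 0) ∧
    (∀ t, 1 - ε < t → deriv r.toFun t = 0) ∧ (∀ t ≤ ε, r.toFun t = 0) ∧
    ∀ t, 1 - ε ≤ t → r.toFun t = 1 := by
  obtain ⟨ε, hε, h0, h1⟩ := r.const
  refine ⟨ε, hε, fun t ht => ?_, fun t ht => ?_, h0, h1⟩
  · have : r.toFun =ᶠ[𝓝 t] fun _ => 0 := by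
      filter_upwards [Iio_mem_nhds ht] with s hs using h0 s (le_of_lt hs)
    simp [this.deriv_eq]
  · have : r.toFun =ᶠ[𝓝 t] fun _ => 1 := by
      filter_upwards [Ioi_mem_nhds ht] with s hs using h1 s (le_of_lt hs)
    simp [this.deriv_eq]

/-- Near each time, the concatenation is a smooth reparametrization of one of the two paths. -/
theorem FPath.concat_local (r : Reparam) (Q P : FPath F) (h : P.p 1 = Q.p 0) (t : ℝ) :
    ∃ (O : Set ℝ) (R : FPath F) (ψ : ℝ → ℝ), IsOpen O ∧ t ∈ O ∧ ContDiff ℝ ∞ ψ ∧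
      (∀ τ, ψ τ ∈ Icc (0 : ℝ) 1) ∧ (∀ τ ∈ O, concatX r Q P τ = deriv ψ τ • R.X (ψ τ)) ∧
      ∀ τ ∈ O, concatCurve r Q P τ = R.p (ψ τ) := by
  obtain ⟨ε, hε, d0, d1, v0, v1⟩ := r.deriv_zero
  have hr : Differentiable ℝ r.toFun := r.smooth.differentiable (by simp)
  have e1 : ∀ τ, deriv (fun t => r.toFun (2 * t)) τ = 2 * deriv r.toFun (2 * τ) := fun τ => by
    have := (hr (2 * τ)).hasDerivAt.comp τ ((hasDerivAt_id τ).const_mul 2)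
    simpa [mul_comm, Function.comp_def] using this.deriv
  have e2 : ∀ τ, deriv (fun t => r.toFun (2 * t - 1)) τ = 2 * deriv r.toFun (2 * τ - 1) :=
    fun τ => by
      have := (hr (2 * τ - 1)).hasDerivAt.comp τ (((hasDerivAt_id τ).const_mul 2).sub_const 1)
      simpa [mul_comm, Function.comp_def] using this.deriv
  by_cases ht : t < 1 / 2 + ε / 2
  · refine ⟨Iio (1 / 2 + ε / 2), P, fun t => r.toFun (2 * t), isOpen_Iio, ht,
      r.smooth.comp (contDiff_const.mul contDiff_id), fun τ => r.mem _, fun τ hτ => ?_,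
      fun τ hτ => ?_⟩
    · rw [concatX, e1]
      split_ifs with hc
      · rfl
      · have hτ' : τ < 1 / 2 + ε / 2 := hτ
        rw [d0 _ (by linarith), d1 (2 * τ) (by linarith)]
        simp
    · rw [concatCurve]
      split_ifs with hc
      · rfl
      · have hτ' : τ < 1 / 2 + ε / 2 := hτ
        change Q.p (r.toFun (2 * τ - 1)) = P.p (r.toFun (2 * τ))
        rw [v0 _ (by linarith), v1 (2 * τ) (by linarith), h]
  · refine ⟨Ioi (1 / 2), Q, fun t => r.toFun (2 * t - 1), isOpen_Ioi, ?_,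
      r.smooth.comp ((contDiff_const.mul contDiff_id).sub contDiff_const), fun τ => r.mem _,
      fun τ hτ => ?_, fun τ hτ => ?_⟩
    · simp only [mem_Ioi]; linarith
    · rw [concatX, e2, if_neg (not_le.2 hτ)]
    · rw [concatCurve, if_neg (not_le.2 hτ)]

/-- The concatenation `Q ⊙ P` (first `P`, then `Q`). -/
def FPath.concat (r : Reparam) (Q P : FPath F) (h : P.p 1 = Q.p 0) : FPath F where
  X := concatX r Q P
  p := concatCurve r Q P
  plot := by
    refine VFModule.IsPlotOn.of_local fun t _ => ?_
    obtain ⟨O, R, ψ, hO, htO, hψ, hm, hX, -⟩ := concat_local r Q P h t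
    exact ⟨O, hO, htO, (R.plot_reparam hψ hm _).congr fun τ hτ => (hX τ hτ.2).symm⟩
  smooth := by
    intro t _
    obtain ⟨O, R, ψ, hO, htO, hψ, hm, -, hp⟩ := concat_local r Q P h t
    refine ((R.smooth_reparam hψ hm).contMDiffAt.congr_of_eventuallyEq ?_).contMDiffWithinAt
    filter_upwards [hO.mem_nhds htO] with τ hτ using hp τ hτ
  integral := by
    intro t _
    obtain ⟨O, R, ψ, hO, htO, hψ, hm, hX, hp⟩ := concat_local r Q P h t
    rw [hX t htO]
    have h1 := R.deriv_reparam hψ hm t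
    rw [← hp t htO] at h1
    refine (h1.congr_of_eventuallyEq ?_).hasMFDerivWithinAt
    filter_upwards [hO.mem_nhds htO] with τ hτ using hp τ hτ
  X_left t ht := by
    obtain ⟨ε, hε, d0, -⟩ := r.deriv_zero
    rw [concatX, concatX, if_pos (by linarith), if_pos (by norm_num), d0 _ (by linarith),
      d0 _ (by linarith)]
    simp
  X_right t ht := by
    obtain ⟨ε, hε, -, d1, -⟩ := r.deriv_zero
    rw [concatX, concatX, if_neg (by linarith), if_neg (by norm_num), d1 _ (by linarith),
      d1 _ (by linarith)]
    simp
  p_left t ht := by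
    obtain ⟨ε, hε, -, -, v0, -⟩ := r.deriv_zero
    rw [concatCurve, concatCurve, if_pos (by linarith), if_pos (by norm_num), v0 _ (by linarith),
      v0 _ (by linarith)]
  p_right t ht := by
    obtain ⟨ε, hε, -, -, -, v1⟩ := r.deriv_zero
    rw [concatCurve, concatCurve, if_neg (by linarith), if_neg (by norm_num), v1 _ (by linarith),
      v1 _ (by linarith)]

/-! ### `𝓕`-homotopy and the fundamental groupoid -/

open Classical in
/-- The complement `Y(t,s)` of a two-parameter family `X(t,s)`: with `Φ^{t,s}` the flow of
`X(·, s)`, its value at `y = Φ^{t,s}(x)` is the derivative of `u ↦ Φ^{t,u}(x)` at `u = s`.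
At the points `y` outside the image of `Φ^{t,s}` it is set to `0`. -/
def complement (X : ℝ → ℝ → VF E M) (t s : ℝ) : VF E M := fun y =>
  if h : ∃ x, FlowsTo (fun τ => X τ s) t x y then
    (mfderivWithin 𝓘(ℝ, ℝ) 𝓘(ℝ, E) (fun u => flow (fun τ => X τ u) t h.choose) (Icc (0 : ℝ) 1) s
      (1 : ℝ) : E)
  else (0 : E)

/-- A variation of `𝓕`-paths, `X(t,s)` and `p(t,s)` for `(t,s) ∈ [0,1]²`. -/
structure IsVariation (F : SingularFoliation E M) (X : ℝ → ℝ → VF E M) (p : ℝ → ℝ → M) : Prop where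
  plot : F.IsPlotOn (Icc (0 : ℝ) 1 ×ˢ Icc (0 : ℝ) 1) (fun z : ℝ × ℝ => X z.1 z.2)
  smooth : ContMDiffOn 𝓘(ℝ, ℝ × ℝ) 𝓘(ℝ, E) ∞ (fun z : ℝ × ℝ => p z.1 z.2)
    (Icc (0 : ℝ) 1 ×ˢ Icc (0 : ℝ) 1)
  integral : ∀ s ∈ Icc (0 : ℝ) 1, IsIntegralCurve (fun t => X t s) (fun t => p t s) 1
  base : ∀ s ∈ Icc (0 : ℝ) 1, p 0 s = p 0 0

/-- `𝓕`-homotopy. The flow of `X(·, s)` need only exist near `p(0, s)`, so the complement is in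
general only defined near `p(1, s)`, and the condition `Y(1, s) ∈ I_{p(1, s)} 𝓕` is imposed on a
neighbourhood of `p(1, s)` (for elements of `𝓕(M)` this is the same as the global condition). -/
def FHomotopic (P₀ P₁ : FPath F) : Prop :=
  ∃ (X : ℝ → ℝ → VF E M) (p : ℝ → ℝ → M), IsVariation F X p ∧
    (∀ t ∈ Icc (0 : ℝ) 1, X t 0 = P₀.X t ∧ p t 0 = P₀.p t) ∧
    (∀ t ∈ Icc (0 : ℝ) 1, X t 1 = P₁.X t ∧ p t 1 = P₁.p t) ∧
    ∀ s ∈ Icc (0 : ℝ) 1, ∃ V : Opens M, p 1 s ∈ V ∧ F.IdealSec (p 1 s) V (complement X 1 s)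

/-- The underlying set of the fundamental groupoid: `𝓕`-homotopy classes of `𝓕`-paths. -/
def MonGroupoid (F : SingularFoliation E M) : Type _ :=
  Quot (FHomotopic (F := F))

/-- The `𝓕`-homotopy class of an `𝓕`-path. -/
def MonGroupoid.mk (P : FPath F) : MonGroupoid F := Quot.mk _ P

instance MonGroupoid.diffeology (F : SingularFoliation E M) : DiffeologicalSpace (MonGroupoid F) :=
  quotientDiffeology MonGroupoid.mk

/-! ### Slices, holonomy transformations, holonomy -/

/-- A slice through `x`: an embedded submanifold, transverse to the leaves, and of complementary
dimension at `x`. -/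
structure Slice (F : SingularFoliation E M) (x : M) where
  carrier : Set M
  dim : ℕ
  charted : ChartedSpace (EuclideanSpace ℝ (Fin dim)) carrier
  isManifold : IsManifold (𝓡 dim) ∞ carrier
  embedded : Manifold.IsSmoothEmbedding (𝓡 dim) 𝓘(ℝ, E) ∞ (Subtype.val : carrier → M)
  mem : x ∈ carrier
  transverse : ∀ y : carrier,
    (mfderiv (𝓡 dim) 𝓘(ℝ, E) (Subtype.val : carrier → M) y).range ⊔ F.leafTangent (y : M) = ⊤
  disjoint :
    (mfderiv (𝓡 dim) 𝓘(ℝ, E) (Subtype.val : carrier → M) ⟨x, mem⟩).range ⊓ F.leafTangent x = ⊥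

attribute [instance] Slice.charted Slice.isManifold

/-- The base point of a slice. -/
def Slice.pt {x : M} (A : Slice F x) : A.carrier := ⟨x, A.mem⟩

/-- The foliation induced on a slice. -/
def Slice.fol {x : M} (A : Slice F x) : VFModule (EuclideanSpace ℝ (Fin A.dim)) A.carrier :=
  F.toVFModule.pullback (Subtype.val : A.carrier → M)

/-- The germs at `x` of foliation preserving diffeomorphisms from a slice through `x` to a slice
through `y` which map `x` to `y`. -/
def SliceDiff {x y : M} (A : Slice F x) (B : Slice F y) : Type _ :=
  {g : Germ (𝓝 A.pt) B.carrier //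
    ∃ Φ : PartialDiffeomorph (𝓡 A.dim) (𝓡 B.dim) A.carrier B.carrier ∞,
      A.pt ∈ Φ.source ∧ Φ A.pt = B.pt ∧ g = ((Φ : A.carrier → B.carrier) : Germ _ _) ∧
      ∀ (U : Opens A.carrier) (W : Opens B.carrier), (W : Set B.carrier) ⊆ Φ.target →
        (U : Set A.carrier) = Φ.source ∩ Φ ⁻¹' W →
        ∀ Y : VF (EuclideanSpace ℝ (Fin B.dim)) B.carrier,
          B.fol.Sec W Y ↔ A.fol.Sec U (VectorField.mpullback (𝓡 A.dim) (𝓡 B.dim) Φ Y)}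

/-- `g` lies in the orbit of `f` under `exp(I_y 𝓕_{S_y})`. -/
def SliceDiff.ExpRel {x y : M} {A : Slice F x} {B : Slice F y} (f g : SliceDiff A B) : Prop :=
  ∃ h : B.carrier → B.carrier, B.fol.InExp B.pt h ∧ g.1 = f.1.map h

/-- The set of holonomy transformations, for a choice of a slice at each point. -/
def HT (S : ∀ x : M, Slice F x) : Type _ :=
  Σ xy : M × M, Quot (SliceDiff.ExpRel (A := S xy.1) (B := S xy.2))

/-- The graph of `Hol`: `c` is the class of `Φ_Z^1 ∘ Φ_X^1` restricted to the slice at `p(0)`, for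
a time-dependent element `Z` of `I_{p(1)} 𝓕` such that this maps (a neighbourhood of `p(0)` in) the
slice at `p(0)` to the slice at `p(1)`. -/
def IsHolonomy (S : ∀ x : M, Slice F x) (P : FPath F) (c : HT S) : Prop :=
  ∃ Z : ℝ → VF E M, F.IsPlotOn (Icc 0 1) Z ∧
    (∀ t ∈ Icc (0 : ℝ) 1, F.IdealSec (P.p 1) ⊤ (Z t)) ∧
    ∃ (φ : (S (P.p 0)).carrier → (S (P.p 1)).carrier) (f : SliceDiff (S (P.p 0)) (S (P.p 1))),
      (∀ᶠ a : (S (P.p 0)).carrier in 𝓝 (S (P.p 0)).pt,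
        ∃ y : M, FlowsTo P.X 1 (a : M) y ∧ FlowsTo Z 1 y (φ a)) ∧
      f.1 = (φ : Germ _ _) ∧ c = ⟨(P.p 0, P.p 1), Quot.mk _ f⟩

/-- Two `𝓕`-paths have the same holonomy. -/
def SameHolonomy (S : ∀ x : M, Slice F x) (P Q : FPath F) : Prop :=
  ∃ c : HT S, IsHolonomy S P c ∧ IsHolonomy S Q c

/-- The underlying set of the holonomy groupoid: classes of `𝓕`-paths for the equivalence relation
generated by having the same holonomy. -/
def HolonomyGroupoid (S : ∀ x : M, Slice F x) : Type _ := Quot (SameHolonomy S)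

/-- The holonomy class of an `𝓕`-path. -/
def HolonomyGroupoid.mk (S : ∀ x : M, Slice F x) (P : FPath F) : HolonomyGroupoid S :=
  Quot.mk _ P

instance HolonomyGroupoid.diffeology (S : ∀ x : M, Slice F x) : DiffeologicalSpace (HolonomyGroupoid S) :=
  quotientDiffeology (HolonomyGroupoid.mk S)

/-! ### Groupoids -/

/-- A groupoid structure with set of objects `O` and set of arrows `G`; `mul g h` is `g` after
`h`. -/
structure GroupoidOver (O G : Type*) where
  src : G → O
  tgt : G → O
  one : O → G
  inv : G → G
  mul : ∀ g h : G, src g = tgt h → G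
  src_one : ∀ x, src (one x) = x
  tgt_one : ∀ x, tgt (one x) = x
  src_inv : ∀ g, src (inv g) = tgt g
  tgt_inv : ∀ g, tgt (inv g) = src g
  src_mul : ∀ g h e, src (mul g h e) = src h
  tgt_mul : ∀ g h e, tgt (mul g h e) = tgt g
  mul_assoc : ∀ g h k (e : src g = tgt h) (e' : src h = tgt k),
    mul (mul g h e) k ((src_mul g h e).trans e') = mul g (mul h k e') (e.trans (tgt_mul h k e').symm)
  one_mul : ∀ g, mul (one (tgt g)) g (src_one _) = g
  mul_one : ∀ g, mul g (one (src g)) (tgt_one _).symm = g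
  inv_mul : ∀ g, mul (inv g) g (src_inv g) = one (src g)
  mul_inv : ∀ g, mul g (inv g) (tgt_inv g).symm = one (tgt g)

/-- The groupoid structure on a set of classes of `𝓕`-paths is the one inherited from sources,
targets and concatenation of `𝓕`-paths. -/
def GroupoidOver.InheritedFrom {G : Type*} (𝒢 : GroupoidOver M G) (π : FPath F → G)
    (r : Reparam) : Prop :=
  (∀ P, 𝒢.src (π P) = P.p 0) ∧ (∀ P, 𝒢.tgt (π P) = P.p 1) ∧
  ∀ (P Q : FPath F) (h : P.p 1 = Q.p 0) (e : 𝒢.src (π Q) = 𝒢.tgt (π P)),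
    𝒢.mul (π Q) (π P) e = π (FPath.concat r Q P h)

/-- Morphisms of groupoids which are the identity on objects. -/
structure GroupoidOver.IsHom {O G H : Type*} (𝒢 : GroupoidOver O G) (ℋ : GroupoidOver O H)
    (q : G → H) : Prop where
  src : ∀ g, ℋ.src (q g) = 𝒢.src g
  tgt : ∀ g, ℋ.tgt (q g) = 𝒢.tgt g
  one : ∀ x, q (𝒢.one x) = ℋ.one x
  mul : ∀ g h e e', q (𝒢.mul g h e) = ℋ.mul (q g) (q h) e'

end Paths

end SingFol

end

open Set Filter Topology TopologicalSpace
open scoped Manifold ContDiff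

noncomputable section

namespace SingFol

/-! ### Smooth dependence of local flows on the initial value -/

section LocalFlow

universe u

variable {E : Type u} [NormedAddCommGroup E] [NormedSpace ℝ E]

theorem gronwallBound_zero_left_mul (L c t : ℝ) :
    gronwallBound 0 L c t = c * gronwallBound 0 L 1 t := by
  unfold gronwallBound
  split_ifs <;> ring

/-- Deviation of a solution of `x' = f x` from its linearization, forward in time. -/
theorem norm_sub_linearization_le_of_nonneg {f : E → E} {f' : E → E →L[ℝ] E} {B : Set E}
    {L K T : ℝ} (hL0 : 0 ≤ L) (hK0 : 0 ≤ K)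
    (hlip : ∀ x ∈ B, ∀ y ∈ B, ‖f y - f x‖ ≤ L * ‖y - x‖) (hL : ∀ x ∈ B, ‖f' x‖ ≤ L)
    (hK : ∀ x ∈ B, ∀ y ∈ B, ‖f y - f x - f' x (y - x)‖ ≤ K * ‖y - x‖ ^ 2)
    {x y : ℝ → E} {R : ℝ → E →L[ℝ] E}
    (hx : ∀ t ∈ Icc 0 T, HasDerivAt x (f (x t)) t) (hy : ∀ t ∈ Icc 0 T, HasDerivAt y (f (y t)) t)
    (hR : ∀ t ∈ Icc 0 T, HasDerivAt R ((f' (x t)).comp (R t)) t)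
    (hxB : ∀ t ∈ Icc 0 T, x t ∈ B) (hyB : ∀ t ∈ Icc 0 T, y t ∈ B) (hR0 : R 0 = 1) :
    ∀ t ∈ Icc 0 T, ‖y t - x t - R t (y 0 - x 0)‖ ≤
      K * Real.exp (L * T) ^ 2 * gronwallBound 0 L 1 t * ‖y 0 - x 0‖ ^ 2 := by
  have h1 : ∀ t ∈ Icc 0 T, ‖y t - x t‖ ≤ ‖y 0 - x 0‖ * Real.exp (L * T) := by
    intro t ht
    have := norm_le_gronwallBound_of_norm_deriv_right_le (f := fun t => y t - x t)
      (f' := fun t => f (y t) - f (x t)) (δ := ‖y 0 - x 0‖) (K := L) (ε := 0) (a := 0) (b := T)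
      (fun t ht => ((hy t ht).sub (hx t ht)).continuousAt.continuousWithinAt)
      (fun t ht => ((hy t (Ico_subset_Icc_self ht)).sub
        (hx t (Ico_subset_Icc_self ht))).hasDerivWithinAt)
      le_rfl (fun t ht => by
        simpa using hlip _ (hxB t (Ico_subset_Icc_self ht)) _ (hyB t (Ico_subset_Icc_self ht))) t ht
    rw [gronwallBound_ε0] at this
    refine this.trans ?_
    gcongr
    simpa using ht.2
  intro t ht
  have h2 := norm_le_gronwallBound_of_norm_deriv_right_le
    (f := fun t => y t - x t - R t (y 0 - x 0))
    (f' := fun t => f (y t) - f (x t) - (f' (x t)).comp (R t) (y 0 - x 0)) (δ := 0) (K := L)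
    (ε := K * (‖y 0 - x 0‖ * Real.exp (L * T)) ^ 2) (a := 0) (b := T)
    (fun t ht => (((hy t ht).sub (hx t ht)).sub
      ((hR t ht).clm_apply (hasDerivAt_const t _))).continuousAt.continuousWithinAt)
    (fun t ht => by
      have ht := Ico_subset_Icc_self ht
      have := (((hy t ht).sub (hx t ht)).sub
        ((hR t ht).clm_apply (hasDerivAt_const t (y 0 - x 0)))).hasDerivWithinAt (s := Ici t)
      rw [map_zero, add_zero] at this
      exact this)
    (by simp [hR0]) (fun t ht => by
      have ht := Ico_subset_Icc_self ht
      have e : f (y t) - f (x t) - (f' (x t)).comp (R t) (y 0 - x 0) =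
          f' (x t) (y t - x t - R t (y 0 - x 0)) + (f (y t) - f (x t) - f' (x t) (y t - x t)) := by
        simp only [map_sub, ContinuousLinearMap.comp_apply]
        abel
      rw [e]
      refine (norm_add_le _ _).trans (add_le_add ?_ ?_)
      · exact ((f' (x t)).le_opNorm _).trans
          (mul_le_mul_of_nonneg_right (hL _ (hxB t ht)) (norm_nonneg _))
      · refine (hK _ (hxB t ht) _ (hyB t ht)).trans ?_
        have := h1 t ht
        gcongr) t ht
  rw [sub_zero, gronwallBound_zero_left_mul] at h2
  refine h2.trans (le_of_eq ?_)
  ring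

theorem norm_sub_linearization_le {f : E → E} {f' : E → E →L[ℝ] E} {B : Set E}
    {L K T : ℝ} (hL0 : 0 ≤ L) (hK0 : 0 ≤ K)
    (hlip : ∀ x ∈ B, ∀ y ∈ B, ‖f y - f x‖ ≤ L * ‖y - x‖) (hL : ∀ x ∈ B, ‖f' x‖ ≤ L)
    (hK : ∀ x ∈ B, ∀ y ∈ B, ‖f y - f x - f' x (y - x)‖ ≤ K * ‖y - x‖ ^ 2)
    {x y : ℝ → E} {R : ℝ → E →L[ℝ] E}
    (hx : ∀ t ∈ Icc (-T) T, HasDerivAt x (f (x t)) t)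
    (hy : ∀ t ∈ Icc (-T) T, HasDerivAt y (f (y t)) t)
    (hR : ∀ t ∈ Icc (-T) T, HasDerivAt R ((f' (x t)).comp (R t)) t)
    (hxB : ∀ t ∈ Icc (-T) T, x t ∈ B) (hyB : ∀ t ∈ Icc (-T) T, y t ∈ B) (hR0 : R 0 = 1) :
    ∀ t ∈ Icc (-T) T, ‖y t - x t - R t (y 0 - x 0)‖ ≤
      K * Real.exp (L * T) ^ 2 * gronwallBound 0 L 1 |t| * ‖y 0 - x 0‖ ^ 2 := by
  intro t ht
  rcases le_total 0 t with h0 | h0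
  · have hm : ∀ s ∈ Icc 0 T, s ∈ Icc (-T) T := fun s hs => ⟨by linarith [hs.1, hs.2], hs.2⟩
    rw [abs_of_nonneg h0]
    exact norm_sub_linearization_le_of_nonneg hL0 hK0 hlip hL hK (fun s hs => hx s (hm s hs))
      (fun s hs => hy s (hm s hs)) (fun s hs => hR s (hm s hs)) (fun s hs => hxB s (hm s hs))
      (fun s hs => hyB s (hm s hs)) hR0 t ⟨h0, ht.2⟩
  · have hm : ∀ s ∈ Icc 0 T, -s ∈ Icc (-T) T :=
      fun s hs => ⟨by linarith [hs.2], by linarith [hs.1, hs.2]⟩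
    rw [abs_of_nonpos h0]
    have key := norm_sub_linearization_le_of_nonneg (f := fun z => -f z) (f' := fun z => -f' z)
      (B := B) (x := fun s => x (-s)) (y := fun s => y (-s)) (R := fun s => R (-s)) (T := T)
      hL0 hK0 (fun a ha b hb => by
        have := hlip a ha b hb
        rwa [← neg_sub', norm_neg]) (fun a ha => by rw [norm_neg]; exact hL a ha)
      (fun a ha b hb => by
        have := hK a ha b hb
        rw [← norm_neg] at this
        have e : -f b - -f a - (-f' a) (b - a) = -(f b - f a - f' a (b - a)) := by
          change -f b - -f a - -(f' a (b - a)) = _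
          abel
        rwa [e])
      (fun s hs => by
        have := (hx _ (hm s hs)).scomp s (hasDerivAt_neg s)
        rw [neg_one_smul] at this
        exact this)
      (fun s hs => by
        have := (hy _ (hm s hs)).scomp s (hasDerivAt_neg s)
        rw [neg_one_smul] at this
        exact this)
      (fun s hs => by
        have := (hR _ (hm s hs)).scomp s (hasDerivAt_neg s)
        rw [neg_one_smul, ← ContinuousLinearMap.neg_comp] at this
        exact this)
      (fun s hs => hxB _ (hm s hs)) (fun s hs => hyB _ (hm s hs)) (by simpa using hR0) (-t)
      ⟨by linarith, by linarith [ht.1]⟩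
    simpa using key

theorem hasFDerivAt_of_norm_sub_le_sq {G : Type*} [NormedAddCommGroup G] [NormedSpace ℝ G]
    {g : E → G} {A : E →L[ℝ] G} {z : E} {C : ℝ}
    (h : ∀ᶠ z' in 𝓝 z, ‖g z' - g z - A (z' - z)‖ ≤ C * ‖z' - z‖ ^ 2) : HasFDerivAt g A z := by
  rw [hasFDerivAt_iff_isLittleO]
  have h1 : (fun z' => g z' - g z - A (z' - z)) =O[𝓝 z] fun z' => ‖z' - z‖ ^ 2 :=
    Asymptotics.IsBigO.of_bound C (by
      filter_upwards [h] with z' hz'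
      simpa using hz')
  refine h1.trans_isLittleO ?_
  have h2 : (fun v : E => ‖v‖ ^ 2) =o[𝓝 0] fun v => v :=
    Asymptotics.isLittleO_norm_pow_id one_lt_two
  have h3 : Tendsto (fun z' => z' - z) (𝓝 z) (𝓝 0) := by
    simpa using (tendsto_id (x := 𝓝 z)).sub_const z
  exact h2.comp_tendsto h3

/-- Local flows are `C^n`, for every `n`. -/
theorem exists_local_flow_contDiffOn_nat (n : ℕ) : ∀ {E : Type u} [NormedAddCommGroup E]
    [NormedSpace ℝ E] [FiniteDimensional ℝ E] (f : E → E), ContDiff ℝ ∞ f → ∀ z₀ : E,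
    ∃ ε > 0, ∃ r > 0, ∃ ψ : E → ℝ → E, (∀ z ∈ Metric.ball z₀ r, ψ z 0 = z ∧
      ∀ t ∈ Ioo (-ε) ε, HasDerivAt (ψ z) (f (ψ z t)) t) ∧
      ContDiffOn ℝ n (fun w : E × ℝ => ψ w.1 w.2) (Metric.ball z₀ r ×ˢ Ioo (-ε) ε) := by
  induction n with
  | zero =>
    intro E _ _ _ f hf z₀
    obtain ⟨ε, hε, a, r, L, K, hr, h⟩ := IsPicardLindelof.of_contDiffAt_one
      (hf.contDiffAt.of_le (by simp) : ContDiffAt ℝ 1 f z₀)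
    obtain ⟨α, hα, hc⟩ := (h 0).exists_forall_mem_closedBall_eq_hasDerivWithinAt_continuousOn
    refine ⟨ε, hε, r, hr, fun z t => α (z, t), fun z hz => ?_, ?_⟩
    · obtain ⟨h0, h1⟩ := hα z (Metric.ball_subset_closedBall hz)
      refine ⟨h0, fun t ht => ?_⟩
      have ht' : t ∈ Ioo (0 - ε) (0 + ε) := by simpa using ht
      exact (h1 t (Ioo_subset_Icc_self ht')).hasDerivAt (Icc_mem_nhds ht'.1 ht'.2)
    · rw [Nat.cast_zero, contDiffOn_zero]
      refine hc.mono (prod_mono Metric.ball_subset_closedBall ?_)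
      simpa using Ioo_subset_Icc_self
  | succ n ih =>
    intro E _ _ _ f hf z₀
    have hf' : ContDiff ℝ ∞ (fderiv ℝ f) := (contDiff_infty_iff_fderiv.1 hf).2
    let g : E × (E →L[ℝ] E) → E × (E →L[ℝ] E) := fun w => (f w.1, (fderiv ℝ f w.1).comp w.2)
    have hg : ContDiff ℝ ∞ g :=
      (hf.comp contDiff_fst).prodMk ((hf'.comp contDiff_fst).clm_comp contDiff_snd)
    obtain ⟨ε, hε, r, hr, Ψ, hΨ, hΨn⟩ := ih g hg (z₀, 1)
    let ψ : E → ℝ → E := fun z t => (Ψ (z, 1) t).1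
    let R : E → ℝ → E →L[ℝ] E := fun z t => (Ψ (z, 1) t).2
    have hb : ∀ z ∈ Metric.ball z₀ r, (z, (1 : E →L[ℝ] E)) ∈ Metric.ball (z₀, (1 : E →L[ℝ] E)) r := by
      intro z hz
      rw [Metric.mem_ball, Prod.dist_eq, dist_self]
      exact max_lt hz hr
    have hin : ContDiffOn ℝ n (fun w : E × ℝ => Ψ (w.1, 1) w.2)
        (Metric.ball z₀ r ×ˢ Ioo (-ε) ε) := by
      refine hΨn.comp (f := fun w : E × ℝ => ((w.1, (1 : E →L[ℝ] E)), w.2)) ?_ ?_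
      · exact ((contDiff_fst.prodMk contDiff_const).prodMk contDiff_snd).contDiffOn
      · exact fun w hw => ⟨hb _ hw.1, hw.2⟩
    have hψn : ContDiffOn ℝ n (fun w : E × ℝ => ψ w.1 w.2) (Metric.ball z₀ r ×ˢ Ioo (-ε) ε) :=
      contDiff_fst.comp_contDiffOn hin
    have hRn : ContDiffOn ℝ n (fun w : E × ℝ => R w.1 w.2) (Metric.ball z₀ r ×ˢ Ioo (-ε) ε) :=
      contDiff_snd.comp_contDiffOn hin
    have hψ0 : ∀ z ∈ Metric.ball z₀ r, ψ z 0 = z := fun z hz => by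
      simp only [ψ, (hΨ _ (hb z hz)).1]
    have hR0 : ∀ z ∈ Metric.ball z₀ r, R z 0 = 1 := fun z hz => by
      simp only [R, (hΨ _ (hb z hz)).1]
    have hψd : ∀ z ∈ Metric.ball z₀ r, ∀ t ∈ Ioo (-ε) ε, HasDerivAt (ψ z) (f (ψ z t)) t :=
      fun z hz t ht => ((hΨ _ (hb z hz)).2 t ht).fst
    have hRd : ∀ z ∈ Metric.ball z₀ r, ∀ t ∈ Ioo (-ε) ε,
        HasDerivAt (R z) ((fderiv ℝ f (ψ z t)).comp (R z t)) t :=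
      fun z hz t ht => ((hΨ _ (hb z hz)).2 t ht).snd
    -- bounds on a ball
    obtain ⟨K, U, hU, hKU⟩ := (hf'.contDiffAt.of_le (by simp) :
      ContDiffAt ℝ 1 (fderiv ℝ f) z₀).exists_lipschitzOnWith
    obtain ⟨ρ, hρ, hρU⟩ := Metric.mem_nhds_iff.1 hU
    set B := Metric.ball z₀ ρ with hBdef
    have hBc : Convex ℝ B := convex_ball z₀ ρ
    set L : ℝ := ‖fderiv ℝ f z₀‖ + K * ρ with hLdef
    have hL0 : 0 ≤ L := by positivity
    have hL : ∀ x ∈ B, ‖fderiv ℝ f x‖ ≤ L := fun x hx => by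
      have h1 := hKU.norm_sub_le (hρU hx) (mem_of_mem_nhds hU)
      have h2 : ‖x - z₀‖ ≤ ρ := by rw [← dist_eq_norm]; exact (Metric.mem_ball.1 hx).le
      calc ‖fderiv ℝ f x‖ = ‖fderiv ℝ f z₀ + (fderiv ℝ f x - fderiv ℝ f z₀)‖ := by congr 1; abel
        _ ≤ ‖fderiv ℝ f z₀‖ + ‖fderiv ℝ f x - fderiv ℝ f z₀‖ := norm_add_le _ _
        _ ≤ L := by
          rw [hLdef]
          gcongr
          exact h1.trans (by gcongr)
    have hfd : ∀ x, HasFDerivAt f (fderiv ℝ f x) x := fun x =>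
      (hf.differentiable (by simp) x).hasFDerivAt
    have hlip : ∀ x ∈ B, ∀ y ∈ B, ‖f y - f x‖ ≤ L * ‖y - x‖ := fun x hx y hy =>
      hBc.norm_image_sub_le_of_norm_hasFDerivWithin_le
        (fun z _ => (hfd z).hasFDerivWithinAt) hL hx hy
    have hK : ∀ x ∈ B, ∀ y ∈ B, ‖f y - f x - fderiv ℝ f x (y - x)‖ ≤ K * ‖y - x‖ ^ 2 := by
      intro x hx y hy
      have hseg : segment ℝ x y ⊆ B := hBc.segment_subset hx hy
      have := Convex.norm_image_sub_le_of_norm_hasFDerivWithin_le' (f := f) (φ := fderiv ℝ f x)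
        (C := K * ‖y - x‖) (s := segment ℝ x y) (x := x) (y := y)
        (fun z _ => (hfd z).hasFDerivWithinAt)
        (fun z hz => by
          refine (hKU.norm_sub_le (hρU (hseg hz)) (hρU hx)).trans ?_
          gcongr
          obtain ⟨a, b, ha, hb', hab, rfl⟩ := hz
          have : a • x + b • y - x = b • (y - x) := by
            rw [show a = 1 - b by linarith]; module
          rw [this, norm_smul, Real.norm_of_nonneg hb']
          exact mul_le_of_le_one_left (norm_nonneg _) (by linarith))
        (convex_segment x y) (left_mem_segment ℝ x y) (right_mem_segment ℝ x y)
      refine this.trans (le_of_eq ?_)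
      ring
    -- shrink so that the solutions stay in the ball
    have hopen : IsOpen (Metric.ball z₀ r ×ˢ Ioo (-ε) ε) := Metric.isOpen_ball.prod isOpen_Ioo
    have hmem₀ : (z₀, (0 : ℝ)) ∈ Metric.ball z₀ r ×ˢ Ioo (-ε) ε :=
      ⟨Metric.mem_ball_self hr, by simpa using hε⟩
    have hcont : ContinuousAt (fun w : E × ℝ => ψ w.1 w.2) (z₀, 0) :=
      hψn.continuousOn.continuousAt (hopen.mem_nhds hmem₀)
    have hev : ∀ᶠ w : E × ℝ in 𝓝 (z₀, 0), ψ w.1 w.2 ∈ B := by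
      refine hcont (Metric.isOpen_ball.mem_nhds ?_)
      simp only [hψ0 z₀ (Metric.mem_ball_self hr)]
      exact Metric.mem_ball_self hρ
    rw [nhds_prod_eq, Filter.eventually_prod_iff] at hev
    obtain ⟨pa, ha, pb, hb', hab⟩ := hev
    obtain ⟨r₁, hr₁, hr₁'⟩ := Metric.mem_nhds_iff.1 ha
    obtain ⟨ε₁, hε₁, hε₁'⟩ := Metric.mem_nhds_iff.1 hb'
    set r' := min r r₁ with hr'
    set ε' := min ε ε₁ with hε'
    have hr'0 : 0 < r' := lt_min hr hr₁
    have hε'0 : 0 < ε' := lt_min hε hε₁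
    have hsub1 : Metric.ball z₀ r' ⊆ Metric.ball z₀ r := Metric.ball_subset_ball (min_le_left _ _)
    have hsub2 : Ioo (-ε') ε' ⊆ Ioo (-ε) ε :=
      Ioo_subset_Ioo (neg_le_neg (min_le_left _ _)) (min_le_left _ _)
    have hB : ∀ z ∈ Metric.ball z₀ r', ∀ t ∈ Ioo (-ε') ε', ψ z t ∈ B := by
      intro z hz t ht
      refine hab (hr₁' (Metric.ball_subset_ball (min_le_right _ _) hz)) (hε₁' ?_)
      rw [Metric.mem_ball, Real.dist_eq, sub_zero, abs_lt]
      exact ⟨by linarith [ht.1, min_le_right ε ε₁], ht.2.trans_le (min_le_right _ _)⟩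
    have hopen' : IsOpen (Metric.ball z₀ r' ×ˢ Ioo (-ε') ε') := Metric.isOpen_ball.prod isOpen_Ioo
    have hsub : Metric.ball z₀ r' ×ˢ Ioo (-ε') ε' ⊆ Metric.ball z₀ r ×ˢ Ioo (-ε) ε :=
      prod_mono hsub1 hsub2
    have hD1 : ∀ z ∈ Metric.ball z₀ r', ∀ t ∈ Ioo (-ε') ε',
        HasFDerivAt (fun z => ψ z t) (R z t) z := by
      intro z hz t ht
      have hT : ∀ s ∈ Icc (-|t|) |t|, s ∈ Ioo (-ε') ε' := fun s hs => by
        have : |t| < ε' := abs_lt.2 ht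
        exact ⟨by linarith [hs.1], by linarith [hs.2]⟩
      refine hasFDerivAt_of_norm_sub_le_sq
        (C := K * Real.exp (L * |t|) ^ 2 * gronwallBound 0 L 1 |t|) ?_
      filter_upwards [Metric.isOpen_ball.mem_nhds hz] with z' hz'
      have := norm_sub_linearization_le (f := f) (f' := fderiv ℝ f) (T := |t|) (B := B) hL0
        K.coe_nonneg hlip hL hK
        (x := ψ z) (y := ψ z') (R := R z) (fun s hs => hψd z (hsub1 hz) s (hsub2 (hT s hs)))
        (fun s hs => hψd z' (hsub1 hz') s (hsub2 (hT s hs)))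
        (fun s hs => hRd z (hsub1 hz) s (hsub2 (hT s hs)))
        (fun s hs => hB z hz s (hT s hs)) (fun s hs => hB z' hz' s (hT s hs))
        (hR0 z (hsub1 hz)) t ⟨neg_abs_le t, le_abs_self t⟩
      rwa [hψ0 z (hsub1 hz), hψ0 z' (hsub1 hz')] at this
    have hDt : ContDiffOn ℝ n (fun w : E × ℝ => (1 : ℝ →L[ℝ] ℝ).smulRight (f (ψ w.1 w.2)))
        (Metric.ball z₀ r' ×ˢ Ioo (-ε') ε') :=
      contDiffOn_const.smulRight ((hf.of_le (by exact_mod_cast le_top)).comp_contDiffOn (hψn.mono hsub))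
    have hDz := hRn.mono hsub
    have hD : ∀ w ∈ Metric.ball z₀ r' ×ˢ Ioo (-ε') ε', HasFDerivAt (fun w : E × ℝ => ψ w.1 w.2)
        ((R w.1 w.2).coprod ((1 : ℝ →L[ℝ] ℝ).smulRight (f (ψ w.1 w.2)))) w := by
      intro w hw
      have hnw := hopen'.mem_nhds hw
      have := hasStrictFDerivAt_uncurry_coprod (𝕜 := ℝ) (u := w) (f := ψ) (f₁ := R)
        (f₂ := fun z t => (1 : ℝ →L[ℝ] ℝ).smulRight (f (ψ z t)))
        (by filter_upwards [hnw] with v hv using hD1 v.1 hv.1 v.2 hv.2)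
        (by
          filter_upwards [hnw] with v hv
          exact (hψd v.1 (hsub1 hv.1) v.2 (hsub2 hv.2)).hasFDerivAt)
        (hDz.continuousOn.continuousAt hnw) (hDt.continuousOn.continuousAt hnw)
      exact this.hasFDerivAt
    refine ⟨ε', hε'0, r', hr'0, ψ, fun z hz => ⟨hψ0 z (hsub1 hz), fun t ht =>
      hψd z (hsub1 hz) t (hsub2 ht)⟩, ?_⟩
    push_cast
    rw [contDiffOn_succ_iff_fderiv_of_isOpen hopen']
    refine ⟨fun w hw => (hD w hw).differentiableAt.differentiableWithinAt, by simp, ?_⟩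
    refine ContDiffOn.congr (f := fun w : E × ℝ =>
      (R w.1 w.2).coprod ((1 : ℝ →L[ℝ] ℝ).smulRight (f (ψ w.1 w.2)))) ?_
      fun w hw => (hD w hw).fderiv
    have e : ∀ (A : E →L[ℝ] E) (B : ℝ →L[ℝ] E), A.coprod B =
      A.comp (ContinuousLinearMap.fst ℝ E ℝ) + B.comp (ContinuousLinearMap.snd ℝ E ℝ) := by
      intro A B; ext <;> simp
    simp only [e]
    exact (hDz.clm_comp contDiffOn_const).add (hDt.clm_comp contDiffOn_const)

theorem eqOn_Ioo_of_hasDerivAt {f : E → E} (hf : ContDiff ℝ ∞ f) {a b t₀ : ℝ}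
    (ht₀ : t₀ ∈ Ioo a b) {x y : ℝ → E} (hx : ∀ t ∈ Ioo a b, HasDerivAt x (f (x t)) t)
    (hy : ∀ t ∈ Ioo a b, HasDerivAt y (f (y t)) t) (h : x t₀ = y t₀) : EqOn x y (Ioo a b) := by
  refine isMIntegralCurveOn_Ioo_eqOn_of_contMDiff_boundaryless (I := 𝓘(ℝ, E)) (v := f) ht₀
    (contMDiff_vectorSpace_iff_contDiff.2 (hf.of_le (by simp))) ?_ ?_ h
  · exact fun t ht => (hx t ht).hasFDerivAt.hasMFDerivAt.hasMFDerivWithinAt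
  · exact fun t ht => (hy t ht).hasFDerivAt.hasMFDerivAt.hasMFDerivWithinAt

/-- Local flows of smooth vector fields are smooth at time `0`. -/
theorem exists_local_flow [FiniteDimensional ℝ E] (f : E → E) (hf : ContDiff ℝ ∞ f) (z₀ : E) :
    ∃ ε > 0, ∃ r > 0, ∃ ψ : E → ℝ → E, (∀ z ∈ Metric.ball z₀ r, ψ z 0 = z ∧
      ∀ t ∈ Ioo (-ε) ε, HasDerivAt (ψ z) (f (ψ z t)) t) ∧
      ContDiffAt ℝ ∞ (fun w : E × ℝ => ψ w.1 w.2) (z₀, 0) := by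
  obtain ⟨ε, hε, r, hr, ψ, hψ, -⟩ := exists_local_flow_contDiffOn_nat 0 f hf z₀
  refine ⟨ε, hε, r, hr, ψ, hψ, contDiffAt_infty.2 fun n => ?_⟩
  obtain ⟨ε', hε', r', hr', ψ', hψ', hn⟩ := exists_local_flow_contDiffOn_nat n f hf z₀
  have hmem : Metric.ball z₀ r' ×ˢ Ioo (-ε') ε' ∈ 𝓝 (z₀, (0 : ℝ)) :=
    prod_mem_nhds (Metric.ball_mem_nhds z₀ hr') (Ioo_mem_nhds (by linarith) hε')
  refine (hn.contDiffAt hmem).congr_of_eventuallyEq ?_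
  filter_upwards [hmem, prod_mem_nhds (Metric.ball_mem_nhds z₀ hr)
    (Ioo_mem_nhds (neg_lt_zero.2 hε) hε)] with w hw hw'
  have hs1 : Ioo (-min ε ε') (min ε ε') ⊆ Ioo (-ε) ε :=
    Ioo_subset_Ioo (neg_le_neg (min_le_left _ _)) (min_le_left _ _)
  have hs2 : Ioo (-min ε ε') (min ε ε') ⊆ Ioo (-ε') ε' :=
    Ioo_subset_Ioo (neg_le_neg (min_le_right _ _)) (min_le_right _ _)
  refine eqOn_Ioo_of_hasDerivAt hf (t₀ := 0) (a := -min ε ε') (b := min ε ε')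
    (by simp [hε, hε']) (fun t ht => (hψ w.1 hw'.1).2 t (hs1 ht))
    (fun t ht => (hψ' w.1 hw.1).2 t (hs2 ht)) ((hψ w.1 hw'.1).1.trans (hψ' w.1 hw.1).1.symm) ?_
  have h1 := abs_lt.2 hw'.2
  have h2 := abs_lt.2 hw.2
  exact abs_lt.1 (lt_min h1 h2)

end LocalFlow

/-! ### Flows on manifolds -/

section ManifoldFlow

variable {E : Type*} [NormedAddCommGroup E] [NormedSpace ℝ E]
  {H : Type*} [TopologicalSpace H] {I : ModelWithCorners ℝ E H}
  {N : Type*} [TopologicalSpace N] [ChartedSpace H N]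

/-- The coordinate representation of a vector field in the preferred chart at `x₀`. -/
def chartVF (I : ModelWithCorners ℝ E H) {N : Type*} [TopologicalSpace N] [ChartedSpace H N]
    (v : ∀ x : N, TangentSpace I x) (x₀ : N) (z : E) : E :=
  mfderiv I 𝓘(ℝ, E) (extChartAt I x₀) ((extChartAt I x₀).symm z) (v ((extChartAt I x₀).symm z))

theorem contMDiffOn_mfderiv_extChartAt [IsManifold I ∞ N] {v : ∀ x : N, TangentSpace I x}
    {U : Set N} (hU : IsOpen U)
    (hv : ContMDiffOn I I.tangent ∞ (fun x => (⟨x, v x⟩ : TangentBundle I N)) U) (x₀ : N) :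
    ContMDiffOn I 𝓘(ℝ, E) ∞
      (fun x => (mfderiv I 𝓘(ℝ, E) (extChartAt I x₀) x (v x) : E)) (U ∩ (extChartAt I x₀).source) := by
  have h1 := ((trivializationAt E (TangentSpace I) x₀).contMDiffOn_section_iff (IB := I)
    (n := ∞) (s := v) (a := U ∩ (extChartAt I x₀).source)
    (hU.inter (isOpen_extChartAt_source x₀)) (by simp)).1 (hv.mono inter_subset_left)
  refine h1.congr fun x hx => ?_
  have hx' : x ∈ (chartAt H x₀).source := by simpa using hx.2
  have : IsManifold I 1 N := IsManifold.of_le (n := ∞) (by simp)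
  have h2 := DFunLike.congr_fun (TangentBundle.continuousLinearMapAt_trivializationAt hx') (v x)
  refine Eq.trans h2.symm ?_
  change (trivializationAt E (TangentSpace I) x₀).linearMapAt ℝ x (v x) = _
  rw [Bundle.Trivialization.linearMapAt_apply, if_pos (by simpa using hx')]

theorem contDiffOn_chartVF [IsManifold I ∞ N] {v : ∀ x : N, TangentSpace I x}
    (hv : ContMDiff I I.tangent ∞ (fun x => (⟨x, v x⟩ : TangentBundle I N))) (x₀ : N) :
    ContDiffOn ℝ ∞ (chartVF I v x₀) (extChartAt I x₀).target := by
  rw [← contMDiffOn_iff_contDiffOn]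
  refine (contMDiffOn_mfderiv_extChartAt isOpen_univ hv.contMDiffOn x₀).comp
    (contMDiffOn_extChartAt_symm x₀) fun z hz => ⟨mem_univ _, (extChartAt I x₀).map_target hz⟩

theorem hasDerivWithinAt_extChartAt_comp [IsManifold I ∞ N] {γ : ℝ → N} {t : ℝ} {s : Set ℝ}
    {w : TangentSpace I (γ t)}
    (h : HasMFDerivWithinAt 𝓘(ℝ, ℝ) I γ s t ((1 : ℝ →L[ℝ] ℝ).smulRight w)) {x₀ : N}
    (hx : γ t ∈ (extChartAt I x₀).source) :
    HasDerivWithinAt (fun τ => extChartAt I x₀ (γ τ))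
      (mfderiv I 𝓘(ℝ, E) (extChartAt I x₀) (γ t) w : E) s t := by
  have : IsManifold I 1 N := IsManifold.of_le (n := ∞) (by simp)
  have h1 := (mdifferentiableAt_extChartAt (I := I) (x := x₀) (y := γ t)
    (by simpa using hx)).hasMFDerivAt
  have h2 := h1.comp_hasMFDerivWithinAt t h
  obtain ⟨u, hu⟩ : ∃ u : E, u = (mfderiv I 𝓘(ℝ, E) (extChartAt I x₀) (γ t) w : E) := ⟨_, rfl⟩
  suffices HasDerivWithinAt (fun τ => extChartAt I x₀ (γ τ)) u s t from hu ▸ this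
  rw [hasDerivWithinAt_iff_hasFDerivWithinAt]
  refine hasMFDerivWithinAt_iff_hasFDerivWithinAt.1 ?_
  refine h2.congr_mfderiv (ContinuousLinearMap.ext fun (a : ℝ) => ?_)
  exact (map_smul (mfderiv I 𝓘(ℝ, E) (extChartAt I x₀) (γ t)) a w).trans
    (congrArg (fun e : E => a • e) hu.symm)

theorem hasMFDerivAt_extChartAt_symm_comp [IsManifold I ∞ N] [I.Boundaryless] {c : ℝ → E} {t : ℝ}
    {x₀ : N} (hc : c t ∈ (extChartAt I x₀).target)
    {w : TangentSpace I ((extChartAt I x₀).symm (c t))}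
    (h : HasDerivAt c (mfderiv I 𝓘(ℝ, E) (extChartAt I x₀) ((extChartAt I x₀).symm (c t)) w : E) t) :
    HasMFDerivAt 𝓘(ℝ, ℝ) I (fun τ => (extChartAt I x₀).symm (c τ)) t
      ((1 : ℝ →L[ℝ] ℝ).smulRight w) := by
  have : IsManifold I 1 N := IsManifold.of_le (n := ∞) (by simp)
  have h1 := (mdifferentiableWithinAt_extChartAt_symm (I := I) (x := x₀) hc).hasMFDerivWithinAt
  have h1' : HasMFDerivAt 𝓘(ℝ, E) I (extChartAt I x₀).symm (c t)
      (mfderivWithin 𝓘(ℝ, E) I (extChartAt I x₀).symm (range I) (c t)) := by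
    rw [← hasMFDerivWithinAt_univ]
    rwa [I.range_eq_univ] at h1 ⊢
  have h2 := h1'.comp t h.hasFDerivAt.hasMFDerivAt
  refine h2.congr_mfderiv ?_
  have h3 := mfderivWithin_extChartAt_symm_comp_mfderiv_extChartAt (I := I) (x := x₀) hc
  have h4 := DFunLike.congr_fun h3 w
  refine ContinuousLinearMap.ext fun (a : ℝ) => ?_
  refine (map_smul (mfderivWithin 𝓘(ℝ, E) I (extChartAt I x₀).symm (range I) (c t)) a _).trans ?_
  exact congrArg (fun e : TangentSpace I ((extChartAt I x₀).symm (c t)) => a • e) h4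

/-- Local flows on manifolds, smooth at time `0`. -/
theorem exists_local_flow_manifold [FiniteDimensional ℝ E] [IsManifold I ∞ N] [I.Boundaryless]
    {v : ∀ x : N, TangentSpace I x}
    (hv : ContMDiff I I.tangent ∞ (fun x => (⟨x, v x⟩ : TangentBundle I N))) (x₀ : N) :
    ∃ ε > 0, ∃ U ∈ 𝓝 x₀, ∃ ψ : N → ℝ → N,
      (∀ x ∈ U, ψ x 0 = x ∧ IsMIntegralCurveOn (ψ x) v (Ioo (-ε) ε)) ∧
      ContMDiffAt (I.prod 𝓘(ℝ, ℝ)) I ∞ (fun w : N × ℝ => ψ w.1 w.2) (x₀, 0) := by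
  set e := extChartAt I x₀ with he
  set z₀ := e x₀ with hz₀
  have ht : IsOpen e.target := isOpen_extChartAt_target x₀
  have hz₀t : z₀ ∈ e.target := mem_extChartAt_target x₀
  obtain ⟨ρ, hρ, hρt⟩ := Metric.isOpen_iff.1 ht z₀ hz₀t
  let b : ContDiffBump z₀ := ⟨ρ / 3, ρ / 2, by positivity, by linarith⟩
  let f : E → E := fun z => b z • chartVF I v x₀ z
  have hf : ContDiff ℝ ∞ f := by
    rw [contDiff_iff_contDiffAt]
    intro z
    by_cases hz : z ∈ e.target
    · exact b.contDiff.contDiffAt.smul ((contDiffOn_chartVF hv x₀).contDiffAt (ht.mem_nhds hz))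
    · have : f =ᶠ[𝓝 z] fun _ => 0 := by
        have hcl : (Metric.closedBall z₀ (ρ / 2))ᶜ ∈ 𝓝 z := by
          refine Metric.isClosed_closedBall.isOpen_compl.mem_nhds fun hz' => hz (hρt ?_)
          exact Metric.closedBall_subset_ball (by linarith) hz'
        filter_upwards [hcl] with y hy
        have : b y = 0 := b.zero_of_le_dist (by
          have := Metric.mem_closedBall.not.1 hy
          exact (not_le.1 this).le)
        simp [f, this]
      exact contDiffAt_const.congr_of_eventuallyEq this
  have hfeq : ∀ z ∈ Metric.ball z₀ (ρ / 3), f z = chartVF I v x₀ z := fun z hz => by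
    simp [f, b.one_of_mem_closedBall (Metric.ball_subset_closedBall hz)]
  obtain ⟨ε, hε, r, hr, ψ, hψ, hψs⟩ := exists_local_flow f hf z₀
  have hcont := hψs.continuousAt
  have hev : ∀ᶠ w : E × ℝ in 𝓝 (z₀, 0), ψ w.1 w.2 ∈ Metric.ball z₀ (ρ / 3) := by
    refine hcont (Metric.isOpen_ball.mem_nhds ?_)
    simp only [(hψ z₀ (Metric.mem_ball_self hr)).1]
    exact Metric.mem_ball_self (by positivity)
  rw [nhds_prod_eq, Filter.eventually_prod_iff] at hev
  obtain ⟨pa, ha, pb, hb, hab⟩ := hev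
  obtain ⟨ε₁, hε₁, hε₁'⟩ := Metric.mem_nhds_iff.1 hb
  refine ⟨min ε ε₁, lt_min hε hε₁, e.source ∩ e ⁻¹' (Metric.ball z₀ r ∩ {z | pa z}), ?_,
    fun x t => e.symm (ψ (e x) t), fun x hx => ⟨?_, fun t ht' => ?_⟩, ?_⟩
  · refine inter_mem (extChartAt_source_mem_nhds x₀) ((continuousAt_extChartAt x₀) ?_)
    exact inter_mem (Metric.ball_mem_nhds _ hr) ha
  · simp only [(hψ _ hx.2.1).1]
    exact e.left_inv hx.1
  · have h1 : t ∈ Ioo (-ε) ε :=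
      ⟨by linarith [ht'.1, min_le_left ε ε₁], by linarith [ht'.2, min_le_left ε ε₁]⟩
    have h2 : ψ (e x) t ∈ Metric.ball z₀ (ρ / 3) := by
      refine hab hx.2.2 (hε₁' ?_)
      rw [Metric.mem_ball, Real.dist_eq, sub_zero, abs_lt]
      exact ⟨by linarith [ht'.1, min_le_right ε ε₁], by linarith [ht'.2, min_le_right ε ε₁]⟩
    have h3 : ψ (e x) t ∈ e.target := hρt (Metric.ball_subset_ball (by linarith) h2)
    have h4 := (hψ _ hx.2.1).2 t h1
    rw [hfeq _ h2] at h4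
    exact (hasMFDerivAt_extChartAt_symm_comp h3 h4).hasMFDerivWithinAt
  · have hψ00 : ψ (e x₀) 0 = z₀ := (hψ z₀ (Metric.mem_ball_self hr)).1
    have h1 : ContMDiffAt 𝓘(ℝ, E) I ∞ e.symm (ψ (e x₀) 0) := by
      rw [hψ00]
      exact (contMDiffOn_extChartAt_symm x₀).contMDiffAt (ht.mem_nhds hz₀t)
    have h2 : ContMDiffAt (𝓘(ℝ, E).prod 𝓘(ℝ, ℝ)) 𝓘(ℝ, E) ∞ (fun w : E × ℝ => ψ w.1 w.2)
        (e x₀, 0) := by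
      rw [← modelWithCornersSelf_prod, chartedSpaceSelf_prod]
      exact hψs.contMDiffAt
    have h3 : ContMDiffAt (I.prod 𝓘(ℝ, ℝ)) (𝓘(ℝ, E).prod 𝓘(ℝ, ℝ)) ∞
        (fun w : N × ℝ => (e w.1, w.2)) (x₀, 0) :=
      ((contMDiffAt_extChartAt (I := I) (x := x₀)).comp (x₀, (0 : ℝ)) contMDiffAt_fst).prodMk
        contMDiffAt_snd
    exact h1.comp (x₀, (0 : ℝ)) (h2.comp (x₀, (0 : ℝ)) h3)

end ManifoldFlow

section GlobalFlow

variable {E : Type*} [NormedAddCommGroup E] [NormedSpace ℝ E]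
  {H : Type*} [TopologicalSpace H] {I : ModelWithCorners ℝ E H}
  {N : Type*} [TopologicalSpace N] [ChartedSpace H N]

theorem IsMIntegralCurve.flow_add [IsManifold I ∞ N] [I.Boundaryless] [T2Space N]
    {v : ∀ x : N, TangentSpace I x}
    (hv : ContMDiff I I.tangent ∞ (fun x => (⟨x, v x⟩ : TangentBundle I N)))
    {φ : ℝ → N → N} (h0 : ∀ x, φ 0 x = x) (hφ : ∀ x, IsMIntegralCurve (fun t => φ t x) v)
    (s t : ℝ) (x : N) : φ (s + t) x = φ s (φ t x) := by
  have : IsManifold I 1 N := IsManifold.of_le (n := ∞) (by simp)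
  have h1 := (hφ x).comp_add t
  have h2 := hφ (φ t x)
  have h3 := isMIntegralCurve_Ioo_eq_of_contMDiff_boundaryless (t₀ := 0) (hv.of_le (by simp)) h1 h2
    (by simp [h0])
  exact congrFun h3 s

/-- A complete flow of a smooth vector field is smooth. -/
theorem contMDiff_of_isMIntegralCurve [FiniteDimensional ℝ E] [IsManifold I ∞ N] [I.Boundaryless]
    [T2Space N] {v : ∀ x : N, TangentSpace I x}
    (hv : ContMDiff I I.tangent ∞ (fun x => (⟨x, v x⟩ : TangentBundle I N)))
    {φ : ℝ → N → N} (h0 : ∀ x, φ 0 x = x) (hφ : ∀ x, IsMIntegralCurve (fun t => φ t x) v) :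
    ContMDiff (𝓘(ℝ, ℝ).prod I) I ∞ (fun w : ℝ × N => φ w.1 w.2) := by
  have : IsManifold I 1 N := IsManifold.of_le (n := ∞) (by simp)
  have hloc : ∀ y : N, ContMDiffAt (𝓘(ℝ, ℝ).prod I) I ∞ (fun w : ℝ × N => φ w.1 w.2) (0, y) := by
    intro y
    obtain ⟨ε, hε, U, hU, ψ, hψ, hs⟩ := exists_local_flow_manifold hv y
    have h1 : ContMDiffAt (𝓘(ℝ, ℝ).prod I) I ∞ (fun w : ℝ × N => ψ w.2 w.1) (0, y) :=
      hs.comp ((0 : ℝ), y) (f := fun w : ℝ × N => (w.2, w.1))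
        (contMDiffAt_snd.prodMk contMDiffAt_fst)
    refine h1.congr_of_eventuallyEq ?_
    have : Ioo (-ε) ε ×ˢ U ∈ 𝓝 ((0 : ℝ), y) :=
      prod_mem_nhds (Ioo_mem_nhds (by linarith) hε) hU
    filter_upwards [this] with w hw
    exact isMIntegralCurveOn_Ioo_eqOn_of_contMDiff_boundaryless (t₀ := 0) ⟨by linarith, hε⟩
      (hv.of_le (by simp)) ((hφ w.2).isMIntegralCurveOn _) (hψ w.2 hw.2).2
      (by rw [h0, (hψ w.2 hw.2).1]) hw.1
  rw [contMDiff_infty]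
  intro n
  have : IsManifold I n N := IsManifold.of_le (n := ∞) (by exact_mod_cast le_top)
  have hnear : ∀ {t : ℝ} {y : N}, ContMDiffAt (𝓘(ℝ, ℝ).prod I) I n
      (fun w : ℝ × N => φ w.1 w.2) (t, y) → ∀ᶠ w in 𝓝 (t, y), ContMDiffAt (𝓘(ℝ, ℝ).prod I) I n
      (fun w : ℝ × N => φ w.1 w.2) w := fun h =>
    (contMDiffAt_iff_contMDiffAt_nhds (by simp)).1 h
  rintro ⟨t₁, x₀⟩
  set A := {t : ℝ | ContMDiffAt (𝓘(ℝ, ℝ).prod I) I n (fun w : ℝ × N => φ w.1 w.2) (t, x₀)} with hA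
  have hA0 : (0 : ℝ) ∈ A := (hloc x₀).of_le (by exact_mod_cast le_top)
  have hAo : IsOpen A := by
    rw [isOpen_iff_mem_nhds]
    intro t ht
    have hc : ContinuousAt (fun τ : ℝ => (τ, x₀)) t := by fun_prop
    exact hc.eventually (hnear ht)
  have hAc : IsClosed A := by
    rw [isClosed_iff_frequently]
    intro t ht
    have h1 := hnear ((hloc (φ t x₀)).of_le (m := (n : WithTop ℕ∞)) (by exact_mod_cast le_top))
    have hc : ContinuousAt (fun τ : ℝ => (t - τ, φ τ x₀)) t :=
      (by fun_prop : ContinuousAt (fun τ : ℝ => t - τ) t).prodMk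
        (hφ x₀).continuous.continuousAt
    have h2 : ∀ᶠ τ in 𝓝 t, ContMDiffAt (𝓘(ℝ, ℝ).prod I) I n
      (fun w : ℝ × N => φ w.1 w.2) (t - τ, φ τ x₀) := by
      refine hc.eventually ?_
      simpa using h1
    obtain ⟨τ, hτ, hτ'⟩ := (ht.and_eventually h2).exists
    have h3 : ContMDiffAt (𝓘(ℝ, ℝ).prod I) I n (fun w : ℝ × N => φ τ w.2) (t, x₀) :=
      ContMDiffAt.comp (t, x₀) (g := fun w : ℝ × N => φ w.1 w.2) (f := fun w : ℝ × N => (τ, w.2))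
        hτ (contMDiffAt_const.prodMk contMDiffAt_snd)
    have h4 : ContMDiffAt (𝓘(ℝ, ℝ).prod I) (𝓘(ℝ, ℝ).prod I) n
        (fun w : ℝ × N => (w.1 - τ, φ τ w.2)) (t, x₀) := by
      refine ContMDiffAt.prodMk ?_ h3
      exact ((contDiff_id.sub contDiff_const).contMDiff.contMDiffAt).comp (t, x₀)
        (g := fun a : ℝ => a - τ) contMDiffAt_fst
    have h5 := ContMDiffAt.comp (t, x₀) (g := fun w : ℝ × N => φ w.1 w.2) hτ' h4
    refine h5.congr_of_eventuallyEq (Eventually.of_forall fun w => ?_)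
    simp only [Function.comp_apply]
    rw [← IsMIntegralCurve.flow_add hv h0 hφ, sub_add_cancel]
  have : A = univ := IsClopen.eq_univ ⟨hAc, hAo⟩ ⟨0, hA0⟩
  exact this.symm.subset (mem_univ t₁)

theorem exists_uniform_time [FiniteDimensional ℝ E] [IsManifold I ∞ N] [I.Boundaryless]
    {v : ∀ x : N, TangentSpace I x}
    (hv : ContMDiff I I.tangent ∞ (fun x => (⟨x, v x⟩ : TangentBundle I N)))
    {K : Set N} (hK : IsCompact K) :
    ∃ ε > 0, ∀ x ∈ K, ∃ γ : ℝ → N, γ 0 = x ∧ IsMIntegralCurveOn γ v (Ioo (-ε) ε) := by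
  refine hK.induction_on (p := fun K => ∃ ε > 0, ∀ x ∈ K, ∃ γ : ℝ → N, γ 0 = x ∧
    IsMIntegralCurveOn γ v (Ioo (-ε) ε)) ⟨1, one_pos, by simp⟩ ?_ ?_ ?_
  · rintro s t hst ⟨ε, hε, h⟩
    exact ⟨ε, hε, fun x hx => h x (hst hx)⟩
  · rintro s t ⟨ε, hε, h⟩ ⟨ε', hε', h'⟩
    refine ⟨min ε ε', lt_min hε hε', ?_⟩
    rintro x (hx | hx)
    · obtain ⟨γ, h0, h1⟩ := h x hx
      exact ⟨γ, h0, h1.mono (Ioo_subset_Ioo (neg_le_neg (min_le_left _ _)) (min_le_left _ _))⟩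
    · obtain ⟨γ, h0, h1⟩ := h' x hx
      exact ⟨γ, h0, h1.mono (Ioo_subset_Ioo (neg_le_neg (min_le_right _ _)) (min_le_right _ _))⟩
  · intro x _
    obtain ⟨ε, hε, U, hU, ψ, hψ, -⟩ := exists_local_flow_manifold hv x
    exact ⟨U, mem_nhdsWithin_of_mem_nhds hU, ε, hε, fun y hy => ⟨ψ y, hψ y hy⟩⟩

/-- An integral curve which can always be continued for a uniform time is global. -/
theorem exists_isMIntegralCurve_of_extend [FiniteDimensional ℝ E] [IsManifold I ∞ N]
    [I.Boundaryless] [T2Space N] {v : ∀ x : N, TangentSpace I x}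
    (hv : ContMDiff I I.tangent ∞ (fun x => (⟨x, v x⟩ : TangentBundle I N))) (x : N)
    (h : ∀ A : ℝ, ∃ ε > 0, ∀ b ≤ A, ∀ γ : ℝ → N, γ 0 = x → IsMIntegralCurveOn γ v (Ioo (-b) b) →
      ∀ t ∈ Ioo (-b) b, ∃ γ' : ℝ → N, γ' 0 = γ t ∧ IsMIntegralCurveOn γ' v (Ioo (-ε) ε)) :
    ∃ γ : ℝ → N, γ 0 = x ∧ IsMIntegralCurve γ v := by
  have : IsManifold I 1 N := IsManifold.of_le (n := ∞) (by simp)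
  obtain ⟨ε₀, hε₀, hx⟩ := exists_uniform_time hv (isCompact_singleton (x := x))
  have hx := hx x rfl
  have hv1 : ContMDiff I I.tangent 1 (fun x => (⟨x, v x⟩ : TangentBundle I N)) :=
    hv.of_le (by simp)
  let s := { a | ∃ γ, γ 0 = x ∧ IsMIntegralCurveOn γ v (Ioo (-a) a) }
  suffices hbdd : ¬BddAbove s by
    rw [not_bddAbove_iff] at hbdd
    rw [exists_isMIntegralCurve_iff_exists_isMIntegralCurveOn_Ioo hv1]
    intro a
    obtain ⟨y, ⟨γ, hγ1, hγ2⟩, hlt⟩ := hbdd a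
    exact ⟨γ, hγ1, hγ2.mono <| Ioo_subset_Ioo (neg_le_neg hlt.le) hlt.le⟩
  intro hbdd
  set asup := sSup s with hasup
  obtain ⟨ε₁, hε₁, hext⟩ := h asup
  set ε := min ε₀ ε₁ with hεdef
  have hε : 0 < ε := lt_min hε₀ hε₁
  have hεε₁ : ε ≤ ε₁ := min_le_right _ _
  obtain ⟨a, ha, hlt⟩ := Real.add_neg_lt_sSup (⟨ε₀, hx⟩ : Set.Nonempty s) (ε := - (ε / 2))
    (by rw [neg_lt, neg_zero]; exact half_pos hε)
  have haa : a ≤ asup := le_csSup hbdd ha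
  have hεle : ε ≤ asup := (min_le_left _ _).trans (le_csSup hbdd hx)
  rw [← hasup, ← sub_eq_add_neg] at hlt
  obtain ⟨γ, h0, hγ⟩ := ha
  obtain ⟨γ1_aux, h1_aux, hγ1⟩ := hext a haa γ h0 hγ (-(asup - ε / 2)) ⟨by linarith, by linarith⟩
  obtain ⟨γ2_aux, h2_aux, hγ2⟩ := hext a haa γ h0 hγ (asup - ε / 2) ⟨by linarith, by linarith⟩
  replace hγ1 := hγ1.mono (Ioo_subset_Ioo (neg_le_neg hεε₁) hεε₁)
  replace hγ2 := hγ2.mono (Ioo_subset_Ioo (neg_le_neg hεε₁) hεε₁)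
  rw [← isMIntegralCurveOn_comp_add (dt := asup - ε / 2)] at hγ1
  set γ1 := γ1_aux ∘ (· + (asup - ε / 2)) with γ1_def
  have heq1 : γ1 (-(asup - ε / 2)) = γ (-(asup - ε / 2)) := by simp [γ1_def, h1_aux]
  rw [← isMIntegralCurveOn_comp_sub (dt := asup - ε / 2)] at hγ2
  set γ2 := γ2_aux ∘ (· - (asup - ε / 2)) with γ2_def
  have heq2 : γ2 (asup - ε / 2) = γ (asup - ε / 2) := by simp [γ2_def, h2_aux]
  simp_rw [Set.mem_Ioo, ← sub_lt_iff_lt_add, ← lt_sub_iff_add_lt, ← Set.mem_Ioo] at hγ1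
  simp_rw [Set.mem_Ioo, lt_sub_iff_add_lt, sub_lt_iff_lt_add, ← Set.mem_Ioo] at hγ2
  set γ_ext : ℝ → N := piecewise (Ioo (-(asup + ε / 2)) a)
    (piecewise (Ioo (-a) a) γ γ1) γ2 with γ_ext_def
  have heq_ext : γ_ext 0 = x := by
    rw [γ_ext_def, piecewise, if_pos ⟨by linarith, by linarith⟩, piecewise,
      if_pos ⟨by linarith, by linarith⟩, h0]
  suffices hext : IsMIntegralCurveOn γ_ext v (Ioo (-(asup + ε / 2)) (asup + ε / 2)) from
    (not_lt.mpr <| le_csSup hbdd ⟨γ_ext, heq_ext, hext⟩) <| lt_add_of_pos_right asup (half_pos hε)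
  apply (isMIntegralCurveOn_piecewise (t₀ := asup - ε / 2) hv1 _ hγ2
      ⟨⟨by linarith, hlt⟩, ⟨by linarith, by linarith⟩⟩
      (by rw [piecewise, if_pos ⟨by linarith, hlt⟩, ← heq2])).mono
    (Ioo_subset_Ioo_union_Ioo le_rfl (by linarith) (by linarith))
  exact (isMIntegralCurveOn_piecewise (t₀ := -(asup - ε / 2)) hv1 hγ hγ1
      ⟨⟨neg_lt_neg hlt, by linarith⟩, ⟨by linarith, by linarith⟩⟩ heq1.symm).mono
    (union_comm _ _ ▸ Ioo_subset_Ioo_union_Ioo (by linarith) (by linarith) le_rfl)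

end GlobalFlow

/-! ### Flows of fields on a product with a vector space -/

section ProductField

variable {E : Type*} [NormedAddCommGroup E] [NormedSpace ℝ E]
  {M : Type*} [TopologicalSpace M] [ChartedSpace E M]
  {Q : Type*} [NormedAddCommGroup Q] [NormedSpace ℝ Q]

theorem hasMFDerivAt_smulRight_iff_hasDerivAt {q : ℝ → Q} {a : Q} {t : ℝ} :
    HasMFDerivAt 𝓘(ℝ, ℝ) 𝓘(ℝ, Q) q t ((1 : ℝ →L[ℝ] ℝ).smulRight a) ↔ HasDerivAt q a t := by
  rw [hasDerivAt_iff_hasFDerivAt]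
  refine Iff.trans hasMFDerivAt_iff_hasFDerivAt ?_
  have : (1 : ℝ →L[ℝ] ℝ).smulRight a = ContinuousLinearMap.toSpanSingleton ℝ a := by
    ext; simp
  exact Iff.of_eq (congrArg (fun L => HasFDerivAt q L t) this)

/-- The vector field `(f, X)` on `Q × M`. -/
def prodVF (f : Q × M → Q) (X : Q → VF E M) (z : Q × M) :
    TangentSpace (𝓘(ℝ, Q).prod 𝓘(ℝ, E)) z :=
  ((f z, X z.1 z.2) : Q × E)

theorem contMDiff_prodVF [IsManifold 𝓘(ℝ, E) ∞ M] {f : Q × M → Q}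
    (hf : ContMDiff (𝓘(ℝ, Q).prod 𝓘(ℝ, E)) 𝓘(ℝ, Q) ∞ f) {X : Q → VF E M}
    (hX : ContMDiff (𝓘(ℝ, Q).prod 𝓘(ℝ, E)) 𝓘(ℝ, E).tangent ∞
      (fun z : Q × M => (⟨z.2, X z.1 z.2⟩ : TangentBundle 𝓘(ℝ, E) M))) :
    ContMDiff (𝓘(ℝ, Q).prod 𝓘(ℝ, E)) (𝓘(ℝ, Q).prod 𝓘(ℝ, E)).tangent ∞
      (fun z : Q × M => (⟨z, prodVF f X z⟩ : TangentBundle (𝓘(ℝ, Q).prod 𝓘(ℝ, E)) (Q × M))) := by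
  have : IsManifold 𝓘(ℝ, E) 1 M := IsManifold.of_le (n := ∞) (by simp)
  have h1 : ContMDiff (𝓘(ℝ, Q).prod 𝓘(ℝ, E)) 𝓘(ℝ, Q).tangent ∞
      (fun z : Q × M => (⟨z.1, f z⟩ : TangentBundle 𝓘(ℝ, Q) Q)) := by
    intro z
    refine (Bundle.contMDiffAt_totalSpace).2 ⟨contMDiffAt_fst, ?_⟩
    simpa using hf z
  exact contMDiff_equivTangentBundleProd_symm.comp (h1.prodMk hX)

theorem hasMFDerivAt_prodVF_iff {f : Q × M → Q} {X : Q → VF E M} {γ : ℝ → Q × M} {t : ℝ} :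
    HasMFDerivAt 𝓘(ℝ, ℝ) (𝓘(ℝ, Q).prod 𝓘(ℝ, E)) γ t
      ((1 : ℝ →L[ℝ] ℝ).smulRight (prodVF f X (γ t))) ↔
    HasDerivAt (fun τ => (γ τ).1) (f (γ t)) t ∧
      HasMFDerivAt 𝓘(ℝ, ℝ) 𝓘(ℝ, E) (fun τ => (γ τ).2) t
        ((1 : ℝ →L[ℝ] ℝ).smulRight (X (γ t).1 (γ t).2)) := by
  constructor
  · intro h
    constructor
    · rw [← hasMFDerivAt_smulRight_iff_hasDerivAt]
      exact ((hasMFDerivAt_fst (I := 𝓘(ℝ, Q)) (I' := 𝓘(ℝ, E)) (γ t)).comp t h).congr_mfderiv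
        (ContinuousLinearMap.ext fun a => rfl)
    · exact ((hasMFDerivAt_snd (I := 𝓘(ℝ, Q)) (I' := 𝓘(ℝ, E)) (γ t)).comp t h).congr_mfderiv
        (ContinuousLinearMap.ext fun a => rfl)
  · rintro ⟨h1, h2⟩
    rw [← hasMFDerivAt_smulRight_iff_hasDerivAt] at h1
    exact (h1.prodMk h2).congr_mfderiv (ContinuousLinearMap.ext fun a => rfl)

end ProductField

section CocycleFlow

variable {E : Type*} [NormedAddCommGroup E] [NormedSpace ℝ E]
  {M : Type*} [TopologicalSpace M] [ChartedSpace E M]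
  {P : Type*} [NormedAddCommGroup P] [NormedSpace ℝ P]

theorem isMIntegralCurveOn_iff_of_isOpen {E' H N : Type*} [NormedAddCommGroup E'] [NormedSpace ℝ E']
    [TopologicalSpace H] {I : ModelWithCorners ℝ E' H} [TopologicalSpace N] [ChartedSpace H N]
    {v : ∀ x : N, TangentSpace I x} {γ : ℝ → N} {s : Set ℝ} (hs : IsOpen s) :
    IsMIntegralCurveOn γ v s ↔
      ∀ t ∈ s, HasMFDerivAt 𝓘(ℝ, ℝ) I γ t ((1 : ℝ →L[ℝ] ℝ).smulRight (v (γ t))) :=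
  ⟨fun h t ht => (h t ht).hasMFDerivAt (hs.mem_nhds ht),
    fun h t ht => (h t ht).hasMFDerivWithinAt⟩

theorem hasMFDerivAt_const_zero {x : M} {w : TangentSpace 𝓘(ℝ, E) x} (hw : w = 0) (t : ℝ) :
    HasMFDerivAt 𝓘(ℝ, ℝ) 𝓘(ℝ, E) (fun _ : ℝ => x) t ((1 : ℝ →L[ℝ] ℝ).smulRight w) := by
  subst hw
  refine (hasMFDerivAt_const x t).congr_mfderiv (ContinuousLinearMap.ext fun (a : ℝ) => ?_)
  exact (smul_zero a).symm

theorem eq_add_smul_of_hasDerivAt {p : ℝ → P} {e : P} {a b : ℝ}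
    (h : ∀ t ∈ Ioo a b, HasDerivAt p e t) {t₀ t : ℝ} (ht₀ : t₀ ∈ Ioo a b) (ht : t ∈ Ioo a b) :
    p t = p t₀ + (t - t₀) • e := by
  have h1 : ∀ τ ∈ Ioo a b, HasDerivAt (fun τ => p τ - τ • e) 0 τ := fun τ hτ => by
    have := (h τ hτ).sub ((hasDerivAt_id τ).smul_const e)
    simpa using! this
  have h2 := (convex_Ioo a b).is_const_of_fderivWithin_eq_zero (𝕜 := ℝ)
    (f := fun τ => p τ - τ • e)
    (fun τ hτ => (h1 τ hτ).differentiableAt.differentiableWithinAt) (fun τ hτ => ?_) ht ht₀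
  · replace h2 : p t - t • e = p t₀ - t₀ • e := h2
    rw [sub_smul]
    rw [sub_eq_iff_eq_add] at h2
    rw [h2]; abel
  · rw [fderivWithin_of_isOpen isOpen_Ioo hτ]
    have := (h1 τ hτ).hasFDerivAt.fderiv
    rw [this]; ext; simp

variable [IsManifold 𝓘(ℝ, E) ∞ M]

/-- Uniqueness of integral curves of a time-dependent field with parameters. -/
theorem eqOn_of_hasMFDerivAt [T2Space M] {X : P → VF E M} {e : P}
    (hX : ContMDiff (𝓘(ℝ, P).prod 𝓘(ℝ, E)) 𝓘(ℝ, E).tangent ∞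
      (fun z : P × M => (⟨z.2, X z.1 z.2⟩ : TangentBundle 𝓘(ℝ, E) M))) {p : P} {γ γ' : ℝ → M}
    {a b : ℝ}
    (h : ∀ t ∈ Ioo a b, HasMFDerivAt 𝓘(ℝ, ℝ) 𝓘(ℝ, E) γ t
      ((1 : ℝ →L[ℝ] ℝ).smulRight (X (p + t • e) (γ t))))
    (h' : ∀ t ∈ Ioo a b, HasMFDerivAt 𝓘(ℝ, ℝ) 𝓘(ℝ, E) γ' t
      ((1 : ℝ →L[ℝ] ℝ).smulRight (X (p + t • e) (γ' t)))) {t₀ : ℝ} (ht₀ : t₀ ∈ Ioo a b)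
    (h0 : γ t₀ = γ' t₀) : EqOn γ γ' (Ioo a b) := by
  have : IsManifold 𝓘(ℝ, E) 1 M := IsManifold.of_le (n := ∞) (by simp)
  have hv := contMDiff_prodVF (f := fun _ => e) contMDiff_const hX
  have key : ∀ δ : ℝ → M, (∀ t ∈ Ioo a b, HasMFDerivAt 𝓘(ℝ, ℝ) 𝓘(ℝ, E) δ t
      ((1 : ℝ →L[ℝ] ℝ).smulRight (X (p + t • e) (δ t)))) →
      IsMIntegralCurveOn (fun t => (p + t • e, δ t)) (prodVF (fun _ => e) X) (Ioo a b) := by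
    intro δ hδ
    rw [isMIntegralCurveOn_iff_of_isOpen isOpen_Ioo]
    intro t ht
    rw [hasMFDerivAt_prodVF_iff]
    refine ⟨?_, hδ t ht⟩
    simpa using! ((hasDerivAt_id t).smul_const e).const_add p
  have := isMIntegralCurveOn_Ioo_eqOn_of_contMDiff_boundaryless ht₀ (hv.of_le (by simp))
    (key γ h) (key γ' h') (by simp [h0])
  exact fun t ht => (Prod.ext_iff.1 (this ht)).2

/-- A compactly supported vector field on `M` which depends on time and parameters has a complete
smooth flow `Φ`; moreover a linear equation along the flow has a smooth solution `R`. -/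
theorem exists_flow_cocycle [FiniteDimensional ℝ E] [T2Space M] [FiniteDimensional ℝ P]
    {A : Type*} [NormedRing A] [NormedAlgebra ℝ A] [FiniteDimensional ℝ A] (e : P)
    {X : P → VF E M}
    (hX : ContMDiff (𝓘(ℝ, P).prod 𝓘(ℝ, E)) 𝓘(ℝ, E).tangent ∞
      (fun z : P × M => (⟨z.2, X z.1 z.2⟩ : TangentBundle 𝓘(ℝ, E) M)))
    {lam : P × M → A} (hlam : ContMDiff (𝓘(ℝ, P).prod 𝓘(ℝ, E)) 𝓘(ℝ, A) ∞ lam)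
    {C : Set M} (hC : IsCompact C) (hXC : ∀ p, ∀ x ∉ C, X p x = 0)
    (hlC : ∀ p, ∀ x ∉ C, lam (p, x) = 0) :
    ∃ (Φ : ℝ → P → M → M) (R : ℝ → P → M → A),
      ContMDiff (𝓘(ℝ, ℝ).prod (𝓘(ℝ, P).prod 𝓘(ℝ, E))) 𝓘(ℝ, E) ∞
        (fun z : ℝ × (P × M) => Φ z.1 z.2.1 z.2.2) ∧
      ContMDiff (𝓘(ℝ, ℝ).prod (𝓘(ℝ, P).prod 𝓘(ℝ, E))) 𝓘(ℝ, A) ∞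
        (fun z : ℝ × (P × M) => R z.1 z.2.1 z.2.2) ∧
      (∀ p x, Φ 0 p x = x) ∧ (∀ p x, R 0 p x = 1) ∧
      (∀ t p x, HasMFDerivAt 𝓘(ℝ, ℝ) 𝓘(ℝ, E) (fun τ => Φ τ p x) t
        ((1 : ℝ →L[ℝ] ℝ).smulRight (X (p + t • e) (Φ t p x)))) ∧
      (∀ t p x, HasDerivAt (fun τ => R τ p x) (lam (p + t • e, Φ t p x) * R t p x) t) := by
  let f : (P × A) × M → P × A := fun z => (e, lam (z.1.1, z.2) * z.1.2)
  let X' : P × A → VF E M := fun q => X q.1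
  have hpr : ContMDiff (𝓘(ℝ, P × A).prod 𝓘(ℝ, E)) (𝓘(ℝ, P).prod 𝓘(ℝ, E)) ∞
      (fun z : (P × A) × M => (z.1.1, z.2)) :=
    (contDiff_fst.contMDiff.comp contMDiff_fst).prodMk contMDiff_snd
  have hf : ContMDiff (𝓘(ℝ, P × A).prod 𝓘(ℝ, E)) 𝓘(ℝ, P × A) ∞ f := by
    refine contMDiff_const.prodMk_space ?_
    have h2 : ContMDiff (𝓘(ℝ, P × A).prod 𝓘(ℝ, E)) 𝓘(ℝ, A) ∞ (fun z : (P × A) × M => z.1.2) :=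
      contDiff_snd.contMDiff.comp contMDiff_fst
    exact ContDiff.comp_contMDiff (g := fun w : A × A => w.1 * w.2) contDiff_mul
      ((hlam.comp hpr).prodMk_space h2)
  have hX' : ContMDiff (𝓘(ℝ, P × A).prod 𝓘(ℝ, E)) 𝓘(ℝ, E).tangent ∞
      (fun z : (P × A) × M => (⟨z.2, X' z.1 z.2⟩ : TangentBundle 𝓘(ℝ, E) M)) := hX.comp hpr
  have hv := contMDiff_prodVF hf hX'
  have hex : ∀ z : (P × A) × M, ∃ γ : ℝ → (P × A) × M, γ 0 = z ∧
      IsMIntegralCurve γ (prodVF f X') := by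
    intro z
    refine exists_isMIntegralCurve_of_extend hv z fun B => ?_
    have hK : IsCompact ((Metric.closedBall z.1.1 (B * ‖e‖) ×ˢ ({1} : Set A)) ×ˢ C) := by
      have : ProperSpace P := FiniteDimensional.proper ℝ P
      exact ((isCompact_closedBall _ _).prod isCompact_singleton).prod hC
    obtain ⟨ε, hε, hunif⟩ := exists_uniform_time hv hK
    refine ⟨ε, hε, fun b hb γ hγ0 hγ t ht => ?_⟩
    rw [isMIntegralCurveOn_iff_of_isOpen isOpen_Ioo] at hγ
    simp only [hasMFDerivAt_prodVF_iff] at hγ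
    have hp : (γ t).1.1 = z.1.1 + t • e := by
      have := eq_add_smul_of_hasDerivAt (p := fun τ => (γ τ).1.1) (e := e) (a := -b) (b := b)
        (fun τ hτ => ((hγ τ hτ).1).fst) (t₀ := 0) (t := t)
        ⟨by linarith [ht.1, ht.2], by linarith [ht.1, ht.2]⟩ ht
      simpa [hγ0] using this
    have hpb : (γ t).1.1 ∈ Metric.closedBall z.1.1 (B * ‖e‖) := by
      rw [hp, Metric.mem_closedBall, dist_self_add_left, norm_smul]
      gcongr
      exact (abs_le.2 ⟨ht.1.le, ht.2.le⟩).trans hb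
    by_cases hxC : (γ t).2 ∈ C
    · obtain ⟨δ, hδ0, hδ⟩ := hunif (((γ t).1.1, 1), (γ t).2) ⟨⟨hpb, rfl⟩, hxC⟩
      refine ⟨fun τ => (((δ τ).1.1, (δ τ).1.2 * (γ t).1.2), (δ τ).2), by simp [hδ0], ?_⟩
      rw [isMIntegralCurveOn_iff_of_isOpen isOpen_Ioo] at hδ ⊢
      intro τ hτ
      have h1 := hδ τ hτ
      rw [hasMFDerivAt_prodVF_iff] at h1 ⊢
      refine ⟨?_, h1.2⟩
      have h2 : HasDerivAt (fun τ => (δ τ).1.1) e τ := h1.1.fst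
      have h3 : HasDerivAt (fun τ => (δ τ).1.2) (lam ((δ τ).1.1, (δ τ).2) * (δ τ).1.2) τ := h1.1.snd
      have h4 := h2.prodMk (h3.mul_const (γ t).1.2)
      simpa only [f, mul_assoc] using h4
    · refine ⟨fun τ => (((γ t).1.1 + τ • e, (γ t).1.2), (γ t).2), by simp, ?_⟩
      rw [isMIntegralCurveOn_iff_of_isOpen isOpen_Ioo]
      intro τ hτ
      rw [hasMFDerivAt_prodVF_iff]
      refine ⟨?_, hasMFDerivAt_const_zero (hXC _ _ hxC) τ⟩
      have h2 : HasDerivAt (fun τ : ℝ => (γ t).1.1 + τ • e) e τ := by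
        simpa using! ((hasDerivAt_id τ).smul_const e).const_add (γ t).1.1
      have h4 := h2.prodMk (hasDerivAt_const τ (γ t).1.2)
      simpa only [f, hlC _ _ hxC, zero_mul] using h4
  choose φ hφ0 hφ using hex
  have hs := contMDiff_of_isMIntegralCurve hv (φ := fun t z => φ z t) hφ0 hφ
  have hin : ContMDiff (𝓘(ℝ, ℝ).prod (𝓘(ℝ, P).prod 𝓘(ℝ, E)))
      (𝓘(ℝ, ℝ).prod (𝓘(ℝ, P × A).prod 𝓘(ℝ, E))) ∞
      (fun z : ℝ × (P × M) => (z.1, ((z.2.1, (1 : A)), z.2.2))) := by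
    refine contMDiff_fst.prodMk (ContMDiff.prodMk ?_ (contMDiff_snd.comp contMDiff_snd))
    exact (contMDiff_fst.comp contMDiff_snd).prodMk_space contMDiff_const
  have hs' := hs.comp hin
  have hd : ∀ t p x, HasDerivAt (fun τ => (φ ((p, 1), x) τ).1) (f (φ ((p, 1), x) t)) t ∧
      HasMFDerivAt 𝓘(ℝ, ℝ) 𝓘(ℝ, E) (fun τ => (φ ((p, 1), x) τ).2) t
        ((1 : ℝ →L[ℝ] ℝ).smulRight (X (φ ((p, 1), x) t).1.1 (φ ((p, 1), x) t).2)) := by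
    intro t p x
    exact hasMFDerivAt_prodVF_iff.1 (hφ ((p, 1), x) t)
  have hpc : ∀ t p x, (φ ((p, 1), x) t).1.1 = p + t • e := by
    intro t p x
    have := eq_add_smul_of_hasDerivAt (p := fun τ => (φ ((p, 1), x) τ).1.1) (e := e)
      (a := -(|t| + 1)) (b := |t| + 1) (fun τ _ => ((hd τ p x).1).fst) (t₀ := 0) (t := t)
      ⟨by linarith [abs_nonneg t], by linarith [abs_nonneg t]⟩
      ⟨by linarith [neg_abs_le t], by linarith [le_abs_self t]⟩
    simpa [hφ0] using this
  refine ⟨fun t p x => (φ ((p, 1), x) t).2, fun t p x => (φ ((p, 1), x) t).1.2,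
    contMDiff_snd.comp hs', (contDiff_snd.contMDiff.comp contMDiff_fst).comp hs', ?_, ?_, ?_, ?_⟩
  · intro p x; simp only [hφ0]
  · intro p x; simp only [hφ0]
  · intro t p x
    have := (hd t p x).2
    rwa [hpc] at this
  · intro t p x
    have h1 : HasDerivAt (fun τ => (φ ((p, 1), x) τ).1.2) _ t := ((hd t p x).1).snd
    rw [← hpc t p x]
    exact h1

end CocycleFlow

section LieDerivative

variable {E : Type*} [NormedAddCommGroup E] [NormedSpace ℝ E]
  {H : Type*} [TopologicalSpace H] {I : ModelWithCorners ℝ E H}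
  {N : Type*} [TopologicalSpace N] [ChartedSpace H N]
  {E' : Type*} [NormedAddCommGroup E'] [NormedSpace ℝ E']

/-- The derivative of a vector valued map, as a map on the model space. -/
def tderiv (I : ModelWithCorners ℝ E H) (f : N → E') (x : N) : E →L[ℝ] E' :=
  mfderiv I 𝓘(ℝ, E') f x

theorem tderiv_extChartAt_self [IsManifold I ∞ N] [I.Boundaryless] (x : N) :
    tderiv I (extChartAt I x) x = ContinuousLinearMap.id ℝ E := by
  have : IsManifold I 1 N := IsManifold.of_le (n := ∞) (by simp)
  exact mfderiv_extChartAt_self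

/-- The value of a vector field, as an element of the model space. -/
def vfVal (V : ∀ x : N, TangentSpace I x) (x : N) : E := V x

theorem hasDerivWithinAt_extChartAt_comp_chartVF [IsManifold I ∞ N]
    {v : ∀ x : N, TangentSpace I x} {γ : ℝ → N} {t : ℝ} {s : Set ℝ}
    (h : HasMFDerivWithinAt 𝓘(ℝ, ℝ) I γ s t ((1 : ℝ →L[ℝ] ℝ).smulRight (v (γ t)))) {x₀ : N}
    (hx : γ t ∈ (extChartAt I x₀).source) :
    HasDerivWithinAt (fun τ => extChartAt I x₀ (γ τ))
      (chartVF I v x₀ (extChartAt I x₀ (γ t))) s t := by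
  have h1 := hasDerivWithinAt_extChartAt_comp h hx
  have h2 : chartVF I v x₀ (extChartAt I x₀ (γ t)) =
      (mfderiv I 𝓘(ℝ, E) (extChartAt I x₀) (γ t) (v (γ t)) : E) := by
    unfold chartVF
    rw [(extChartAt I x₀).left_inv hx]
  rw [h2]
  exact h1

theorem tderiv_comp_of_eq [IsManifold I ∞ N] [I.Boundaryless] {N' : Type*} [TopologicalSpace N']
    {H' E'' : Type*} [NormedAddCommGroup E''] [NormedSpace ℝ E''] [TopologicalSpace H']
    {I' : ModelWithCorners ℝ E'' H'} [ChartedSpace H' N'] {g : N' → N} {e : N → E'} {y : N'}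
    {z : N} (hz : g y = z)
    (hg : MDifferentiableAt I' I g y) (he : MDifferentiableAt I 𝓘(ℝ, E') e z) :
    tderiv I' (fun w => e (g w)) y = (tderiv I e z).comp (tderiv I' (fun w => extChartAt I z (g w)) y) := by
  subst hz
  have : IsManifold I 1 N := IsManifold.of_le (n := ∞) (by simp)
  have h1 := mfderiv_comp y he hg
  have h2 := mfderiv_comp y (mdifferentiableAt_extChartAt (mem_chart_source H (g y))) hg
  have h3 : tderiv I' (fun w => extChartAt I (g y) (g w)) y = (mfderiv I' I g y : E'' →L[ℝ] E) := by
    refine Eq.trans h2 ?_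
    have := tderiv_extChartAt_self (I := I) (g y)
    exact (congrArg (fun L : E →L[ℝ] E => L.comp (mfderiv I' I g y : E'' →L[ℝ] E)) this).trans
      (ContinuousLinearMap.id_comp _)
  rw [h3]
  exact h1

theorem mpullback_extChartAt_symm [IsManifold I ∞ N] [I.Boundaryless] [CompleteSpace E]
    (V : ∀ x : N, TangentSpace I x)
    (x₀ : N) {z : E} (hz : z ∈ (extChartAt I x₀).target) :
    (VectorField.mpullbackWithin 𝓘(ℝ, E) I (extChartAt I x₀).symm V (range I) z : E) =
      chartVF I V x₀ z := by
  have : IsManifold I 1 N := IsManifold.of_le (n := ∞) (by simp)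
  have h : (mfderivWithin 𝓘(ℝ, E) I (extChartAt I x₀).symm (range I) z).inverse =
      mfderiv I 𝓘(ℝ, E) (extChartAt I x₀) ((extChartAt I x₀).symm z) :=
    ContinuousLinearMap.inverse_eq
      (mfderivWithin_extChartAt_symm_comp_mfderiv_extChartAt hz)
      (mfderiv_extChartAt_comp_mfderivWithin_extChartAt_symm hz)
  exact DFunLike.congr_fun h _

theorem mlieBracket_eq_lieBracket_chartVF [IsManifold I ∞ N] [I.Boundaryless] [CompleteSpace E]
    (V W : ∀ x : N, TangentSpace I x) (x₀ : N) :
    (VectorField.mlieBracket I V W x₀ : E) =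
      VectorField.lieBracket ℝ (chartVF I V x₀) (chartVF I W x₀) (extChartAt I x₀ x₀) := by
  have h1 : (VectorField.mlieBracket I V W x₀ : E) = (tderiv I (extChartAt I x₀) x₀).inverse
      (VectorField.lieBracketWithin ℝ
        (fun z => (VectorField.mpullbackWithin 𝓘(ℝ, E) I (extChartAt I x₀).symm V (range I) z : E))
        (fun z => (VectorField.mpullbackWithin 𝓘(ℝ, E) I (extChartAt I x₀).symm W (range I) z : E))
        ((extChartAt I x₀).symm ⁻¹' univ ∩ range I) (extChartAt I x₀ x₀)) := rfl
  have ht : (extChartAt I x₀).target ∈ 𝓝 (extChartAt I x₀ x₀) := extChartAt_target_mem_nhds x₀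
  have key : ∀ A B : E → E, (∀ z ∈ (extChartAt I x₀).target, A z = chartVF I V x₀ z) →
      (∀ z ∈ (extChartAt I x₀).target, B z = chartVF I W x₀ z) →
      (tderiv I (extChartAt I x₀) x₀).inverse
      (VectorField.lieBracketWithin ℝ A B ((extChartAt I x₀).symm ⁻¹' univ ∩ range I)
        (extChartAt I x₀ x₀)) =
      VectorField.lieBracket ℝ (chartVF I V x₀) (chartVF I W x₀) (extChartAt I x₀ x₀) := by
    intro A B hA hB
    rw [tderiv_extChartAt_self, ContinuousLinearMap.inverse_id, I.range_eq_univ, preimage_univ,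
      inter_univ, VectorField.lieBracketWithin_univ]
    refine Filter.EventuallyEq.lieBracket_vectorField_eq ?_ ?_
    · filter_upwards [ht] with z hz using hA z hz
    · filter_upwards [ht] with z hz using hB z hz
  exact h1.trans (key _ _ (fun z hz => mpullback_extChartAt_symm V x₀ hz)
    (fun z hz => mpullback_extChartAt_symm W x₀ hz))

variable [IsManifold I ∞ N] [I.Boundaryless]

/-- The Lie derivative of a vector field along a flow. -/
theorem hasDerivAt_pullback_flow [FiniteDimensional ℝ E] {v V : ∀ x : N, TangentSpace I x}
    (hv : ContMDiff I I.tangent ∞ (fun x => (⟨x, v x⟩ : TangentBundle I N)))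
    (hV : ContMDiff I I.tangent ∞ (fun x => (⟨x, V x⟩ : TangentBundle I N)))
    {φ : ℝ → N → N} (h0 : ∀ x, φ 0 x = x) (hφ : ∀ x, IsMIntegralCurve (fun t => φ t x) v)
    (hs : ContMDiff (𝓘(ℝ, ℝ).prod I) I ∞ (fun w : ℝ × N => φ w.1 w.2)) (z : N) :
    HasDerivAt (fun s => tderiv I (fun y => extChartAt I z (φ (-s) y)) (φ s z) (vfVal V (φ s z)))
      (vfVal (VectorField.mlieBracket I v V) z) 0 := by
  have : IsManifold I 1 N := IsManifold.of_le (n := ∞) (by simp)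
  have : CompleteSpace E := FiniteDimensional.complete ℝ E
  rw [show vfVal (VectorField.mlieBracket I v V) z = _ from mlieBracket_eq_lieBracket_chartVF v V z]
  set c := extChartAt I z with hc
  set f := chartVF I v z with hf
  set g := chartVF I V z with hg
  have hct : IsOpen c.target := isOpen_extChartAt_target z
  have hzt : c z ∈ c.target := mem_extChartAt_target z
  have hcz : c.symm (c z) = z := extChartAt_to_inv z
  have hft : ContDiffAt ℝ ∞ f (c z) := (contDiffOn_chartVF hv z).contDiffAt (hct.mem_nhds hzt)
  have hgt : ContDiffAt ℝ ∞ g (c z) := (contDiffOn_chartVF hV z).contDiffAt (hct.mem_nhds hzt)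
  let K : ℝ × E → E := fun w => c (φ (-w.1) (c.symm w.2))
  have hK : ContDiffAt ℝ ∞ K (0, c z) := by
    rw [← contMDiffAt_iff_contDiffAt]
    have h1 : ContMDiffAt 𝓘(ℝ, ℝ × E) (𝓘(ℝ, ℝ).prod I) ∞ (fun w : ℝ × E => (-w.1, c.symm w.2))
        (0, c z) := by
      refine ContMDiffAt.prodMk contDiff_fst.neg.contMDiff.contMDiffAt ?_
      exact ((contMDiffOn_extChartAt_symm z).contMDiffAt (hct.mem_nhds hzt)).comp (0, c z)
        contDiff_snd.contMDiff.contMDiffAt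
    have h2 := (hs (-0, c.symm (c z))).comp ((0 : ℝ), c z) h1
    have h3 : ContMDiffAt I 𝓘(ℝ, E) ∞ c (φ (-0) (c.symm (c z))) := by
      rw [hcz, neg_zero, h0]; exact contMDiffAt_extChartAt
    exact h3.comp ((0 : ℝ), c z) h2
  have hK2 : ContDiffAt ℝ 2 K (0, c z) := hK.of_le (WithTop.coe_le_coe.2 le_top)
  have hKev : ∀ᶠ w in 𝓝 ((0 : ℝ), c z), ContDiffAt ℝ 2 K w := hK2.eventually (by simp)
  have hKd : HasFDerivAt (fderiv ℝ K) (fderiv ℝ (fderiv ℝ K) (0, c z)) (0, c z) :=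
    ((hK2.fderiv_right (m := 1) (by norm_num)).differentiableAt (by simp)).hasFDerivAt
  have hcont : Continuous (fun s => φ s z) := (hφ z).continuous
  have hsrc : ∀ᶠ s in 𝓝 (0 : ℝ), φ s z ∈ c.source :=
    hcont.continuousAt.eventually
      (by simp only [h0]; exact extChartAt_source_mem_nhds z)
  have hη : HasDerivAt (fun s => c (φ s z)) (f (c z)) 0 := by
    have h1 := hasDerivWithinAt_extChartAt_comp_chartVF (x₀ := z) (s := univ) (t := 0)
      ((hφ z 0).hasMFDerivWithinAt) (by simp only [h0]; exact mem_extChartAt_source z)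
    rw [hasDerivWithinAt_univ, h0] at h1
    exact h1
  have hη0 : c (φ 0 z) = c z := by rw [h0]
  -- identify the curve in the chart
  have hcurve : (fun s => tderiv I (fun y => c (φ (-s) y)) (φ s z) (vfVal V (φ s z))) =ᶠ[𝓝 0]
      fun s => fderiv ℝ K (s, c (φ s z)) (0, g (c (φ s z))) := by
    have hcc : ContinuousAt (fun s => (s, c (φ s z))) (0 : ℝ) :=
      continuousAt_id.prodMk hη.continuousAt
    have h1 : ∀ᶠ s in 𝓝 (0 : ℝ), ContDiffAt ℝ 2 K (s, c (φ s z)) :=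
      hcc.eventually (by simpa only [hη0] using hKev)
    filter_upwards [hsrc, h1] with s hs1 hs2
    have hKs : HasFDerivAt (fun η => K (s, η)) ((fderiv ℝ K (s, c (φ s z))).comp
        (ContinuousLinearMap.inr ℝ ℝ E)) (c (φ s z)) :=
      HasFDerivAt.comp (c (φ s z)) (g := K) (f := fun η => (s, η))
        (hs2.differentiableAt (by simp)).hasFDerivAt (hasFDerivAt_prodMk_right s _)
    have hcd := (mdifferentiableAt_extChartAt (I := I) (x := z) (y := φ s z)
      (by simpa [hc] using hs1)).hasMFDerivAt
    have h2 := HasMFDerivAt.comp (φ s z) hKs.hasMFDerivAt hcd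
    have h3 : (fun y => c (φ (-s) y)) =ᶠ[𝓝 (φ s z)] (fun η => K (s, η)) ∘ c := by
      filter_upwards [extChartAt_source_mem_nhds' (I := I) hs1] with y hy
      simp only [K, Function.comp_apply]
      rw [c.left_inv hy]
    have h4 := (h2.congr_of_eventuallyEq h3).mfderiv
    have h5 := DFunLike.congr_fun h4 (V (φ s z))
    refine Eq.trans h5 ?_
    have hcs : c.symm (c (φ s z)) = φ s z := c.left_inv hs1
    have h6 : g (c (φ s z)) = tderiv I c (φ s z) (vfVal V (φ s z)) := by
      have : g (c (φ s z)) = tderiv I c (c.symm (c (φ s z))) (vfVal V (c.symm (c (φ s z)))) := rfl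
      rw [this, hcs]
    rw [h6]
    rfl
  refine HasDerivAt.congr_of_eventuallyEq ?_ hcurve
  -- differentiate
  have hpair : HasDerivAt (fun s => (s, c (φ s z))) ((1 : ℝ), f (c z)) 0 :=
    (hasDerivAt_id (0 : ℝ)).prodMk hη
  have hd1 : HasDerivAt (fun s => fderiv ℝ K (s, c (φ s z)))
      (fderiv ℝ (fderiv ℝ K) (0, c z) (1, f (c z))) 0 := by
    have h1 : HasFDerivAt (fderiv ℝ K) (fderiv ℝ (fderiv ℝ K) (0, c z)) ((0 : ℝ), c (φ 0 z)) := by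
      rwa [hη0]
    exact h1.comp_hasDerivAt (0 : ℝ) hpair
  have hgd : HasFDerivAt g (fderiv ℝ g (c z)) (c (φ 0 z)) := by
    rw [hη0]; exact (hgt.differentiableAt (by simp)).hasFDerivAt
  have hd2 : HasDerivAt (fun s => ((0 : ℝ), g (c (φ s z)))) ((0 : ℝ), fderiv ℝ g (c z) (f (c z))) 0 :=
    (hasDerivAt_const _ _).prodMk (HasFDerivAt.comp_hasDerivAt (f := fun s => c (φ s z)) (0 : ℝ) hgd hη)
  have hd := hd1.clm_apply hd2
  simp only [hη0] at hd
  convert! hd using 1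
  -- second derivatives of `K`
  have hK0 : ∀ᶠ η in 𝓝 (c z), K (0, η) = η := by
    filter_upwards [hct.mem_nhds hzt] with η hη'
    simp only [K, neg_zero, h0]
    exact c.right_inv hη'
  have hinr : ContinuousAt (fun η : E => ((0 : ℝ), η)) (c z) := by fun_prop
  have hKev' : ∀ᶠ η in 𝓝 (c z), ContDiffAt ℝ 2 K (0, η) := hinr.eventually hKev
  have hA : ∀ᶠ η in 𝓝 (c z), ∀ w : E, fderiv ℝ K (0, η) (0, w) = w := by
    filter_upwards [hK0.eventually_nhds, hKev'] with η h1 h2 w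
    have h3 : HasFDerivAt (fun η => K (0, η)) ((fderiv ℝ K (0, η)).comp
        (ContinuousLinearMap.inr ℝ ℝ E)) η :=
      HasFDerivAt.comp η (g := K) (f := fun η => ((0 : ℝ), η))
        (h2.differentiableAt (by simp)).hasFDerivAt (hasFDerivAt_prodMk_right _ _)
    have h4 : HasFDerivAt (fun η => K (0, η)) (ContinuousLinearMap.id ℝ E) η :=
      (hasFDerivAt_id η).congr_of_eventuallyEq h1
    exact DFunLike.congr_fun (h3.unique h4) w
  have hB : ∀ᶠ η in 𝓝 (c z), fderiv ℝ K (0, η) (1, 0) = - f η := by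
    filter_upwards [hct.mem_nhds hzt, hKev'] with η h1 h2
    have h3 : HasDerivAt (fun s : ℝ => K (s, η)) (fderiv ℝ K (0, η) (1, 0)) 0 := by
      have h4 : HasDerivAt (fun s : ℝ => (s, η)) ((1 : ℝ), (0 : E)) 0 :=
        (hasDerivAt_id (0 : ℝ)).prodMk (hasDerivAt_const _ _)
      exact (h2.differentiableAt (by simp)).hasFDerivAt.comp_hasDerivAt (0 : ℝ) h4
    have h5 := hasDerivWithinAt_extChartAt_comp_chartVF (x₀ := z) (s := univ) (t := 0)
      ((hφ (c.symm η) 0).hasMFDerivWithinAt)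
      (by simp only [h0]; exact c.map_target h1)
    rw [hasDerivWithinAt_univ, h0, ← hc, c.right_inv h1] at h5
    have h6 : HasDerivAt (fun s => c (φ s (c.symm η))) (f η) (-0) := by
      rw [neg_zero]; exact h5
    have h7 := h6.scomp (0 : ℝ) (hasDerivAt_neg (0 : ℝ))
    have h8 := h3.unique h7
    simpa using h8
  have hinr' : HasFDerivAt (fun η : E => ((0 : ℝ), η)) (ContinuousLinearMap.inr ℝ ℝ E) (c z) :=
    hasFDerivAt_prodMk_right _ _
  have hcomp := HasFDerivAt.comp (c z) (g := fderiv ℝ K) (f := fun η : E => ((0 : ℝ), η)) hKd hinr'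
  have hC : ∀ w w' : E, fderiv ℝ (fderiv ℝ K) (0, c z) (0, w) (0, w') = 0 := by
    intro w w'
    have h1 := hcomp.clm_apply (hasFDerivAt_const ((0 : ℝ), w') (c z))
    have h2 : (fun η => (fderiv ℝ K ∘ fun η : E => ((0 : ℝ), η)) η (0, w')) =ᶠ[𝓝 (c z)]
        fun _ => w' := by
      filter_upwards [hA] with η hη'
      exact hη' w'
    have h3 := h1.unique ((hasFDerivAt_const w' (c z)).congr_of_eventuallyEq h2)
    have h4 := DFunLike.congr_fun h3 w
    simpa using h4
  have hD : ∀ w : E, fderiv ℝ (fderiv ℝ K) (0, c z) (0, w) (1, 0) = - fderiv ℝ f (c z) w := by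
    intro w
    have h1 := hcomp.clm_apply (hasFDerivAt_const ((1 : ℝ), (0 : E)) (c z))
    have h2 : (fun η => (fderiv ℝ K ∘ fun η : E => ((0 : ℝ), η)) η (1, 0)) =ᶠ[𝓝 (c z)]
        fun η => - f η := by
      filter_upwards [hB] with η hη'
      exact hη'
    have h3 := h1.unique ((hft.differentiableAt (by simp)).hasFDerivAt.neg.congr_of_eventuallyEq h2)
    have h4 := DFunLike.congr_fun h3 w
    simpa using h4
  have hsymm := hK2.isSymmSndFDerivAt (by simp)
  have hsplit : ((1 : ℝ), f (c z)) = (1, 0) + (0, f (c z)) := by simp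
  rw [hsplit, map_add, add_apply, hC, hsymm.eq, hD, hA.self_of_nhds]
  simp only [VectorField.lieBracket]
  abel

/-- If the fields `V ζ`, depending linearly on `ζ`, satisfy `[v, V ζ] = V (λ ζ)`, then the flow of
`v` transports `V ζ` to `V (R ζ)`, where `R` solves `R' = - λ R`. -/
theorem mfderiv_flow_eq [FiniteDimensional ℝ E] [T2Space N] {v : ∀ x : N, TangentSpace I x}
    (hv : ContMDiff I I.tangent ∞ (fun x => (⟨x, v x⟩ : TangentBundle I N)))
    {φ : ℝ → N → N} (h0 : ∀ x, φ 0 x = x) (hφ : ∀ x, IsMIntegralCurve (fun t => φ t x) v)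
    {𝕍 : Type*} [NormedAddCommGroup 𝕍] [NormedSpace ℝ 𝕍] [FiniteDimensional ℝ 𝕍]
    {V : N → 𝕍 →ₗ[ℝ] E}
    (hV : ∀ ζ, ContMDiff I I.tangent ∞ (fun x => (⟨x, V x ζ⟩ : TangentBundle I N)))
    {lam : N → 𝕍 →L[ℝ] 𝕍}
    (hbr : ∀ ζ x, VectorField.mlieBracket I v (fun y => V y ζ) x = V x (lam x ζ))
    {R : ℝ → N → 𝕍 →L[ℝ] 𝕍} (hR0 : ∀ x, R 0 x = 1)
    (hR : ∀ t x, HasDerivAt (fun τ => R τ x) (- (lam (φ t x) * R t x)) t) (t : ℝ) (z : N) (ζ : 𝕍) :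
    (mfderiv I I (φ t) z : E →L[ℝ] E) (V z ζ) = V (φ t z) (R t z ζ) := by
  have : IsManifold I 1 N := IsManifold.of_le (n := ∞) (by simp)
  have hs := contMDiff_of_isMIntegralCurve hv h0 hφ
  have hadd := IsMIntegralCurve.flow_add hv h0 hφ
  have hst : ∀ t, ContMDiff I I ∞ (φ t) := fun t =>
    hs.comp (contMDiff_const.prodMk contMDiff_id)
  have hinv : ∀ t x, φ (-t) (φ t x) = x := fun t x => by rw [← hadd]; simp [h0]
  let e := extChartAt I z
  have he : ∀ t, ContMDiffAt I 𝓘(ℝ, E) ∞ (fun y => e (φ (-t) y)) (φ t z) := by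
    intro t
    refine ContMDiffAt.comp (φ t z) (g := e) (f := φ (-t)) ?_ (hst _ _)
    rw [hinv]; exact contMDiffAt_extChartAt
  let u : ℝ → 𝕍 → E := fun t ζ => tderiv I (fun y => e (φ (-t) y)) (φ t z) (V (φ t z) ζ)
  have hu : ∀ t ζ, HasDerivAt (fun τ => u τ ζ) (u t (lam (φ t z) ζ)) t := by
    intro t ζ
    have h1 := hasDerivAt_pullback_flow hv (hV ζ) h0 hφ hs (φ t z)
    have h2 := (tderiv I (fun y => e (φ (-t) y)) (φ t z)).hasFDerivAt.comp_hasDerivAt (0 : ℝ) h1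
    have h2' : vfVal (VectorField.mlieBracket I v (fun y => (V y ζ : TangentSpace I y))) (φ t z) =
      V (φ t z) (lam (φ t z) ζ) := hbr ζ (φ t z)
    rw [h2'] at h2
    have h3 : (fun s => u (s + t) ζ) = fun s => tderiv I (fun y => e (φ (-t) y)) (φ t z)
        (tderiv I (fun y => extChartAt I (φ t z) (φ (-s) y)) (φ s (φ t z))
          (V (φ s (φ t z)) ζ)) := by
      funext s
      have h4 := tderiv_comp_of_eq (I := I) (I' := I) (g := φ (-s)) (e := fun y => e (φ (-t) y))
        (y := φ s (φ t z)) (z := φ t z) (hinv s _) ((hst _).mdifferentiableAt (by simp))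
        ((he t).mdifferentiableAt (by simp))
      rw [← ContinuousLinearMap.comp_apply, ← h4]
      have h5 : (fun y => e (φ (-(s + t)) y)) = fun y => e (φ (-t) (φ (-s) y)) := by
        funext y
        rw [← hadd]
        congr 2
        ring
      simp only [u]
      rw [h5, hadd]
    have h6 : HasDerivAt (fun s => u (s + t) ζ) (u t (lam (φ t z) ζ)) 0 := by
      rw [h3]; exact h2
    have h7 := HasDerivAt.comp_sub_const (f := fun s => u (s + t) ζ) (x := t) (a := t)
      (by simpa using h6)
    simpa using h7
  have hlin : ∀ t, ∀ (b : Module.Basis (Fin (Module.finrank ℝ 𝕍)) ℝ 𝕍) (ξ : 𝕍),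
      u t ξ = ∑ i, b.repr ξ i • u t (b i) := by
    intro t b ξ
    conv_lhs => rw [← b.sum_repr ξ]
    simp only [u]
    rw [map_sum]
    refine (map_sum (tderiv I (fun y => e (φ (-t) y)) (φ t z)) _ _).trans
      (Finset.sum_congr rfl fun i _ => ?_)
    rw [map_smul]
    exact map_smul (tderiv I (fun y => e (φ (-t) y)) (φ t z)) _ _
  let b := Module.finBasis ℝ 𝕍
  have hconst : ∀ t, HasDerivAt (fun τ => u τ (R τ z ζ)) 0 t := by
    intro t
    have hr : ∀ i, HasDerivAt (fun τ => b.repr (R τ z ζ) i)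
        (b.repr (-(lam (φ t z) (R t z ζ))) i) t := by
      intro i
      have h1 : HasDerivAt (fun τ => R τ z ζ) (-(lam (φ t z) (R t z ζ))) t := by
        have := (hR t z).clm_apply (hasDerivAt_const t ζ)
        simpa using this
      exact (LinearMap.toContinuousLinearMap (b.coord i)).hasFDerivAt.comp_hasDerivAt t h1
    have h2 : HasDerivAt (fun τ => ∑ i, b.repr (R τ z ζ) i • u τ (b i))
        (∑ i, (b.repr (R t z ζ) i • u t (lam (φ t z) (b i)) +
          b.repr (-(lam (φ t z) (R t z ζ))) i • u t (b i))) t :=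
      HasDerivAt.fun_sum fun i _ => (hr i).smul (hu t (b i))
    have h3 : (fun τ => u τ (R τ z ζ)) = fun τ => ∑ i, b.repr (R τ z ζ) i • u τ (b i) := by
      funext τ; exact hlin τ b _
    rw [h3]
    convert! h2 using 1
    rw [Finset.sum_add_distrib, ← hlin t b]
    have h4 : ∑ i, b.repr (R t z ζ) i • u t (lam (φ t z) (b i)) = u t (lam (φ t z) (R t z ζ)) := by
      conv_rhs => rw [← b.sum_repr (R t z ζ)]
      simp only [u]
      rw [map_sum, map_sum]
      refine Eq.symm ((map_sum (tderiv I (fun y => e (φ (-t) y)) (φ t z)) _ _).trans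
        (Finset.sum_congr rfl fun i _ => ?_))
      rw [map_smul, map_smul]
      exact map_smul (tderiv I (fun y => e (φ (-t) y)) (φ t z)) _ _
    have h5 : u t (-(lam (φ t z) (R t z ζ))) = - u t (lam (φ t z) (R t z ζ)) := by
      simp only [u]
      rw [map_neg]
      exact map_neg (tderiv I (fun y => e (φ (-t) y)) (φ t z)) _
    rw [h4, h5]
    simp
  have hval : u t (R t z ζ) = u 0 (R 0 z ζ) :=
    is_const_of_deriv_eq_zero (fun τ => (hconst τ).differentiableAt) (fun τ => (hconst τ).deriv) t 0
  have hu0 : u 0 (R 0 z ζ) = V z ζ := by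
    have h1 : tderiv I (fun y => e (φ (-0) y)) (φ 0 z) = tderiv I e z := by
      simp only [neg_zero, h0]
    simp only [u, hR0]
    rw [h1, tderiv_extChartAt_self, h0]
    rfl
  rw [hu0] at hval
  have hcomp := mfderiv_comp (I := I) (I' := I) (I'' := I) (f := φ (-t)) (g := φ t) (φ t z)
    ((hst _).mdifferentiableAt (by simp)) ((hst _).mdifferentiableAt (by simp))
  have hid : φ t ∘ φ (-t) = id := by
    funext y
    simp only [Function.comp_apply, ← hadd]; simp [h0]
  rw [hid, mfderiv_id] at hcomp
  have hcomp' := DFunLike.congr_fun hcomp (V (φ t z) (R t z ζ))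
  have hte : (tderiv I (fun y => e (φ (-t) y)) (φ t z)) =
      (mfderiv I I (φ (-t)) (φ t z) : E →L[ℝ] E) := by
    have h1 := mfderiv_comp (I := I) (I' := I) (I'' := 𝓘(ℝ, E)) (f := φ (-t)) (g := e) (φ t z)
      (by rw [hinv]; exact contMDiffAt_extChartAt.mdifferentiableAt (n := ∞) (by simp))
      ((hst _).mdifferentiableAt (by simp))
    have h2 : tderiv I e (φ (-t) (φ t z)) = ContinuousLinearMap.id ℝ E := by
      rw [hinv]; exact tderiv_extChartAt_self z
    refine Eq.trans h1 ?_
    exact (congrArg (fun L : E →L[ℝ] E => L.comp (mfderiv I I (φ (-t)) (φ t z) : E →L[ℝ] E)) h2).trans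
      (ContinuousLinearMap.id_comp _)
  have hval' : (mfderiv I I (φ (-t)) (φ t z) : E →L[ℝ] E) (V (φ t z) (R t z ζ)) = V z ζ := by
    rw [← hte]; exact hval
  refine Eq.symm (Eq.trans hcomp' ?_)
  have h8 : (mfderiv I I (φ t) (φ (-t) (φ t z)) : E →L[ℝ] E) = (mfderiv I I (φ t) z : E →L[ℝ] E) := by
    rw [hinv]
  exact (congrArg (fun w : E => (mfderiv I I (φ t) (φ (-t) (φ t z)) : E →L[ℝ] E) w) hval').trans
    (DFunLike.congr_fun h8 _)

end LieDerivative

section TangentSmooth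

variable {E : Type*} [NormedAddCommGroup E] [NormedSpace ℝ E]
  {H : Type*} [TopologicalSpace H] {I : ModelWithCorners ℝ E H}
  {N : Type*} [TopologicalSpace N] [ChartedSpace H N]
  {E' : Type*} [NormedAddCommGroup E'] [NormedSpace ℝ E']
  {H' : Type*} [TopologicalSpace H'] {J : ModelWithCorners ℝ E' H'}
  {N' : Type*} [TopologicalSpace N'] [ChartedSpace H' N']

/-- A tangent vector, given by its base point and its component in the model space. -/
def tmk (I : ModelWithCorners ℝ E H) (x : N) (w : E) : TangentBundle I N := ⟨x, w⟩

theorem trivializationAt_apply_snd [IsManifold I ∞ N] {x y : N} (hy : y ∈ (chartAt H x).source)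
    (u : TangentSpace I y) :
    ((trivializationAt E (TangentSpace I) x) (⟨y, u⟩ : TangentBundle I N)).2 =
      mfderiv I 𝓘(ℝ, E) (extChartAt I x) y u := by
  have : IsManifold I 1 N := IsManifold.of_le (n := ∞) (by simp)
  have h2 := DFunLike.congr_fun (TangentBundle.continuousLinearMapAt_trivializationAt (I := I) hy) u
  refine Eq.trans ?_ h2
  change _ = (trivializationAt E (TangentSpace I) x).linearMapAt ℝ y u
  rw [Bundle.Trivialization.linearMapAt_apply, if_pos (by simpa using hy)]

theorem contMDiffWithinAt_tangent_iff [IsManifold I ∞ N] {f : N' → N} {w : N' → E} {z₀ : N'}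
    {s : Set N'} :
    ContMDiffWithinAt J I.tangent ∞ (fun z => tmk I (f z) (w z)) s z₀ ↔
      ContMDiffWithinAt J I ∞ f s z₀ ∧
      ContMDiffWithinAt J 𝓘(ℝ, E) ∞ (fun z => tderiv I (extChartAt I (f z₀)) (f z) (w z)) s z₀ := by
  have : IsManifold I 1 N := IsManifold.of_le (n := ∞) (by simp)
  rw [Bundle.contMDiffWithinAt_totalSpace]
  refine and_congr_right fun hf => ?_
  have hsrc : ∀ᶠ z in 𝓝[s] z₀, f z ∈ (chartAt H (f z₀)).source :=
    hf.continuousWithinAt.eventually (chart_source_mem_nhds H (f z₀))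
  have key : ∀ z, f z ∈ (chartAt H (f z₀)).source →
      ((trivializationAt E (TangentSpace I) (f z₀)) (tmk I (f z) (w z))).2 =
      tderiv I (extChartAt I (f z₀)) (f z) (w z) := by
    exact fun z hz => trivializationAt_apply_snd hz (w z)
  have he : (fun z => ((trivializationAt E (TangentSpace I) (f z₀)) (tmk I (f z) (w z))).2) =ᶠ[𝓝[s] z₀]
      fun z => tderiv I (extChartAt I (f z₀)) (f z) (w z) := by
    filter_upwards [hsrc] with z hz using key z hz
  exact he.contMDiffWithinAt_iff (key z₀ (mem_chart_source H (f z₀)))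

theorem contMDiffAt_tangent_iff [IsManifold I ∞ N] {f : N' → N} {w : N' → E} {z₀ : N'} :
    ContMDiffAt J I.tangent ∞ (fun z => tmk I (f z) (w z)) z₀ ↔
      ContMDiffAt J I ∞ f z₀ ∧
      ContMDiffAt J 𝓘(ℝ, E) ∞ (fun z => tderiv I (extChartAt I (f z₀)) (f z) (w z)) z₀ := by
  simp only [← contMDiffWithinAt_univ]
  exact contMDiffWithinAt_tangent_iff

/-- Smooth combinations of vector fields along a map. -/
theorem contMDiffWithinAt_sum_smul [IsManifold I ∞ N] {f : N' → N} {s : Set N'} {z₀ : N'}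
    (hf : ContMDiffWithinAt J I ∞ f s z₀)
    {ι : Type*} [Fintype ι] {c : ι → N' → ℝ} (hc : ∀ i, ContMDiffWithinAt J 𝓘(ℝ, ℝ) ∞ (c i) s z₀)
    {w : ι → N' → E} (hw : ∀ i, ContMDiffWithinAt J I.tangent ∞
      (fun z => tmk I (f z) (w i z)) s z₀) :
    ContMDiffWithinAt J I.tangent ∞
      (fun z => tmk I (f z) (∑ i, c i z • w i z)) s z₀ := by
  rw [contMDiffWithinAt_tangent_iff]
  refine ⟨hf, ?_⟩
  have : (fun z => tderiv I (extChartAt I (f z₀)) (f z) (∑ i, c i z • w i z)) =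
      fun z => ∑ i, c i z • tderiv I (extChartAt I (f z₀)) (f z) (w i z) := by
    funext z
    rw [map_sum]
    simp only [map_smul]
  rw [this]
  refine ContMDiffWithinAt.sum fun i _ => (hc i).smul ?_
  exact (contMDiffWithinAt_tangent_iff.1 (hw i)).2

theorem contMDiff_of_clm_apply {V W : Type*} [NormedAddCommGroup V] [NormedSpace ℝ V]
    [FiniteDimensional ℝ V] [NormedAddCommGroup W] [NormedSpace ℝ W] {f : N' → V →L[ℝ] W}
    (hf : ∀ v, ContMDiff J 𝓘(ℝ, W) ∞ (fun z => f z v)) :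
    ContMDiff J 𝓘(ℝ, V →L[ℝ] W) ∞ f := by
  let b := Module.finBasis ℝ V
  have h : f = fun z => ∑ i, ContinuousLinearMap.smulRightL ℝ V W
      (LinearMap.toContinuousLinearMap (b.coord i)) (f z (b i)) := by
    funext z
    ext v
    conv_lhs => rw [← b.sum_repr v, map_sum]
    simp [-Module.Basis.sum_repr]
  rw [h]
  refine ContMDiff.sum fun i _ => ?_
  exact (ContinuousLinearMap.contDiff _).comp_contMDiff (hf (b i))

theorem contMDiff_tderiv_apply [IsManifold I ∞ N] {g : N → E'} (hg : ContMDiff I 𝓘(ℝ, E') ∞ g)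
    {V : N → E} (hV : ContMDiff I I.tangent ∞ (fun x => tmk I x (V x))) :
    ContMDiff I 𝓘(ℝ, E') ∞ (fun x => tderiv I g x (V x)) := by
  have : IsManifold I 1 N := IsManifold.of_le (n := ∞) (by simp)
  have h1 := (hg.contMDiff_tangentMap (m := ∞) (by simp)).comp hV
  intro x
  have h2 := (contMDiffAt_tangent_iff (I := 𝓘(ℝ, E')) (f := g) (w := fun x => tderiv I g x (V x))
    (z₀ := x)).1 (h1 x)
  refine h2.2.congr_of_eventuallyEq (Eventually.of_forall fun y => ?_)
  have h3 : tderiv 𝓘(ℝ, E') (extChartAt 𝓘(ℝ, E') (g x)) (g y) = ContinuousLinearMap.id ℝ E' := by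
    rw [extChartAt_model_space_eq_id]
    exact mfderiv_id
  simp only [h3]
  rfl

theorem tderiv_eq_fderiv [I.Boundaryless] {g : N → E'} {z : N} (hg : MDifferentiableAt I 𝓘(ℝ, E') g z) :
    tderiv I g z = fderiv ℝ (fun w => g ((extChartAt I z).symm w)) (extChartAt I z z) := by
  have h1 : mfderiv I 𝓘(ℝ, E') g z = fderivWithin ℝ (writtenInExtChartAt I 𝓘(ℝ, E') z g) (range I)
    (extChartAt I z z) := hg.mfderiv
  rw [I.range_eq_univ, fderivWithin_univ] at h1
  exact h1

end TangentSmooth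

section Brackets

variable {E : Type*} [NormedAddCommGroup E] [NormedSpace ℝ E]
  {M : Type*} [TopologicalSpace M] [ChartedSpace E M]
  {P : Type*} [NormedAddCommGroup P] [NormedSpace ℝ P]

theorem chartVF_prodVF [IsManifold 𝓘(ℝ, E) ∞ M] (f : P × M → P) (X : P → VF E M) (p : P) (x : M)
    {w : P × E} (hw : w.2 ∈ (extChartAt 𝓘(ℝ, E) x).target) :
    chartVF (𝓘(ℝ, P).prod 𝓘(ℝ, E)) (prodVF f X) (p, x) w =
      (f (w.1, (extChartAt 𝓘(ℝ, E) x).symm w.2), chartVF 𝓘(ℝ, E) (X w.1) x w.2) := by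
  have : IsManifold 𝓘(ℝ, E) 1 M := IsManifold.of_le (n := ∞) (by simp)
  have hsymm : (extChartAt (𝓘(ℝ, P).prod 𝓘(ℝ, E)) (p, x)).symm w =
      (w.1, (extChartAt 𝓘(ℝ, E) x).symm w.2) := by
    rw [extChartAt_prod, extChartAt_model_space_eq_id]
    rfl
  have hfun : (extChartAt (𝓘(ℝ, P).prod 𝓘(ℝ, E)) (p, x) : P × M → P × E) =
      fun z => (z.1, extChartAt 𝓘(ℝ, E) x z.2) := by
    rw [extChartAt_prod, extChartAt_model_space_eq_id]
    rfl
  have h1 := (mdifferentiableAt_extChartAt (I := 𝓘(ℝ, E)) (x := x)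
    (y := (extChartAt 𝓘(ℝ, E) x).symm w.2)
    (by simpa using (extChartAt 𝓘(ℝ, E) x).map_target hw)).hasMFDerivAt
  have h2 := (hasMFDerivAt_fst (I := 𝓘(ℝ, P)) (I' := 𝓘(ℝ, E))
    (w.1, (extChartAt 𝓘(ℝ, E) x).symm w.2))
  have h3 := HasMFDerivAt.comp (w.1, (extChartAt 𝓘(ℝ, E) x).symm w.2) h1
    (hasMFDerivAt_snd (I := 𝓘(ℝ, P)) (I' := 𝓘(ℝ, E)) (w.1, (extChartAt 𝓘(ℝ, E) x).symm w.2))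
  have h4 : HasMFDerivAt (𝓘(ℝ, P).prod 𝓘(ℝ, E)) 𝓘(ℝ, P × E)
      (fun z : P × M => (z.1, extChartAt 𝓘(ℝ, E) x z.2)) (w.1, (extChartAt 𝓘(ℝ, E) x).symm w.2) _ :=
    ⟨h2.1.prodMk h3.1, h2.2.prodMk h3.2⟩
  unfold chartVF
  rw [hsymm, hfun]
  exact DFunLike.congr_fun h4.mfderiv _

theorem vfVal_eq_chartVF [IsManifold 𝓘(ℝ, E) ∞ M] (X : VF E M) (x : M) :
    chartVF 𝓘(ℝ, E) X x (extChartAt 𝓘(ℝ, E) x x) = vfVal X x := by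
  have h : chartVF 𝓘(ℝ, E) X x (extChartAt 𝓘(ℝ, E) x x) =
    tderiv 𝓘(ℝ, E) (extChartAt 𝓘(ℝ, E) x)
      ((extChartAt 𝓘(ℝ, E) x).symm (extChartAt 𝓘(ℝ, E) x x))
      (vfVal X ((extChartAt 𝓘(ℝ, E) x).symm (extChartAt 𝓘(ℝ, E) x x))) := rfl
  rw [h, extChartAt_to_inv, tderiv_extChartAt_self]
  rfl

theorem chartVF_sum_smul {ι : Type*} [Fintype ι] (c : ι → M → ℝ) (G : ι → VF E M) (x : M) (w : E) :
    chartVF 𝓘(ℝ, E) (fun y => ∑ i, c i y • G i y) x w =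
      ∑ i, c i ((extChartAt 𝓘(ℝ, E) x).symm w) • chartVF 𝓘(ℝ, E) (G i) x w := by
  unfold chartVF
  refine (map_sum (mfderiv 𝓘(ℝ, E) 𝓘(ℝ, E) (extChartAt 𝓘(ℝ, E) x)
    ((extChartAt 𝓘(ℝ, E) x).symm w)) _ _).trans (Finset.sum_congr rfl fun i _ => ?_)
  exact map_smul (mfderiv 𝓘(ℝ, E) 𝓘(ℝ, E) (extChartAt 𝓘(ℝ, E) x)
    ((extChartAt 𝓘(ℝ, E) x).symm w)) _ _

theorem lieBracket_prod_sum {n : ℕ} {η : P × E} {e δ : P} {c : Fin n → P × E → ℝ}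
    (hc : ∀ i, DifferentiableAt ℝ (c i) η) {g : Fin n → E → E}
    (hg : ∀ i, DifferentiableAt ℝ (g i) η.2) (ξ : Fin n → ℝ) :
    VectorField.lieBracket ℝ (fun w : P × E => (e, ∑ i, c i w • g i w.2))
      (fun w : P × E => (δ, ∑ j, ξ j • g j w.2)) η =
    ((0 : P), (∑ j, ∑ i, (ξ j * c i η) • VectorField.lieBracket ℝ (g i) (g j) η.2) -
      ∑ i, fderiv ℝ (c i) η (δ, ∑ j, ξ j • g j η.2) • g i η.2) := by
  have hg' : ∀ i, HasFDerivAt (fun w : P × E => g i w.2)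
      ((fderiv ℝ (g i) η.2).comp (ContinuousLinearMap.snd ℝ P E)) η := fun i =>
    HasFDerivAt.comp η (hg i).hasFDerivAt hasFDerivAt_snd
  have h1 : HasFDerivAt (fun w : P × E => (e, ∑ i, c i w • g i w.2))
      ((0 : P × E →L[ℝ] P).prod (∑ i, (c i η • ((fderiv ℝ (g i) η.2).comp
        (ContinuousLinearMap.snd ℝ P E)) + (fderiv ℝ (c i) η).smulRight (g i η.2)))) η :=
    (hasFDerivAt_const e η).prodMk
      (HasFDerivAt.fun_sum fun i _ => (hc i).hasFDerivAt.smul (hg' i))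
  have h2 : HasFDerivAt (fun w : P × E => (δ, ∑ j, ξ j • g j w.2))
      ((0 : P × E →L[ℝ] P).prod (∑ j, ξ j • ((fderiv ℝ (g j) η.2).comp
        (ContinuousLinearMap.snd ℝ P E)))) η :=
    (hasFDerivAt_const δ η).prodMk
      (HasFDerivAt.fun_sum fun j _ => (hg' j).const_smul (ξ j))
  rw [VectorField.lieBracket, h1.fderiv, h2.fderiv]
  refine Prod.ext (by simp) ?_
  simp only [ContinuousLinearMap.prod_apply, Prod.snd_sub, sum_apply,
    smul_apply, ContinuousLinearMap.comp_apply, ContinuousLinearMap.coe_snd', add_apply,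
    ContinuousLinearMap.smulRight_apply, Finset.sum_add_distrib, VectorField.lieBracket, map_sum, map_smul,
    Finset.smul_sum, smul_sub, Finset.sum_sub_distrib, mul_smul]
  rw [sub_add_eq_sub_sub]
  congr 2
  rw [Finset.sum_comm]
  refine Finset.sum_congr rfl fun i _ => Finset.sum_congr rfl fun j _ => ?_
  exact smul_comm _ _ _

end Brackets

section FoliatedFlow

variable {E : Type*} [NormedAddCommGroup E] [NormedSpace ℝ E]
  {M : Type*} [TopologicalSpace M] [ChartedSpace E M] [IsManifold 𝓘(ℝ, E) ∞ M]
  {P : Type*} [NormedAddCommGroup P] [NormedSpace ℝ P]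

/-- The linear combination of vector fields, as an element of the model space. -/
def combVF {n : ℕ} (G : Fin n → VF E M) (ξ : Fin n → ℝ) (x : M) : E := ∑ j, ξ j • vfVal (G j) x

/-- The combination of vector fields with coefficients in functions. -/
def lcVF {n : ℕ} (G : Fin n → VF E M) (c : Fin n → M → ℝ) : VF E M := fun x => ∑ i, c i x • G i x

/-- The linear family of fields on `P × M` spanned by constant fields on `P` and the `G j`. -/
def prodFrame {n : ℕ} (G : Fin n → VF E M) (z : P × M) :
    ((Fin n → ℝ) × P) →ₗ[ℝ] P × E where
  toFun ζ := (ζ.2, combVF G ζ.1 z.2)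
  map_add' ζ ζ' := by
    simp [combVF, add_smul, Finset.sum_add_distrib]
  map_smul' a ζ := by
    simp [combVF, mul_smul, Finset.smul_sum]

theorem contMDiff_combVF {n : ℕ} {G : Fin n → VF E M} (hG : ∀ i, SmoothVFOn E M (G i) univ)
    {c : Fin n → P × M → ℝ} (hc : ∀ i, ContMDiff (𝓘(ℝ, P).prod 𝓘(ℝ, E)) 𝓘(ℝ, ℝ) ∞ (c i)) :
    ContMDiff (𝓘(ℝ, P).prod 𝓘(ℝ, E)) 𝓘(ℝ, E).tangent ∞
      (fun z : P × M => tmk 𝓘(ℝ, E) z.2 (combVF G (fun i => c i z) z.2)) := by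
  intro z
  have := contMDiffWithinAt_sum_smul (J := 𝓘(ℝ, P).prod 𝓘(ℝ, E)) (I := 𝓘(ℝ, E))
    (f := fun z : P × M => z.2) (s := univ) (z₀ := z) contMDiffWithinAt_snd
    (c := c) (fun i => (hc i).contMDiffAt.contMDiffWithinAt) (w := fun i z => vfVal (G i) z.2)
    (fun i => (((hG i) z.2 (mem_univ _)).comp z contMDiffWithinAt_snd (mapsTo_univ _ _)))
  exact this.contMDiffAt univ_mem

theorem contMDiff_prodFrame {n : ℕ} {G : Fin n → VF E M} (hG : ∀ i, SmoothVFOn E M (G i) univ)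
    (ζ : (Fin n → ℝ) × P) :
    ContMDiff (𝓘(ℝ, P).prod 𝓘(ℝ, E)) (𝓘(ℝ, P).prod 𝓘(ℝ, E)).tangent ∞
      (fun z : P × M => tmk (𝓘(ℝ, P).prod 𝓘(ℝ, E)) z (prodFrame G z ζ)) :=
  contMDiff_prodVF (f := fun _ => ζ.2) (X := fun _ => lcVF G (fun i _ => ζ.1 i)) contMDiff_const
    (contMDiff_combVF hG (c := fun i _ => ζ.1 i) fun _ => contMDiff_const)

/-- The bracket of `(e, ∑ c i G i)` with the fields of `prodFrame`. -/
theorem mlieBracket_prodFrame [FiniteDimensional ℝ E] [FiniteDimensional ℝ P] {n : ℕ}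
    {G : Fin n → VF E M} (hG : ∀ i, SmoothVFOn E M (G i) univ)
    {c : Fin n → P × M → ℝ} (hc : ∀ i, ContMDiff (𝓘(ℝ, P).prod 𝓘(ℝ, E)) 𝓘(ℝ, ℝ) ∞ (c i))
    {b : Fin n → Fin n → Fin n → M → ℝ} (e : P)
    (hb : ∀ i j p x, c i (p, x) • vfVal (VectorField.mlieBracket 𝓘(ℝ, E) (G i) (G j)) x =
      combVF G (fun k => c i (p, x) * b i j k x) x) (ζ : (Fin n → ℝ) × P) (z : P × M) :
    vfVal (VectorField.mlieBracket (𝓘(ℝ, P).prod 𝓘(ℝ, E))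
      (prodVF (fun _ => e) (fun p => lcVF G (fun i x => c i (p, x))))
      (prodVF (fun _ => ζ.2) (fun _ => lcVF G (fun i _ => ζ.1 i)))) z =
    prodFrame G z (fun k => (∑ j, ∑ i, ζ.1 j * (c i z * b i j k z.2)) -
      tderiv (𝓘(ℝ, P).prod 𝓘(ℝ, E)) (c k) z (prodFrame G z ζ), 0) := by
  have : CompleteSpace E := FiniteDimensional.complete ℝ E
  have : CompleteSpace P := FiniteDimensional.complete ℝ P
  obtain ⟨p, x⟩ := z
  set ch := extChartAt 𝓘(ℝ, E) x with hch
  have hz : extChartAt (𝓘(ℝ, P).prod 𝓘(ℝ, E)) (p, x) (p, x) = (p, ch x) := by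
    rw [extChartAt_prod, extChartAt_model_space_eq_id]; rfl
  have hzs : ∀ w : P × E, (extChartAt (𝓘(ℝ, P).prod 𝓘(ℝ, E)) (p, x)).symm w = (w.1, ch.symm w.2) := by
    intro w
    rw [extChartAt_prod, extChartAt_model_space_eq_id]; rfl
  have hxt : ch x ∈ ch.target := mem_extChartAt_target x
  have hct : IsOpen ch.target := isOpen_extChartAt_target x
  let g : Fin n → E → E := fun i => chartVF 𝓘(ℝ, E) (G i) x
  have hg : ∀ i, DifferentiableAt ℝ (g i) (ch x) := fun i =>
    ((contDiffOn_chartVF (contMDiffOn_univ.1 (hG i)) x).contDiffAt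
      (hct.mem_nhds hxt)).differentiableAt (by simp)
  let ĉ : Fin n → P × E → ℝ := fun i w => c i (w.1, ch.symm w.2)
  have hĉ : ∀ i, DifferentiableAt ℝ (ĉ i) (p, ch x) := by
    intro i
    have h1 : ContMDiffAt 𝓘(ℝ, P × E) (𝓘(ℝ, P).prod 𝓘(ℝ, E)) ∞
        (fun w : P × E => (w.1, ch.symm w.2)) (p, ch x) := by
      refine ContMDiffAt.prodMk contDiff_fst.contMDiff.contMDiffAt ?_
      exact ((contMDiffOn_extChartAt_symm x).contMDiffAt (hct.mem_nhds hxt)).comp (p, ch x)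
        contDiff_snd.contMDiff.contMDiffAt
    exact (((hc i) _).comp (p, ch x) h1).contDiffAt.differentiableAt (by simp)
  have hG' : ∀ i, g i (ch x) = vfVal (G i) x := fun i => vfVal_eq_chartVF (G i) x
  have htarget : ∀ᶠ w : P × E in 𝓝 (p, ch x), w.2 ∈ ch.target :=
    continuousAt_snd.eventually (hct.mem_nhds hxt)
  refine (mlieBracket_eq_lieBracket_chartVF _ _ (p, x)).trans ?_
  rw [hz]
  have e1 : chartVF (𝓘(ℝ, P).prod 𝓘(ℝ, E))
      (prodVF (fun _ => e) (fun p => lcVF G (fun i x => c i (p, x)))) (p, x) =ᶠ[𝓝 (p, ch x)]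
      fun w : P × E => (e, ∑ i, ĉ i w • g i w.2) := by
    filter_upwards [htarget] with w hw
    rw [chartVF_prodVF _ _ _ _ hw]
    exact congrArg (Prod.mk e) (chartVF_sum_smul (fun i y => c i (w.1, y)) G x w.2)
  have e2 : chartVF (𝓘(ℝ, P).prod 𝓘(ℝ, E))
      (prodVF (fun _ => ζ.2) (fun _ => lcVF G (fun i _ => ζ.1 i))) (p, x) =ᶠ[𝓝 (p, ch x)]
      fun w : P × E => (ζ.2, ∑ i, ζ.1 i • g i w.2) := by
    filter_upwards [htarget] with w hw
    rw [chartVF_prodVF _ _ _ _ hw]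
    exact congrArg (Prod.mk ζ.2) (chartVF_sum_smul (fun i _ => ζ.1 i) G x w.2)
  rw [Filter.EventuallyEq.lieBracket_vectorField_eq e1 e2,
    lieBracket_prod_sum hĉ hg]
  refine Prod.ext rfl ?_
  have hbr : ∀ i j, VectorField.lieBracket ℝ (g i) (g j) (ch x) =
      vfVal (VectorField.mlieBracket 𝓘(ℝ, E) (G i) (G j)) x := fun i j =>
    (mlieBracket_eq_lieBracket_chartVF (G i) (G j) x).symm
  have hd : ∀ k, fderiv ℝ (ĉ k) (p, ch x) = tderiv (𝓘(ℝ, P).prod 𝓘(ℝ, E)) (c k) (p, x) := by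
    intro k
    rw [tderiv_eq_fderiv ((hc k).mdifferentiableAt (by simp)), hz]
    simp only [hzs, ĉ]
  have hĉx : ∀ i, ĉ i (p, ch x) = c i (p, x) := by
    intro i
    simp only [ĉ]
    rw [hch, extChartAt_to_inv]
  simp only [hbr, hd, hĉx, hG', mul_smul, hb]
  change _ = combVF G _ x
  simp only [combVF, sub_smul, Finset.sum_sub_distrib, Finset.sum_smul, mul_smul, Finset.smul_sum,
    prodFrame, LinearMap.coe_mk, AddHom.coe_mk]
  congr 1
  rw [Finset.sum_comm' (s := Finset.univ) (t := fun _ => Finset.univ) (t' := Finset.univ)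
    (s' := fun _ => Finset.univ) (by simp)]
  conv_rhs => rw [Finset.sum_comm]
  rw [Finset.sum_comm]
  refine Finset.sum_congr rfl fun j _ => ?_
  rw [Finset.sum_comm]

/-- The flow of a compactly supported combination `∑ c i G i` of an involutive family, with
parameters: its derivative in the parameters and along the `G j` is again a combination of the
`G j`, with smooth coefficients. -/
theorem exists_foliated_flow [FiniteDimensional ℝ E] [T2Space M] [FiniteDimensional ℝ P] (e : P)
    {n : ℕ} {G : Fin n → VF E M} (hG : ∀ i, SmoothVFOn E M (G i) univ)
    {c : Fin n → P × M → ℝ} (hc : ∀ i, ContMDiff (𝓘(ℝ, P).prod 𝓘(ℝ, E)) 𝓘(ℝ, ℝ) ∞ (c i))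
    {C : Set M} (hC : IsCompact C) (hcC : ∀ i p, ∀ x ∉ C, c i (p, x) = 0)
    {b : Fin n → Fin n → Fin n → M → ℝ} (hbs : ∀ i j k, ContMDiff 𝓘(ℝ, E) 𝓘(ℝ, ℝ) ∞ (b i j k))
    (hb : ∀ i j p x, c i (p, x) • vfVal (VectorField.mlieBracket 𝓘(ℝ, E) (G i) (G j)) x =
      combVF G (fun k => c i (p, x) * b i j k x) x) :
    ∃ (Φ : ℝ → P → M → M) (R : ℝ → P → M → ((Fin n → ℝ) × P) →L[ℝ] (Fin n → ℝ)),
      ContMDiff (𝓘(ℝ, ℝ).prod (𝓘(ℝ, P).prod 𝓘(ℝ, E))) 𝓘(ℝ, E) ∞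
        (fun z : ℝ × (P × M) => Φ z.1 z.2.1 z.2.2) ∧
      ContMDiff (𝓘(ℝ, ℝ).prod (𝓘(ℝ, P).prod 𝓘(ℝ, E)))
        𝓘(ℝ, ((Fin n → ℝ) × P) →L[ℝ] (Fin n → ℝ)) ∞ (fun z : ℝ × (P × M) => R z.1 z.2.1 z.2.2) ∧
      (∀ p x, Φ 0 p x = x) ∧
      (∀ t p x, HasMFDerivAt 𝓘(ℝ, ℝ) 𝓘(ℝ, E) (fun τ => Φ τ p x) t
        ((1 : ℝ →L[ℝ] ℝ).smulRight
          (lcVF G (fun i y => c i (p + t • e, y)) (Φ t p x)))) ∧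
      (∀ t p x ζ, (mfderiv (𝓘(ℝ, P).prod 𝓘(ℝ, E)) 𝓘(ℝ, E) (fun z : P × M => Φ t z.1 z.2) (p, x) :
          P × E →L[ℝ] E) (prodFrame G (p, x) ζ) = combVF G (R t p x ζ) (Φ t p x)) := by
  let X : P → VF E M := fun p => lcVF G (fun i x => c i (p, x))
  have hX : ContMDiff (𝓘(ℝ, P).prod 𝓘(ℝ, E)) 𝓘(ℝ, E).tangent ∞
      (fun z : P × M => (⟨z.2, X z.1 z.2⟩ : TangentBundle 𝓘(ℝ, E) M)) := contMDiff_combVF hG hc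
  -- the matrix of the bracket with `(e, X)`
  let D : P × M → ((Fin n → ℝ) × P) →L[ℝ] (Fin n → ℝ) := fun z => LinearMap.toContinuousLinearMap
    (LinearMap.pi fun k => (∑ j, ∑ i, (c i z * b i j k z.2) •
      ((LinearMap.proj j).comp (LinearMap.fst ℝ (Fin n → ℝ) P))) -
      ((tderiv (𝓘(ℝ, P).prod 𝓘(ℝ, E)) (c k) z : P × E →ₗ[ℝ] ℝ).comp (prodFrame G z)))
  have hDapp : ∀ z ζ k, D z ζ k = (∑ j, ∑ i, ζ.1 j * (c i z * b i j k z.2)) -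
      tderiv (𝓘(ℝ, P).prod 𝓘(ℝ, E)) (c k) z (prodFrame G z ζ) := by
    intro z ζ k
    simp [D, mul_comm]
  let lam : P × M → ((Fin n → ℝ) × P) →L[ℝ] ((Fin n → ℝ) × P) := fun z =>
    (ContinuousLinearMap.inl ℝ (Fin n → ℝ) P).comp (D z)
  have hlam : ContMDiff (𝓘(ℝ, P).prod 𝓘(ℝ, E))
      𝓘(ℝ, ((Fin n → ℝ) × P) →L[ℝ] ((Fin n → ℝ) × P)) ∞ (fun z => -lam z) := by
    refine ContMDiff.neg (contMDiff_of_clm_apply fun ζ => ?_)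
    refine (ContinuousLinearMap.contDiff (ContinuousLinearMap.inl ℝ (Fin n → ℝ) P)).comp_contMDiff
      (f := fun z => D z ζ) ?_
    rw [contMDiff_pi_space]
    intro k
    simp only [hDapp]
    refine ContMDiff.sub ?_ (contMDiff_tderiv_apply (hc k) (contMDiff_prodFrame hG ζ))
    refine ContMDiff.sum fun j _ => ContMDiff.sum fun i _ => ?_
    exact contMDiff_const.mul ((hc i).mul ((hbs i j k).comp contMDiff_snd))
  have hXC : ∀ p, ∀ x ∉ C, X p x = 0 := by
    intro p x hx
    change ∑ j, c j (p, x) • vfVal (G j) x = 0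
    exact Finset.sum_eq_zero fun j _ => by rw [hcC j p x hx, zero_smul]
  have hlC : ∀ p, ∀ x ∉ C, -lam (p, x) = 0 := by
    intro p x hx
    have hd : ∀ k, tderiv (𝓘(ℝ, P).prod 𝓘(ℝ, E)) (c k) (p, x) = 0 := by
      intro k
      have h1 : c k =ᶠ[𝓝 (p, x)] fun _ => 0 := by
        have : (univ : Set P) ×ˢ Cᶜ ∈ 𝓝 (p, x) :=
          prod_mem_nhds univ_mem (hC.isClosed.isOpen_compl.mem_nhds hx)
        filter_upwards [this] with z hz using hcC k z.1 z.2 hz.2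
      have h2 := ((hasMFDerivAt_const (I := 𝓘(ℝ, P).prod 𝓘(ℝ, E)) (I' := 𝓘(ℝ, ℝ)) (0 : ℝ)
        ((p, x) : P × M)).congr_of_eventuallyEq h1).mfderiv
      exact h2
    rw [neg_eq_zero]
    refine ContinuousLinearMap.ext fun ζ => ?_
    refine Prod.ext (funext fun k => ?_) rfl
    change D (p, x) ζ k = 0
    rw [hDapp, hd]
    simp [hcC _ p x hx]
  obtain ⟨Φ, R, hΦs, hRs, hΦ0, hR0, hΦ, hR⟩ := exists_flow_cocycle e hX hlam hC hXC hlC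
  refine ⟨Φ, fun t p x => (ContinuousLinearMap.fst ℝ (Fin n → ℝ) P).comp (R t p x), hΦs, ?_, hΦ0,
    hΦ, fun t p x ζ => ?_⟩
  · exact (ContinuousLinearMap.contDiff (ContinuousLinearMap.compL ℝ ((Fin n → ℝ) × P)
      ((Fin n → ℝ) × P) (Fin n → ℝ) (ContinuousLinearMap.fst ℝ (Fin n → ℝ) P))).comp_contMDiff hRs
  have hv := contMDiff_prodVF (f := fun _ => e) contMDiff_const hX
  let φ : ℝ → P × M → P × M := fun t z => (z.1 + t • e, Φ t z.1 z.2)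
  have hφ : ∀ z, IsMIntegralCurve (fun t => φ t z) (prodVF (fun _ => e) X) := by
    intro z t
    rw [hasMFDerivAt_prodVF_iff]
    refine ⟨?_, hΦ t z.1 z.2⟩
    have h : HasDerivAt (fun τ : ℝ => z.1 + τ • e) e t := by
      simpa using! ((hasDerivAt_id t).smul_const e).const_add z.1
    exact h
  have hφ0 : ∀ z, φ 0 z = z := fun z => by simp [φ, hΦ0]
  have key := mfderiv_flow_eq hv hφ0 hφ (V := prodFrame G) (contMDiff_prodFrame hG)
    (lam := lam) (R := fun t z => R t z.1 z.2) ?_ (fun z => hR0 _ _) ?_ t (p, x) ζ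
  · have hΦt : ContMDiff (𝓘(ℝ, P).prod 𝓘(ℝ, E)) 𝓘(ℝ, E) ∞ (fun z : P × M => Φ t z.1 z.2) :=
      hΦs.comp (contMDiff_const.prodMk contMDiff_id)
    have hφt : ContMDiff (𝓘(ℝ, P).prod 𝓘(ℝ, E)) (𝓘(ℝ, P).prod 𝓘(ℝ, E)) ∞ (φ t) := by
      refine ContMDiff.prodMk ?_ hΦt
      exact contMDiff_fst.add contMDiff_const
    have h1 := HasMFDerivAt.comp (p, x) (hasMFDerivAt_snd (I := 𝓘(ℝ, P)) (I' := 𝓘(ℝ, E))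
      (φ t (p, x))) (hφt.mdifferentiableAt (x := (p, x)) (by simp)).hasMFDerivAt
    have h2 := h1.mfderiv
    have h3 := DFunLike.congr_fun h2 (prodFrame G (p, x) ζ)
    refine Eq.trans h3 ?_
    exact congrArg Prod.snd key
  · intro ζ z
    refine (mlieBracket_prodFrame hG hc e hb ζ z).trans ?_
    congr 1
    refine Prod.ext (funext fun k => ?_) rfl
    exact (hDapp z ζ k).symm
  · intro t z
    have := hR t z.1 z.2
    rw [← neg_mul]
    exact this

end FoliatedFlow

section Coefficients

variable {E : Type*} [NormedAddCommGroup E] [NormedSpace ℝ E]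
  {M : Type*} [TopologicalSpace M] [ChartedSpace E M] [IsManifold 𝓘(ℝ, E) ∞ M]
  {P : Type*} [NormedAddCommGroup P] [NormedSpace ℝ P]

/-- The fields `G i` generate the module near `z`. -/
def VFModule.GeneratesAt (F : VFModule E M) {n : ℕ} (G : Fin n → VF E M) (z : M) : Prop :=
  ∀ V : Opens M, z ∈ V → ∀ Y : VF E M, F.Sec V Y → ∃ V' : Opens M, z ∈ V' ∧ V' ≤ V ∧
    ∃ c : Fin n → M → ℝ, (∀ i, ContMDiffOn 𝓘(ℝ, E) 𝓘(ℝ, ℝ) ∞ (c i) V') ∧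
      ∀ y ∈ V', Y y = lcVF G c y

theorem VFModule.sec_sum (F : VFModule E M) {U : Opens M} {ι : Type*} (s : Finset ι)
    {X : ι → VF E M} (hX : ∀ i ∈ s, F.Sec U (X i)) : F.Sec U (fun x => ∑ i ∈ s, X i x) := by
  classical
  induction s using Finset.induction_on with
  | empty => exact F.congr (fun x _ => by simp) (F.zero U)
  | insert a s ha ih =>
    refine F.congr (fun x _ => ?_) (F.add (hX a (Finset.mem_insert_self a s))
      (ih fun i hi => hX i (Finset.mem_insert_of_mem hi)))
    rw [Finset.sum_insert ha]
    rfl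

theorem VFModule.sec_lcVF (F : VFModule E M) {U : Opens M} {n : ℕ} {G : Fin n → VF E M}
    (hG : ∀ i, F.Sec U (G i)) {c : Fin n → M → ℝ}
    (hc : ∀ i, ContMDiffOn 𝓘(ℝ, E) 𝓘(ℝ, ℝ) ∞ (c i) U) : F.Sec U (lcVF G c) :=
  F.sec_sum Finset.univ fun i _ => F.smul (hc i) (hG i)

/-- A section multiplied by a function supported in its domain is a global section. -/
theorem VFModule.sec_top_of_tsupport (F : VFModule E M) {V : Opens M} {X : VF E M} (hX : F.Sec V X)
    {f : M → ℝ} (hf : ContMDiff 𝓘(ℝ, E) 𝓘(ℝ, ℝ) ∞ f) (hs : tsupport f ⊆ V) :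
    F.Sec ⊤ (fun x => f x • X x) := by
  refine F.glue fun x _ => ?_
  by_cases hx : x ∈ V
  · exact ⟨V, hx, le_top, F.smul hf.contMDiffOn hX⟩
  · refine ⟨⟨(tsupport f)ᶜ, (isClosed_tsupport f).isOpen_compl⟩, fun h => hx (hs h), le_top,
      F.congr (fun y hy => ?_) (F.zero _)⟩
    have : f y = 0 := image_eq_zero_of_notMem_tsupport hy
    rw [this, zero_smul]
    rfl

theorem exists_bump [FiniteDimensional ℝ E] [T2Space M] {x : M} {U : Set M} (hU : U ∈ 𝓝 x) :
    ∃ f : M → ℝ, ContMDiff 𝓘(ℝ, E) 𝓘(ℝ, ℝ) ∞ f ∧ HasCompactSupport f ∧ tsupport f ⊆ U ∧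
      ∃ V : Opens M, x ∈ V ∧ (V : Set M) ⊆ U ∧ ∀ y ∈ V, f y = 1 := by
  obtain ⟨f, -, hf⟩ := (SmoothBumpFunction.nhds_basis_tsupport (I := 𝓘(ℝ, E)) x).mem_iff.1 hU
  obtain ⟨V, hV, hVo, hxV⟩ := mem_nhds_iff.1 (inter_mem f.eventuallyEq_one hU)
  exact ⟨f, f.contMDiff, f.hasCompactSupport, hf, ⟨V, hVo⟩, hxV, fun y hy => (hV hy).2,
    fun y hy => (hV hy).1⟩

theorem VFModule.GeneratesAt.append_left {F : VFModule E M} {n m : ℕ} {G : Fin n → VF E M}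
    (G' : Fin m → VF E M) {z : M} (h : F.GeneratesAt G z) : F.GeneratesAt (Fin.append G G') z := by
  intro V hz Y hY
  obtain ⟨V', h1, h2, c, hc, h3⟩ := h V hz Y hY
  refine ⟨V', h1, h2, Fin.append c (fun _ _ => 0), fun i => ?_, fun y hy => ?_⟩
  · refine Fin.addCases (fun i => ?_) (fun i => ?_) i
    · simpa using hc i
    · simpa using contMDiffOn_const
  · rw [h3 y hy]
    simp [lcVF, Fin.sum_univ_add]

theorem VFModule.GeneratesAt.append_right {F : VFModule E M} {n m : ℕ} (G : Fin n → VF E M)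
    {G' : Fin m → VF E M} {z : M} (h : F.GeneratesAt G' z) : F.GeneratesAt (Fin.append G G') z := by
  intro V hz Y hY
  obtain ⟨V', h1, h2, c, hc, h3⟩ := h V hz Y hY
  refine ⟨V', h1, h2, Fin.append (fun _ _ => 0) c, fun i => ?_, fun y hy => ?_⟩
  · refine Fin.addCases (fun i => ?_) (fun i => ?_) i
    · simpa using contMDiffOn_const
    · simpa using hc i
  · rw [h3 y hy]
    simp [lcVF, Fin.sum_univ_add]

theorem SingularFoliation.exists_generators [FiniteDimensional ℝ E] [T2Space M]
    (F : SingularFoliation E M) (x : M) :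
    ∃ (n : ℕ) (G : Fin n → VF E M) (V : Opens M), (∀ i, F.Sec ⊤ (G i)) ∧ x ∈ V ∧
      ∀ z ∈ V, F.GeneratesAt G z := by
  obtain ⟨U, hxU, n, G, hG, hgen⟩ := F.locallyFinitelyGenerated x
  obtain ⟨f, hf, -, hfs, V, hxV, hVU, hfV⟩ := exists_bump (E := E) (U.isOpen.mem_nhds hxU)
  refine ⟨n, fun i y => f y • G i y, V, fun i => F.sec_top_of_tsupport (hG i) hf hfs, hxV,
    fun z hz V₁ hzV₁ Y hY => ?_⟩
  obtain ⟨ρ, hρ, -, hρs, V₂, hzV₂, hV₂, hρV⟩ := exists_bump (E := E)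
    ((V ⊓ V₁).isOpen.mem_nhds (show z ∈ V ⊓ V₁ from ⟨hz, hzV₁⟩))
  have h1 : F.Sec ⊤ (fun x => ρ x • Y x) :=
    F.sec_top_of_tsupport hY hρ (hρs.trans inter_subset_right)
  obtain ⟨c, hc, hY'⟩ := hgen _ (F.restrict le_top h1)
  refine ⟨V₂, hzV₂, hV₂.trans inter_subset_right, c, fun i => (hc i).mono ?_, fun y hy => ?_⟩
  · exact (hV₂.trans inter_subset_left).trans hVU
  · have hyV : y ∈ V := (hV₂ hy).1
    have := hY' y (hVU hyV)
    rw [hρV y hy, one_smul] at this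
    rw [this]
    refine Finset.sum_congr rfl fun i _ => ?_
    change c i y • G i y = c i y • (f y • G i y)
    rw [hfV y hyV, one_smul]

theorem SingularFoliation.exists_generators_compact [FiniteDimensional ℝ E] [T2Space M]
    (F : SingularFoliation E M) {K : Set M} (hK : IsCompact K) :
    ∃ (n : ℕ) (G : Fin n → VF E M) (V : Opens M), (∀ i, F.Sec ⊤ (G i)) ∧ K ⊆ V ∧
      ∀ z ∈ V, F.GeneratesAt G z := by
  refine hK.induction_on (p := fun K => ∃ (n : ℕ) (G : Fin n → VF E M) (V : Opens M),
    (∀ i, F.Sec ⊤ (G i)) ∧ K ⊆ V ∧ ∀ z ∈ V, F.GeneratesAt G z) ?_ ?_ ?_ ?_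
  · exact ⟨0, Fin.elim0, ⊥, fun i => i.elim0, empty_subset _, fun z hz => hz.elim⟩
  · rintro s t hst ⟨n, G, V, h1, h2, h3⟩
    exact ⟨n, G, V, h1, hst.trans h2, h3⟩
  · rintro s t ⟨n, G, V, h1, h2, h3⟩ ⟨n', G', V', h1', h2', h3'⟩
    refine ⟨n + n', Fin.append G G', V ⊔ V', fun i => ?_, ?_, ?_⟩
    · refine Fin.addCases (fun i => ?_) (fun i => ?_) i
      · simpa using h1 i
      · simpa using h1' i
    · exact union_subset_union h2 h2'
    · rintro z (hz | hz)
      · exact (h3 z hz).append_left _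
      · exact (h3' z hz).append_right _
  · intro x _
    obtain ⟨n, G, V, h1, h2, h3⟩ := F.exists_generators x
    exact ⟨V, mem_nhdsWithin_of_mem_nhds (V.isOpen.mem_nhds h2), n, G, V, h1, subset_rfl, h3⟩

theorem exists_cutoff [FiniteDimensional ℝ E] [T2Space M] [SecondCountableTopology M] {K : Set M}
    (hK : IsCompact K) {V : Set M} (hV : IsOpen V) (hKV : K ⊆ V) :
    ∃ (χ : M → ℝ) (O : Set M), ContMDiff 𝓘(ℝ, E) 𝓘(ℝ, ℝ) ∞ χ ∧ IsOpen O ∧ K ⊆ O ∧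
      (∀ x ∈ O, χ x = 1) ∧ HasCompactSupport χ ∧ tsupport χ ⊆ V := by
  have := ChartedSpace.locallyCompactSpace E M
  obtain ⟨K', hK', h1, h2⟩ := exists_compact_between hK hV hKV
  obtain ⟨f, hf1, hf0, -⟩ := exists_contMDiffMap_one_nhds_of_subset_interior (M := M) (n := (⊤ : ℕ∞))
    𝓘(ℝ, E) hK.isClosed h1
  obtain ⟨O, hO, hKO, hO1⟩ := mem_nhdsSet_iff_exists.1 hf1
  have hts : tsupport f ⊆ K' := closure_minimal (fun x hx => by
    by_contra h; exact hx (hf0 x h)) hK'.isClosed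
  exact ⟨f, O, f.contMDiff, hO, hKO, fun x hx => hO1 hx,
    hK'.of_isClosed_subset (isClosed_tsupport _) hts, hts.trans h2⟩

/-- Generators near a compact set, with a cut-off function supported where they generate. -/
structure GenData (F : SingularFoliation E M) (K : Set M) where
  n : ℕ
  G : Fin n → VF E M
  χ : M → ℝ
  O : Opens M
  sec : ∀ i, F.Sec ⊤ (G i)
  subset : K ⊆ O
  smooth : ContMDiff 𝓘(ℝ, E) 𝓘(ℝ, ℝ) ∞ χ
  one : ∀ x ∈ O, χ x = 1
  compact : HasCompactSupport χ
  gen : ∀ z ∈ tsupport χ, F.GeneratesAt G z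

theorem exists_genData [FiniteDimensional ℝ E] [T2Space M] [SecondCountableTopology M]
    (F : SingularFoliation E M) {K : Set M} (hK : IsCompact K) : Nonempty (GenData F K) := by
  obtain ⟨n, G, V, h1, h2, h3⟩ := F.exists_generators_compact hK
  obtain ⟨χ, O, g1, g2, g3, g4, g5, g6⟩ := exists_cutoff (E := E) hK V.isOpen h2
  exact ⟨⟨n, G, χ, ⟨O, g2⟩, h1, g3, g1, g4, g5, fun z hz => h3 z (g6 hz)⟩⟩

theorem GenData.smoothVF {F : SingularFoliation E M} {K : Set M} (D : GenData F K) (i : Fin D.n) :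
    SmoothVFOn E M (D.G i) univ := F.smooth (D.sec i)

theorem GenData.gen_of_mem {F : SingularFoliation E M} {K : Set M} (D : GenData F K) {z : M}
    (hz : z ∈ D.O) : F.GeneratesAt D.G z :=
  D.gen z (subset_tsupport _ (by simp [D.one z hz]))

/-- A plot is locally a combination of generators, with smooth coefficients. -/
theorem VFModule.IsPlotOn.exists_local_coef {F : VFModule E M} {n : ℕ} {G : Fin n → VF E M}
    {X : P → VF E M} {U : Set P} (hX : F.IsPlotOn U X) {p : P} (hp : p ∈ U) {x : M}
    (hx : F.GeneratesAt G x) :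
    ∃ (U' : Set P) (V : Opens M), IsOpen U' ∧ p ∈ U' ∧ x ∈ V ∧ ∃ c : Fin n → P × M → ℝ,
      (∀ i, ContMDiffOn (𝓘(ℝ, P).prod 𝓘(ℝ, E)) 𝓘(ℝ, ℝ) ∞ (c i) ((U ∩ U') ×ˢ (V : Set M))) ∧
      ∀ q ∈ U ∩ U', ∀ y ∈ V, X q y = lcVF G (fun i y => c i (q, y)) y := by
  obtain ⟨U', V, h1, h2, h3, m, d, A, h4, h5, h6⟩ := hX.2 p hp x
  have h7 : ∀ j, ∃ V' : Opens M, x ∈ V' ∧ V' ≤ V ∧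
    ∃ c : Fin n → M → ℝ, (∀ i, ContMDiffOn 𝓘(ℝ, E) 𝓘(ℝ, ℝ) ∞ (c i) V') ∧
      ∀ y ∈ V', A j y = lcVF G c y := fun j => hx V h3 (A j) (h5 j)
  choose V' hxV' hV' c hc hA using h7
  refine ⟨U', ⟨V ∩ ⋂ j, (V' j : Set M), V.isOpen.inter (isOpen_iInter_of_finite fun j => (V' j).isOpen)⟩,
    h1, h2, ⟨h3, mem_iInter.2 hxV'⟩, fun i z => ∑ j, d j z * c j i z.2, fun i => ?_, ?_⟩
  · refine contMDiffOn_finsetSum fun j _ => ContMDiffOn.mul ?_ ?_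
    · exact (h4 j).mono (prod_mono subset_rfl inter_subset_left)
    · exact (hc j i).comp contMDiffOn_snd fun z hz => mem_iInter.1 hz.2.2 j
  · intro q hq y hy
    rw [h6 q hq y hy.1]
    unfold lcVF
    have : ∀ j, A j y = ∑ i, c j i y • G i y := fun j => hA j y (mem_iInter.1 hy.2 j)
    simp only [this, Finset.smul_sum, Finset.sum_smul, mul_smul]
    rw [Finset.sum_comm]

theorem GenData.exists_coef [FiniteDimensional ℝ E] [FiniteDimensional ℝ P] [T2Space M]
    [SecondCountableTopology M] {F : SingularFoliation E M} {K : Set M} (D : GenData F K)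
    {X : P → VF E M} (hX : F.IsPlotOn univ X) :
    ∃ c : Fin D.n → P × M → ℝ, (∀ i, ContMDiff (𝓘(ℝ, P).prod 𝓘(ℝ, E)) 𝓘(ℝ, ℝ) ∞ (c i)) ∧
      (∀ i p, ∀ x ∉ tsupport D.χ, c i (p, x) = 0) ∧
      ∀ p x, D.χ x • X p x = lcVF D.G (fun i y => c i (p, y)) x := by
  have := ChartedSpace.locallyCompactSpace E M
  have : ProperSpace P := FiniteDimensional.proper ℝ P
  let t : P × M → Set (Fin D.n → ℝ) := fun z =>
    {ξ | D.χ z.2 • X z.1 z.2 = ∑ i, ξ i • D.G i z.2 ∧ (z.2 ∉ tsupport D.χ → ξ = 0)}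
  have ht : ∀ z, Convex ℝ (t z) := by
    intro z ξ hξ ξ' hξ' a b _ _ hab
    refine ⟨?_, fun h => by rw [hξ.2 h, hξ'.2 h]; simp⟩
    simp only [Pi.add_apply, Pi.smul_apply, smul_eq_mul, add_smul, mul_smul,
      Finset.sum_add_distrib, ← Finset.smul_sum]
    rw [← hξ.1, ← hξ'.1, ← add_smul, hab, one_smul]
  obtain ⟨g, hg⟩ := exists_contMDiffMap_forall_mem_convex_of_local (n := (⊤ : ℕ∞))
    (𝓘(ℝ, P).prod 𝓘(ℝ, E)) ht (fun z => by
      by_cases hz : z.2 ∈ tsupport D.χ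
      · obtain ⟨U', V, h1, h2, h3, c, hc, hXc⟩ := hX.exists_local_coef (mem_univ z.1) (D.gen _ hz)
        refine ⟨U' ×ˢ V, prod_mem_nhds (h1.mem_nhds h2) (V.isOpen.mem_nhds h3),
          fun w i => D.χ w.2 * c i w, ?_, fun w hw => ⟨?_, fun h => ?_⟩⟩
        · rw [contMDiffOn_pi_space]
          intro i
          refine (D.smooth.comp contMDiff_snd).contMDiffOn.mul ((hc i).mono ?_)
          rw [univ_inter]
        · rw [hXc w.1 (by simpa using hw.1) w.2 hw.2]
          simp only [lcVF, Finset.smul_sum, mul_smul]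
        · funext i
          simp [image_eq_zero_of_notMem_tsupport h]
      · refine ⟨Prod.snd ⁻¹' (tsupport D.χ)ᶜ, continuous_snd.continuousAt.preimage_mem_nhds
          ((isClosed_tsupport _).isOpen_compl.mem_nhds hz), fun _ => 0, contMDiffOn_const,
          fun w hw => ⟨?_, fun _ => rfl⟩⟩
        rw [image_eq_zero_of_notMem_tsupport hw]
        simp)
  refine ⟨fun i z => g z i, fun i => ?_, fun i p x hx => ?_, fun p x => (hg (p, x)).1⟩
  · exact contMDiff_pi_space.1 g.contMDiff i
  · exact congrFun ((hg (p, x)).2 hx) i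

theorem GenData.exists_bracket_coef [FiniteDimensional ℝ E] [T2Space M]
    [SecondCountableTopology M] {F : SingularFoliation E M} {K : Set M} (D : GenData F K) :
    ∃ b : Fin D.n → Fin D.n → Fin D.n → M → ℝ, (∀ i j k, ContMDiff 𝓘(ℝ, E) 𝓘(ℝ, ℝ) ∞ (b i j k)) ∧
      ∀ i j, ∀ x ∈ tsupport D.χ, VectorField.mlieBracket 𝓘(ℝ, E) (D.G i) (D.G j) x =
        lcVF D.G (b i j) x := by
  have := ChartedSpace.locallyCompactSpace E M
  have key : ∀ i j, ∃ b : Fin D.n → M → ℝ, (∀ k, ContMDiff 𝓘(ℝ, E) 𝓘(ℝ, ℝ) ∞ (b k)) ∧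
      ∀ x ∈ tsupport D.χ, VectorField.mlieBracket 𝓘(ℝ, E) (D.G i) (D.G j) x =
        lcVF D.G b x := by
    intro i j
    let t : M → Set (Fin D.n → ℝ) := fun x =>
      {ξ | x ∈ tsupport D.χ → VectorField.mlieBracket 𝓘(ℝ, E) (D.G i) (D.G j) x =
        ∑ i, ξ i • D.G i x}
    have ht : ∀ x, Convex ℝ (t x) := by
      intro x ξ hξ ξ' hξ' a b _ _ hab hx
      simp only [Pi.add_apply, Pi.smul_apply, smul_eq_mul, add_smul, mul_smul,
        Finset.sum_add_distrib, ← Finset.smul_sum]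
      rw [← hξ hx, ← hξ' hx, ← add_smul, hab, one_smul]
    obtain ⟨g, hg⟩ := exists_contMDiffMap_forall_mem_convex_of_local (n := (⊤ : ℕ∞))
      𝓘(ℝ, E) ht (fun x => by
        by_cases hx : x ∈ tsupport D.χ
        · obtain ⟨V, h1, -, c, hc, hY⟩ := D.gen x hx ⊤ trivial _ (F.involutive (D.sec i) (D.sec j))
          exact ⟨V, V.isOpen.mem_nhds h1, fun y k => c k y, contMDiffOn_pi_space.2 hc,
            fun y hy _ => hY y hy⟩
        · exact ⟨(tsupport D.χ)ᶜ, (isClosed_tsupport _).isOpen_compl.mem_nhds hx, fun _ => 0,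
            contMDiffOn_const, fun y hy h => (hy h).elim⟩)
    exact ⟨fun k x => g x k, fun k => contMDiff_pi_space.1 g.contMDiff k, fun x hx => hg x hx⟩
  choose b hb hb' using key
  exact ⟨b, hb, hb'⟩

/-- The data of the flow of a plot `X` of `F`, cut off near a compact set. -/
structure FlowData (F : SingularFoliation E M) (K : Set M) (e : P) (X : P → VF E M) extends
    GenData F K where
  c : Fin n → P × M → ℝ
  c_smooth : ∀ i, ContMDiff (𝓘(ℝ, P).prod 𝓘(ℝ, E)) 𝓘(ℝ, ℝ) ∞ (c i)
  c_eq : ∀ p x, χ x • X p x = lcVF G (fun i y => c i (p, y)) x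
  Φ : ℝ → P → M → M
  R : ℝ → P → M → ((Fin n → ℝ) × P) →L[ℝ] (Fin n → ℝ)
  Φ_smooth : ContMDiff (𝓘(ℝ, ℝ).prod (𝓘(ℝ, P).prod 𝓘(ℝ, E))) 𝓘(ℝ, E) ∞
    (fun z : ℝ × (P × M) => Φ z.1 z.2.1 z.2.2)
  R_smooth : ContMDiff (𝓘(ℝ, ℝ).prod (𝓘(ℝ, P).prod 𝓘(ℝ, E)))
    𝓘(ℝ, ((Fin n → ℝ) × P) →L[ℝ] (Fin n → ℝ)) ∞ (fun z : ℝ × (P × M) => R z.1 z.2.1 z.2.2)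
  Φ_zero : ∀ p x, Φ 0 p x = x
  Φ_deriv : ∀ t p x, HasMFDerivAt 𝓘(ℝ, ℝ) 𝓘(ℝ, E) (fun τ => Φ τ p x) t
    ((1 : ℝ →L[ℝ] ℝ).smulRight (χ (Φ t p x) • X (p + t • e) (Φ t p x)))
  Φ_push : ∀ t p x ζ, (mfderiv (𝓘(ℝ, P).prod 𝓘(ℝ, E)) 𝓘(ℝ, E)
    (fun z : P × M => Φ t z.1 z.2) (p, x) : P × E →L[ℝ] E) (prodFrame G (p, x) ζ) =
      combVF G (R t p x ζ) (Φ t p x)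

theorem exists_flowData [FiniteDimensional ℝ E] [FiniteDimensional ℝ P] [T2Space M]
    [SecondCountableTopology M] {F : SingularFoliation E M} {K : Set M} (hK : IsCompact K) (e : P)
    {X : P → VF E M} (hX : F.IsPlotOn univ X) : Nonempty (FlowData F K e X) := by
  obtain ⟨D⟩ := exists_genData F hK
  obtain ⟨c, hc, hcC, hcX⟩ := D.exists_coef hX
  obtain ⟨b, hb, hb'⟩ := D.exists_bracket_coef
  have hbr : ∀ i j p x, c i (p, x) • vfVal (VectorField.mlieBracket 𝓘(ℝ, E) (D.G i) (D.G j)) x =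
      combVF D.G (fun k => c i (p, x) * b i j k x) x := by
    intro i j p x
    by_cases hx : x ∈ tsupport D.χ
    · have : vfVal (VectorField.mlieBracket 𝓘(ℝ, E) (D.G i) (D.G j)) x =
        ∑ k, b i j k x • vfVal (D.G k) x := hb' i j x hx
      rw [this]
      simp only [combVF, Finset.smul_sum, mul_smul]
    · simp [hcC i p x hx, combVF]
  obtain ⟨Φ, R, h1, h2, h3, h4, h5⟩ := exists_foliated_flow e D.smoothVF hc
    (C := tsupport D.χ) D.compact hcC hb hbr
  have h6 : ∀ t p x, HasMFDerivAt 𝓘(ℝ, ℝ) 𝓘(ℝ, E) (fun τ => Φ τ p x) t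
      ((1 : ℝ →L[ℝ] ℝ).smulRight (D.χ (Φ t p x) • X (p + t • e) (Φ t p x))) := fun t p x => by
    rw [hcX]
    exact h4 t p x
  exact ⟨{ D with
    c := c
    c_smooth := hc
    c_eq := hcX
    Φ := Φ
    R := R
    Φ_smooth := h1
    R_smooth := h2
    Φ_zero := h3
    Φ_deriv := h6
    Φ_push := h5 }⟩

end Coefficients

section Curves

variable {E : Type*} [NormedAddCommGroup E] [NormedSpace ℝ E]
  {N : Type*} [TopologicalSpace N] [ChartedSpace E N] [IsManifold 𝓘(ℝ, E) ∞ N]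
  {W : Type*} [NormedAddCommGroup W] [NormedSpace ℝ W]
  {W' : Type*} [NormedAddCommGroup W'] [NormedSpace ℝ W']

theorem VFModule.IsPlotOn.contMDiffOn {F : VFModule E N} {U : Set W} {X : W → VF E N}
    (hX : F.IsPlotOn U X) :
    ContMDiffOn (𝓘(ℝ, W).prod 𝓘(ℝ, E)) 𝓘(ℝ, E).tangent ∞
      (fun z : W × N => tmk 𝓘(ℝ, E) z.2 (vfVal (X z.1) z.2)) (U ×ˢ univ) := by
  rintro ⟨u, x⟩ ⟨hu, -⟩
  obtain ⟨U', V, h1, h2, h3, n, c, G, h4, h5, h6⟩ := hX.2 u hu x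
  have hmem : (U ∩ U') ×ˢ (V : Set N) ∈ 𝓝[U ×ˢ univ] (u, x) := by
    rw [nhdsWithin_prod_eq, nhdsWithin_univ]
    exact prod_mem_prod (inter_mem_nhdsWithin U (h1.mem_nhds h2)) (V.isOpen.mem_nhds h3)
  refine ContMDiffWithinAt.mono_of_mem_nhdsWithin (s := (U ∩ U') ×ˢ (V : Set N)) ?_ hmem
  have key := contMDiffWithinAt_sum_smul (I := 𝓘(ℝ, E)) (J := 𝓘(ℝ, W).prod 𝓘(ℝ, E))
    (f := fun z : W × N => z.2) (s := (U ∩ U') ×ˢ (V : Set N)) (z₀ := (u, x))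
    contMDiffWithinAt_snd (c := c) (fun i => h4 i (u, x) ⟨⟨hu, h2⟩, h3⟩)
    (w := fun i z => vfVal (G i) z.2) (fun i => by
      have h := F.smooth (h5 i) x h3
      exact ContMDiffWithinAt.comp (t := (V : Set N)) (u, x) h contMDiffWithinAt_snd
        (fun (z : W × N) (hz : z ∈ (U ∩ U') ×ˢ (V : Set N)) => hz.2))
  refine key.congr (fun z hz => ?_) ?_
  · exact congrArg (tmk 𝓘(ℝ, E) z.2) (h6 z.1 hz.1 z.2 hz.2)
  · exact congrArg (tmk 𝓘(ℝ, E) x) (h6 u ⟨hu, h2⟩ x h3)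

theorem VFModule.IsPlotOn.contMDiff {F : VFModule E N} {X : W → VF E N}
    (hX : F.IsPlotOn univ X) :
    ContMDiff (𝓘(ℝ, W).prod 𝓘(ℝ, E)) 𝓘(ℝ, E).tangent ∞
      (fun z : W × N => (⟨z.2, X z.1 z.2⟩ : TangentBundle 𝓘(ℝ, E) N)) := by
  have := hX.contMDiffOn
  rw [univ_prod_univ] at this
  exact contMDiffOn_univ.1 this

theorem VFModule.IsPlotOn.smul {F : VFModule E N} {U : Set W} {φ : W → VF E N}
    (h : F.IsPlotOn U φ) {a : W → ℝ} (ha : ContDiffOn ℝ ∞ a U) :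
    F.IsPlotOn U (fun u => a u • φ u) := by
  refine ⟨fun u hu => F.smul (f := fun _ => a u) contMDiffOn_const (h.1 u hu),
    fun u₀ hu₀ x₀ => ?_⟩
  obtain ⟨U', V, h1, h2, h3, n, c, G, h4, h5, h6⟩ := h.2 u₀ hu₀ x₀
  refine ⟨U', V, h1, h2, h3, n, fun i z => a z.1 * c i z, G, fun i => ?_, h5,
    fun u hu x hx => ?_⟩
  · exact ((ha.contMDiffOn.mono inter_subset_left).comp contMDiffOn_fst fun z hz => hz.1).mul (h4 i)
  · simp only [Pi.smul_apply, h6 u hu x hx, Finset.smul_sum, mul_smul]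

/-- Differentiability at the end points of a curve with continuous velocity. -/
theorem hasMFDerivWithinAt_Icc_of_Ioo {γ : ℝ → N} {w : ℝ → E}
    (hγ : ContinuousOn γ (Icc 0 1))
    (h : ∀ t ∈ Ioo (0 : ℝ) 1, HasMFDerivAt 𝓘(ℝ, ℝ) 𝓘(ℝ, E) γ t
      ((1 : ℝ →L[ℝ] ℝ).smulRight (w t)))
    (hw : ContinuousOn (fun t => tmk 𝓘(ℝ, E) (γ t) (w t)) (Icc 0 1)) {t₀ : ℝ}
    (ht₀ : t₀ ∈ Icc (0 : ℝ) 1) :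
    HasMFDerivWithinAt 𝓘(ℝ, ℝ) 𝓘(ℝ, E) γ (Icc 0 1) t₀ ((1 : ℝ →L[ℝ] ℝ).smulRight (w t₀)) := by
  set e := extChartAt 𝓘(ℝ, E) (γ t₀) with he
  have hsrc : γ ⁻¹' e.source ∈ 𝓝[Icc 0 1] t₀ :=
    hγ t₀ ht₀ ((isOpen_extChartAt_source (γ t₀)).mem_nhds (mem_extChartAt_source (γ t₀)))
  obtain ⟨δ, hδ, hball⟩ := Metric.mem_nhdsWithin_iff.1 hsrc
  set a := max 0 (t₀ - δ / 2) with ha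
  set b := min 1 (t₀ + δ / 2) with hb
  have hab : a < b := by
    refine max_lt (lt_min one_pos (by linarith [ht₀.1])) (lt_min (by linarith [ht₀.2]) (by linarith))
  have hsub : Icc a b ⊆ Icc 0 1 ∩ γ ⁻¹' e.source := by
    intro t ht
    have h1 : t ∈ Icc (0 : ℝ) 1 := ⟨(le_max_left _ _).trans ht.1, ht.2.trans (min_le_left _ _)⟩
    refine ⟨h1, hball ⟨?_, h1⟩⟩
    have h2 : t₀ - δ / 2 ≤ t := (le_max_right _ _).trans ht.1
    have h3 : t ≤ t₀ + δ / 2 := ht.2.trans (min_le_right _ _)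
    rw [Metric.mem_ball, Real.dist_eq, abs_lt]
    constructor <;> linarith
  have hmem : Icc a b ∈ 𝓝[Icc 0 1] t₀ := by
    refine Metric.mem_nhdsWithin_iff.2 ⟨δ / 2, by positivity, fun t ht => ?_⟩
    have h1 := ht.1
    rw [Metric.mem_ball, Real.dist_eq, abs_lt] at h1
    exact ⟨max_le ht.2.1 (by linarith), le_min ht.2.2 (by linarith)⟩
  have hIoo : Ioo a b ⊆ Ioo 0 1 := fun t ht =>
    ⟨(le_max_left _ _).trans_lt ht.1, ht.2.trans_le (min_le_left _ _)⟩
  have hcl : closure (Ioo a b) = Icc a b := closure_Ioo hab.ne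
  set u : ℝ → E := fun t => tderiv 𝓘(ℝ, E) e (γ t) (w t) with hu
  have hder : ∀ t ∈ Ioo a b, HasDerivAt (fun τ => e (γ τ)) (u t) t := by
    intro t ht
    have h1 := hasDerivWithinAt_extChartAt_comp (I := 𝓘(ℝ, E)) (x₀ := γ t₀)
      (s := univ) (h t (hIoo ht)).hasMFDerivWithinAt (hsub (Ioo_subset_Icc_self ht)).2
    exact h1.hasDerivAt univ_mem
  have hecont : ContinuousOn (fun τ => e (γ τ)) (Icc a b) :=
    (continuousOn_extChartAt (γ t₀)).comp (hγ.mono fun t ht => (hsub ht).1) fun t ht => (hsub ht).2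
  have hucont : Tendsto u (𝓝[Icc 0 1] t₀) (𝓝 (u t₀)) := by
    have h1 := hw t₀ ht₀
    rw [FiberBundle.continuousWithinAt_totalSpace] at h1
    refine (h1.2.congr_of_eventuallyEq_of_mem ?_ ht₀)
    filter_upwards [hsrc] with t ht
    exact (trivializationAt_apply_snd (I := 𝓘(ℝ, E)) (x := γ t₀) (y := γ t)
      (by simpa [he] using ht) (w t)).symm
  have hF : HasFDerivWithinAt (fun τ => e (γ τ)) ((1 : ℝ →L[ℝ] ℝ).smulRight (u t₀)) (Icc a b) t₀ := by
    rw [← hcl]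
    refine hasFDerivWithinAt_closure_of_tendsto_fderiv
      (fun t ht => (hder t ht).differentiableAt.differentiableWithinAt) (convex_Ioo a b) isOpen_Ioo
      (fun y hy => (hecont y (hcl ▸ hy)).mono Ioo_subset_Icc_self) ?_
    have h2 : Tendsto (fun t => (1 : ℝ →L[ℝ] ℝ).smulRight (u t)) (𝓝[Ioo a b] t₀)
        (𝓝 ((1 : ℝ →L[ℝ] ℝ).smulRight (u t₀))) := by
      have h3 : Continuous (fun v : E => (1 : ℝ →L[ℝ] ℝ).smulRight v) :=
        (ContinuousLinearMap.smulRightL ℝ ℝ E (1 : ℝ →L[ℝ] ℝ)).continuous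
      exact (h3.tendsto _).comp (hucont.mono_left (nhdsWithin_mono _ (hIoo.trans Ioo_subset_Icc_self)))
    refine h2.congr' ?_
    filter_upwards [self_mem_nhdsWithin] with t ht
    exact (hder t ht).hasFDerivAt.fderiv.symm
  have hu0 : u t₀ = w t₀ := by
    have := tderiv_extChartAt_self (I := 𝓘(ℝ, E)) (γ t₀)
    simp only [hu, he, this]
    rfl
  rw [hu0] at hF
  refine ⟨hγ t₀ ht₀, ?_⟩
  have h5 : HasFDerivWithinAt (fun τ => e (γ τ)) ((1 : ℝ →L[ℝ] ℝ).smulRight (w t₀)) (Icc 0 1) t₀ :=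
    hF.mono_of_mem_nhdsWithin hmem
  have h6 : (extChartAt 𝓘(ℝ, ℝ) t₀).symm ⁻¹' Icc 0 1 ∩ range 𝓘(ℝ, ℝ) = Icc 0 1 := by
    simp only [mfld_simps]
    rfl
  rw [h6]
  exact h5

/-! ### The sinusoidal reparametrization -/

/-- A reparametrization of `[0, 1]` by the real line. -/
def wave (t : ℝ) : ℝ := (1 - Real.cos (Real.pi * t)) / 2

/-- The inverse of `wave` on `[0, 1]`. -/
def waveInv (t : ℝ) : ℝ := Real.arccos (1 - 2 * t) / Real.pi

theorem contDiff_wave : ContDiff ℝ ∞ wave :=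
  (contDiff_const.sub (Real.contDiff_cos.comp (contDiff_const.mul contDiff_id))).div_const 2

theorem hasDerivAt_wave (t : ℝ) : HasDerivAt wave (deriv wave t) t :=
  (contDiff_wave.differentiable (by simp) t).hasDerivAt

theorem contDiff_deriv_wave : ContDiff ℝ ∞ (deriv wave) :=
  (contDiff_infty_iff_deriv.1 contDiff_wave).2

theorem deriv_wave (t : ℝ) : deriv wave t = Real.pi / 2 * Real.sin (Real.pi * t) := by
  have h1 : HasDerivAt (fun t : ℝ => Real.pi * t) Real.pi t := by
    simpa using (hasDerivAt_id t).const_mul Real.pi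
  have h := ((h1.cos.const_sub 1).div_const 2).deriv
  change deriv wave t = _ at h
  rw [h]
  ring

theorem wave_mem (t : ℝ) : wave t ∈ Icc (0 : ℝ) 1 := by
  have h1 := Real.cos_le_one (Real.pi * t)
  have h2 := Real.neg_one_le_cos (Real.pi * t)
  constructor <;> unfold wave <;> linarith

@[simp] theorem wave_zero : wave 0 = 0 := by simp [wave]

@[simp] theorem wave_one : wave 1 = 1 := by norm_num [wave]

@[simp] theorem waveInv_zero : waveInv 0 = 0 := by simp [waveInv]

@[simp] theorem waveInv_one : waveInv 1 = 1 := by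
  have : (1 : ℝ) - 2 * 1 = -1 := by norm_num
  rw [waveInv, this, Real.arccos_neg_one, div_self Real.pi_ne_zero]

theorem waveInv_mem (t : ℝ) : waveInv t ∈ Icc (0 : ℝ) 1 :=
  ⟨div_nonneg (Real.arccos_nonneg _) Real.pi_pos.le,
    (div_le_one Real.pi_pos).2 (Real.arccos_le_pi _)⟩

theorem wave_waveInv {t : ℝ} (ht : t ∈ Icc (0 : ℝ) 1) : wave (waveInv t) = t := by
  rw [wave, waveInv, mul_div_cancel₀ _ Real.pi_ne_zero,
    Real.cos_arccos (by linarith [ht.2]) (by linarith [ht.1])]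
  ring

theorem waveInv_wave {t : ℝ} (ht : t ∈ Icc (0 : ℝ) 1) : waveInv (wave t) = t := by
  have h1 : 1 - 2 * wave t = Real.cos (Real.pi * t) := by unfold wave; ring
  rw [waveInv, h1, Real.arccos_cos (mul_nonneg Real.pi_pos.le ht.1)
    (mul_le_of_le_one_right Real.pi_pos.le ht.2), mul_div_cancel_left₀ _ Real.pi_ne_zero]

theorem continuous_waveInv : Continuous waveInv :=
  (Real.continuous_arccos.comp (continuous_const.sub (continuous_const.mul continuous_id))).div_const _

theorem waveInv_mem_Ioo {t : ℝ} (ht : t ∈ Ioo (0 : ℝ) 1) : waveInv t ∈ Ioo (0 : ℝ) 1 := by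
  have h := waveInv_mem t
  have h' := wave_waveInv (Ioo_subset_Icc_self ht)
  refine ⟨h.1.lt_of_ne fun h0 => ?_, h.2.lt_of_ne fun h1 => ?_⟩
  · rw [← h0, wave_zero] at h'
    exact ht.1.ne h'
  · rw [h1, wave_one] at h'
    exact ht.2.ne h'.symm

theorem deriv_wave_pos {t : ℝ} (ht : t ∈ Ioo (0 : ℝ) 1) : 0 < deriv wave t := by
  rw [deriv_wave]
  refine mul_pos (by positivity) (Real.sin_pos_of_pos_of_lt_pi (mul_pos Real.pi_pos ht.1) ?_)
  exact mul_lt_of_lt_one_right Real.pi_pos ht.2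

theorem hasDerivAt_waveInv {t : ℝ} (ht : t ∈ Ioo (0 : ℝ) 1) :
    HasDerivAt waveInv (deriv wave (waveInv t))⁻¹ t := by
  refine HasDerivAt.of_local_left_inverse continuous_waveInv.continuousAt (hasDerivAt_wave _)
    (deriv_wave_pos (waveInv_mem_Ioo ht)).ne' ?_
  filter_upwards [isOpen_Ioo.mem_nhds ht] with τ hτ using wave_waveInv (Ioo_subset_Icc_self hτ)

/-- The time-dependent field `X`, reparametrized by the real line. -/
def hat (X : ℝ → VF E N) (t : ℝ) : VF E N := deriv wave t • X (wave t)

theorem VFModule.IsPlotOn.hat {F : VFModule E N} {X : ℝ → VF E N} (hX : F.IsPlotOn (Icc 0 1) X) :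
    F.IsPlotOn univ (hat X) :=
  (hX.comp contDiff_wave.contDiffOn fun t _ => wave_mem t).smul contDiff_deriv_wave.contDiffOn

theorem IsIntegralCurve.comp_hasMFDerivAt {X : ℝ → VF E N} {γ : ℝ → N} (h : IsIntegralCurve X γ 1)
    {ψ : ℝ → ℝ} {d t : ℝ} (hψ : HasDerivAt ψ d t) (hm : ∀ t, ψ t ∈ Icc (0 : ℝ) 1) :
    HasMFDerivAt 𝓘(ℝ, ℝ) 𝓘(ℝ, E) (fun τ => γ (ψ τ)) t
      ((1 : ℝ →L[ℝ] ℝ).smulRight (d • X (ψ t) (γ (ψ t)))) := by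
  have h1 := h (ψ t) (hm t)
  have h2 : HasMFDerivWithinAt 𝓘(ℝ, ℝ) 𝓘(ℝ, ℝ) ψ univ t ((1 : ℝ →L[ℝ] ℝ).smulRight d) :=
    hψ.hasFDerivAt.hasMFDerivAt.hasMFDerivWithinAt
  have h3 := h1.comp t h2 (fun τ _ => hm τ)
  rw [hasMFDerivWithinAt_univ] at h3
  refine h3.congr_mfderiv (ContinuousLinearMap.ext fun (a : ℝ) => ?_)
  exact (smul_smul a d (X (ψ t) (γ (ψ t)))).symm

theorem IsIntegralCurve.hasMFDerivAt_hat {X : ℝ → VF E N} {γ : ℝ → N} (h : IsIntegralCurve X γ 1)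
    (t : ℝ) : HasMFDerivAt 𝓘(ℝ, ℝ) 𝓘(ℝ, E) (fun τ => γ (wave τ)) t
      ((1 : ℝ →L[ℝ] ℝ).smulRight (hat X t (γ (wave t)))) :=
  h.comp_hasMFDerivAt (hasDerivAt_wave t) wave_mem

theorem IsIntegralCurve.of_hat {F : VFModule E N} {X : ℝ → VF E N} (hX : F.IsPlotOn (Icc 0 1) X)
    {γ : ℝ → N} (h : ∀ t ∈ Icc (0 : ℝ) 1, HasMFDerivAt 𝓘(ℝ, ℝ) 𝓘(ℝ, E) γ t
      ((1 : ℝ →L[ℝ] ℝ).smulRight (hat X t (γ t)))) :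
    IsIntegralCurve X (fun t => γ (waveInv t)) 1 := by
  have hc : ContinuousOn (fun t => γ (waveInv t)) (Icc 0 1) := fun t ht =>
    ((h _ (waveInv_mem t)).continuousAt.comp continuous_waveInv.continuousAt).continuousWithinAt
  intro t ht
  refine hasMFDerivWithinAt_Icc_of_Ioo (w := fun t => vfVal (X t) (γ (waveInv t))) hc
    (fun τ hτ => ?_) ?_ ht
  · have h1 := (h _ (waveInv_mem τ)).comp τ (hasDerivAt_waveInv hτ).hasFDerivAt.hasMFDerivAt
    refine h1.congr_mfderiv (ContinuousLinearMap.ext fun (a : ℝ) => ?_)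
    have h2 : deriv wave (waveInv τ) ≠ 0 := (deriv_wave_pos (waveInv_mem_Ioo hτ)).ne'
    have h3 := wave_waveInv (Ioo_subset_Icc_self hτ)
    change (a * (deriv wave (waveInv τ))⁻¹) • (deriv wave (waveInv τ) •
      vfVal (X (wave (waveInv τ))) (γ (waveInv τ))) = a • vfVal (X τ) (γ (waveInv τ))
    rw [smul_smul, mul_assoc, inv_mul_cancel₀ h2, mul_one, h3]
  · exact hX.contMDiffOn.continuousOn.comp (f := fun t => (t, γ (waveInv t)))
      (continuousOn_id.prodMk hc) fun t ht => ⟨ht, mem_univ _⟩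

/-- Integral curves of a smooth time-dependent element are determined by their value at one time. -/
theorem IsIntegralCurve.eqOn [T2Space N] {F : VFModule E N} {X : ℝ → VF E N}
    (hX : F.IsPlotOn (Icc 0 1) X) {γ γ' : ℝ → N} (h : IsIntegralCurve X γ 1)
    (h' : IsIntegralCurve X γ' 1) {t₀ : ℝ} (ht₀ : t₀ ∈ Icc (0 : ℝ) 1) (h0 : γ t₀ = γ' t₀) :
    EqOn γ γ' (Icc 0 1) := by
  intro t ht
  have key := eqOn_of_hasMFDerivAt (P := ℝ) (e := 1) (p := 0) (a := -1) (b := 2)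
    hX.hat.contMDiff (γ := fun τ => γ (wave τ)) (γ' := fun τ => γ' (wave τ))
    (fun t _ => by simpa using h.hasMFDerivAt_hat t) (fun t _ => by simpa using h'.hasMFDerivAt_hat t)
    (t₀ := waveInv t₀) ⟨by linarith [(waveInv_mem t₀).1], by linarith [(waveInv_mem t₀).2]⟩
    (by simpa [wave_waveInv ht₀] using h0)
  have := key (x := waveInv t) ⟨by linarith [(waveInv_mem t).1], by linarith [(waveInv_mem t).2]⟩
  simpa [wave_waveInv ht] using this

theorem FlowsTo.unique [T2Space N] {F : VFModule E N} {X : ℝ → VF E N}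
    (hX : F.IsPlotOn (Icc 0 1) X) {x y y' : N} (h : FlowsTo X 1 x y) (h' : FlowsTo X 1 x y') :
    y = y' := by
  obtain ⟨γ, h1, h2, rfl⟩ := h
  obtain ⟨γ', h1', h2', rfl⟩ := h'
  exact h1.eqOn hX h1' (t₀ := 0) (by simp) (h2.trans h2'.symm) (by simp)

theorem FlowsTo.unique_left [T2Space N] {F : VFModule E N} {X : ℝ → VF E N}
    (hX : F.IsPlotOn (Icc 0 1) X) {x x' y : N} (h : FlowsTo X 1 x y) (h' : FlowsTo X 1 x' y) :
    x = x' := by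
  obtain ⟨γ, h1, rfl, h2⟩ := h
  obtain ⟨γ', h1', rfl, h2'⟩ := h'
  exact h1.eqOn hX h1' (t₀ := 1) (by simp) (h2.trans h2'.symm) (by simp)

theorem FlowsTo.flow_eq [T2Space N] {F : VFModule E N} {X : ℝ → VF E N}
    (hX : F.IsPlotOn (Icc 0 1) X) {x y : N} (h : FlowsTo X 1 x y) : flow X 1 x = y := by
  have h' : ∃ y, FlowsTo X 1 x y := ⟨y, h⟩
  rw [flow, dif_pos h']
  exact h'.choose_spec.unique hX h

end Curves

section CutFlow

variable {E : Type*} [NormedAddCommGroup E] [NormedSpace ℝ E]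
  {N : Type*} [TopologicalSpace N] [ChartedSpace E N] [IsManifold 𝓘(ℝ, E) ∞ N]
  {P : Type*} [NormedAddCommGroup P] [NormedSpace ℝ P]

/-- `Φ t p` is the time `t` flow of the parametrized field `Y`, where the parameter `p` moves with
velocity `e`. -/
structure IsFlowOf (e : P) (Y : P → VF E N) (Φ : ℝ → P → N → N) : Prop where
  field_smooth : ContMDiff (𝓘(ℝ, P).prod 𝓘(ℝ, E)) 𝓘(ℝ, E).tangent ∞
    (fun z : P × N => (⟨z.2, Y z.1 z.2⟩ : TangentBundle 𝓘(ℝ, E) N))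
  smooth : ContMDiff (𝓘(ℝ, ℝ).prod (𝓘(ℝ, P).prod 𝓘(ℝ, E))) 𝓘(ℝ, E) ∞
    (fun z : ℝ × (P × N) => Φ z.1 z.2.1 z.2.2)
  zero : ∀ p x, Φ 0 p x = x
  ode : ∀ t p x, HasMFDerivAt 𝓘(ℝ, ℝ) 𝓘(ℝ, E) (fun τ => Φ τ p x) t
    ((1 : ℝ →L[ℝ] ℝ).smulRight (Y (p + t • e) (Φ t p x)))

/-- A parametrized field multiplied by a function. -/
def cut (χ : N → ℝ) (X : P → VF E N) (p : P) : VF E N := fun x => χ x • X p x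

theorem hasMFDerivAt_comp_hasDerivAt {γ : ℝ → N} {ψ : ℝ → ℝ} {d t : ℝ} {w : E}
    (h : HasMFDerivAt 𝓘(ℝ, ℝ) 𝓘(ℝ, E) γ (ψ t) ((1 : ℝ →L[ℝ] ℝ).smulRight w))
    (hψ : HasDerivAt ψ d t) :
    HasMFDerivAt 𝓘(ℝ, ℝ) 𝓘(ℝ, E) (fun τ => γ (ψ τ)) t ((1 : ℝ →L[ℝ] ℝ).smulRight (d • w)) := by
  refine (h.comp t hψ.hasFDerivAt.hasMFDerivAt).congr_mfderiv
    (ContinuousLinearMap.ext fun (a : ℝ) => ?_)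
  exact (smul_smul a d w).symm

theorem IsFlowOf.eq_of_hasMFDerivAt [T2Space N] {e : P} {Y : P → VF E N} {Φ : ℝ → P → N → N}
    (h : IsFlowOf e Y Φ) {p : P} {γ : ℝ → N} {a b : ℝ}
    (hγ : ∀ t ∈ Ioo a b, HasMFDerivAt 𝓘(ℝ, ℝ) 𝓘(ℝ, E) γ t
      ((1 : ℝ →L[ℝ] ℝ).smulRight (Y (p + t • e) (γ t)))) (h0 : (0 : ℝ) ∈ Ioo a b) {t : ℝ}
    (ht : t ∈ Ioo a b) : Φ t p (γ 0) = γ t :=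
  eqOn_of_hasMFDerivAt h.field_smooth (fun t _ => h.ode t p (γ 0)) hγ h0 (h.zero p _) ht

theorem IsFlowOf.add [T2Space N] {e : P} {Y : P → VF E N} {Φ : ℝ → P → N → N}
    (h : IsFlowOf e Y Φ) (s t : ℝ) (p : P) (x : N) :
    Φ s (p + t • e) (Φ t p x) = Φ (t + s) p x := by
  have h0 : Φ (t + 0) p x = Φ t p x := by rw [add_zero]
  rw [← h0]
  refine h.eq_of_hasMFDerivAt (γ := fun s => Φ (t + s) p x) (a := -|s| - 1) (b := |s| + 1)
    (fun σ _ => ?_) ?_ ?_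
  · have h1 := hasMFDerivAt_comp_hasDerivAt (ψ := fun σ => t + σ) (t := σ)
      (w := vfVal (Y (p + (t + σ) • e)) (Φ (t + σ) p x)) (h.ode (t + σ) p x)
      ((hasDerivAt_id σ).const_add t)
    rw [one_smul] at h1
    have h2 : p + t • e + σ • e = p + (t + σ) • e := by rw [add_smul, add_assoc]
    rw [h2]
    exact h1
  · constructor <;> linarith [abs_nonneg s]
  · constructor
    · linarith [neg_abs_le s]
    · linarith [le_abs_self s]

theorem IsFlowOf.left_inv [T2Space N] {e : P} {Y : P → VF E N} {Φ : ℝ → P → N → N}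
    (h : IsFlowOf e Y Φ) (t : ℝ) (p : P) (x : N) : Φ (-t) (p + t • e) (Φ t p x) = x := by
  rw [h.add, add_neg_cancel, h.zero]

theorem IsFlowOf.right_inv [T2Space N] {e : P} {Y : P → VF E N} {Φ : ℝ → P → N → N}
    (h : IsFlowOf e Y Φ) (t : ℝ) (p : P) (x : N) : Φ t p (Φ (-t) (p + t • e) x) = x := by
  have := h.left_inv (-t) (p + t • e) x
  rwa [neg_neg, neg_smul, add_neg_cancel_right] at this

theorem VFModule.IsPlotOn.cut {F : VFModule E N} {U : Set P} {X : P → VF E N}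
    (h : F.IsPlotOn U X) {χ : N → ℝ} (hχ : ContMDiff 𝓘(ℝ, E) 𝓘(ℝ, ℝ) ∞ χ) :
    F.IsPlotOn U (cut χ X) := by
  refine ⟨fun u hu => F.smul hχ.contMDiffOn (h.1 u hu), fun u₀ hu₀ x₀ => ?_⟩
  obtain ⟨U', V, h1, h2, h3, n, c, G, h4, h5, h6⟩ := h.2 u₀ hu₀ x₀
  refine ⟨U', V, h1, h2, h3, n, fun i z => χ z.2 * c i z, G, fun i => ?_, h5,
    fun u hu x hx => ?_⟩
  · exact (hχ.comp contMDiff_snd).contMDiffOn.mul (h4 i)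
  · unfold SingFol.cut
    simp only [h6 u hu x hx, Finset.smul_sum, mul_smul]

theorem FlowData.isFlowOf {F : SingularFoliation E N} {K : Set N} {e : P} {X : P → VF E N}
    (hX : F.IsPlotOn univ X) (D : FlowData F K e X) : IsFlowOf e (cut D.χ X) D.Φ where
  field_smooth := (hX.cut D.smooth).contMDiff
  smooth := D.Φ_smooth
  zero := D.Φ_zero
  ode := D.Φ_deriv

theorem exists_isFlowOf [FiniteDimensional ℝ E] [FiniteDimensional ℝ P] [T2Space N]
    {F : VFModule E N} {X : P → VF E N} (hX : F.IsPlotOn univ X) (e : P) {χ : N → ℝ}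
    (hχ : ContMDiff 𝓘(ℝ, E) 𝓘(ℝ, ℝ) ∞ χ) (hc : HasCompactSupport χ) :
    ∃ Φ, IsFlowOf e (cut χ X) Φ := by
  obtain ⟨Φ, R, h1, -, h3, -, h5, -⟩ := exists_flow_cocycle (A := ℝ) e (X := cut χ X)
    (hX.cut hχ).contMDiff (lam := fun _ => 0) contMDiff_const (C := tsupport χ) hc
    (fun p x hx => by unfold cut; rw [image_eq_zero_of_notMem_tsupport hx, zero_smul])
    (fun _ _ _ => rfl)
  exact ⟨Φ, (hX.cut hχ).contMDiff, h1, h3, h5⟩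

/-- Integral curves along which the cut-off function is `1` are trajectories of the cut-off flow. -/
theorem IsFlowOf.eq_integralCurve [T2Space N] {X : ℝ → VF E N} {χ : N → ℝ} {Φ : ℝ → ℝ → N → N}
    (h : IsFlowOf (1 : ℝ) (cut χ (hat X)) Φ) {p : ℝ → N} (hp : IsIntegralCurve X p 1)
    (hχ : ∀ t ∈ Icc (0 : ℝ) 1, χ (p t) = 1) (t₀ t : ℝ) :
    Φ (t - t₀) t₀ (p (wave t₀)) = p (wave t) := by
  have h1 := h.eq_of_hasMFDerivAt (p := t₀) (γ := fun τ => p (wave (t₀ + τ)))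
    (a := -|t - t₀| - 1) (b := |t - t₀| + 1) (t := t - t₀) (fun τ _ => ?_) ?_ ?_
  · simpa using h1
  · have h2 := hp.comp_hasMFDerivAt (ψ := fun τ => wave (t₀ + τ)) (t := τ)
      (d := deriv wave (t₀ + τ)) (by
        simpa [Function.comp_def] using
          (hasDerivAt_wave (t₀ + τ)).comp τ ((hasDerivAt_id τ).const_add t₀))
      (fun τ => wave_mem _)
    refine h2.congr_mfderiv ?_
    unfold cut
    rw [hχ _ (wave_mem _), one_smul]
    simp only [smul_eq_mul, mul_one]
    rfl
  · constructor <;> linarith [abs_nonneg (t - t₀)]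
  · constructor
    · linarith [neg_abs_le (t - t₀)]
    · linarith [le_abs_self (t - t₀)]

/-- Trajectories of the cut-off flow along which the cut-off function is `1` are integral curves of
the original field. -/
theorem IsFlowOf.isIntegralCurve {F : VFModule E N} {X : ℝ → VF E N}
    (hX : F.IsPlotOn (Icc 0 1) X) {χ : N → ℝ} {Φ : ℝ → ℝ → N → N}
    (h : IsFlowOf (1 : ℝ) (cut χ (hat X)) Φ) {t₀ : ℝ} {x : N}
    (hχ : ∀ t ∈ Icc (0 : ℝ) 1, χ (Φ (t - t₀) t₀ x) = 1) :
    IsIntegralCurve X (fun t => Φ (waveInv t - t₀) t₀ x) 1 := by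
  refine IsIntegralCurve.of_hat hX (γ := fun t => Φ (t - t₀) t₀ x) fun t ht => ?_
  have h1 := hasMFDerivAt_comp_hasDerivAt (ψ := fun t => t - t₀) (t := t)
      (w := vfVal (cut χ (hat X) (t₀ + (t - t₀) • (1 : ℝ))) (Φ (t - t₀) t₀ x))
      (h.ode (t - t₀) t₀ x) ((hasDerivAt_id t).sub_const t₀)
  refine h1.congr_mfderiv ?_
  have h2 : vfVal (cut χ (hat X) (t₀ + (t - t₀) • (1 : ℝ))) (Φ (t - t₀) t₀ x) =
      vfVal (hat X t) (Φ (t - t₀) t₀ x) := by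
    have h3 : t₀ + (t - t₀) • (1 : ℝ) = t := by simp
    rw [h3]
    change χ _ • vfVal (hat X t) (Φ (t - t₀) t₀ x) = _
    rw [hχ t ht, one_smul]
  rw [one_smul, h2]
  rfl

theorem IsFlowOf.eventually_isIntegralCurve [T2Space N] {F : VFModule E N} {X : ℝ → VF E N}
    (hX : F.IsPlotOn (Icc 0 1) X) {χ : N → ℝ} {Φ : ℝ → ℝ → N → N}
    (h : IsFlowOf (1 : ℝ) (cut χ (hat X)) Φ) {O : Set N} (hO : IsOpen O) (hχ : ∀ x ∈ O, χ x = 1)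
    {p : ℝ → N} (hp : IsIntegralCurve X p 1) (hpO : ∀ t ∈ Icc (0 : ℝ) 1, p t ∈ O) (t₀ : ℝ) :
    ∀ᶠ x in 𝓝 (p (wave t₀)), IsIntegralCurve X (fun t => Φ (waveInv t - t₀) t₀ x) 1 ∧
      ∀ t ∈ Icc (0 : ℝ) 1, Φ (t - t₀) t₀ x ∈ O := by
  have hcont : Continuous fun z : N × ℝ => Φ (z.2 - t₀) t₀ z.1 :=
    h.smooth.continuous.comp
      ((continuous_snd.sub continuous_const).prodMk (continuous_const.prodMk continuous_fst))
  have htube : ∀ᶠ x in 𝓝 (p (wave t₀)), ∀ t ∈ Icc (0 : ℝ) 1, Φ (t - t₀) t₀ x ∈ O := by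
    refine isCompact_Icc.eventually_forall_of_forall_eventually fun t _ => ?_
    refine hcont.continuousAt.eventually (hO.mem_nhds ?_)
    change Φ (t - t₀) t₀ (p (wave t₀)) ∈ O
    rw [h.eq_integralCurve hp (fun t ht => hχ _ (hpO t ht))]
    exact hpO _ (wave_mem t)
  filter_upwards [htube] with x hx
  exact ⟨h.isIntegralCurve hX fun t ht => hχ _ (hx t ht), hx⟩

/-- Integral curves exist near a given integral curve. -/
theorem IsIntegralCurve.eventually_exists [FiniteDimensional ℝ E] [T2Space N]
    [SecondCountableTopology N] {F : VFModule E N} {X : ℝ → VF E N}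
    (hX : F.IsPlotOn (Icc 0 1) X) {p : ℝ → N} (hp : IsIntegralCurve X p 1) {O : Set N}
    (hO : IsOpen O) (hpO : ∀ t ∈ Icc (0 : ℝ) 1, p t ∈ O) {t₀ : ℝ} (ht₀ : t₀ ∈ Icc (0 : ℝ) 1) :
    ∀ᶠ x in 𝓝 (p t₀), ∃ γ, IsIntegralCurve X γ 1 ∧ γ t₀ = x ∧ ∀ t ∈ Icc (0 : ℝ) 1, γ t ∈ O := by
  have hpc : ContinuousOn p (Icc 0 1) := fun t ht => (hp t ht).continuousWithinAt
  obtain ⟨χ, O', g1, g2, g3, g4, g5, g6⟩ := exists_cutoff (E := E)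
    (isCompact_Icc.image_of_continuousOn hpc) hO (image_subset_iff.2 hpO)
  obtain ⟨Φ, hΦ⟩ := exists_isFlowOf hX.hat (1 : ℝ) g1 g5
  have := (hΦ.eventually_isIntegralCurve hX (g2.inter hO) (fun x hx => g4 x hx.1) hp
    (fun t ht => ⟨g3 ⟨t, ht, rfl⟩, hpO t ht⟩) (waveInv t₀))
  rw [wave_waveInv ht₀] at this
  filter_upwards [this] with x hx
  exact ⟨_, hx.1, by simp [hΦ.zero], fun t _ => (hx.2 _ (waveInv_mem t)).2⟩

/-- A two-parameter field, reparametrized by the plane. -/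
def hatTwo (X : ℝ → ℝ → VF E N) (z : ℝ × ℝ) : VF E N := hat (fun t => X t (wave z.2)) z.1

theorem VFModule.IsPlotOn.hatTwo {F : VFModule E N} {X : ℝ → ℝ → VF E N}
    (hX : F.IsPlotOn (Icc (0 : ℝ) 1 ×ˢ Icc (0 : ℝ) 1) (fun z : ℝ × ℝ => X z.1 z.2)) :
    F.IsPlotOn univ (hatTwo X) :=
  (hX.comp (g := fun z : ℝ × ℝ => (wave z.1, wave z.2))
    ((contDiff_wave.comp contDiff_fst).prodMk (contDiff_wave.comp contDiff_snd)).contDiffOn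
      fun z _ => ⟨wave_mem _, wave_mem _⟩).smul
    (contDiff_deriv_wave.comp contDiff_fst).contDiffOn

theorem VFModule.IsPlotOn.slice {F : VFModule E N} {X : ℝ → ℝ → VF E N}
    (hX : F.IsPlotOn (Icc (0 : ℝ) 1 ×ˢ Icc (0 : ℝ) 1) (fun z : ℝ × ℝ => X z.1 z.2)) {s : ℝ}
    (hs : s ∈ Icc (0 : ℝ) 1) : F.IsPlotOn (Icc 0 1) (fun t => X t s) :=
  hX.comp (g := fun t => (t, s)) (contDiff_id.prodMk contDiff_const).contDiffOn
    fun _ ht => ⟨ht, hs⟩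

theorem IsFlowOf.slice {X : ℝ → ℝ → VF E N} {χ : N → ℝ} {Φ : ℝ → ℝ × ℝ → N → N}
    (h : IsFlowOf ((1, 0) : ℝ × ℝ) (cut χ (hatTwo X)) Φ) (σ : ℝ) :
    IsFlowOf (1 : ℝ) (cut χ (hat fun t => X t (wave σ))) (fun t τ x => Φ t (τ, σ) x) where
  field_smooth := by
    have h1 : ContMDiff (𝓘(ℝ, ℝ).prod 𝓘(ℝ, E)) (𝓘(ℝ, ℝ × ℝ).prod 𝓘(ℝ, E)) ∞
        (fun z : ℝ × N => ((z.1, σ), z.2)) :=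
      ((contDiff_id.prodMk contDiff_const).contMDiff.comp contMDiff_fst).prodMk contMDiff_snd
    exact h.field_smooth.comp h1
  smooth := by
    have h1 : ContMDiff (𝓘(ℝ, ℝ).prod (𝓘(ℝ, ℝ).prod 𝓘(ℝ, E)))
        (𝓘(ℝ, ℝ).prod (𝓘(ℝ, ℝ × ℝ).prod 𝓘(ℝ, E))) ∞
        (fun z : ℝ × (ℝ × N) => (z.1, ((z.2.1, σ), z.2.2))) :=
      contMDiff_fst.prodMk (((contDiff_id.prodMk contDiff_const).contMDiff.comp
        (contMDiff_fst.comp contMDiff_snd)).prodMk (contMDiff_snd.comp contMDiff_snd))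
    exact h.smooth.comp h1
  zero τ x := h.zero _ x
  ode t τ x := by
    refine (h.ode t (τ, σ) x).congr_mfderiv ?_
    have h1 : ((τ, σ) : ℝ × ℝ) + t • ((1, 0) : ℝ × ℝ) = (τ + t • (1 : ℝ), σ) := by
      ext <;> simp
    rw [h1]
    rfl

theorem IsFlowOf.eventually_variation [T2Space N] {F : VFModule E N} {X : ℝ → ℝ → VF E N}
    (hX : F.IsPlotOn (Icc (0 : ℝ) 1 ×ˢ Icc (0 : ℝ) 1) (fun z : ℝ × ℝ => X z.1 z.2))
    {χ : N → ℝ} {Φ : ℝ → ℝ × ℝ → N → N} (h : IsFlowOf ((1, 0) : ℝ × ℝ) (cut χ (hatTwo X)) Φ)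
    {O : Set N} (hO : IsOpen O) (hχ : ∀ x ∈ O, χ x = 1) {p : ℝ → ℝ → N} {x₀ : N}
    (hp : ∀ s ∈ Icc (0 : ℝ) 1, IsIntegralCurve (fun t => X t s) (fun t => p t s) 1 ∧ p 0 s = x₀)
    (hpO : ∀ t ∈ Icc (0 : ℝ) 1, ∀ s ∈ Icc (0 : ℝ) 1, p t s ∈ O) :
    (∀ t σ, Φ t (0, σ) x₀ = p (wave t) (wave σ)) ∧
    ∀ᶠ x in 𝓝 x₀, ∀ σ ∈ Icc (0 : ℝ) 1,
      IsIntegralCurve (fun t => X t (wave σ)) (fun t => Φ (waveInv t) (0, σ) x) 1 := by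
  have hmid : ∀ t σ, Φ t (0, σ) x₀ = p (wave t) (wave σ) := by
    intro t σ
    have h1 := (h.slice σ).eq_integralCurve (hp _ (wave_mem σ)).1
      (fun t ht => hχ _ (hpO t ht _ (wave_mem σ))) 0 t
    simpa [(hp _ (wave_mem σ)).2] using h1
  refine ⟨hmid, ?_⟩
  have hcont : Continuous fun z : N × (ℝ × ℝ) => Φ z.2.1 (0, z.2.2) z.1 :=
    h.smooth.continuous.comp ((continuous_fst.comp continuous_snd).prodMk
      ((continuous_const.prodMk (continuous_snd.comp continuous_snd)).prodMk continuous_fst))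
  have htube : ∀ᶠ x in 𝓝 x₀, ∀ z ∈ Icc (0 : ℝ) 1 ×ˢ Icc (0 : ℝ) 1, Φ z.1 (0, z.2) x ∈ O := by
    refine (isCompact_Icc.prod isCompact_Icc).eventually_forall_of_forall_eventually fun z _ => ?_
    refine hcont.continuousAt.eventually (hO.mem_nhds ?_)
    change Φ z.1 (0, z.2) x₀ ∈ O
    rw [hmid]
    exact hpO _ (wave_mem _) _ (wave_mem _)
  filter_upwards [htube] with x hx σ hσ
  have := (h.slice σ).isIntegralCurve (hX.slice (wave_mem σ)) (t₀ := 0) (x := x) fun t ht => by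
    simpa using hχ _ (hx (t, σ) ⟨ht, hσ⟩)
  simpa using this

end CutFlow

section Homotopy

variable {E : Type*} [NormedAddCommGroup E] [NormedSpace ℝ E]
  {M : Type*} [TopologicalSpace M] [ChartedSpace E M] [IsManifold 𝓘(ℝ, E) ∞ M]
  {F : SingularFoliation E M}

/-- The velocity at `s` of a curve defined on `[0, 1]`. -/
def velIcc (f : ℝ → M) (s : ℝ) : E :=
  (mfderivWithin 𝓘(ℝ, ℝ) 𝓘(ℝ, E) f (Icc (0 : ℝ) 1) s (1 : ℝ) : E)

theorem velIcc_congr {f g : ℝ → M} {s : ℝ} (h : f =ᶠ[𝓝[Icc (0 : ℝ) 1] s] g)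
    (hs : s ∈ Icc (0 : ℝ) 1) : velIcc (E := E) f s = velIcc g s := by
  have h1 : (mfderivWithin 𝓘(ℝ, ℝ) 𝓘(ℝ, E) f (Icc (0 : ℝ) 1) s : ℝ →L[ℝ] E) =
    mfderivWithin 𝓘(ℝ, ℝ) 𝓘(ℝ, E) g (Icc (0 : ℝ) 1) s := h.mfderivWithin_eq (h.self_of_nhdsWithin hs)
  exact DFunLike.congr_fun h1 (1 : ℝ)

theorem velIcc_eq {f : ℝ → M} {s : ℝ} (hs : s ∈ Icc (0 : ℝ) 1) {w : E}
    (h : HasMFDerivWithinAt 𝓘(ℝ, ℝ) 𝓘(ℝ, E) f (Icc 0 1) s ((1 : ℝ →L[ℝ] ℝ).smulRight w)) :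
    velIcc (E := E) f s = w := by
  have h1 := h.mfderivWithin
    ((uniqueDiffOn_Icc (zero_lt_one (α := ℝ)) s hs).uniqueMDiffWithinAt)
  exact (DFunLike.congr_fun h1 (1 : ℝ)).trans (one_smul ℝ w)

theorem complement_eq [T2Space M] {X : ℝ → ℝ → VF E M} {s : ℝ} (hs : s ∈ Icc (0 : ℝ) 1)
    (hX : F.IsPlotOn (Icc (0 : ℝ) 1 ×ˢ Icc (0 : ℝ) 1) (fun z : ℝ × ℝ => X z.1 z.2)) {x : M}
    {f : ℝ → M} (hf : ∀ᶠ u in 𝓝[Icc (0 : ℝ) 1] s, FlowsTo (fun τ => X τ u) 1 x (f u)) :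
    vfVal (complement X 1 s) (f s) = velIcc f s := by
  have h1 : FlowsTo (fun τ => X τ s) 1 x (f s) := hf.self_of_nhdsWithin hs
  have h : ∃ x, FlowsTo (fun τ => X τ s) 1 x (f s) := ⟨x, h1⟩
  have h2 : h.choose = x := h.choose_spec.unique_left (hX.slice hs) h1
  have h3 : vfVal (complement X 1 s) (f s) = velIcc (fun u => flow (fun τ => X τ u) 1 h.choose) s := by
    exact dif_pos h
  rw [h3, h2]
  refine velIcc_congr ?_ hs
  filter_upwards [hf, self_mem_nhdsWithin] with u hu hu'
  exact hu.flow_eq (hX.slice hu')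

theorem IsIntegralCurve.congr {X X' : ℝ → VF E M} {γ : ℝ → M} (h : IsIntegralCurve X γ 1)
    (e : ∀ t ∈ Icc (0 : ℝ) 1, X t = X' t) : IsIntegralCurve X' γ 1 := fun t ht => by
  rw [← e t ht]
  exact h t ht

theorem FlowsTo.congr {X X' : ℝ → VF E M} {x y : M} (h : FlowsTo X 1 x y)
    (e : ∀ t ∈ Icc (0 : ℝ) 1, X t = X' t) : FlowsTo X' 1 x y := by
  obtain ⟨γ, h1, h2, h3⟩ := h
  exact ⟨γ, h1.congr e, h2, h3⟩

theorem IsIntegralCurve.reparam {X : ℝ → VF E M} {γ : ℝ → M} (h : IsIntegralCurve X γ 1)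
    {ψ : ℝ → ℝ} (hψ : Differentiable ℝ ψ) (hm : MapsTo ψ (Icc 0 1) (Icc 0 1)) :
    IsIntegralCurve (fun t => deriv ψ t • X (ψ t)) (fun t => γ (ψ t)) 1 := by
  intro t ht
  have h3 := (h (ψ t) (hm ht)).comp t
    (hψ t).hasDerivAt.hasFDerivAt.hasMFDerivAt.hasMFDerivWithinAt (s := Icc 0 1) hm
  refine h3.congr_mfderiv (ContinuousLinearMap.ext fun (a : ℝ) => ?_)
  exact (smul_smul a (deriv ψ t) (X (ψ t) (γ (ψ t)))).symm

theorem IsIntegralCurve.flowsTo_reparam {X : ℝ → VF E M} {γ : ℝ → M} (h : IsIntegralCurve X γ 1)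
    {ψ : ℝ → ℝ} (hψ : Differentiable ℝ ψ) (hm : MapsTo ψ (Icc 0 1) (Icc 0 1)) :
    FlowsTo (fun t => deriv ψ t • X (ψ t)) 1 (γ (ψ 0)) (γ (ψ 1)) :=
  ⟨_, h.reparam hψ hm, rfl, rfl⟩

/-! ### Variations -/

theorem ContMDiffOn.continuousOn_slice {p : ℝ → ℝ → M}
    (h : ContMDiffOn 𝓘(ℝ, ℝ × ℝ) 𝓘(ℝ, E) ∞ (fun z : ℝ × ℝ => p z.1 z.2)
      (Icc (0 : ℝ) 1 ×ˢ Icc (0 : ℝ) 1)) {t : ℝ} (ht : t ∈ Icc (0 : ℝ) 1) :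
    ContMDiffOn 𝓘(ℝ, ℝ) 𝓘(ℝ, E) ∞ (fun s => p t s) (Icc 0 1) :=
  h.comp (f := fun s => (t, s)) (contDiff_const.prodMk contDiff_id).contMDiff.contMDiffOn
    fun _ hs => ⟨ht, hs⟩

theorem VFModule.IdealSec.eq_zero {G : VFModule E M} {x : M} {V : Opens M} {X : VF E M}
    (h : G.IdealSec x V X) (hx : x ∈ V) : X x = 0 := by
  obtain ⟨n, f, A, h1, h2⟩ := h
  rw [h2 x hx]
  exact Finset.sum_eq_zero fun i _ => by rw [(h1 i).2.1, zero_smul]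

theorem IsVariation.target_eq [T2Space M] {X : ℝ → ℝ → VF E M} {p : ℝ → ℝ → M}
    (h : IsVariation F X p) (hc : ∀ s ∈ Icc (0 : ℝ) 1, vfVal (complement X 1 s) (p 1 s) = 0) :
    ∀ s ∈ Icc (0 : ℝ) 1, p 1 s = p 1 0 := by
  have hd : IsIntegralCurve (0 : ℝ → VF E M) (fun s => p 1 s) 1 := by
    intro s hs
    have h1 := complement_eq hs h.plot (x := p 0 0) (f := fun u => p 1 u) (by
      filter_upwards [self_mem_nhdsWithin] with u hu
      exact ⟨fun t => p t u, h.integral u hu, h.base u hu, rfl⟩)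
    rw [hc s hs] at h1
    have h2 := ((ContMDiffOn.continuousOn_slice h.smooth (t := 1) (by simp)).mdifferentiableOn
      (by simp) s hs).hasMFDerivWithinAt
    refine h2.congr_mfderiv (ContinuousLinearMap.ext fun (a : ℝ) => ?_)
    have h3 : (mfderivWithin 𝓘(ℝ, ℝ) 𝓘(ℝ, E) (fun s => p 1 s) (Icc (0 : ℝ) 1) s : ℝ →L[ℝ] E) a =
        a • velIcc (E := E) (fun s => p 1 s) s := by
      have h4 := map_smul (mfderivWithin 𝓘(ℝ, ℝ) 𝓘(ℝ, E) (fun s => p 1 s) (Icc (0 : ℝ) 1) s :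
        ℝ →L[ℝ] E) a (1 : ℝ)
      rwa [smul_eq_mul, mul_one] at h4
    rw [← h1] at h3
    exact h3
  have hz : F.IsPlotOn (Icc 0 1) (0 : ℝ → VF E M) :=
    ⟨fun u _ => F.zero ⊤, fun u _ x => ⟨univ, ⊤, isOpen_univ, trivial, trivial, 0, Fin.elim0,
      Fin.elim0, fun i => i.elim0, fun i => i.elim0, fun _ _ _ _ => by simp⟩⟩
  have hc' : IsIntegralCurve (0 : ℝ → VF E M) (fun _ => p 1 0) 1 := fun s _ =>
    (hasMFDerivAt_const_zero rfl s).hasMFDerivWithinAt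
  exact fun s hs => hd.eqOn hz hc' (t₀ := 0) (by simp) rfl hs

theorem FHomotopic.source_eq {P₀ P₁ : FPath F} (h : FHomotopic P₀ P₁) : P₀.p 0 = P₁.p 0 := by
  obtain ⟨X, p, h1, h2, h3, -⟩ := h
  rw [← (h2 0 (by simp)).2, ← (h3 0 (by simp)).2, h1.base 1 (by simp)]

theorem FHomotopic.target_eq [T2Space M] {P₀ P₁ : FPath F} (h : FHomotopic P₀ P₁) :
    P₀.p 1 = P₁.p 1 := by
  obtain ⟨X, p, h1, h2, h3, h4⟩ := h
  rw [← (h2 1 (by simp)).2, ← (h3 1 (by simp)).2]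
  refine (h1.target_eq (fun s hs => ?_) 1 (by simp)).symm
  obtain ⟨V, hV, h5⟩ := h4 s hs
  exact h5.eq_zero hV

section Reparametrization

/-- The family of reparametrizations of a time-dependent field. -/
def reparamX (X : ℝ → VF E M) (ψ : ℝ → ℝ → ℝ) (t s : ℝ) : VF E M :=
  deriv (fun τ => ψ τ s) t • X (ψ t s)

theorem differentiable_left {ψ : ℝ → ℝ → ℝ} (hψ : ContDiff ℝ ∞ (fun z : ℝ × ℝ => ψ z.1 z.2)) (s : ℝ) : Differentiable ℝ (fun t => ψ t s) :=
  (hψ.comp (contDiff_id.prodMk contDiff_const)).differentiable (by simp)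

theorem differentiable_right {ψ : ℝ → ℝ → ℝ} (hψ : ContDiff ℝ ∞ (fun z : ℝ × ℝ => ψ z.1 z.2)) (t : ℝ) : Differentiable ℝ (fun s => ψ t s) :=
  (hψ.comp (contDiff_const.prodMk contDiff_id)).differentiable (by simp)

theorem contDiff_deriv_left {ψ : ℝ → ℝ → ℝ} (hψ : ContDiff ℝ ∞ (fun z : ℝ × ℝ => ψ z.1 z.2)) : ContDiff ℝ ∞ (fun z : ℝ × ℝ => deriv (fun τ => ψ τ z.2) z.1) := by
  have h1 : (fun z : ℝ × ℝ => deriv (fun τ => ψ τ z.2) z.1) =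
      fun z => fderiv ℝ (fun z : ℝ × ℝ => ψ z.1 z.2) z (1, 0) := by
    funext z
    have h2 := ((hψ.differentiable (by simp)) z).hasFDerivAt.comp_hasDerivAt z.1
      (f := fun τ : ℝ => (τ, z.2)) ((hasDerivAt_id z.1).prodMk (hasDerivAt_const z.1 z.2))
    exact h2.deriv
  rw [h1]
  exact (hψ.fderiv_right (m := ∞) (by simp)).clm_apply contDiff_const

theorem isPlotOn_reparamX {ψ : ℝ → ℝ → ℝ} (hψ : ContDiff ℝ ∞ (fun z : ℝ × ℝ => ψ z.1 z.2))
    (hm : ∀ t ∈ Icc (0 : ℝ) 1, ∀ s ∈ Icc (0 : ℝ) 1, ψ t s ∈ Icc (0 : ℝ) 1) {X : ℝ → VF E M} (hX : F.IsPlotOn (Icc 0 1) X) :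
    F.IsPlotOn (Icc (0 : ℝ) 1 ×ˢ Icc (0 : ℝ) 1) (fun z : ℝ × ℝ => reparamX X ψ z.1 z.2) :=
  (hX.comp (g := fun z : ℝ × ℝ => ψ z.1 z.2) hψ.contDiffOn fun z hz => hm _ hz.1 _ hz.2).smul
    (contDiff_deriv_left hψ).contDiffOn

theorem isVariation_reparamX {ψ : ℝ → ℝ → ℝ} (hψ : ContDiff ℝ ∞ (fun z : ℝ × ℝ => ψ z.1 z.2))
    (hm : ∀ t ∈ Icc (0 : ℝ) 1, ∀ s ∈ Icc (0 : ℝ) 1, ψ t s ∈ Icc (0 : ℝ) 1) (h0 : ∀ s, ψ 0 s = ψ 0 0) (P : FPath F) :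
    IsVariation F (reparamX P.X ψ) (fun t s => P.p (ψ t s)) where
  plot := isPlotOn_reparamX hψ hm P.plot
  smooth := P.smooth.comp (f := fun z : ℝ × ℝ => ψ z.1 z.2) hψ.contMDiff.contMDiffOn
    fun z hz => hm _ hz.1 _ hz.2
  integral s hs := P.integral.reparam (differentiable_left hψ s) fun t ht => hm t ht s hs
  base s _ := by rw [h0]

theorem complement_reparamX {ψ : ℝ → ℝ → ℝ} (hψ : ContDiff ℝ ∞ (fun z : ℝ × ℝ => ψ z.1 z.2))
    (hm : ∀ t ∈ Icc (0 : ℝ) 1, ∀ s ∈ Icc (0 : ℝ) 1, ψ t s ∈ Icc (0 : ℝ) 1) (h0 : ∀ s, ψ 0 s = ψ 0 0) [FiniteDimensional ℝ E] [T2Space M] [SecondCountableTopology M]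
    {X : ℝ → VF E M} (hX : F.IsPlotOn (Icc 0 1) X) {p : ℝ → M} (hp : IsIntegralCurve X p 1)
    {s : ℝ} (hs : s ∈ Icc (0 : ℝ) 1) :
    ∀ᶠ w in 𝓝 (p (ψ 1 s)), vfVal (complement (reparamX X ψ) 1 s) w =
      deriv (fun u => ψ 1 u) s • vfVal (X (ψ 1 s)) w := by
  have h1 : (1 : ℝ) ∈ Icc (0 : ℝ) 1 := by simp
  filter_upwards [hp.eventually_exists hX isOpen_univ (fun _ _ => mem_univ _) (hm 1 h1 s hs)]
    with w hw
  obtain ⟨γ, hγ, hw, -⟩ := hw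
  have h2 := complement_eq (F := F) hs (isPlotOn_reparamX hψ hm hX) (x := γ (ψ 0 0))
    (f := fun u => γ (ψ 1 u)) (by
      filter_upwards [self_mem_nhdsWithin] with u hu
      rw [← h0 u]
      exact hγ.flowsTo_reparam (differentiable_left hψ u) fun t ht => hm t ht u hu)
  simp only [hw] at h2
  rw [h2]
  have h3 := hγ.reparam (differentiable_right hψ 1) (fun u hu => hm 1 h1 u hu) s hs
  have h4 := velIcc_eq (w := deriv (fun u => ψ 1 u) s • vfVal (X (ψ 1 s)) (γ (ψ 1 s))) hs h3
  rw [h4, hw]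

end Reparametrization

end Homotopy

section Push

variable {E : Type*} [NormedAddCommGroup E] [NormedSpace ℝ E]
  {M : Type*} [TopologicalSpace M] [ChartedSpace E M] [IsManifold 𝓘(ℝ, E) ∞ M]
  {P : Type*} [NormedAddCommGroup P] [NormedSpace ℝ P]
  {F : SingularFoliation E M}

/-- The derivative of a map between manifolds, as a map on the model spaces. -/
def mder {E' : Type*} [NormedAddCommGroup E'] [NormedSpace ℝ E']
    {N : Type*} [TopologicalSpace N] [ChartedSpace E' N] (φ : M → N) (x : M) : E →L[ℝ] E' :=
  mfderiv 𝓘(ℝ, E) 𝓘(ℝ, E') φ x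

theorem FlowData.mder_comb {K : Set M} {e : P} {X : P → VF E M} (D : FlowData F K e X) (t : ℝ)
    (p : P) (x : M) (ξ : Fin D.n → ℝ) :
    mder (E' := E) (D.Φ t p) x (combVF D.G ξ x) =
      combVF D.G (D.R t p x (ξ, 0)) (D.Φ t p x) := by
  have h0 : ContMDiff (𝓘(ℝ, P).prod 𝓘(ℝ, E)) 𝓘(ℝ, E) ∞ (fun z : P × M => D.Φ t z.1 z.2) :=
    D.Φ_smooth.comp (contMDiff_const.prodMk contMDiff_id)
  have h1 : MDifferentiableAt (𝓘(ℝ, P).prod 𝓘(ℝ, E)) 𝓘(ℝ, E) (fun z : P × M => D.Φ t z.1 z.2)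
    (p, x) := h0.mdifferentiableAt (by simp)
  have h2 : MDifferentiableAt 𝓘(ℝ, E) (𝓘(ℝ, P).prod 𝓘(ℝ, E)) (fun y : M => (p, y)) x :=
    (contMDiff_const.prodMk contMDiff_id : ContMDiff 𝓘(ℝ, E) (𝓘(ℝ, P).prod 𝓘(ℝ, E)) ∞
      (fun y : M => (p, y))).mdifferentiableAt (by simp)
  have h3 := mfderiv_comp x h1 h2
  have h4 : (mfderiv 𝓘(ℝ, E) (𝓘(ℝ, P).prod 𝓘(ℝ, E)) (fun y : M => (p, y)) x : E →L[ℝ] P × E) =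
      ContinuousLinearMap.inr ℝ P E := mfderiv_prod_right
  have h5 := D.Φ_push t p x (ξ, 0)
  refine Eq.trans ?_ h5
  refine (DFunLike.congr_fun h3 (combVF D.G ξ x)).trans ?_
  exact congrArg (mfderiv (𝓘(ℝ, P).prod 𝓘(ℝ, E)) 𝓘(ℝ, E) (fun z : P × M => D.Φ t z.1 z.2) (p, x) :
    P × E →L[ℝ] E) (DFunLike.congr_fun h4 (combVF D.G ξ x))

theorem IsFlowOf.contMDiff {e : P} {Y : P → VF E M} {Φ : ℝ → P → M → M} (h : IsFlowOf e Y Φ)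
    (t : ℝ) (p : P) : ContMDiff 𝓘(ℝ, E) 𝓘(ℝ, E) ∞ (Φ t p) :=
  h.smooth.comp (contMDiff_const.prodMk (contMDiff_const.prodMk contMDiff_id))

/-- Velocities are mapped by the derivative of a diffeomorphism, even at the times where they do not
exist. -/
theorem velIcc_comp {φ φ' : M → M} (hφ : ContMDiff 𝓘(ℝ, E) 𝓘(ℝ, E) ∞ φ)
    (hφ' : ContMDiff 𝓘(ℝ, E) 𝓘(ℝ, E) ∞ φ') (hinv : ∀ x, φ' (φ x) = x) (f : ℝ → M) {s : ℝ}
    (hs : s ∈ Icc (0 : ℝ) 1) :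
    velIcc (E := E) (fun u => φ (f u)) s = mder (E' := E) φ (f s) (velIcc (E := E) f s) := by
  have hu : UniqueMDiffWithinAt 𝓘(ℝ, ℝ) (Icc (0 : ℝ) 1) s :=
    (uniqueDiffOn_Icc (zero_lt_one (α := ℝ)) s hs).uniqueMDiffWithinAt
  by_cases hf : MDifferentiableWithinAt 𝓘(ℝ, ℝ) 𝓘(ℝ, E) f (Icc 0 1) s
  · have h1 := mfderiv_comp_mfderivWithin s (hφ.mdifferentiableAt (by simp) (x := f s)) hf hu
    exact DFunLike.congr_fun h1 (1 : ℝ)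
  · have hf' : ¬ MDifferentiableWithinAt 𝓘(ℝ, ℝ) 𝓘(ℝ, E) (fun u => φ (f u)) (Icc 0 1) s := by
      intro h
      have h2 := (hφ'.mdifferentiableAt (by simp) (x := φ (f s))).comp_mdifferentiableWithinAt s h
      exact hf (h2.congr (fun u _ => (hinv (f u)).symm) (hinv (f s)).symm)
    have h1 : velIcc (E := E) f s = 0 :=
      DFunLike.congr_fun (mfderivWithin_zero_of_not_mdifferentiableWithinAt hf) (1 : ℝ)
    have h2 : velIcc (E := E) (fun u => φ (f u)) s = 0 :=
      DFunLike.congr_fun (mfderivWithin_zero_of_not_mdifferentiableWithinAt hf') (1 : ℝ)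
    rw [h1, h2, map_zero]

theorem VFModule.IdealSec.exists_comb {F : VFModule E M} {n : ℕ} {G : Fin n → VF E M} {x : M}
    {V : Opens M} {Y : VF E M} (h : F.IdealSec x V Y) (hx : x ∈ V) (hG : F.GeneratesAt G x) :
    ∃ V' : Opens M, x ∈ V' ∧ V' ≤ V ∧ ∃ g : Fin n → M → ℝ,
      (∀ i, ContMDiffOn 𝓘(ℝ, E) 𝓘(ℝ, ℝ) ∞ (g i) V' ∧ g i x = 0) ∧
      ∀ y ∈ V', vfVal Y y = combVF G (fun i => g i y) y := by
  obtain ⟨m, f, A, h1, h2⟩ := h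
  choose V' hxV' hV' c hc hA using fun j => hG V hx (A j) (h1 j).2.2
  refine ⟨⟨V ∩ ⋂ j, (V' j : Set M), V.isOpen.inter (isOpen_iInter_of_finite fun j => (V' j).isOpen)⟩,
    ⟨hx, mem_iInter.2 hxV'⟩, fun y hy => hy.1, fun i y => ∑ j, f j y * c j i y,
    fun i => ⟨?_, ?_⟩, fun y hy => ?_⟩
  · refine contMDiffOn_finsetSum fun j _ => ContMDiffOn.mul ?_ ?_
    · exact (h1 j).1.mono inter_subset_left
    · exact (hc j i).mono fun z hz => mem_iInter.1 hz.2 j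
  · simp [(h1 _).2.1]
  · have h3 : vfVal Y y = ∑ j, f j y • vfVal (A j) y := h2 y hy.1
    have h4 : ∀ j, vfVal (A j) y = ∑ i, c j i y • vfVal (G i) y := fun j =>
      hA j y (mem_iInter.1 hy.2 j)
    rw [h3]
    simp only [h4, combVF, Finset.smul_sum, Finset.sum_smul, mul_smul]
    rw [Finset.sum_comm]

theorem VFModule.idealSec_of_comb {F : VFModule E M} {n : ℕ} {G : Fin n → VF E M} {x : M}
    {V : Opens M} {Y : VF E M} (hG : ∀ i, F.Sec ⊤ (G i)) {g : Fin n → M → ℝ}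
    (hg : ∀ i, ContMDiffOn 𝓘(ℝ, E) 𝓘(ℝ, ℝ) ∞ (g i) V ∧ g i x = 0)
    (h : ∀ y ∈ V, vfVal Y y = combVF G (fun i => g i y) y) : F.IdealSec x V Y :=
  ⟨n, g, G, fun i => ⟨(hg i).1, (hg i).2, F.restrict le_top (hG i)⟩, h⟩

/-- The ideal condition is local at the point. -/
theorem VFModule.IdealSec.congr_eventually {F : VFModule E M} {x : M} {V : Opens M} {Y Y' : VF E M}
    (h : F.IdealSec x V Y) (hx : x ∈ V) (e : ∀ᶠ y in 𝓝 x, vfVal Y' y = vfVal Y y) :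
    ∃ V' : Opens M, x ∈ V' ∧ F.IdealSec x V' Y' := by
  obtain ⟨O, hO, hO', hxO⟩ := eventually_nhds_iff.1 e
  obtain ⟨n, f, A, h1, h2⟩ := h
  refine ⟨V ⊓ ⟨O, hO'⟩, ⟨hx, hxO⟩, n, f, A, fun i => ⟨(h1 i).1.mono inter_subset_left, (h1 i).2.1,
    F.restrict inf_le_left (h1 i).2.2⟩, fun y hy => ?_⟩
  exact (hO y hy.2).trans (h2 y hy.1)

theorem VFModule.idealSec_zero (F : VFModule E M) (x : M) (V : Opens M) : F.IdealSec x V 0 :=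
  ⟨0, Fin.elim0, Fin.elim0, fun i => i.elim0, fun _ _ => by simp⟩

theorem VFModule.IdealSec.smul {F : VFModule E M} {x : M} {V : Opens M} {Y : VF E M}
    (h : F.IdealSec x V Y) {a : M → ℝ} (ha : ContMDiffOn 𝓘(ℝ, E) 𝓘(ℝ, ℝ) ∞ a V) :
    F.IdealSec x V (fun y => a y • Y y) := by
  obtain ⟨n, f, A, h1, h2⟩ := h
  refine ⟨n, fun i y => a y * f i y, A, fun i => ⟨ha.mul (h1 i).1, by simp [(h1 i).2.1],
    (h1 i).2.2⟩, fun y hy => ?_⟩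
  simp only [h2 y hy, Finset.smul_sum, mul_smul]

/-- A global section which is in the ideal near the point is in the ideal. -/
theorem VFModule.IdealSec.of_local [FiniteDimensional ℝ E] [T2Space M] {F : VFModule E M} {x : M}
    {V : Opens M} {Y : VF E M} (h : F.IdealSec x V Y) (hx : x ∈ V) (hY : F.Sec ⊤ Y) :
    F.IdealSec x ⊤ Y := by
  obtain ⟨n, f, A, h1, h2⟩ := h
  obtain ⟨ρ, r1, -, r3, O, r4, -, r6⟩ := exists_bump (E := E) (V.isOpen.mem_nhds hx)
  have hloc : ∀ i, ContMDiff 𝓘(ℝ, E) 𝓘(ℝ, ℝ) ∞ (fun y => ρ y * f i y) := by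
    intro i y
    by_cases hy : y ∈ V
    · exact r1.contMDiffAt.mul (((h1 i).1 y hy).contMDiffAt (V.isOpen.mem_nhds hy))
    · refine (contMDiffAt_const (c := (0 : ℝ))).congr_of_eventuallyEq ?_
      filter_upwards [(isClosed_tsupport ρ).isOpen_compl.mem_nhds fun h => hy (r3 h)] with z hz
      rw [image_eq_zero_of_notMem_tsupport hz, zero_mul]
  refine ⟨n + 1, Fin.cons (fun y => 1 - ρ y * ρ y) (fun i y => ρ y * f i y),
    Fin.cons Y (fun i y => ρ y • A i y), fun i => ?_, fun y _ => ?_⟩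
  · refine Fin.cases ⟨?_, ?_, ?_⟩ (fun i => ⟨?_, ?_, ?_⟩) i
    · exact (contMDiff_const.sub (r1.mul r1)).contMDiffOn
    · simp [r6 x r4]
    · exact hY
    · exact (hloc i).contMDiffOn
    · simp [(h1 i).2.1]
    · exact F.sec_top_of_tsupport (h1 i).2.2 r1 r3
  · rw [Fin.sum_univ_succ]
    simp only [Fin.cons_zero, Fin.cons_succ, smul_smul]
    by_cases hy : y ∈ V
    · have h3 : ∑ i, (ρ y * f i y * ρ y) • A i y = (ρ y * ρ y) • Y y := by
        rw [h2 y hy, Finset.smul_sum]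
        refine Finset.sum_congr rfl fun i _ => ?_
        rw [smul_smul]
        congr 1
        ring
      rw [h3, ← add_smul]
      simp
    · have h3 : ρ y = 0 := image_eq_zero_of_notMem_tsupport fun h => hy (r3 h)
      simp [h3]

/-- The push-forward of an element of the ideal by a foliated flow is in the ideal. -/
theorem FlowData.idealSec_push [T2Space M] {K : Set M} {e : P} {X : P → VF E M}
    (hX : F.IsPlotOn univ X) (D : FlowData F K e X) {t : ℝ} {p : P} {x : M} (hxO : x ∈ D.O)
    {V : Opens M} {Y Y' : VF E M} (h : F.IdealSec x V Y) (hx : x ∈ V)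
    (hY' : ∀ᶠ w in 𝓝 (D.Φ t p x), vfVal Y' w =
      mder (E' := E) (D.Φ t p) (D.Φ (-t) (p + t • e) w) (vfVal Y (D.Φ (-t) (p + t • e) w))) :
    ∃ V' : Opens M, D.Φ t p x ∈ V' ∧ F.IdealSec (D.Φ t p x) V' Y' := by
  have hflow := D.isFlowOf hX
  obtain ⟨V₁, h1, -, g, hg, hYg⟩ := h.exists_comb hx (D.gen_of_mem hxO)
  obtain ⟨O, hO, hO', hxO'⟩ := eventually_nhds_iff.1 hY'
  set φ' := D.Φ (-t) (p + t • e) with hφ'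
  have hφ's : ContMDiff 𝓘(ℝ, E) 𝓘(ℝ, E) ∞ φ' := hflow.contMDiff _ _
  have hinv : φ' (D.Φ t p x) = x := hflow.left_inv t p x
  refine ⟨⟨O ∩ φ' ⁻¹' V₁, hO'.inter (V₁.isOpen.preimage hφ's.continuous)⟩, ⟨hxO', ?_⟩, ?_⟩
  · change φ' (D.Φ t p x) ∈ V₁
    rwa [hinv]
  refine VFModule.idealSec_of_comb D.sec
    (g := fun k w => D.R t p (φ' w) (fun i => g i (φ' w), 0) k) (fun k => ⟨?_, ?_⟩) fun w hw => ?_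
  · have h2 : ContMDiffOn 𝓘(ℝ, E) 𝓘(ℝ, ((Fin D.n → ℝ) × P) →L[ℝ] (Fin D.n → ℝ)) ∞
        (fun w => D.R t p (φ' w)) (O ∩ φ' ⁻¹' V₁) :=
      (D.R_smooth.comp (contMDiff_const.prodMk (contMDiff_const.prodMk hφ's))).contMDiffOn
    have h3 : ContMDiffOn 𝓘(ℝ, E) 𝓘(ℝ, (Fin D.n → ℝ) × P) ∞
        (fun w => ((fun i => g i (φ' w), 0) : (Fin D.n → ℝ) × P)) (O ∩ φ' ⁻¹' V₁) := by
      refine ContMDiffOn.prodMk_space ?_ contMDiffOn_const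
      rw [contMDiffOn_pi_space]
      exact fun i => (hg i).1.comp hφ's.contMDiffOn fun w hw => hw.2
    exact contMDiffOn_pi_space.1 (h2.clm_apply h3) k
  · simp only [hinv]
    have : (((fun i => g i x), 0) : (Fin D.n → ℝ) × P) = 0 := by
      ext i
      · exact (hg i).2
      · rfl
    rw [this, map_zero]
    rfl
  · rw [hO w hw.1, hYg _ hw.2, D.mder_comb]
    have h4 : D.Φ t p (φ' w) = w := hflow.right_inv t p w
    rw [h4]

end Push

section Join

variable {E : Type*} [NormedAddCommGroup E] [NormedSpace ℝ E]
  {M : Type*} [TopologicalSpace M] [ChartedSpace E M] [IsManifold 𝓘(ℝ, E) ∞ M]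
  {F : SingularFoliation E M}

/-- The concatenation of two time-dependent fields (first `X`, then `Y`). -/
def joinX (r : Reparam) (Y X : ℝ → VF E M) (t : ℝ) : VF E M :=
  if t ≤ 1 / 2 then (2 * deriv r.toFun (2 * t)) • X (r.toFun (2 * t))
  else (2 * deriv r.toFun (2 * t - 1)) • Y (r.toFun (2 * t - 1))

/-- The concatenation of two curves. -/
def joinCurve (r : Reparam) (q p : ℝ → M) (t : ℝ) : M :=
  if t ≤ 1 / 2 then p (r.toFun (2 * t)) else q (r.toFun (2 * t - 1))

theorem joinX_eq_left {r : Reparam} {ε : ℝ} (d0 : ∀ t < ε, deriv r.toFun t = 0)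
    (d1 : ∀ t, 1 - ε < t → deriv r.toFun t = 0) (hε : 0 < ε) (Y X : ℝ → VF E M) {t : ℝ}
    (ht : t < 1 / 2 + ε / 2) :
    joinX r Y X t = (2 * deriv r.toFun (2 * t)) • X (r.toFun (2 * t)) := by
  rw [joinX]
  split_ifs with hc
  · rfl
  · rw [d0 _ (by linarith), d1 (2 * t) (by linarith)]
    simp

theorem joinX_eq_right {r : Reparam} (Y X : ℝ → VF E M) {t : ℝ} (ht : 1 / 2 < t) :
    joinX r Y X t = (2 * deriv r.toFun (2 * t - 1)) • Y (r.toFun (2 * t - 1)) :=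
  if_neg (not_le.2 ht)

theorem joinCurve_eq_left {r : Reparam} {ε : ℝ} (v0 : ∀ t ≤ ε, r.toFun t = 0)
    (v1 : ∀ t, 1 - ε ≤ t → r.toFun t = 1) (hε : 0 < ε) {q p : ℝ → M} (h : p 1 = q 0) {t : ℝ}
    (ht : t < 1 / 2 + ε / 2) : joinCurve r q p t = p (r.toFun (2 * t)) := by
  rw [joinCurve]
  split_ifs with hc
  · rfl
  · rw [v0 _ (by linarith), v1 (2 * t) (by linarith), h]

theorem joinCurve_eq_right {r : Reparam} (q p : ℝ → M) {t : ℝ} (ht : 1 / 2 < t) :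
    joinCurve r q p t = q (r.toFun (2 * t - 1)) :=
  if_neg (not_le.2 ht)

theorem Reparam.zero (r : Reparam) : r.toFun 0 = 0 := by
  obtain ⟨ε, hε, h0, -⟩ := r.const
  exact h0 0 hε.le

theorem Reparam.one (r : Reparam) : r.toFun 1 = 1 := by
  obtain ⟨ε, hε, -, h1⟩ := r.const
  exact h1 1 (by linarith)

theorem joinCurve_zero (r : Reparam) (q p : ℝ → M) : joinCurve r q p 0 = p 0 := by
  rw [joinCurve, if_pos (by norm_num), mul_zero, r.zero]

theorem joinCurve_one (r : Reparam) (q p : ℝ → M) : joinCurve r q p 1 = q 1 := by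
  rw [joinCurve, if_neg (by norm_num)]
  norm_num [r.one]

theorem Reparam.hasDerivAt_first (r : Reparam) (t : ℝ) :
    HasDerivAt (fun t => r.toFun (2 * t)) (2 * deriv r.toFun (2 * t)) t := by
  have := ((r.smooth.differentiable (by simp)) (2 * t)).hasDerivAt.comp t
    ((hasDerivAt_id t).const_mul 2)
  simpa [mul_comm, Function.comp_def] using this

theorem Reparam.hasDerivAt_second (r : Reparam) (t : ℝ) :
    HasDerivAt (fun t => r.toFun (2 * t - 1)) (2 * deriv r.toFun (2 * t - 1)) t := by
  have := ((r.smooth.differentiable (by simp)) (2 * t - 1)).hasDerivAt.comp t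
    (((hasDerivAt_id t).const_mul 2).sub_const 1)
  simpa [mul_comm, Function.comp_def] using this

theorem Reparam.contDiff_first (r : Reparam) : ContDiff ℝ ∞ (fun t => r.toFun (2 * t)) :=
  r.smooth.comp (contDiff_const.mul contDiff_id)

theorem Reparam.contDiff_second (r : Reparam) : ContDiff ℝ ∞ (fun t => r.toFun (2 * t - 1)) :=
  r.smooth.comp ((contDiff_const.mul contDiff_id).sub contDiff_const)

theorem IsIntegralCurve.join (r : Reparam) {Y X : ℝ → VF E M} {q p : ℝ → M}
    (hq : IsIntegralCurve Y q 1) (hp : IsIntegralCurve X p 1) (h : p 1 = q 0) :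
    IsIntegralCurve (joinX r Y X) (joinCurve r q p) 1 := by
  obtain ⟨ε, hε, d0, d1, v0, v1⟩ := r.deriv_zero
  intro t _
  by_cases ht : t < 1 / 2 + ε / 2
  · have h1 := hp.comp_hasMFDerivAt (r.hasDerivAt_first t) (fun τ => r.mem _)
    rw [joinX_eq_left d0 d1 hε Y X ht]
    rw [← joinCurve_eq_left v0 v1 hε h ht] at h1
    refine (h1.congr_of_eventuallyEq ?_).hasMFDerivWithinAt
    filter_upwards [Iio_mem_nhds ht] with τ hτ using joinCurve_eq_left v0 v1 hε h hτ
  · have ht' : 1 / 2 < t := by linarith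
    have h1 := hq.comp_hasMFDerivAt (r.hasDerivAt_second t) (fun τ => r.mem _)
    rw [joinX_eq_right Y X ht']
    rw [← joinCurve_eq_right (r := r) q p ht'] at h1
    refine (h1.congr_of_eventuallyEq ?_).hasMFDerivWithinAt
    filter_upwards [Ioi_mem_nhds ht'] with τ hτ using joinCurve_eq_right q p hτ

theorem FlowsTo.join (r : Reparam) {Y X : ℝ → VF E M} {x y z : M} (h : FlowsTo X 1 x y)
    (h' : FlowsTo Y 1 y z) : FlowsTo (joinX r Y X) 1 x z := by
  obtain ⟨p, hp, h0, h1⟩ := h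
  obtain ⟨q, hq, h2, h3⟩ := h'
  exact ⟨_, hq.join r hp (h1.trans h2.symm), by rw [joinCurve_zero, h0], by rw [joinCurve_one, h3]⟩

theorem IsVariation.join (r : Reparam) {X Y : ℝ → ℝ → VF E M} {p q : ℝ → ℝ → M}
    (hX : IsVariation F X p) (hY : IsVariation F Y q)
    (h : ∀ s ∈ Icc (0 : ℝ) 1, p 1 s = q 0 s) :
    IsVariation F (fun t s => joinX r (fun τ => Y τ s) (fun τ => X τ s) t)
      (fun t s => joinCurve r (fun τ => q τ s) (fun τ => p τ s) t) := by
  obtain ⟨ε, hε, d0, d1, v0, v1⟩ := r.deriv_zero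
  have hd : ContDiff ℝ ∞ (deriv r.toFun) := (contDiff_infty_iff_deriv.1 r.smooth).2
  have c1 : ContDiff ℝ ∞ (fun z : ℝ × ℝ => (r.toFun (2 * z.1), z.2)) :=
    (r.contDiff_first.comp contDiff_fst).prodMk contDiff_snd
  have c2 : ContDiff ℝ ∞ (fun z : ℝ × ℝ => (r.toFun (2 * z.1 - 1), z.2)) :=
    (r.contDiff_second.comp contDiff_fst).prodMk contDiff_snd
  have e1 : ContDiff ℝ ∞ (fun z : ℝ × ℝ => 2 * deriv r.toFun (2 * z.1)) :=
    contDiff_const.mul (hd.comp (contDiff_const.mul contDiff_fst))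
  have e2 : ContDiff ℝ ∞ (fun z : ℝ × ℝ => 2 * deriv r.toFun (2 * z.1 - 1)) :=
    contDiff_const.mul (hd.comp ((contDiff_const.mul contDiff_fst).sub contDiff_const))
  refine ⟨VFModule.IsPlotOn.of_local fun z _ => ?_, fun z hz => ?_, fun s hs => ?_, fun s hs => ?_⟩
  · by_cases ht : z.1 < 1 / 2 + ε / 2
    · refine ⟨{z | z.1 < 1 / 2 + ε / 2}, isOpen_lt continuous_fst continuous_const, ht, ?_⟩
      refine VFModule.IsPlotOn.congr ((hX.plot.comp (g := fun z : ℝ × ℝ => (r.toFun (2 * z.1), z.2))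
        c1.contDiffOn fun w hw => ⟨r.mem _, hw.1.2⟩).smul e1.contDiffOn) fun w hw => ?_
      exact (joinX_eq_left d0 d1 hε (fun τ => Y τ w.2) (fun τ => X τ w.2) hw.2).symm
    · refine ⟨{z | 1 / 2 < z.1}, isOpen_lt continuous_const continuous_fst, ?_, ?_⟩
      · change 1 / 2 < z.1
        linarith
      refine VFModule.IsPlotOn.congr ((hY.plot.comp
        (g := fun z : ℝ × ℝ => (r.toFun (2 * z.1 - 1), z.2))
        c2.contDiffOn fun w hw => ⟨r.mem _, hw.1.2⟩).smul e2.contDiffOn) fun w hw => ?_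
      exact (joinX_eq_right (r := r) (fun τ => Y τ w.2) (fun τ => X τ w.2) hw.2).symm
  · by_cases ht : z.1 < 1 / 2 + ε / 2
    · have h1 : ContMDiffOn 𝓘(ℝ, ℝ × ℝ) 𝓘(ℝ, E) ∞ (fun z : ℝ × ℝ => p (r.toFun (2 * z.1)) z.2)
          (Icc (0 : ℝ) 1 ×ˢ Icc (0 : ℝ) 1) :=
        hX.smooth.comp (f := fun z : ℝ × ℝ => (r.toFun (2 * z.1), z.2)) c1.contMDiff.contMDiffOn
          fun w hw => ⟨r.mem _, hw.2⟩
      refine (h1 z hz).congr_of_eventuallyEq_of_mem ?_ hz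
      filter_upwards [self_mem_nhdsWithin, mem_nhdsWithin_of_mem_nhds
        ((isOpen_lt continuous_fst continuous_const).mem_nhds ht)] with w hw hw'
      exact joinCurve_eq_left v0 v1 hε (h _ hw.2) hw'
    · have ht' : 1 / 2 < z.1 := by linarith
      have h1 : ContMDiffOn 𝓘(ℝ, ℝ × ℝ) 𝓘(ℝ, E) ∞ (fun z : ℝ × ℝ => q (r.toFun (2 * z.1 - 1)) z.2)
          (Icc (0 : ℝ) 1 ×ˢ Icc (0 : ℝ) 1) :=
        hY.smooth.comp (f := fun z : ℝ × ℝ => (r.toFun (2 * z.1 - 1), z.2)) c2.contMDiff.contMDiffOn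
          fun w hw => ⟨r.mem _, hw.2⟩
      refine (h1 z hz).congr_of_eventuallyEq_of_mem ?_ hz
      filter_upwards [mem_nhdsWithin_of_mem_nhds
        ((isOpen_lt continuous_const continuous_fst).mem_nhds ht')] with w hw'
      exact joinCurve_eq_right _ _ hw'
  · exact (hY.integral s hs).join r (hX.integral s hs) (h s hs)
  · simp only [joinCurve_zero]
    exact hX.base s hs

theorem FPath.isVariation (Q : FPath F) : IsVariation F (fun t _ => Q.X t) (fun t _ => Q.p t) where
  plot := Q.plot.comp contDiff_fst.contDiffOn fun _ hz => hz.1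
  smooth := Q.smooth.comp (f := fun z : ℝ × ℝ => z.1) contDiff_fst.contMDiff.contMDiffOn
    fun _ hz => hz.1
  integral _ _ := Q.integral
  base _ _ := rfl

/-- The flows of a variation exist near the base point, and depend continuously on the
parameters. -/
theorem IsVariation.exists_flow [FiniteDimensional ℝ E] [T2Space M] [SecondCountableTopology M]
    {X : ℝ → ℝ → VF E M} {p : ℝ → ℝ → M} (h : IsVariation F X p) :
    ∃ (f : ℝ → M → M) (g : ℝ → M → M), Continuous (fun z : ℝ × M => f z.1 z.2) ∧
      (∀ s, Continuous (g s)) ∧ (∀ s, g s (f s (p 0 0)) = p 0 0) ∧ (∀ s x, f s (g s x) = x) ∧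
      (∀ s ∈ Icc (0 : ℝ) 1, f s (p 0 0) = p 1 s) ∧
      ∀ᶠ x in 𝓝 (p 0 0), ∀ s ∈ Icc (0 : ℝ) 1, FlowsTo (fun t => X t s) 1 x (f s x) := by
  obtain ⟨χ, O, g1, g2, g3, g4, g5, -⟩ := exists_cutoff (E := E)
    ((isCompact_Icc.prod isCompact_Icc).image_of_continuousOn h.smooth.continuousOn) isOpen_univ
    (subset_univ _)
  obtain ⟨Φ, hΦ⟩ := exists_isFlowOf h.plot.hatTwo ((1, 0) : ℝ × ℝ) g1 g5
  obtain ⟨h1, h2⟩ := hΦ.eventually_variation h.plot g2 g4 (fun s hs => ⟨h.integral s hs, h.base s hs⟩)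
    (fun t ht s hs => g3 ⟨(t, s), ⟨ht, hs⟩, rfl⟩)
  have e1 : ∀ σ : ℝ, ((1, σ) : ℝ × ℝ) = (0, σ) + (1 : ℝ) • ((1, 0) : ℝ × ℝ) := fun σ => by
    ext <;> simp
  refine ⟨fun s => Φ 1 (0, waveInv s), fun s => Φ (-1) (1, waveInv s), ?_, ?_, ?_, ?_, ?_, ?_⟩
  · exact hΦ.smooth.continuous.comp (continuous_const.prodMk ((continuous_const.prodMk
      (continuous_waveInv.comp continuous_fst)).prodMk continuous_snd))
  · exact fun s => (hΦ.contMDiff _ _).continuous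
  · intro s
    simp only [e1 (waveInv s)]
    exact hΦ.left_inv 1 (0, waveInv s) (p 0 0)
  · intro s x
    simp only [e1 (waveInv s)]
    exact hΦ.right_inv 1 (0, waveInv s) x
  · intro s hs
    simp only [h1, wave_one, wave_waveInv hs]
  · filter_upwards [h2] with x hx s hs
    have h3 := hx (waveInv s) (waveInv_mem s)
    rw [wave_waveInv hs] at h3
    exact ⟨_, h3, by simp [hΦ.zero], by simp⟩

theorem FPath.exists_flowData [FiniteDimensional ℝ E] [T2Space M] [SecondCountableTopology M]
    (Q : FPath F) : Nonempty (FlowData F (Q.p '' Icc 0 1) (1 : ℝ) (hat Q.X)) :=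
  SingFol.exists_flowData (isCompact_Icc.image_of_continuousOn Q.smooth.continuousOn) 1 Q.plot.hat

theorem FPath.flowData_flowsTo [T2Space M] {Q : FPath F}
    (D : FlowData F (Q.p '' Icc 0 1) (1 : ℝ) (hat Q.X)) :
    D.Φ 1 0 (Q.p 0) = Q.p 1 ∧ ∀ᶠ x in 𝓝 (Q.p 0), FlowsTo Q.X 1 x (D.Φ 1 0 x) := by
  have hD := D.isFlowOf Q.plot.hat
  have hO : ∀ t ∈ Icc (0 : ℝ) 1, Q.p t ∈ (D.O : Set M) := fun t ht => D.subset ⟨t, ht, rfl⟩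
  constructor
  · simpa using hD.eq_integralCurve Q.integral (fun t ht => D.one _ (hO t ht)) 0 1
  · have := hD.eventually_isIntegralCurve Q.plot D.O.isOpen D.one Q.integral hO 0
    rw [wave_zero] at this
    filter_upwards [this] with x hx
    exact ⟨_, hx.1, by simp [hD.zero], by simp⟩

theorem complement_join_left [FiniteDimensional ℝ E] [T2Space M] [SecondCountableTopology M]
    (r : Reparam) {Y : ℝ → ℝ → VF E M} {q : ℝ → ℝ → M} (hY : IsVariation F Y q) (P : FPath F)
    (h : P.p 1 = q 0 0) {s : ℝ} (hs : s ∈ Icc (0 : ℝ) 1) :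
    ∀ᶠ w in 𝓝 (q 1 s), vfVal (complement (fun t s => joinX r (fun τ => Y τ s) P.X t) 1 s) w =
      vfVal (complement Y 1 s) w := by
  obtain ⟨f, g, f1, g1, gf, fg, fp, hf⟩ := hY.exists_flow
  have hp0 := P.integral.eventually_exists P.plot isOpen_univ (fun _ _ => mem_univ _) (t₀ := 1)
    (by simp)
  rw [h] at hp0
  have hg : Tendsto (g s) (𝓝 (q 1 s)) (𝓝 (q 0 0)) := by
    have := (g1 s).tendsto (f s (q 0 0))
    rwa [gf, fp s hs] at this
  filter_upwards [hg.eventually hf, hg.eventually hp0] with w hw hw'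
  obtain ⟨γ, hγ, h1, -⟩ := hw'
  have h2 := complement_eq (F := F) hs hY.plot (x := g s w) (f := fun u => f u (g s w)) (by
    filter_upwards [self_mem_nhdsWithin] with u hu using hw u hu)
  have h3 := complement_eq (F := F) hs (P.isVariation.join r hY
      (fun s hs => h.trans (hY.base s hs).symm)).plot
    (x := γ 0) (f := fun u => f u (g s w)) (by
    filter_upwards [self_mem_nhdsWithin] with u hu
    exact FlowsTo.join r (X := P.X) ⟨γ, hγ, rfl, h1⟩ (hw u hu))
  simp only [fg] at h2 h3
  rw [h2, h3]

theorem complement_join_right [FiniteDimensional ℝ E] [T2Space M] [SecondCountableTopology M]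
    (r : Reparam) {X : ℝ → ℝ → VF E M} {p : ℝ → ℝ → M} (hX : IsVariation F X p) (Q : FPath F)
    (h : ∀ s ∈ Icc (0 : ℝ) 1, p 1 s = Q.p 0) (D : FlowData F (Q.p '' Icc 0 1) (1 : ℝ) (hat Q.X))
    {s : ℝ} (hs : s ∈ Icc (0 : ℝ) 1) :
    ∀ᶠ w in 𝓝 (Q.p 1), vfVal (complement (fun t s => joinX r Q.X (fun τ => X τ s) t) 1 s) w =
      mder (E' := E) (D.Φ 1 0) (D.Φ (-1) 1 w) (vfVal (complement X 1 s) (D.Φ (-1) 1 w)) := by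
  obtain ⟨f, g, f1, g1, gf, fg, fp, hf⟩ := hX.exists_flow
  obtain ⟨hQ1, hQ⟩ := FPath.flowData_flowsTo D
  have hD := D.isFlowOf Q.plot.hat
  have e1 : (1 : ℝ) = 0 + (1 : ℝ) • (1 : ℝ) := by simp
  have hli : ∀ x, D.Φ (-1) 1 (D.Φ 1 0 x) = x := fun x => by
    have := hD.left_inv 1 0 x
    rwa [← e1] at this
  have hri : ∀ x, D.Φ 1 0 (D.Φ (-1) 1 x) = x := fun x => by
    have := hD.right_inv 1 0 x
    rwa [← e1] at this
  have hφ' : Tendsto (D.Φ (-1) 1) (𝓝 (Q.p 1)) (𝓝 (Q.p 0)) := by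
    have := (hD.contMDiff (-1) 1).continuous.tendsto (D.Φ 1 0 (Q.p 0))
    rwa [hli, hQ1] at this
  have hg : Tendsto (g s) (𝓝 (Q.p 0)) (𝓝 (p 0 0)) := by
    have := (g1 s).tendsto (f s (p 0 0))
    rwa [gf, fp s hs, h s hs] at this
  filter_upwards [hφ'.eventually hQ.eventually_nhds, hφ'.eventually (hg.eventually hf)]
    with w hw hw'
  set v := D.Φ (-1) 1 w with hv
  set x := g s v with hx
  have h2 := complement_eq (F := F) hs hX.plot (x := x) (f := fun u => f u x) (by
    filter_upwards [self_mem_nhdsWithin] with u hu using hw' u hu)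
  have hfx : f s x = v := fg s v
  have hfc : Continuous (fun u => f u x) := f1.comp (continuous_id.prodMk continuous_const)
  have h3 := complement_eq (F := F) (X := fun t s => joinX r Q.X (fun τ => X τ s) t) hs
    (hX.join r Q.isVariation h).plot
    (x := x) (f := fun u => D.Φ 1 0 (f u x)) (by
    have h4 : ∀ᶠ u in 𝓝 s, FlowsTo Q.X 1 (f u x) (D.Φ 1 0 (f u x)) :=
      hfc.continuousAt.eventually (p := fun y => FlowsTo Q.X 1 y (D.Φ 1 0 y)) (by
        change ∀ᶠ y in 𝓝 (f s x), FlowsTo Q.X 1 y (D.Φ 1 0 y)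
        rw [hfx]
        exact hw)
    filter_upwards [self_mem_nhdsWithin, mem_nhdsWithin_of_mem_nhds h4] with u hu hu'
    exact FlowsTo.join r (hw' u hu) hu')
  simp only [hfx, hv, hri] at h3
  simp only [hfx, hv] at h2
  rw [h2]
  refine h3.trans ?_
  have h5 := velIcc_comp (hD.contMDiff 1 0) (hD.contMDiff (-1) 1) hli (fun u => f u x) hs
  rw [hfx] at h5
  exact h5

theorem FHomotopic.concat_left [FiniteDimensional ℝ E] [T2Space M] [SecondCountableTopology M]
    (r : Reparam) {Q₀ Q₁ : FPath F} (h : FHomotopic Q₀ Q₁) (P : FPath F) (h₀ : P.p 1 = Q₀.p 0)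
    (h₁ : P.p 1 = Q₁.p 0) : FHomotopic (FPath.concat r Q₀ P h₀) (FPath.concat r Q₁ P h₁) := by
  obtain ⟨Y, q, hY, e0, e1, hI⟩ := h
  have hq0 : P.p 1 = q 0 0 := by rw [(e0 0 (by simp)).2, h₀]
  refine ⟨fun t s => joinX r (fun τ => Y τ s) P.X t,
    fun t s => joinCurve r (fun τ => q τ s) P.p t,
    P.isVariation.join r hY (fun s hs => hq0.trans (hY.base s hs).symm), fun t _ => ⟨?_, ?_⟩,
    fun t _ => ⟨?_, ?_⟩, fun s hs => ?_⟩
  · change joinX r _ _ t = joinX r Q₀.X P.X t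
    simp only [joinX, (e0 _ (r.mem _)).1]
  · change joinCurve r _ _ t = joinCurve r Q₀.p P.p t
    simp only [joinCurve, (e0 _ (r.mem _)).2]
  · change joinX r _ _ t = joinX r Q₁.X P.X t
    simp only [joinX, (e1 _ (r.mem _)).1]
  · change joinCurve r _ _ t = joinCurve r Q₁.p P.p t
    simp only [joinCurve, (e1 _ (r.mem _)).2]
  · simp only [joinCurve_one]
    obtain ⟨V, hV, hI⟩ := hI s hs
    exact hI.congr_eventually hV (complement_join_left r hY P hq0 hs)

theorem FHomotopic.concat_right [FiniteDimensional ℝ E] [T2Space M] [SecondCountableTopology M]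
    (r : Reparam) {P₀ P₁ : FPath F} (h : FHomotopic P₀ P₁) (Q : FPath F) (h₀ : P₀.p 1 = Q.p 0)
    (h₁ : P₁.p 1 = Q.p 0) : FHomotopic (FPath.concat r Q P₀ h₀) (FPath.concat r Q P₁ h₁) := by
  obtain ⟨X, p, hX, e0, e1, hI⟩ := h
  have hp1 : ∀ s ∈ Icc (0 : ℝ) 1, p 1 s = Q.p 0 := by
    intro s hs
    rw [← h₀, ← (e0 1 (by simp)).2]
    refine hX.target_eq (fun s hs => ?_) s hs
    obtain ⟨V, hV, h5⟩ := hI s hs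
    exact h5.eq_zero hV
  obtain ⟨D⟩ := Q.exists_flowData
  refine ⟨fun t s => joinX r Q.X (fun τ => X τ s) t,
    fun t s => joinCurve r Q.p (fun τ => p τ s) t,
    hX.join r Q.isVariation hp1, fun t _ => ⟨?_, ?_⟩,
    fun t _ => ⟨?_, ?_⟩, fun s hs => ?_⟩
  · change joinX r _ _ t = joinX r Q.X P₀.X t
    simp only [joinX, (e0 _ (r.mem _)).1]
  · change joinCurve r _ _ t = joinCurve r Q.p P₀.p t
    simp only [joinCurve, (e0 _ (r.mem _)).2]
  · change joinX r _ _ t = joinX r Q.X P₁.X t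
    simp only [joinX, (e1 _ (r.mem _)).1]
  · change joinCurve r _ _ t = joinCurve r Q.p P₁.p t
    simp only [joinCurve, (e1 _ (r.mem _)).2]
  · simp only [joinCurve_one]
    obtain ⟨V, hV, hI⟩ := hI s hs
    rw [hp1 s hs] at hV hI
    have hQ1 := (FPath.flowData_flowsTo D).1
    have h1 : (0 : ℝ) + (1 : ℝ) • (1 : ℝ) = 1 := by simp
    have := D.idealSec_push Q.plot.hat (t := 1) (p := 0) (x := Q.p 0)
      (D.subset ⟨0, by simp, rfl⟩) hI hV
      (Y' := complement (fun t s => joinX r Q.X (fun τ => X τ s) t) 1 s) (by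
        rw [hQ1, h1]
        exact complement_join_right r hX Q hp1 D hs)
    rwa [hQ1] at this

end Join

section PathAlgebra

variable {E : Type*} [NormedAddCommGroup E] [NormedSpace ℝ E]
  {M : Type*} [TopologicalSpace M] [ChartedSpace E M] [IsManifold 𝓘(ℝ, E) ∞ M]
  {F : SingularFoliation E M}

theorem isPlotOn_zero (F : VFModule E M) {W : Type*} [NormedAddCommGroup W] [NormedSpace ℝ W]
    (U : Set W) : F.IsPlotOn U (fun _ => 0) :=
  ⟨fun _ _ => F.zero ⊤, fun _ _ _ => ⟨univ, ⊤, isOpen_univ, trivial, trivial, 0, Fin.elim0,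
    Fin.elim0, fun i => i.elim0, fun i => i.elim0, fun _ _ _ _ => by simp⟩⟩

/-- The constant path. -/
def FPath.const (F : SingularFoliation E M) (x : M) : FPath F where
  X _ := 0
  p _ := x
  plot := isPlotOn_zero _ _
  smooth := contMDiffOn_const
  integral t _ := (hasMFDerivAt_const_zero rfl t).hasMFDerivWithinAt
  X_left _ _ := rfl
  X_right _ _ := rfl
  p_left _ _ := rfl
  p_right _ _ := rfl

theorem deriv_eq_zero_of_const {ψ : ℝ → ℝ} {ε : ℝ} (hε : 0 < ε) (h0 : ∀ t ≤ ε, ψ t = ψ 0)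
    (h1 : ∀ t, 1 - ε ≤ t → ψ t = ψ 1) :
    (∀ t ≤ 0, deriv ψ t = 0) ∧ ∀ t, 1 ≤ t → deriv ψ t = 0 := by
  refine ⟨fun t ht => ?_, fun t ht => ?_⟩
  · have : ψ =ᶠ[𝓝 t] fun _ => ψ 0 := by
      filter_upwards [Iio_mem_nhds (lt_of_le_of_lt ht hε)] with s hs using h0 s (le_of_lt hs)
    simp [this.deriv_eq]
  · have : ψ =ᶠ[𝓝 t] fun _ => ψ 1 := by
      filter_upwards [Ioi_mem_nhds (show 1 - ε < t by linarith)] with s hs using h1 s (le_of_lt hs)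
    simp [this.deriv_eq]

/-- The reparametrization of a path by a function which is constant near the ends. -/
def FPath.reparam (P : FPath F) (ψ : ℝ → ℝ) (hψ : ContDiff ℝ ∞ ψ) (hm : ∀ t, ψ t ∈ Icc (0 : ℝ) 1)
    (hc : ∃ ε > 0, (∀ t ≤ ε, ψ t = ψ 0) ∧ ∀ t, 1 - ε ≤ t → ψ t = ψ 1) : FPath F where
  X t := deriv ψ t • P.X (ψ t)
  p t := P.p (ψ t)
  plot := P.plot_reparam hψ hm _
  smooth := (P.smooth_reparam hψ hm).contMDiffOn
  integral t _ := (P.deriv_reparam hψ hm t).hasMFDerivWithinAt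
  X_left t ht := by
    obtain ⟨ε, hε, h0, h1⟩ := hc
    have := (deriv_eq_zero_of_const hε h0 h1).1
    rw [this t ht, this 0 le_rfl]
    simp
  X_right t ht := by
    obtain ⟨ε, hε, h0, h1⟩ := hc
    have := (deriv_eq_zero_of_const hε h0 h1).2
    rw [this t ht, this 1 le_rfl]
    simp
  p_left t ht := by
    obtain ⟨ε, hε, h0, h1⟩ := hc
    rw [h0 t (by linarith)]
  p_right t ht := by
    obtain ⟨ε, hε, h0, h1⟩ := hc
    rw [h1 t (by linarith)]

/-- The path `P ∘ r`. -/
def FPath.slow (r : Reparam) (P : FPath F) : FPath F :=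
  P.reparam r.toFun r.smooth r.mem (by
    obtain ⟨ε, hε, h0, h1⟩ := r.const
    exact ⟨ε, hε, fun t ht => by rw [h0 t ht, r.zero], fun t ht => by rw [h1 t ht, r.one]⟩)

/-- The path `P` run backwards. -/
def FPath.reverse (r : Reparam) (P : FPath F) : FPath F :=
  P.reparam (fun t => 1 - r.toFun t) (contDiff_const.sub r.smooth)
    (fun t => ⟨by linarith [(r.mem t).2], by linarith [(r.mem t).1]⟩) (by
    obtain ⟨ε, hε, h0, h1⟩ := r.const
    exact ⟨ε, hε, fun t ht => by rw [h0 t ht, r.zero], fun t ht => by rw [h1 t ht, r.one]⟩)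

theorem FHomotopic.of_reparam [FiniteDimensional ℝ E] [T2Space M] [SecondCountableTopology M]
    (P : FPath F) {ψ₀ ψ₁ : ℝ → ℝ} (h₀ : ContDiff ℝ ∞ ψ₀) (h₁ : ContDiff ℝ ∞ ψ₁)
    (m₀ : MapsTo ψ₀ (Icc 0 1) (Icc 0 1)) (m₁ : MapsTo ψ₁ (Icc 0 1) (Icc 0 1)) (e0 : ψ₀ 0 = ψ₁ 0)
    (e1 : ψ₀ 1 = ψ₁ 1) {P₀ P₁ : FPath F}
    (hP₀ : ∀ t ∈ Icc (0 : ℝ) 1, P₀.X t = deriv ψ₀ t • P.X (ψ₀ t) ∧ P₀.p t = P.p (ψ₀ t))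
    (hP₁ : ∀ t ∈ Icc (0 : ℝ) 1, P₁.X t = deriv ψ₁ t • P.X (ψ₁ t) ∧ P₁.p t = P.p (ψ₁ t)) :
    FHomotopic P₀ P₁ := by
  set ψ : ℝ → ℝ → ℝ := fun t s => (1 - s) * ψ₀ t + s * ψ₁ t with hψd
  have hψ : ContDiff ℝ ∞ (fun z : ℝ × ℝ => ψ z.1 z.2) :=
    ((contDiff_const.sub contDiff_snd).mul (h₀.comp contDiff_fst)).add
      (contDiff_snd.mul (h₁.comp contDiff_fst))
  have hm : ∀ t ∈ Icc (0 : ℝ) 1, ∀ s ∈ Icc (0 : ℝ) 1, ψ t s ∈ Icc (0 : ℝ) 1 := fun t ht s hs =>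
    (convex_Icc (0 : ℝ) 1) (m₀ ht) (m₁ ht) (by linarith [hs.2]) hs.1 (by ring)
  have hz : ∀ s, ψ 0 s = ψ 0 0 := fun s => by
    simp only [hψd, e0]
    ring
  have ho : ∀ s, ψ 1 s = ψ₁ 1 := fun s => by
    simp only [hψd, e1]
    ring
  refine ⟨_, _, isVariation_reparamX hψ hm hz P, fun t ht => ?_, fun t ht => ?_, fun s hs => ?_⟩
  · have h1 : (fun t => ψ t 0) = ψ₀ := by
      funext t
      simp [hψd]
    have h2 : ψ t 0 = ψ₀ t := congrFun h1 t
    rw [reparamX, h1, h2, (hP₀ t ht).1, (hP₀ t ht).2]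
    exact ⟨rfl, rfl⟩
  · have h1 : (fun t => ψ t 1) = ψ₁ := by
      funext t
      simp [hψd]
    have h2 : ψ t 1 = ψ₁ t := congrFun h1 t
    rw [reparamX, h1, h2, (hP₁ t ht).1, (hP₁ t ht).2]
    exact ⟨rfl, rfl⟩
  · refine (F.idealSec_zero (P.p (ψ 1 s)) ⊤).congr_eventually trivial ?_
    filter_upwards [complement_reparamX hψ hm hz P.plot P.integral hs] with w hw
    have : (fun u => ψ 1 u) = fun _ => ψ₁ 1 := funext ho
    rw [hw, this, deriv_const, zero_smul]
    rfl

/-- The path stays at a point, and its field is in the ideal of this point. -/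
def FPath.IsIdeal (P : FPath F) (y : M) : Prop :=
  (∀ t, P.p t = y) ∧ ∀ t ∈ Icc (0 : ℝ) 1, F.IdealSec y ⊤ (P.X t)

theorem FPath.IsIdeal.fHomotopic [FiniteDimensional ℝ E] [T2Space M] [SecondCountableTopology M]
    {P : FPath F} {y : M} (h : P.IsIdeal y) : FHomotopic (FPath.const F y) P := by
  set ψ : ℝ → ℝ → ℝ := fun t s => t * s with hψd
  have hψ : ContDiff ℝ ∞ (fun z : ℝ × ℝ => ψ z.1 z.2) := contDiff_fst.mul contDiff_snd
  have hm : ∀ t ∈ Icc (0 : ℝ) 1, ∀ s ∈ Icc (0 : ℝ) 1, ψ t s ∈ Icc (0 : ℝ) 1 := fun t ht s hs =>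
    ⟨mul_nonneg ht.1 hs.1, mul_le_one₀ ht.2 hs.1 hs.2⟩
  have hz : ∀ s, ψ 0 s = ψ 0 0 := fun s => by simp [hψd]
  have hd : ∀ t s, deriv (fun τ => ψ τ s) t = s := fun t s => by simp [hψd]
  refine ⟨_, _, isVariation_reparamX hψ hm hz P, fun t ht => ⟨?_, ?_⟩, fun t ht => ⟨?_, ?_⟩,
    fun s hs => ?_⟩
  · rw [reparamX, hd, zero_smul]
    rfl
  · exact h.1 _
  · rw [reparamX, hd, one_smul]
    simp [hψd]
  · simp [hψd]
  · have h1 : ψ 1 s = s := one_mul s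
    have h2 := complement_reparamX hψ hm hz P.plot P.integral hs
    simp only [h1, h.1] at h2 ⊢
    refine (h.2 s hs).congr_eventually trivial ?_
    filter_upwards [h2] with w hw
    have h3 : deriv (fun u => ψ 1 u) s = 1 := by simp [hψd]
    rw [hw, h3, one_smul]

section TriplePath

/-- Assembling a path from local reparametrizations of paths. -/
def FPath.ofLocal (X : ℝ → VF E M) (p : ℝ → M)
    (h : ∀ t, ∃ (O : Set ℝ) (R : FPath F) (ψ : ℝ → ℝ), IsOpen O ∧ t ∈ O ∧ ContDiff ℝ ∞ ψ ∧
      (∀ τ, ψ τ ∈ Icc (0 : ℝ) 1) ∧ (∀ τ ∈ O, X τ = deriv ψ τ • R.X (ψ τ)) ∧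
      ∀ τ ∈ O, p τ = R.p (ψ τ))
    (hX0 : ∀ t ≤ 0, X t = X 0) (hX1 : ∀ t, 1 ≤ t → X t = X 1) (hp0 : ∀ t ≤ 0, p t = p 0)
    (hp1 : ∀ t, 1 ≤ t → p t = p 1) : FPath F where
  X := X
  p := p
  plot := by
    refine VFModule.IsPlotOn.of_local fun t _ => ?_
    obtain ⟨O, R, ψ, hO, htO, hψ, hm, hX, -⟩ := h t
    exact ⟨O, hO, htO, (R.plot_reparam hψ hm _).congr fun τ hτ => (hX τ hτ.2).symm⟩
  smooth := by
    intro t _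
    obtain ⟨O, R, ψ, hO, htO, hψ, hm, -, hp⟩ := h t
    refine ((R.smooth_reparam hψ hm).contMDiffAt.congr_of_eventuallyEq ?_).contMDiffWithinAt
    filter_upwards [hO.mem_nhds htO] with τ hτ using hp τ hτ
  integral := by
    intro t _
    obtain ⟨O, R, ψ, hO, htO, hψ, hm, hX, hp⟩ := h t
    rw [hX t htO]
    have h1 := R.deriv_reparam hψ hm t
    rw [← hp t htO] at h1
    refine (h1.congr_of_eventuallyEq ?_).hasMFDerivWithinAt
    filter_upwards [hO.mem_nhds htO] with τ hτ using hp τ hτ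
  X_left := hX0
  X_right := hX1
  p_left := hp0
  p_right := hp1

/-- The field of a triple concatenation, with pieces of equal length. -/
def tripleX (r : Reparam) (R Q P : FPath F) (t : ℝ) : VF E M :=
  if t ≤ 1 / 3 then (3 * deriv r.toFun (3 * t)) • P.X (r.toFun (3 * t))
  else if t ≤ 2 / 3 then (3 * deriv r.toFun (3 * t - 1)) • Q.X (r.toFun (3 * t - 1))
  else (3 * deriv r.toFun (3 * t - 2)) • R.X (r.toFun (3 * t - 2))

/-- The curve of a triple concatenation. -/
def tripleCurve (r : Reparam) (R Q P : FPath F) (t : ℝ) : M :=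
  if t ≤ 1 / 3 then P.p (r.toFun (3 * t))
  else if t ≤ 2 / 3 then Q.p (r.toFun (3 * t - 1))
  else R.p (r.toFun (3 * t - 2))

theorem Reparam.deriv_comp_affine (r : Reparam) (a b t : ℝ) :
    deriv (fun t => r.toFun (a * t - b)) t = a * deriv r.toFun (a * t - b) := by
  have := ((r.smooth.differentiable (by simp)) (a * t - b)).hasDerivAt.comp t
    (((hasDerivAt_id t).const_mul a).sub_const b)
  simpa [mul_comm, Function.comp_def] using this.deriv

theorem Reparam.contDiff_affine (r : Reparam) (a b : ℝ) :
    ContDiff ℝ ∞ (fun t => r.toFun (a * t - b)) :=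
  r.smooth.comp ((contDiff_const.mul contDiff_id).sub contDiff_const)

theorem tripleX_local (r : Reparam) (R Q P : FPath F) (h : P.p 1 = Q.p 0) (h' : Q.p 1 = R.p 0)
    (t : ℝ) :
    ∃ (O : Set ℝ) (R' : FPath F) (ψ : ℝ → ℝ), IsOpen O ∧ t ∈ O ∧ ContDiff ℝ ∞ ψ ∧
      (∀ τ, ψ τ ∈ Icc (0 : ℝ) 1) ∧ (∀ τ ∈ O, tripleX r R Q P τ = deriv ψ τ • R'.X (ψ τ)) ∧
      ∀ τ ∈ O, tripleCurve r R Q P τ = R'.p (ψ τ) := by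
  obtain ⟨ε, hε, d0, d1, v0, v1⟩ := r.deriv_zero
  have hε2 : ε < 1 / 2 := by
    by_contra hc
    have h1 := v0 (1 / 2) (by linarith)
    rw [v1 (1 / 2) (by linarith)] at h1
    exact one_ne_zero h1
  rcases lt_or_ge t (1 / 3 + ε / 3) with ht | ht
  · refine ⟨Iio (1 / 3 + ε / 3), P, fun t => r.toFun (3 * t - 0), isOpen_Iio, ht,
      r.contDiff_affine 3 0, fun τ => r.mem _, fun τ hτ => ?_, fun τ hτ => ?_⟩
    · have hτ' : τ < 1 / 3 + ε / 3 := hτ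
      rw [r.deriv_comp_affine]
      simp only [tripleX, sub_zero]
      split_ifs with h1 h2
      · rfl
      · rw [d0 _ (by linarith), d1 (3 * τ) (by linarith)]
        simp
      · linarith
    · have hτ' : τ < 1 / 3 + ε / 3 := hτ
      simp only [tripleCurve, sub_zero]
      split_ifs with h1 h2
      · rfl
      · rw [v0 _ (by linarith), v1 (3 * τ) (by linarith), h]
      · linarith
  rcases lt_or_ge t (2 / 3 + ε / 3) with ht2 | ht2
  · refine ⟨Ioo (1 / 3) (2 / 3 + ε / 3), Q, fun t => r.toFun (3 * t - 1), isOpen_Ioo,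
      ⟨by linarith, ht2⟩, r.contDiff_affine 3 1, fun τ => r.mem _, fun τ hτ => ?_, fun τ hτ => ?_⟩
    · rw [tripleX, r.deriv_comp_affine, if_neg (not_le.2 hτ.1)]
      split_ifs with h2
      · rfl
      · rw [d0 _ (by linarith [hτ.2]), d1 (3 * τ - 1) (by linarith)]
        simp
    · rw [tripleCurve, if_neg (not_le.2 hτ.1)]
      split_ifs with h2
      · rfl
      · simp only [v0 (3 * τ - 2) (by linarith [hτ.2]), v1 (3 * τ - 1) (by linarith), h']
  · refine ⟨Ioi (2 / 3), R, fun t => r.toFun (3 * t - 2), isOpen_Ioi, ?_,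
      r.contDiff_affine 3 2, fun τ => r.mem _, fun τ hτ => ?_, fun τ hτ => ?_⟩
    · simp only [mem_Ioi]
      linarith
    · have hτ' : 2 / 3 < τ := hτ
      rw [tripleX, r.deriv_comp_affine, if_neg (by linarith), if_neg (by linarith)]
    · have hτ' : 2 / 3 < τ := hτ
      rw [tripleCurve, if_neg (by linarith), if_neg (by linarith)]

/-- The triple concatenation. -/
def FPath.triple (r : Reparam) (R Q P : FPath F) (h : P.p 1 = Q.p 0) (h' : Q.p 1 = R.p 0) :
    FPath F :=
  FPath.ofLocal (tripleX r R Q P) (tripleCurve r R Q P) (tripleX_local r R Q P h h')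
    (fun t ht => by
      obtain ⟨ε, hε, d0, -⟩ := r.deriv_zero
      rw [tripleX, tripleX, if_pos (by linarith), if_pos (by norm_num), d0 _ (by linarith),
        d0 _ (by linarith)]
      simp)
    (fun t ht => by
      obtain ⟨ε, hε, -, d1, -⟩ := r.deriv_zero
      rw [tripleX, tripleX, if_neg (by linarith), if_neg (by linarith), if_neg (by norm_num),
        if_neg (by norm_num), d1 _ (by linarith), d1 _ (by linarith)]
      simp)
    (fun t ht => by
      obtain ⟨ε, hε, -, -, v0, -⟩ := r.deriv_zero
      rw [tripleCurve, tripleCurve, if_pos (by linarith), if_pos (by norm_num), v0 _ (by linarith),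
        v0 _ (by linarith)])
    (fun t ht => by
      obtain ⟨ε, hε, -, -, -, v1⟩ := r.deriv_zero
      rw [tripleCurve, tripleCurve, if_neg (by linarith), if_neg (by linarith),
        if_neg (by norm_num), if_neg (by norm_num), v1 _ (by linarith), v1 _ (by linarith)])

theorem Reparam.hasDerivAt_mix (r : Reparam) (a b t : ℝ) :
    deriv (fun t => a * r.toFun (2 * t) + b * r.toFun (2 * t - 1)) t =
      a * (2 * deriv r.toFun (2 * t)) + b * (2 * deriv r.toFun (2 * t - 1)) :=
  (((r.hasDerivAt_first t).const_mul a).add ((r.hasDerivAt_second t).const_mul b)).deriv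

theorem Reparam.contDiff_mix (r : Reparam) (a b : ℝ) :
    ContDiff ℝ ∞ (fun t => a * r.toFun (2 * t) + b * r.toFun (2 * t - 1)) :=
  (contDiff_const.mul r.contDiff_first).add (contDiff_const.mul r.contDiff_second)

theorem FHomotopic.triple_left [FiniteDimensional ℝ E] [T2Space M] [SecondCountableTopology M]
    (r : Reparam) (R Q P : FPath F) (h : P.p 1 = Q.p 0) (h' : Q.p 1 = R.p 0)
    (h₁' : (P.slow r).p 1 = (FPath.concat r R Q h').p 0)
    (h₂' : (FPath.concat r Q P h).p 1 = (R.slow r).p 0) :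
    FHomotopic (FPath.concat r (R.slow r) (FPath.concat r Q P h) h₂')
      (FPath.concat r (FPath.concat r R Q h') (P.slow r) h₁') := by
  obtain ⟨ε, hε, d0, d1, v0, v1⟩ := r.deriv_zero
  have mix : ∀ a b : ℝ, 0 ≤ a → 0 ≤ b → a + b = 1 → MapsTo
      (fun t => a * r.toFun (2 * t) + b * r.toFun (2 * t - 1)) (Icc 0 1) (Icc 0 1) :=
    fun a b ha hb hab t _ => (convex_Icc (0 : ℝ) 1) (r.mem _) (r.mem _) ha hb hab
  refine FHomotopic.of_reparam (FPath.triple r R Q P h h') (r.contDiff_mix (2 / 3) (1 / 3))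
    (r.contDiff_mix (1 / 3) (2 / 3)) (mix _ _ (by norm_num) (by norm_num) (by norm_num))
    (mix _ _ (by norm_num) (by norm_num) (by norm_num)) ?_ ?_ (fun t ht => ?_) (fun t ht => ?_)
  · simp [r.zero, v0 (-1) (by linarith)]
  · norm_num [r.one, v1 2 (by linarith)]
  · have m1 := r.mem (2 * t)
    have m2 := r.mem (2 * t - 1)
    rw [r.hasDerivAt_mix]
    change joinX r (fun t => deriv r.toFun t • R.X (r.toFun t)) (joinX r Q.X P.X) t =
        _ • tripleX r R Q P _ ∧
      joinCurve r (fun t => R.p (r.toFun t)) (joinCurve r Q.p P.p) t = tripleCurve r R Q P _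
    by_cases hc : t ≤ 1 / 2
    · rw [joinX, if_pos hc, joinCurve, if_pos hc, d0 (2 * t - 1) (by linarith),
        v0 (2 * t - 1) (by linarith)]
      set ρ := r.toFun (2 * t)
      have e1 : 3 * (2 / 3 * ρ + 1 / 3 * 0) = 2 * ρ := by ring
      unfold joinX joinCurve tripleX tripleCurve
      rw [e1]
      by_cases hρ : ρ ≤ 1 / 2
      · have c1 : 2 / 3 * ρ + 1 / 3 * 0 ≤ 1 / 3 := by linarith
        simp only [if_pos hρ, if_pos c1, smul_smul]
        refine ⟨?_, by trivial⟩
        congr 1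
        ring
      · have c1 : ¬ 2 / 3 * ρ + 1 / 3 * 0 ≤ 1 / 3 := by linarith
        have c2 : 2 / 3 * ρ + 1 / 3 * 0 ≤ 2 / 3 := by linarith [m1.2]
        simp only [if_neg hρ, if_neg c1, if_pos c2, smul_smul]
        refine ⟨?_, by trivial⟩
        congr 1
        ring
    · rw [joinX, if_neg hc, joinCurve, if_neg hc, d1 (2 * t) (by linarith),
        v1 (2 * t) (by linarith)]
      set ρ := r.toFun (2 * t - 1)
      have e1 : 3 * (2 / 3 * 1 + 1 / 3 * ρ) - 1 = 1 + ρ := by ring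
      have e2 : 3 * (2 / 3 * 1 + 1 / 3 * ρ) - 2 = ρ := by ring
      unfold tripleX tripleCurve
      have c1 : ¬ 2 / 3 * 1 + 1 / 3 * ρ ≤ 1 / 3 := by linarith [m2.1]
      simp only [if_neg c1]
      rw [e1, e2]
      by_cases hρ : ρ = 0
      · have c2 : 2 / 3 * 1 + 1 / 3 * ρ ≤ 2 / 3 := by rw [hρ]; norm_num
        simp only [if_pos c2]
        rw [hρ, add_zero, d0 0 hε, d1 1 (by linarith), r.zero, r.one, h']
        simp
      · have hpos : 0 < ρ := lt_of_le_of_ne m2.1 (Ne.symm hρ)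
        have c2 : ¬ 2 / 3 * 1 + 1 / 3 * ρ ≤ 2 / 3 := by linarith
        simp only [if_neg c2, smul_smul]
        refine ⟨?_, by trivial⟩
        congr 1
        ring
  · have m1 := r.mem (2 * t)
    have m2 := r.mem (2 * t - 1)
    rw [r.hasDerivAt_mix]
    change joinX r (joinX r R.X Q.X) (fun t => deriv r.toFun t • P.X (r.toFun t)) t =
        _ • tripleX r R Q P _ ∧
      joinCurve r (joinCurve r R.p Q.p) (fun t => P.p (r.toFun t)) t = tripleCurve r R Q P _
    by_cases hc : t ≤ 1 / 2
    · rw [joinX, if_pos hc, joinCurve, if_pos hc, d0 (2 * t - 1) (by linarith),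
        v0 (2 * t - 1) (by linarith)]
      set ρ := r.toFun (2 * t)
      have e1 : 3 * (1 / 3 * ρ + 2 / 3 * 0) = ρ := by ring
      unfold tripleX tripleCurve
      have c1 : 1 / 3 * ρ + 2 / 3 * 0 ≤ 1 / 3 := by linarith [m1.2]
      simp only [if_pos c1, smul_smul]
      rw [e1]
      refine ⟨?_, by trivial⟩
      congr 1
      ring
    · rw [joinX, if_neg hc, joinCurve, if_neg hc, d1 (2 * t) (by linarith),
        v1 (2 * t) (by linarith)]
      set ρ := r.toFun (2 * t - 1)
      have e1 : 3 * (1 / 3 * 1 + 2 / 3 * ρ) = 1 + 2 * ρ := by ring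
      have e2 : 1 + 2 * ρ - 1 = 2 * ρ := by ring
      have e3 : 1 + 2 * ρ - 2 = 2 * ρ - 1 := by ring
      unfold joinX joinCurve tripleX tripleCurve
      rw [e1, e2, e3]
      by_cases hρ : ρ = 0
      · have c1 : 1 / 3 * 1 + 2 / 3 * ρ ≤ 1 / 3 := by rw [hρ]; norm_num
        have c2 : ρ ≤ 1 / 2 := by rw [hρ]; norm_num
        simp only [if_pos c1, if_pos c2]
        rw [hρ, mul_zero, add_zero, d0 0 hε, d1 1 (by linarith), r.zero, r.one, h]
        simp
      have hpos : 0 < ρ := lt_of_le_of_ne m2.1 (Ne.symm hρ)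
      have c1 : ¬ 1 / 3 * 1 + 2 / 3 * ρ ≤ 1 / 3 := by linarith
      simp only [if_neg c1]
      by_cases hρ' : ρ ≤ 1 / 2
      · have c2 : 1 / 3 * 1 + 2 / 3 * ρ ≤ 2 / 3 := by linarith
        simp only [if_pos hρ', if_pos c2, smul_smul]
        refine ⟨?_, by trivial⟩
        congr 1
        ring
      · have c2 : ¬ 1 / 3 * 1 + 2 / 3 * ρ ≤ 2 / 3 := by linarith
        simp only [if_neg hρ', if_neg c2, smul_smul]
        refine ⟨?_, by trivial⟩
        congr 1
        ring

end TriplePath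

end PathAlgebra

section Groupoid

variable {E : Type*} [NormedAddCommGroup E] [NormedSpace ℝ E]
  {M : Type*} [TopologicalSpace M] [ChartedSpace E M] [IsManifold 𝓘(ℝ, E) ∞ M]
  {F : SingularFoliation E M}

theorem FPath.concat_zero (r : Reparam) (Q P : FPath F) (h : P.p 1 = Q.p 0) :
    (FPath.concat r Q P h).p 0 = P.p 0 := joinCurve_zero r Q.p P.p

theorem FPath.concat_one (r : Reparam) (Q P : FPath F) (h : P.p 1 = Q.p 0) :
    (FPath.concat r Q P h).p 1 = Q.p 1 := joinCurve_one r Q.p P.p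

theorem FPath.slow_zero (r : Reparam) (P : FPath F) : (P.slow r).p 0 = P.p 0 :=
  congrArg P.p r.zero

theorem FPath.slow_one (r : Reparam) (P : FPath F) : (P.slow r).p 1 = P.p 1 :=
  congrArg P.p r.one

theorem FPath.reverse_zero (r : Reparam) (P : FPath F) : (P.reverse r).p 0 = P.p 1 :=
  congrArg P.p (show 1 - r.toFun 0 = 1 by rw [r.zero, sub_zero])

theorem FPath.reverse_one (r : Reparam) (P : FPath F) : (P.reverse r).p 1 = P.p 0 :=
  congrArg P.p (show 1 - r.toFun 1 = 0 by rw [r.one, sub_self])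

variable [FiniteDimensional ℝ E] [T2Space M] [SecondCountableTopology M]

theorem FPath.eq_reparam_id (P : FPath F) : ∀ t ∈ Icc (0 : ℝ) 1,
    P.X t = deriv (fun t : ℝ => t) t • P.X t ∧ P.p t = P.p t := fun t _ => by simp

theorem FHomotopic.slow (r : Reparam) (P : FPath F) : FHomotopic P (P.slow r) :=
  FHomotopic.of_reparam P contDiff_id r.smooth (fun _ h => h) (fun t _ => r.mem t)
    r.zero.symm r.one.symm P.eq_reparam_id (fun _ _ => ⟨rfl, rfl⟩)

theorem FHomotopic.const_concat (r : Reparam) (P : FPath F) (h : P.p 1 = (FPath.const F (P.p 1)).p 0) :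
    FHomotopic (FPath.concat r (FPath.const F (P.p 1)) P h) P := by
  obtain ⟨ε, hε, d0, d1, v0, v1⟩ := r.deriv_zero
  refine FHomotopic.of_reparam P r.contDiff_first contDiff_id (fun t _ => r.mem _) (fun _ h => h)
    (by simp [r.zero]) (by simpa using v1 2 (by linarith)) (fun t _ => ?_) P.eq_reparam_id
  rw [(r.hasDerivAt_first t).deriv]
  change joinX r (fun _ => 0) P.X t = _ ∧ joinCurve r (fun _ => P.p 1) P.p t = _
  unfold joinX joinCurve
  by_cases hc : t ≤ 1 / 2
  · simp only [if_pos hc]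
    exact ⟨by trivial, by trivial⟩
  · simp only [if_neg hc, d1 (2 * t) (by linarith), v1 (2 * t) (by linarith)]
    simp

theorem FHomotopic.concat_const (r : Reparam) (P : FPath F)
    (h : (FPath.const F (P.p 0)).p 1 = P.p 0) :
    FHomotopic (FPath.concat r P (FPath.const F (P.p 0)) h) P := by
  obtain ⟨ε, hε, d0, d1, v0, v1⟩ := r.deriv_zero
  refine FHomotopic.of_reparam P r.contDiff_second contDiff_id (fun t _ => r.mem _) (fun _ h => h)
    (by simpa using v0 (-1) (by linarith)) (by norm_num [r.one]) (fun t _ => ?_) P.eq_reparam_id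
  rw [(r.hasDerivAt_second t).deriv]
  change joinX r P.X (fun _ => 0) t = _ ∧ joinCurve r P.p (fun _ => P.p 0) t = _
  unfold joinX joinCurve
  by_cases hc : t ≤ 1 / 2
  · simp only [if_pos hc, d0 (2 * t - 1) (by linarith), v0 (2 * t - 1) (by linarith)]
    simp
  · simp only [if_neg hc]
    exact ⟨by trivial, by trivial⟩

theorem Reparam.hasDerivAt_twice (r : Reparam) {g : ℝ → ℝ} {g' t : ℝ} (hg : HasDerivAt g g' t) :
    HasDerivAt (fun t => r.toFun (g t)) (deriv r.toFun (g t) * g') t :=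
  ((r.smooth.differentiable (by simp)) (g t)).hasDerivAt.comp t hg

theorem FHomotopic.reverse_concat (r : Reparam) (P : FPath F) (h : P.p 1 = (P.reverse r).p 0) :
    FHomotopic (FPath.concat r (P.reverse r) P h) (FPath.const F (P.p 0)) := by
  obtain ⟨ε, hε, d0, d1, v0, v1⟩ := r.deriv_zero
  set ψ : ℝ → ℝ := fun t => r.toFun (2 * t) - r.toFun (r.toFun (2 * t - 1)) with hψd
  have hψ : ContDiff ℝ ∞ ψ := r.contDiff_first.sub (r.smooth.comp r.contDiff_second)
  have h1 : ∀ t ≤ 1 / 2, ψ t = r.toFun (2 * t) := fun t ht => by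
    simp only [hψd, v0 (2 * t - 1) (by linarith), r.zero, sub_zero]
  have h2 : ∀ t, 1 / 2 < t → ψ t = 1 - r.toFun (r.toFun (2 * t - 1)) := fun t ht => by
    simp only [hψd, v1 (2 * t) (by linarith)]
  have hder : ∀ t, deriv ψ t = 2 * deriv r.toFun (2 * t) -
      deriv r.toFun (r.toFun (2 * t - 1)) * (2 * deriv r.toFun (2 * t - 1)) := fun t =>
    ((r.hasDerivAt_first t).sub (r.hasDerivAt_twice (r.hasDerivAt_second t))).deriv
  refine FHomotopic.of_reparam P (ψ₁ := fun _ => 0) hψ contDiff_const (fun t _ => ?_)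
    (fun _ _ => by simp) ?_ ?_ (fun t _ => ?_) (fun t _ => ?_)
  · by_cases hc : t ≤ 1 / 2
    · rw [h1 t hc]
      exact r.mem _
    · rw [h2 t (not_le.1 hc)]
      have := r.mem (r.toFun (2 * t - 1))
      exact ⟨by linarith [this.2], by linarith [this.1]⟩
  · rw [h1 0 (by norm_num), mul_zero, r.zero]
  · rw [h2 1 (by norm_num)]
    norm_num [r.one]
  · change joinX r (fun t => deriv (fun t => 1 - r.toFun t) t • P.X (1 - r.toFun t)) P.X t = _ ∧
      joinCurve r (fun t => P.p (1 - r.toFun t)) P.p t = _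
    unfold joinX joinCurve
    by_cases hc : t ≤ 1 / 2
    · simp only [if_pos hc, h1 t hc, hder, d0 (2 * t - 1) (by linarith), mul_zero, sub_zero]
      exact ⟨by trivial, by trivial⟩
    · simp only [if_neg hc, h2 t (not_le.1 hc), hder, d1 (2 * t) (by linarith), mul_zero, zero_sub,
        deriv_const_sub, smul_smul]
      refine ⟨?_, by trivial⟩
      congr 1
      ring
  · simp only [deriv_const, zero_smul]
    exact ⟨by trivial, by trivial⟩

theorem FHomotopic.concat_reverse (r : Reparam) (P : FPath F) (h : (P.reverse r).p 1 = P.p 0) :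
    FHomotopic (FPath.concat r P (P.reverse r) h) (FPath.const F (P.p 1)) := by
  obtain ⟨ε, hε, d0, d1, v0, v1⟩ := r.deriv_zero
  set ψ : ℝ → ℝ := fun t => 1 - r.toFun (r.toFun (2 * t)) + r.toFun (2 * t - 1) with hψd
  have hψ : ContDiff ℝ ∞ ψ :=
    (contDiff_const.sub (r.smooth.comp r.contDiff_first)).add r.contDiff_second
  have h1 : ∀ t ≤ 1 / 2, ψ t = 1 - r.toFun (r.toFun (2 * t)) := fun t ht => by
    simp only [hψd, v0 (2 * t - 1) (by linarith), add_zero]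
  have h2 : ∀ t, 1 / 2 < t → ψ t = r.toFun (2 * t - 1) := fun t ht => by
    simp only [hψd, v1 (2 * t) (by linarith), r.one, sub_self, zero_add]
  have hder : ∀ t, deriv ψ t = -(deriv r.toFun (r.toFun (2 * t)) * (2 * deriv r.toFun (2 * t))) +
      2 * deriv r.toFun (2 * t - 1) := fun t =>
    (((r.hasDerivAt_twice (r.hasDerivAt_first t)).const_sub 1).add (r.hasDerivAt_second t)).deriv
  refine FHomotopic.of_reparam P (ψ₁ := fun _ => 1) hψ contDiff_const (fun t _ => ?_)
    (fun _ _ => by simp) ?_ ?_ (fun t _ => ?_) (fun t _ => ?_)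
  · by_cases hc : t ≤ 1 / 2
    · rw [h1 t hc]
      have := r.mem (r.toFun (2 * t))
      exact ⟨by linarith [this.2], by linarith [this.1]⟩
    · rw [h2 t (not_le.1 hc)]
      exact r.mem _
  · rw [h1 0 (by norm_num), mul_zero, r.zero, r.zero, sub_zero]
  · rw [h2 1 (by norm_num)]
    norm_num [r.one]
  · change joinX r P.X (fun t => deriv (fun t => 1 - r.toFun t) t • P.X (1 - r.toFun t)) t = _ ∧
      joinCurve r P.p (fun t => P.p (1 - r.toFun t)) t = _
    unfold joinX joinCurve
    by_cases hc : t ≤ 1 / 2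
    · simp only [if_pos hc, h1 t hc, hder, d0 (2 * t - 1) (by linarith), mul_zero, add_zero,
        deriv_const_sub, smul_smul]
      refine ⟨?_, by trivial⟩
      congr 1
      ring
    · simp only [if_neg hc, h2 t (not_le.1 hc), hder, d1 (2 * t) (by linarith), mul_zero, neg_zero,
        zero_add]
      exact ⟨by trivial, by trivial⟩
  · simp only [deriv_const, zero_smul]
    exact ⟨by trivial, by trivial⟩

/-- A quotient of the set of paths by a congruence which is coarser than homotopy is a groupoid. -/
theorem exists_groupoidOver {G : Type*} {π : FPath F → G} (hπ : Function.Surjective π) (r : Reparam)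
    (hs : ∀ P P', π P = π P' → P.p 0 = P'.p 0) (ht : ∀ P P', π P = π P' → P.p 1 = P'.p 1)
    (hmul : ∀ P P' Q Q' (h : P.p 1 = Q.p 0) (h' : P'.p 1 = Q'.p 0), π P = π P' → π Q = π Q' →
      π (FPath.concat r Q P h) = π (FPath.concat r Q' P' h'))
    (hh : ∀ P P', FHomotopic P P' → π P = π P') :
    ∃ 𝒢 : GroupoidOver M G, 𝒢.InheritedFrom π r ∧ ∀ x, 𝒢.one x = π (FPath.const F x) := by
  choose out hout using hπ
  have src_eq : ∀ P, (out (π P)).p 0 = P.p 0 := fun P => hs _ _ (hout _)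
  have tgt_eq : ∀ P, (out (π P)).p 1 = P.p 1 := fun P => ht _ _ (hout _)
  let mul : ∀ g h : G, (out g).p 0 = (out h).p 1 → G := fun g h e =>
    π (FPath.concat r (out g) (out h) e.symm)
  have mul_eq : ∀ P Q (h : P.p 1 = Q.p 0) (e : (out (π Q)).p 0 = (out (π P)).p 1),
      mul (π Q) (π P) e = π (FPath.concat r Q P h) := fun P Q h e =>
    hmul _ _ _ _ _ _ (hout _) (hout _)
  have mul_eq' : ∀ g h e P Q (hPQ : P.p 1 = Q.p 0), g = π Q → h = π P →
      mul g h e = π (FPath.concat r Q P hPQ) := by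
    rintro _ _ e P Q hPQ rfl rfl
    exact mul_eq P Q hPQ e
  refine ⟨{
    src := fun g => (out g).p 0
    tgt := fun g => (out g).p 1
    one := fun x => π (FPath.const F x)
    inv := fun g => π ((out g).reverse r)
    mul := mul
    src_one := fun x => src_eq _
    tgt_one := fun x => tgt_eq _
    src_inv := fun g => (src_eq _).trans (FPath.reverse_zero r _)
    tgt_inv := fun g => (tgt_eq _).trans (FPath.reverse_one r _)
    src_mul := fun g h e => (src_eq _).trans (FPath.concat_zero r _ _ _)
    tgt_mul := fun g h e => (tgt_eq _).trans (FPath.concat_one r _ _ _)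
    mul_assoc := fun g h k e e' => ?_
    one_mul := fun g => ?_
    mul_one := fun g => ?_
    inv_mul := fun g => ?_
    mul_inv := fun g => ?_ }, ⟨src_eq, tgt_eq, fun P Q h e => mul_eq P Q h e⟩, fun x => rfl⟩
  · have eQP := e'.symm
    have eRQ := e.symm
    have e1 := eQP.trans (FPath.concat_zero r (out g) (out h) eRQ).symm
    have e2 := (FPath.concat_one r (out h) (out k) eQP).trans eRQ
    have e1' := ((out k).slow_one r).trans e1
    have e2' := e2.trans ((out g).slow_zero r).symm
    have key1 : ∀ e'', mul (mul g h e) k e'' =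
        π (FPath.concat r (FPath.concat r (out g) (out h) eRQ) (out k) e1) := fun e'' =>
      mul_eq' _ _ e'' (out k) (FPath.concat r (out g) (out h) eRQ) e1 rfl (hout k).symm
    have key2 : ∀ e'', mul g (mul h k e') e'' =
        π (FPath.concat r (out g) (FPath.concat r (out h) (out k) eQP) e2) := fun e'' =>
      mul_eq' _ _ e'' (FPath.concat r (out h) (out k) eQP) (out g) e2 (hout g).symm rfl
    refine (key1 (((src_eq _).trans (FPath.concat_zero r _ _ _)).trans e')).trans (Eq.trans ?_
      (key2 (e.trans ((tgt_eq _).trans (FPath.concat_one r _ _ _)).symm)).symm)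
    rw [hmul _ _ _ _ e1 e1' (hh _ _ (FHomotopic.slow r (out k))) rfl,
      hmul _ _ _ _ e2 e2' rfl (hh _ _ (FHomotopic.slow r (out g)))]
    exact (hh _ _ (FHomotopic.triple_left r (out g) (out h) (out k) eQP eRQ e1' e2')).symm
  · refine (mul_eq' _ _ (src_eq _) (out g) (FPath.const F ((out g).p 1)) rfl rfl (hout g).symm).trans ?_
    rw [hh _ _ (FHomotopic.const_concat r (out g) rfl), hout]
  · refine (mul_eq' _ _ (tgt_eq (FPath.const F ((out g).p 0))).symm (FPath.const F ((out g).p 0)) (out g) rfl (hout g).symm rfl).trans ?_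
    rw [hh _ _ (FHomotopic.concat_const r (out g) rfl), hout]
  · have e := (FPath.reverse_zero r (out g)).symm
    refine (mul_eq' _ _ ((src_eq _).trans (FPath.reverse_zero r _)) (out g) ((out g).reverse r) e rfl (hout g).symm).trans ?_
    exact hh _ _ (FHomotopic.reverse_concat r (out g) e)
  · have e := FPath.reverse_one r (out g)
    refine (mul_eq' _ _ ((tgt_eq _).trans (FPath.reverse_one r _)).symm ((out g).reverse r) (out g) e (hout g).symm rfl).trans ?_
    exact hh _ _ (FHomotopic.concat_reverse r (out g) e)

theorem MonGroupoid.exists_groupoidOver (F : SingularFoliation E M) (r : Reparam) :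
    ∃ 𝒢 : GroupoidOver M (MonGroupoid F), 𝒢.InheritedFrom MonGroupoid.mk r ∧
      ∀ x, 𝒢.one x = MonGroupoid.mk (FPath.const F x) := by
  have hind : ∀ {P P' : FPath F}, MonGroupoid.mk P = MonGroupoid.mk P' →
      Relation.EqvGen FHomotopic P P' := fun h => Quot.eqvGen_exact h
  have h0 : ∀ P P' : FPath F, MonGroupoid.mk P = MonGroupoid.mk P' → P.p 0 = P'.p 0 := by
    intro P P' h
    have h' := hind h
    clear h
    induction h' with
    | rel _ _ h => exact h.source_eq
    | refl => rfl
    | symm _ _ h ih => exact ih.symm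
    | trans _ _ _ h h' ih ih' => exact ih.trans ih'
  have h1 : ∀ P P' : FPath F, MonGroupoid.mk P = MonGroupoid.mk P' → P.p 1 = P'.p 1 := by
    intro P P' h
    have h' := hind h
    clear h
    induction h' with
    | rel _ _ h => exact h.target_eq
    | refl => rfl
    | symm _ _ h ih => exact ih.symm
    | trans _ _ _ h h' ih ih' => exact ih.trans ih'
  have hr : ∀ P P' : FPath F, Relation.EqvGen FHomotopic P P' → ∀ Q (h : P.p 1 = Q.p 0)
      (h' : P'.p 1 = Q.p 0), MonGroupoid.mk (FPath.concat r Q P h) =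
        MonGroupoid.mk (FPath.concat r Q P' h') := by
    intro P P' hPP
    induction hPP with
    | rel _ _ hp => exact fun Q h h' => Quot.sound (hp.concat_right r Q h h')
    | refl => exact fun Q h h' => rfl
    | symm _ _ _ ih => exact fun Q h h' => (ih Q h' h).symm
    | trans _ _ _ ha hb ih ih' =>
      exact fun Q h h' => (ih Q h ((h1 _ _ (Quot.eqvGen_sound hb)).trans h')).trans (ih' Q _ h')
  have hl : ∀ Q Q' : FPath F, Relation.EqvGen FHomotopic Q Q' → ∀ P (h : P.p 1 = Q.p 0)
      (h' : P.p 1 = Q'.p 0), MonGroupoid.mk (FPath.concat r Q P h) =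
        MonGroupoid.mk (FPath.concat r Q' P h') := by
    intro Q Q' hQQ
    induction hQQ with
    | rel _ _ hp => exact fun P h h' => Quot.sound (hp.concat_left r P h h')
    | refl => exact fun P h h' => rfl
    | symm _ _ _ ih => exact fun P h h' => (ih P h' h).symm
    | trans _ _ _ ha hb ih ih' =>
      exact fun P h h' => (ih P h (h.trans (h0 _ _ (Quot.eqvGen_sound ha)))).trans (ih' P _ h')
  refine SingFol.exists_groupoidOver Quot.mk_surjective r h0 h1 (fun P P' Q Q' h h' hP hQ => ?_)
    fun P P' h => Quot.sound h
  exact (hr P P' (hind hP) Q h ((h1 _ _ hP).symm.trans h)).trans (hl Q Q' (hind hQ) P' _ h')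

end Groupoid

section InverseFunction

variable {E : Type*} [NormedAddCommGroup E] [NormedSpace ℝ E]
  {H : Type*} [TopologicalSpace H] {I : ModelWithCorners ℝ E H} [I.Boundaryless]
  {N : Type*} [TopologicalSpace N] [ChartedSpace H N] [IsManifold I ∞ N]
  {E' : Type*} [NormedAddCommGroup E'] [NormedSpace ℝ E']
  {H' : Type*} [TopologicalSpace H'] {J : ModelWithCorners ℝ E' H'} [J.Boundaryless]
  {N' : Type*} [TopologicalSpace N'] [ChartedSpace H' N'] [IsManifold J ∞ N']

/-- The inverse function theorem on manifolds. -/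
theorem exists_smooth_inverse_at [CompleteSpace E] [CompleteSpace E'] {f : N → N'} {x : N}
    (hf : ContMDiffAt I J ∞ f x) (hb : Function.Bijective (mfderiv I J f x)) :
    ∃ g : N' → N, ContMDiffAt J I ∞ g (f x) ∧ (∀ᶠ z in 𝓝 x, g (f z) = z) ∧
      ∀ᶠ w in 𝓝 (f x), f (g w) = w := by
  set F := writtenInExtChartAt I J x f with hF
  set a := extChartAt I x x with ha
  have hFa : F a = extChartAt J (f x) (f x) := by simp [hF, ha, writtenInExtChartAt]
  have hFs : ContDiffAt ℝ ∞ F a := by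
    have := (contMDiffAt_iff.1 hf).2
    rwa [I.range_eq_univ, contDiffWithinAt_univ] at this
  have hFd : HasFDerivAt F (mfderiv I J f x : E →L[ℝ] E') a := by
    obtain ⟨L, hL⟩ : ∃ L : E →L[ℝ] E', L = mfderiv I J f x := ⟨_, rfl⟩
    have h1 : HasFDerivWithinAt F L (range I) a := by
      rw [hL]
      exact (hf.mdifferentiableAt (by simp)).hasMFDerivAt.2
    rw [I.range_eq_univ, hasFDerivWithinAt_univ, hL] at h1
    exact h1
  let f' : E ≃L[ℝ] E' := ContinuousLinearEquiv.ofBijective (mfderiv I J f x : E →L[ℝ] E')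
    (LinearMap.ker_eq_bot.2 hb.1) (LinearMap.range_eq_top.2 hb.2)
  have hFd' : HasFDerivAt F (f' : E →L[ℝ] E') a := hFd
  let e := hFs.toOpenPartialHomeomorph F hFd' (by simp)
  have hea : a ∈ e.source := hFs.mem_toOpenPartialHomeomorph_source hFd' (by simp)
  have heF : ∀ z, e z = F z := fun _ => rfl
  have heb : F a ∈ e.target := e.map_source hea
  have hsymm : e.symm (F a) = a := e.left_inv hea
  have hes : ContDiffAt ℝ ∞ e.symm (F a) := by
    refine e.contDiffAt_symm heb (f₀' := f') ?_ ?_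
    · rw [hsymm]
      exact hFd'
    · rw [hsymm]
      exact hFs
  have hc : ContinuousAt f x := hf.continuousAt
  have hx1 : ∀ᶠ z in 𝓝 x, z ∈ (extChartAt I x).source := extChartAt_source_mem_nhds x
  have hx2 : ∀ᶠ z in 𝓝 x, f z ∈ (extChartAt J (f x)).source :=
    hc.eventually (extChartAt_source_mem_nhds (f x))
  have hx3 : ∀ᶠ z in 𝓝 x, extChartAt I x z ∈ e.source :=
    (continuousAt_extChartAt x).eventually (e.open_source.mem_nhds hea)
  have hw1 : ∀ᶠ w in 𝓝 (f x), w ∈ (extChartAt J (f x)).source := extChartAt_source_mem_nhds _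
  have hw2 : ∀ᶠ w in 𝓝 (f x), extChartAt J (f x) w ∈ e.target :=
    (continuousAt_extChartAt (f x)).eventually (e.open_target.mem_nhds (hFa ▸ heb))
  have hcs : ContinuousAt (fun w => e.symm (extChartAt J (f x) w)) (f x) :=
    ContinuousAt.comp (hFa ▸ hes.continuousAt) (continuousAt_extChartAt (f x))
  have hval : e.symm (extChartAt J (f x) (f x)) = a := by rw [← hFa, hsymm]
  have hw3 : ∀ᶠ w in 𝓝 (f x), e.symm (extChartAt J (f x) w) ∈ (extChartAt I x).target := by
    refine hcs.eventually (p := fun v => v ∈ (extChartAt I x).target) ?_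
    simp only [hval]
    exact extChartAt_target_mem_nhds x
  have hgc : ContinuousAt (fun w => (extChartAt I x).symm (e.symm (extChartAt J (f x) w))) (f x) := by
    refine ContinuousAt.comp (g := (extChartAt I x).symm) ?_ hcs
    rw [hval]
    exact continuousAt_extChartAt_symm x
  have hgx : (extChartAt I x).symm (e.symm (extChartAt J (f x) (f x))) = x := by
    rw [hval]
    exact extChartAt_to_inv x
  have hw4 : ∀ᶠ w in 𝓝 (f x), f ((extChartAt I x).symm (e.symm (extChartAt J (f x) w))) ∈
      (extChartAt J (f x)).source := by
    refine hgc.eventually (p := fun z => f z ∈ (extChartAt J (f x)).source) ?_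
    simp only [hgx]
    exact hx2
  refine ⟨fun w => (extChartAt I x).symm (e.symm (extChartAt J (f x) w)), ?_, ?_, ?_⟩
  · have h1 : ContMDiffAt 𝓘(ℝ, E) I ∞ (extChartAt I x).symm a :=
      (contMDiffOn_extChartAt_symm x).contMDiffAt (extChartAt_target_mem_nhds x)
    have h2 : ContMDiffAt 𝓘(ℝ, E') 𝓘(ℝ, E) ∞ e.symm (extChartAt J (f x) (f x)) :=
      (hFa ▸ hes).contMDiffAt
    have h3 : ContMDiffAt J 𝓘(ℝ, E') ∞ (extChartAt J (f x)) (f x) := contMDiffAt_extChartAt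
    have h4 := h2.comp (f x) h3
    exact ContMDiffAt.comp (g := (extChartAt I x).symm) (f x) (by
      simp only [Function.comp_apply, hval]
      exact h1) h4
  · filter_upwards [hx1, hx2, hx3] with z z1 z2 z3
    have : extChartAt J (f x) (f z) = e (extChartAt I x z) := by
      rw [heF, hF]
      simp only [writtenInExtChartAt, Function.comp_apply, (extChartAt I x).left_inv z1]
    rw [this, e.left_inv z3, (extChartAt I x).left_inv z1]
  · filter_upwards [hw1, hw2, hw3, hw4] with w w1 w2 w3 w4
    have h5 := e.right_inv w2
    rw [heF] at h5
    refine (extChartAt J (f x)).injOn w4 w1 ?_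
    exact h5

theorem mfderiv_bijective_of_inverse {f : N → N'} {g : N' → N} {x : N}
    (hf : MDifferentiableAt I J f x) (hg : MDifferentiableAt J I g (f x))
    (h1 : ∀ᶠ z in 𝓝 x, g (f z) = z) (h2 : ∀ᶠ w in 𝓝 (f x), f (g w) = w) :
    Function.Bijective (mfderiv I J f x) := by
  have hgx : g (f x) = x := h1.self_of_nhds
  have hf' : MDifferentiableAt I J f (g (f x)) := by rwa [hgx]
  have e1 : mfderiv I I (g ∘ f) x = mfderiv I I id x :=
    Filter.EventuallyEq.mfderiv_eq (h1 : g ∘ f =ᶠ[𝓝 x] id)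
  have e2 : mfderiv J J (f ∘ g) (f x) = mfderiv J J id (f x) :=
    Filter.EventuallyEq.mfderiv_eq (h2 : f ∘ g =ᶠ[𝓝 (f x)] id)
  rw [mfderiv_comp x hg hf, mfderiv_id] at e1
  rw [mfderiv_comp (f x) hf' hg, mfderiv_id] at e2
  constructor
  · exact Function.LeftInverse.injective (g := mfderiv J I g (f x)) fun v => DFunLike.congr_fun e1 v
  · intro w
    refine ⟨(mfderiv J I g (f x) w : E), ?_⟩
    have e3 : (mfderiv I J f (g (f x)) : E →L[ℝ] E') (mfderiv J I g (f x) w : E) = w :=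
      DFunLike.congr_fun e2 w
    have e4 : (mfderiv I J f (g (f x)) : E →L[ℝ] E') = (mfderiv I J f x : E →L[ℝ] E') := by
      rw [hgx]
    exact (DFunLike.congr_fun e4 _).symm.trans e3

theorem ContMDiffAt.mfderiv_bijective_eventually [CompleteSpace E] [CompleteSpace E'] {f : N → N'}
    {x : N} (hf : ContMDiffAt I J ∞ f x) (hb : Function.Bijective (mfderiv I J f x)) :
    ∀ᶠ z in 𝓝 x, Function.Bijective (mfderiv I J f z) := by
  obtain ⟨g, hg, h1, h2⟩ := exists_smooth_inverse_at hf hb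
  have : IsManifold I 1 N := IsManifold.of_le (n := ∞) (WithTop.coe_le_coe.2 le_top)
  have : IsManifold J 1 N' := IsManifold.of_le (n := ∞) (WithTop.coe_le_coe.2 le_top)
  have hf1 : ∀ᶠ z in 𝓝 x, ContMDiffAt I J 1 f z :=
    (contMDiffAt_iff_contMDiffAt_nhds (by simp)).1 (hf.of_le (WithTop.coe_le_coe.2 le_top))
  have hg1 : ∀ᶠ w in 𝓝 (f x), ContMDiffAt J I 1 g w :=
    (contMDiffAt_iff_contMDiffAt_nhds (by simp)).1 (hg.of_le (WithTop.coe_le_coe.2 le_top))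
  filter_upwards [hf1, hf.continuousAt.eventually hg1, h1.eventually_nhds,
    hf.continuousAt.eventually h2.eventually_nhds] with z z1 z2 z3 z4
  exact mfderiv_bijective_of_inverse (z1.mdifferentiableAt (by simp))
    (z2.mdifferentiableAt (by simp)) z3 z4

/-- A map which is injective on a compact set, with bijective derivatives there, is invertible near
this set. -/
theorem exists_smooth_inverse_near [CompleteSpace E] [CompleteSpace E'] [T2Space N'] [Nonempty N] {f : N → N'}
    {U K : Set N} (hU : IsOpen U) (hf : ContMDiffOn I J ∞ f U) (hK : IsCompact K) (hKU : K ⊆ U)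
    (hinj : InjOn f K) (hb : ∀ x ∈ K, Function.Bijective (mfderiv I J f x)) :
    ∃ (O : Set N) (O' : Set N') (g : N' → N), IsOpen O ∧ K ⊆ O ∧ O ⊆ U ∧ IsOpen O' ∧
      MapsTo f O O' ∧ MapsTo g O' O ∧ ContMDiffOn J I ∞ g O' ∧ (∀ x ∈ O, g (f x) = x) ∧
      ∀ w ∈ O', f (g w) = w := by
  have hat : ∀ x ∈ U, ContMDiffAt I J ∞ f x := fun x hx => hf.contMDiffAt (hU.mem_nhds hx)
  obtain ⟨t, ht, htK⟩ := hinj.exists_mem_nhdsSet hK (fun x hx => (hat x (hKU hx)).continuousAt)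
    fun x hx => by
      obtain ⟨g, -, h1, -⟩ := exists_smooth_inverse_at (hat x (hKU hx)) (hb x hx)
      exact ⟨_, h1, fun a ha b hb h => by
        rw [← show g (f a) = a from ha, ← show g (f b) = b from hb, h]⟩
  have hbK : ∀ᶠ z in 𝓝ˢ K, Function.Bijective (mfderiv I J f z) :=
    eventually_nhdsSet_iff_forall.2 fun x hx =>
      ContMDiffAt.mfderiv_bijective_eventually (hat x (hKU hx)) (hb x hx)
  obtain ⟨O, hO, hKO, hOs⟩ := mem_nhdsSet_iff_exists.1
    (inter_mem (inter_mem ht hbK) (hU.mem_nhdsSet.2 hKU))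
  have hOinj : InjOn f O := htK.mono fun x hx => (hOs hx).1.1
  have hg : ∀ x ∈ O, Function.invFunOn f O (f x) = x := fun x hx => hOinj.leftInvOn_invFunOn hx
  have hloc : ∀ x ∈ O, ∃ g : N' → N, ContMDiffAt J I ∞ g (f x) ∧
      ∀ᶠ w in 𝓝 (f x), g w ∈ O ∧ f (g w) = w := by
    intro x hx
    obtain ⟨g, g1, g2, g3⟩ := exists_smooth_inverse_at (hat x (hOs hx).2) (hOs hx).1.2
    refine ⟨g, g1, Eventually.and (g1.continuousAt.eventually ?_) g3⟩
    rw [g2.self_of_nhds]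
    exact hO.mem_nhds hx
  refine ⟨O, f '' O, Function.invFunOn f O, hO, hKO, fun x hx => (hOs hx).2, ?_,
    mapsTo_image f O, ?_, ?_, hg, ?_⟩
  · rw [isOpen_iff_mem_nhds]
    rintro _ ⟨x, hx, rfl⟩
    obtain ⟨g, -, g2⟩ := hloc x hx
    filter_upwards [g2] with w hw
    exact ⟨g w, hw⟩
  · rintro _ ⟨x, hx, rfl⟩
    rwa [hg x hx]
  · rintro _ ⟨x, hx, rfl⟩
    obtain ⟨g, g1, g2⟩ := hloc x hx
    refine (g1.congr_of_eventuallyEq ?_).contMDiffWithinAt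
    filter_upwards [g2] with w hw
    rw [← hw.2, hg _ hw.1, hw.2]
  · rintro _ ⟨x, hx, rfl⟩
    rw [hg x hx]

/-- An immersion has local smooth retractions. -/
theorem exists_left_inverse_of_isImmersionAt {f : N → N'} {x : N}
    (h : Manifold.IsImmersionAt I J ∞ f x) :
    ∃ g : N' → N, ContMDiffAt J I ∞ g (f x) ∧ ∀ᶠ z in 𝓝 x, g (f z) = z := by
  have hw := h.writtenInCharts
  set d := h.domChart with hd
  set c := h.codChart with hc
  have hdx : x ∈ d.source := h.mem_domChart_source
  have key : ∀ z ∈ d.source, (d.extend I).symm ((h.equiv.symm (c.extend J (f z))).1) = z := by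
    intro z hz
    have h1 : (d.extend I) z ∈ (d.extend I).target :=
      (d.extend I).map_source (by simpa using hz)
    have h2 := hw h1
    simp only [Function.comp_apply, d.extend_left_inv hz] at h2
    rw [h2, ContinuousLinearEquiv.symm_apply_apply]
    exact d.extend_left_inv hz
  refine ⟨fun w => (d.extend I).symm ((h.equiv.symm (c.extend J w)).1), ?_, ?_⟩
  · have h1 : ContMDiffAt J 𝓘(ℝ, E') ∞ (c.extend J) (f x) :=
      c.contMDiffAt_extend h.codChart_mem_maximalAtlas h.mem_codChart_source
    have h2 : ContMDiff 𝓘(ℝ, E') 𝓘(ℝ, E) ∞ (fun w => (h.equiv.symm w).1) :=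
      (contDiff_fst.comp h.equiv.symm.contDiff).contMDiff
    have h3 := h2.contMDiffAt.comp (f x) h1
    have hval : (h.equiv.symm (c.extend J (f x))).1 = d.extend I x := by
      have h1 : (d.extend I) x ∈ (d.extend I).target :=
        (d.extend I).map_source (by simpa using hdx)
      have h2 := hw h1
      simp only [Function.comp_apply, d.extend_left_inv hdx] at h2
      rw [h2, ContinuousLinearEquiv.symm_apply_apply]
    refine ContMDiffAt.comp (g := (d.extend I).symm) (f x) ?_ h3
    simp only [Function.comp_apply, hval]
    have h4 := contMDiffOn_extend_symm (I := I) (n := ∞) h.domChart_mem_maximalAtlas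
    refine h4.contMDiffAt ?_
    have h5 : I '' d.target = (d.extend I).target := by
      rw [I.image_eq, d.extend_target, inter_comm]
    rw [h5]
    have h6 := d.extend_target_mem_nhdsWithin (I := I) hdx
    rwa [I.range_eq_univ, nhdsWithin_univ] at h6
  · filter_upwards [d.open_source.mem_nhds hdx] with z hz using key z hz

theorem mfderiv_injective_of_isImmersionAt {f : N → N'} {x : N}
    (h : Manifold.IsImmersionAt I J ∞ f x) : Function.Injective (mfderiv I J f x) := by
  obtain ⟨g, hg, h1⟩ := exists_left_inverse_of_isImmersionAt h
  have e1 : mfderiv I I (g ∘ f) x = mfderiv I I id x :=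
    Filter.EventuallyEq.mfderiv_eq (h1 : g ∘ f =ᶠ[𝓝 x] id)
  rw [mfderiv_comp x (hg.mdifferentiableAt (by simp)) (h.contMDiffAt.mdifferentiableAt (by simp)),
    mfderiv_id] at e1
  exact Function.LeftInverse.injective (g := mfderiv J I g (f x)) fun v => DFunLike.congr_fun e1 v

end InverseFunction

section Derivatives

variable {E : Type*} [NormedAddCommGroup E] [NormedSpace ℝ E]
  {H : Type*} [TopologicalSpace H] {I : ModelWithCorners ℝ E H}
  {N : Type*} [TopologicalSpace N] [ChartedSpace H N] [IsManifold I ∞ N]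
  {E' : Type*} [NormedAddCommGroup E'] [NormedSpace ℝ E']
  {H' : Type*} [TopologicalSpace H'] {J : ModelWithCorners ℝ E' H'}
  {N' : Type*} [TopologicalSpace N'] [ChartedSpace H' N'] [IsManifold J ∞ N']
  {E'' : Type*} [NormedAddCommGroup E''] [NormedSpace ℝ E'']
  {H'' : Type*} [TopologicalSpace H''] {L : ModelWithCorners ℝ E'' H''}
  {Z : Type*} [TopologicalSpace Z] [ChartedSpace H'' Z]

theorem contMDiffOn_tangent_push {f : N → N'} {O : Set N} (hO : IsOpen O)
    (hf : ContMDiffOn I J ∞ f O) {g : Z → N} {w : Z → E} {s : Set Z}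
    (hw : ContMDiffOn L I.tangent ∞ (fun z => tmk I (g z) (w z)) s) (hg : MapsTo g s O) :
    ContMDiffOn L J.tangent ∞
      (fun z => tmk J (f (g z)) ((mfderiv I J f (g z) : E →L[ℝ] E') (w z))) s := by
  have : IsManifold I 1 N := IsManifold.of_le (n := ∞) (WithTop.coe_le_coe.2 le_top)
  have : IsManifold J 1 N' := IsManifold.of_le (n := ∞) (WithTop.coe_le_coe.2 le_top)
  have h1 := hf.contMDiffOn_tangentMapWithin (m := ∞) (by simp) hO.uniqueMDiffOn
  have h2 := h1.comp hw fun z hz => hg hz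
  refine h2.congr fun z hz => ?_
  exact (tangentMapWithin_eq_tangentMap (p := tmk I (g z) (w z)) (hO.uniqueMDiffOn _ (hg hz))
    ((hf.contMDiffAt (hO.mem_nhds (hg hz))).mdifferentiableAt (by simp))).symm

theorem contMDiffOn_snd_of_tangent {f : Z → E'} {w : Z → E'} {s : Set Z}
    (h : ContMDiffOn L 𝓘(ℝ, E').tangent ∞ (fun z => tmk 𝓘(ℝ, E') (f z) (w z)) s) :
    ContMDiffOn L 𝓘(ℝ, E') ∞ w s := by
  intro x hx
  refine ((contMDiffWithinAt_tangent_iff (I := 𝓘(ℝ, E'))).1 (h x hx)).2.congr (fun y _ => ?_) ?_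
  all_goals
    rw [extChartAt_model_space_eq_id]
    exact (DFunLike.congr_fun (mfderiv_id (I := 𝓘(ℝ, E'))) _).symm

theorem contMDiff_cutoff {ρ : Z → ℝ} (hρ : ContMDiff L 𝓘(ℝ, ℝ) ∞ ρ) {O : Set Z} (hO : IsOpen O)
    (hs : tsupport ρ ⊆ O) {f : Z → ℝ} (hf : ContMDiffOn L 𝓘(ℝ, ℝ) ∞ f O) :
    ContMDiff L 𝓘(ℝ, ℝ) ∞ (fun x => ρ x * f x) := by
  intro y
  by_cases hy : y ∈ O
  · exact hρ.contMDiffAt.mul (hf.contMDiffAt (hO.mem_nhds hy))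
  · refine (contMDiffAt_const (c := (0 : ℝ))).congr_of_eventuallyEq ?_
    filter_upwards [(isClosed_tsupport ρ).isOpen_compl.mem_nhds fun h => hy (hs h)] with z hz
    rw [image_eq_zero_of_notMem_tsupport hz, zero_mul]

end Derivatives

section Mder

variable {E : Type*} [NormedAddCommGroup E] [NormedSpace ℝ E]
  {M : Type*} [TopologicalSpace M] [ChartedSpace E M]
  {E' : Type*} [NormedAddCommGroup E'] [NormedSpace ℝ E']
  {N : Type*} [TopologicalSpace N] [ChartedSpace E' N]
  {E'' : Type*} [NormedAddCommGroup E''] [NormedSpace ℝ E'']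
  {Z : Type*} [TopologicalSpace Z] [ChartedSpace E'' Z]

theorem mder_comp {g : N → Z} {f : M → N} {x : M}
    (hg : MDifferentiableAt 𝓘(ℝ, E') 𝓘(ℝ, E'') g (f x))
    (hf : MDifferentiableAt 𝓘(ℝ, E) 𝓘(ℝ, E') f x) (v : E) :
    mder (E := E) (E' := E'') (fun z => g (f z)) x v =
      mder (E := E') (E' := E'') g (f x) (mder (E := E) (E' := E') f x v) :=
  DFunLike.congr_fun (mfderiv_comp x hg hf) v

theorem mder_congr {f g : M → N} {x : M} (h : f =ᶠ[𝓝 x] g) :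
    mder (E := E) (E' := E') f x = mder (E := E) (E' := E') g x := h.mfderiv_eq

theorem mder_id (x : M) (v : E) : mder (E := E) (E' := E) (fun z : M => z) x v = v :=
  DFunLike.congr_fun (mfderiv_id (I := 𝓘(ℝ, E))) v

theorem mder_const (x : M) (y : N) (v : E) :
    mder (E := E) (E' := E') (fun _ : M => y) x v = 0 :=
  DFunLike.congr_fun (mfderiv_const (I := 𝓘(ℝ, E)) (I' := 𝓘(ℝ, E'))) v

/-- The derivative of a map, in the direction of a curve. -/
theorem HasMFDerivAt.map_curve {g : M → N} {γ : ℝ → M} {t : ℝ} {w : E}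
    (hg : MDifferentiableAt 𝓘(ℝ, E) 𝓘(ℝ, E') g (γ t))
    (h : HasMFDerivAt 𝓘(ℝ, ℝ) 𝓘(ℝ, E) γ t ((1 : ℝ →L[ℝ] ℝ).smulRight w)) :
    HasMFDerivAt 𝓘(ℝ, ℝ) 𝓘(ℝ, E') (fun τ => g (γ τ)) t
      ((1 : ℝ →L[ℝ] ℝ).smulRight (mder (E := E) (E' := E') g (γ t) w)) := by
  refine (hg.hasMFDerivAt.comp t h).congr_mfderiv (ContinuousLinearMap.ext fun (a : ℝ) => ?_)
  exact (mder (E := E) (E' := E') g (γ t)).map_smul a w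

theorem hasMFDerivAt_unique {γ : ℝ → M} {t : ℝ} {w w' : E}
    (h : HasMFDerivAt 𝓘(ℝ, ℝ) 𝓘(ℝ, E) γ t ((1 : ℝ →L[ℝ] ℝ).smulRight w))
    (h' : HasMFDerivAt 𝓘(ℝ, ℝ) 𝓘(ℝ, E) γ t ((1 : ℝ →L[ℝ] ℝ).smulRight w')) : w = w' := by
  have h1 : ((1 : ℝ →L[ℝ] ℝ).smulRight w : ℝ →L[ℝ] E) = (1 : ℝ →L[ℝ] ℝ).smulRight w' :=
    h.mfderiv.symm.trans h'.mfderiv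
  simpa using DFunLike.congr_fun h1 (1 : ℝ)

theorem hasMFDerivAt_line {W : Type*} [NormedAddCommGroup W] [NormedSpace ℝ W] (u m : W) (t : ℝ) :
    HasMFDerivAt 𝓘(ℝ, ℝ) 𝓘(ℝ, W) (fun τ : ℝ => u + τ • m) t ((1 : ℝ →L[ℝ] ℝ).smulRight m) := by
  have h : HasDerivAt (fun τ : ℝ => u + τ • m) m t := by
    simpa using ((hasDerivAt_id t).smul_const m).const_add u
  exact h.hasFDerivAt.hasMFDerivAt

end Mder

section Combination

variable {E : Type*} [NormedAddCommGroup E] [NormedSpace ℝ E]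
  {M : Type*} [TopologicalSpace M] [ChartedSpace E M] [IsManifold 𝓘(ℝ, E) ∞ M]

theorem combVF_smul {n : ℕ} (G : Fin n → VF E M) (a : ℝ) (ξ : Fin n → ℝ) (x : M) :
    combVF G (a • ξ) x = a • combVF G ξ x := by
  simp [combVF, mul_smul, Finset.smul_sum]

theorem combVF_zero {n : ℕ} (G : Fin n → VF E M) (x : M) : combVF G 0 x = 0 := by
  simp [combVF]

theorem combVF_sum {n k : ℕ} (G : Fin n → VF E M) (ξ : Fin k → Fin n → ℝ) (x : M) :
    combVF G (∑ i, ξ i) x = ∑ i, combVF G (ξ i) x := by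
  unfold combVF
  simp only [Finset.sum_apply, Finset.sum_smul]
  rw [Finset.sum_comm]

theorem VFModule.isPlotOn_lcVF (F : VFModule E M) {W : Type*} [NormedAddCommGroup W]
    [NormedSpace ℝ W] {U : Set W} {n : ℕ} {G : Fin n → VF E M} (hG : ∀ i, F.Sec ⊤ (G i))
    {c : Fin n → W × M → ℝ}
    (hc : ∀ i, ContMDiffOn (𝓘(ℝ, W).prod 𝓘(ℝ, E)) 𝓘(ℝ, ℝ) ∞ (c i) (U ×ˢ univ)) :
    F.IsPlotOn U (fun u => lcVF G (fun i x => c i (u, x))) := by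
  refine ⟨fun u hu => F.sec_lcVF hG fun i => ?_, fun u₀ hu₀ x₀ => ⟨univ, ⊤, isOpen_univ, trivial,
    trivial, n, c, G, fun i => ?_, hG, fun u hu x hx => rfl⟩⟩
  · exact (hc i).comp (contMDiff_const.prodMk contMDiff_id).contMDiffOn fun x _ => ⟨hu, trivial⟩
  · exact (hc i).mono (prod_mono inter_subset_left (subset_univ _))

end Combination

/-! ### Splitting off the leaf directions along a transversal -/

section Splitting

variable {E : Type*} [NormedAddCommGroup E] [NormedSpace ℝ E]
  {M : Type*} [TopologicalSpace M] [ChartedSpace E M] [IsManifold 𝓘(ℝ, E) ∞ M]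
  {E' : Type*} [NormedAddCommGroup E'] [NormedSpace ℝ E']
  {B : Type*} [TopologicalSpace B] [ChartedSpace E' B] [IsManifold 𝓘(ℝ, E') ∞ B]

variable (E') in
/-- Coordinates `Ψ : B × ℝᵏ → M` near a point of a transversal `ι : B → M`, in which the coordinate
fields of the factor `ℝᵏ` are elements of the foliation. -/
structure Splitting (F : SingularFoliation E M) (ι : B → M) (b₀ : B) where
  k : ℕ
  Ψ : B → (Fin k → ℝ) → M
  π : M → B
  υ : M → Fin k → ℝ
  D : Fin k → VF E M
  O : Opens M
  Q : Opens B
  ε : ℝ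
  ε_pos : 0 < ε
  base_mem : b₀ ∈ Q
  Ψ_smooth : ContMDiff (𝓘(ℝ, E').prod 𝓘(ℝ, Fin k → ℝ)) 𝓘(ℝ, E) ∞
    (fun z : B × (Fin k → ℝ) => Ψ z.1 z.2)
  Ψ_zero : ∀ b, Ψ b 0 = ι b
  π_smooth : ContMDiffOn 𝓘(ℝ, E) 𝓘(ℝ, E') ∞ π O
  υ_smooth : ContMDiffOn 𝓘(ℝ, E) 𝓘(ℝ, Fin k → ℝ) ∞ υ O
  Ψ_mem : ∀ b ∈ Q, ∀ u ∈ Metric.ball 0 ε, Ψ b u ∈ O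
  π_Ψ : ∀ b ∈ Q, ∀ u ∈ Metric.ball 0 ε, π (Ψ b u) = b
  υ_Ψ : ∀ b ∈ Q, ∀ u ∈ Metric.ball 0 ε, υ (Ψ b u) = u
  π_mem : ∀ x ∈ O, π x ∈ Q
  υ_mem : ∀ x ∈ O, υ x ∈ Metric.ball 0 ε
  Ψ_π : ∀ x ∈ O, Ψ (π x) (υ x) = x
  D_sec : ∀ i, F.Sec ⊤ (D i)
  Ψ_deriv : ∀ b ∈ Q, ∀ u ∈ Metric.ball 0 ε, ∀ m,
    mder (E := Fin k → ℝ) (E' := E) (Ψ b) u m = combVF D m (Ψ b u)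
  leaf : ∀ X, F.Sec ⊤ X → ∃ m, vfVal X (ι b₀) = combVF D m (ι b₀)

theorem IsFlowOf.scale [T2Space M] {k : ℕ} {X : Fin k → VF E M} {χ : M → ℝ}
    {Φ : ℝ → (Fin k → ℝ) → M → M}
    (h : IsFlowOf 0 (cut χ fun u => lcVF X fun i _ => u i) Φ) (s : ℝ) (m : Fin k → ℝ) (x : M) :
    Φ 1 (s • m) x = Φ s m x := by
  have h1 := h.eq_of_hasMFDerivAt (p := s • m) (γ := fun τ => Φ (s * τ) m x) (a := -1) (b := 2)
    (t := 1) (fun t _ => ?_) (by norm_num) (by norm_num)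
  · simpa [h.zero] using h1
  · have h2 := hasMFDerivAt_comp_hasDerivAt (γ := fun τ => Φ τ m x) (ψ := fun τ => s * τ) (d := s)
      (t := t) (w := vfVal (cut χ (fun u => lcVF X fun i _ => u i) (m + (s * t) • 0))
        (Φ (s * t) m x)) (h.ode (s * t) m x) (by simpa using (hasDerivAt_id t).const_mul s)
    have h3 : vfVal (cut χ (fun u => lcVF X fun i _ => u i) (s • m + t • 0)) (Φ (s * t) m x) =
        s • vfVal (cut χ (fun u => lcVF X fun i _ => u i) (m + (s * t) • 0)) (Φ (s * t) m x) := by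
      change χ _ • combVF X (s • m + t • 0) _ = s • χ _ • combVF X (m + (s * t) • 0) _
      rw [smul_zero, smul_zero, add_zero, add_zero, combVF_smul, smul_comm]
    rw [← h3] at h2
    exact h2

theorem FlowData.mder_param {P : Type*} [NormedAddCommGroup P] [NormedSpace ℝ P]
    {F : SingularFoliation E M} {K : Set M} {e : P} {X : P → VF E M} (D : FlowData F K e X) (t : ℝ)
    (p : P) (x : M) (m : P) :
    mder (E := P) (E' := E) (fun q => D.Φ t q x) p m =
      combVF D.G (D.R t p x (0, m)) (D.Φ t p x) := by
  have h0 : ContMDiff (𝓘(ℝ, P).prod 𝓘(ℝ, E)) 𝓘(ℝ, E) ∞ (fun z : P × M => D.Φ t z.1 z.2) :=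
    D.Φ_smooth.comp (contMDiff_const.prodMk contMDiff_id)
  have h1 : MDifferentiableAt (𝓘(ℝ, P).prod 𝓘(ℝ, E)) 𝓘(ℝ, E) (fun z : P × M => D.Φ t z.1 z.2)
    (p, x) := h0.mdifferentiableAt (by simp)
  have h2 : MDifferentiableAt 𝓘(ℝ, P) (𝓘(ℝ, P).prod 𝓘(ℝ, E)) (fun q : P => (q, x)) p :=
    (contMDiff_id.prodMk contMDiff_const : ContMDiff 𝓘(ℝ, P) (𝓘(ℝ, P).prod 𝓘(ℝ, E)) ∞
      (fun q : P => (q, x))).mdifferentiableAt (by simp)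
  have h3 := mfderiv_comp p h1 h2
  have h4 : (mfderiv 𝓘(ℝ, P) (𝓘(ℝ, P).prod 𝓘(ℝ, E)) (fun q : P => (q, x)) p : P →L[ℝ] P × E) =
      ContinuousLinearMap.inl ℝ P E := mfderiv_prod_left
  have h5 := D.Φ_push t p x (0, m)
  refine Eq.trans ?_ h5
  refine (DFunLike.congr_fun h3 m).trans ?_
  refine congrArg (mfderiv (𝓘(ℝ, P).prod 𝓘(ℝ, E)) 𝓘(ℝ, E) (fun z : P × M => D.Φ t z.1 z.2) (p, x) :
    P × E →L[ℝ] E) ((DFunLike.congr_fun h4 m).trans ?_)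
  exact Prod.ext rfl (combVF_zero D.G x).symm

theorem mder_prod {P : Type*} [NormedAddCommGroup P] [NormedSpace ℝ P] {f : B → P → M}
    (hf : ContMDiff (𝓘(ℝ, E').prod 𝓘(ℝ, P)) 𝓘(ℝ, E) ∞ (fun z : B × P => f z.1 z.2)) (b : B) (u : P)
    (v : E') (m : P) :
    (mfderiv (𝓘(ℝ, E').prod 𝓘(ℝ, P)) 𝓘(ℝ, E) (fun z : B × P => f z.1 z.2) (b, u) :
      E' × P →L[ℝ] E) (v, m) =
      mder (E := E') (E' := E) (fun b => f b u) b v + mder (E := P) (E' := E) (f b) u m :=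
  mfderiv_prod_eq_add_apply (v := ((v, m) : E' × P)) (hf.mdifferentiableAt (by simp))

theorem exists_splitting [FiniteDimensional ℝ E] [FiniteDimensional ℝ E'] [T2Space M]
    [SecondCountableTopology M] (F : SingularFoliation E M) {ι : B → M}
    (hι : ContMDiff 𝓘(ℝ, E') 𝓘(ℝ, E) ∞ ι) {b₀ : B}
    (hinj : Function.Injective (mder (E := E') (E' := E) ι b₀))
    (htr : ∀ w : E, ∃ (v : E') (X : VF E M), F.Sec ⊤ X ∧ w = mder (E := E') (E' := E) ι b₀ v + vfVal X (ι b₀))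
    (hdj : ∀ (v : E') (X : VF E M), F.Sec ⊤ X → mder (E := E') (E' := E) ι b₀ v = vfVal X (ι b₀) →
      mder (E := E') (E' := E) ι b₀ v = 0) :
    Nonempty (Splitting E' F ι b₀) := by
  have : FiniteDimensional ℝ (TangentSpace 𝓘(ℝ, E) (ι b₀)) :=
    inferInstanceAs (FiniteDimensional ℝ E)
  set y := ι b₀ with hy
  set k := Module.finrank ℝ (F.leafTangent y) with hk
  let bas := Module.finBasis ℝ (F.leafTangent y)
  choose X hXs hX using fun i => (bas i).2
  have hcombX : ∀ m : Fin k → ℝ, combVF X m y = ((∑ i, m i • bas i : F.leafTangent y) :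
      TangentSpace 𝓘(ℝ, E) y) := by
    intro m
    rw [Submodule.coe_sum]
    exact Finset.sum_congr rfl fun i _ => congrArg (fun w : E => m i • w) (hX i)
  have hspan : ∀ Z, F.Sec ⊤ Z → ∃ m : Fin k → ℝ, vfVal Z y = combVF X m y := by
    intro Z hZ
    let z : F.leafTangent y := ⟨Z y, Z, hZ, rfl⟩
    refine ⟨bas.repr z, ?_⟩
    rw [hcombX, bas.sum_repr]
    rfl
  have hindep : ∀ m : Fin k → ℝ, combVF X m y = 0 → m = 0 := by
    intro m hm
    have h1 : (∑ i, m i • bas i : F.leafTangent y) = 0 := by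
      ext
      exact (hcombX m).symm.trans hm
    funext i
    exact Fintype.linearIndependent_iff.1 bas.linearIndependent m h1 i
  have hV : F.IsPlotOn univ (fun u : Fin k → ℝ => lcVF X fun i _ => u i) :=
    F.isPlotOn_lcVF hXs (c := fun i (z : (Fin k → ℝ) × M) => z.1 i) fun i =>
      (contMDiff_pi_space.1 (contMDiff_fst (I := 𝓘(ℝ, Fin k → ℝ)) (J := 𝓘(ℝ, E))) i).contMDiffOn
  obtain ⟨A⟩ := exists_flowData (isCompact_singleton (x := y)) 0 hV
  have hfl := A.isFlowOf hV
  have hyO : y ∈ A.O := A.subset rfl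
  let Ψ : B → (Fin k → ℝ) → M := fun b u => A.Φ 1 u (ι b)
  have hΨ : ContMDiff (𝓘(ℝ, E').prod 𝓘(ℝ, Fin k → ℝ)) 𝓘(ℝ, E) ∞
      (fun z : B × (Fin k → ℝ) => Ψ z.1 z.2) :=
    A.Φ_smooth.comp (contMDiff_const.prodMk (contMDiff_snd.prodMk (hι.comp contMDiff_fst)))
  have hΨ0 : ∀ b, Ψ b 0 = ι b := fun b => by
    have := hfl.scale 0 0 (ι b)
    rw [zero_smul, hfl.zero] at this
    exact this
  have hd0 : ∀ m, mder (E := Fin k → ℝ) (E' := E) (Ψ b₀) 0 m = combVF X m y := by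
    intro m
    have hs : MDifferentiableAt 𝓘(ℝ, Fin k → ℝ) 𝓘(ℝ, E) (Ψ b₀) (0 + (0 : ℝ) • m) :=
      (hΨ.comp (contMDiff_const.prodMk contMDiff_id)).mdifferentiableAt (by simp)
    have h1 := HasMFDerivAt.map_curve (E := Fin k → ℝ) (E' := E) (g := Ψ b₀) hs
      (hasMFDerivAt_line 0 m 0)
    have h2 := A.Φ_deriv 0 m y
    have h3 : (fun τ : ℝ => Ψ b₀ (0 + τ • m)) = fun τ => A.Φ τ m y := by
      funext τ
      rw [zero_add]
      exact hfl.scale τ m y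
    rw [h3] at h1
    have h4 := hasMFDerivAt_unique (E := E) (w' := A.χ (A.Φ 0 m y) •
      vfVal (lcVF X fun i _ => (m + (0 : ℝ) • (0 : Fin k → ℝ)) i) (A.Φ 0 m y)) h1 h2
    rw [zero_smul, add_zero] at h4
    rw [h4, A.Φ_zero, A.one y hyO, one_smul, zero_smul, add_zero]
    rfl
  have hfull : ∀ v m, (mfderiv (𝓘(ℝ, E').prod 𝓘(ℝ, Fin k → ℝ)) 𝓘(ℝ, E)
      (fun z : B × (Fin k → ℝ) => Ψ z.1 z.2) (b₀, 0) : E' × (Fin k → ℝ) →L[ℝ] E) (v, m) =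
      mder (E := E') (E' := E) ι b₀ v + combVF X m y := by
    intro v m
    rw [mder_prod hΨ, hd0]
    have : (fun b => Ψ b 0) = ι := funext hΨ0
    rw [this]
  have hbij : Function.Bijective (mfderiv (𝓘(ℝ, E').prod 𝓘(ℝ, Fin k → ℝ)) 𝓘(ℝ, E)
      (fun z : B × (Fin k → ℝ) => Ψ z.1 z.2) (b₀, 0)) := by
    let T : E' × (Fin k → ℝ) →L[ℝ] E := mfderiv (𝓘(ℝ, E').prod 𝓘(ℝ, Fin k → ℝ)) 𝓘(ℝ, E)
      (fun z : B × (Fin k → ℝ) => Ψ z.1 z.2) (b₀, 0)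
    have hT : ∀ v m, T (v, m) = mder (E := E') (E' := E) ι b₀ v + combVF X m y := hfull
    suffices h : Function.Bijective T from h
    constructor
    · refine (injective_iff_map_eq_zero T).2 ?_
      rintro ⟨v, m⟩ h0
      rw [hT] at h0
      have h1 := eq_neg_of_add_eq_zero_left h0
      have h2 : mder (E := E') (E' := E) ι b₀ v = 0 := by
        refine hdj v (lcVF X fun i _ => (-m) i) (F.sec_lcVF hXs fun i => contMDiffOn_const) ?_
        rw [h1]
        change _ = combVF X (-m) y
        rw [← neg_one_smul ℝ m, combVF_smul, neg_one_smul]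
      have h3 : v = 0 := hinj (h2.trans (map_zero _).symm)
      rw [h2, zero_add] at h0
      rw [h3, hindep m h0]
      rfl
    · intro w
      obtain ⟨v, Z, hZ, hw⟩ := htr w
      obtain ⟨m, hm⟩ := hspan Z hZ
      exact ⟨(v, m), by rw [hT, hw, hm]⟩
  have : Nonempty (B × (Fin k → ℝ)) := ⟨(b₀, 0)⟩
  obtain ⟨O₀, O₁, g, hO₀, h0O₀, -, hO₁, hmap, hmap', hg, hgl, hgr⟩ :=
    exists_smooth_inverse_near (I := 𝓘(ℝ, E').prod 𝓘(ℝ, Fin k → ℝ)) (J := 𝓘(ℝ, E)) isOpen_univ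
      hΨ.contMDiffOn (isCompact_singleton (x := (b₀, (0 : Fin k → ℝ)))) (subset_univ _)
      (injOn_singleton _ _) (by rintro x rfl; exact hbij)
  have hyO₁ : y ∈ O₁ := by
    have := hmap (h0O₀ rfl)
    simpa only [hΨ0] using this
  obtain ⟨ρ, r1, -, r3, V, r4, -, r6⟩ := exists_bump (E := E) (hO₁.mem_nhds hyO₁)
  have hπ : ContMDiffOn 𝓘(ℝ, E) 𝓘(ℝ, E') ∞ (fun x => (g x).1) O₁ :=
    contMDiff_fst.comp_contMDiffOn hg
  have hυ : ContMDiffOn 𝓘(ℝ, E) 𝓘(ℝ, Fin k → ℝ) ∞ (fun x => (g x).2) O₁ :=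
    contMDiff_snd.comp_contMDiffOn hg
  let a : M → ((Fin A.n → ℝ) × (Fin k → ℝ)) →L[ℝ] (Fin A.n → ℝ) :=
    fun x => A.R 1 (g x).2 (ι (g x).1)
  have ha : ContMDiffOn 𝓘(ℝ, E) 𝓘(ℝ, ((Fin A.n → ℝ) × (Fin k → ℝ)) →L[ℝ] (Fin A.n → ℝ)) ∞ a O₁ :=
    A.R_smooth.comp_contMDiffOn (contMDiffOn_const.prodMk (hυ.prodMk (hι.comp_contMDiffOn hπ)))
  let D : Fin k → VF E M := fun i =>
    lcVF A.G (fun j x => ρ x * a x (0, Pi.single i 1) j)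
  have hDcomb : ∀ m, ∀ x ∈ V, combVF D m x = combVF A.G (a x (0, m)) x := by
    intro m x hx
    have h1 : ((0, m) : (Fin A.n → ℝ) × (Fin k → ℝ)) =
        ∑ i, m i • ((0, Pi.single i 1) : (Fin A.n → ℝ) × (Fin k → ℝ)) := by
      refine Prod.ext ?_ ?_
      · simp [Prod.fst_sum]
      · simp only [Prod.snd_sum, Prod.smul_snd]
        exact pi_eq_sum_univ' m
    rw [h1, map_sum, combVF_sum]
    unfold combVF
    refine Finset.sum_congr rfl fun i _ => ?_
    change m i • ∑ j, (ρ x * a x (0, Pi.single i 1) j) • vfVal (A.G j) x = _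
    simp only [r6 x hx, one_mul, map_smul, Pi.smul_apply, smul_eq_mul, mul_smul, Finset.smul_sum]
  have hsmall : ∀ᶠ z in 𝓝 (b₀, (0 : Fin k → ℝ)), z ∈ O₀ ∧ Ψ z.1 z.2 ∈ V := by
    refine Filter.Eventually.and (hO₀.mem_nhds (h0O₀ rfl))
      (hΨ.continuous.continuousAt.eventually (p := fun x => x ∈ V) ?_)
    simp only [hΨ0]
    exact V.isOpen.mem_nhds r4
  obtain ⟨Q, T, hQ, hbQ, hT, h0T, hQT⟩ := mem_nhds_prod_iff'.1 hsmall
  obtain ⟨ε, hε, hεT⟩ := Metric.isOpen_iff.1 hT 0 h0T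
  have hin : ∀ b ∈ Q, ∀ u ∈ Metric.ball (0 : Fin k → ℝ) ε, (b, u) ∈ O₀ ∧ Ψ b u ∈ V :=
    fun b hb u hu => hQT (mk_mem_prod hb (hεT hu))
  have hgi : ∀ b ∈ Q, ∀ u ∈ Metric.ball (0 : Fin k → ℝ) ε, g (Ψ b u) = (b, u) :=
    fun b hb u hu => hgl _ (hin b hb u hu).1
  have hOo : IsOpen (O₁ ∩ g ⁻¹' (Q ×ˢ Metric.ball 0 ε)) :=
    hg.continuousOn.isOpen_inter_preimage hO₁ (hQ.prod Metric.isOpen_ball)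
  refine ⟨{
    k := k
    Ψ := Ψ
    π := fun x => (g x).1
    υ := fun x => (g x).2
    D := D
    O := ⟨_, hOo⟩
    Q := ⟨Q, hQ⟩
    ε := ε
    ε_pos := hε
    base_mem := hbQ
    Ψ_smooth := hΨ
    Ψ_zero := hΨ0
    π_smooth := hπ.mono inter_subset_left
    υ_smooth := hυ.mono inter_subset_left
    Ψ_mem := fun b hb u hu => ⟨hmap (hin b hb u hu).1, ?_⟩
    π_Ψ := fun b hb u hu => by rw [hgi b hb u hu]
    υ_Ψ := fun b hb u hu => by rw [hgi b hb u hu]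
    π_mem := fun x hx => hx.2.1
    υ_mem := fun x hx => hx.2.2
    Ψ_π := fun x hx => hgr x hx.1
    D_sec := fun i => F.sec_lcVF A.sec fun j => ?_
    Ψ_deriv := fun b hb u hu m => ?_
    leaf := fun Z hZ => ?_ }⟩
  · rw [mem_preimage, hgi b hb u hu]
    exact ⟨hb, hu⟩
  · exact (contMDiff_cutoff r1 hO₁ r3
      (contMDiffOn_pi_space.1 (ha.clm_apply contMDiffOn_const) j)).contMDiffOn
  · rw [hDcomb m _ (hin b hb u hu).2]
    refine (A.mder_param 1 u (ι b) m).trans ?_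
    change _ = combVF A.G (A.R 1 (g (Ψ b u)).2 (ι (g (Ψ b u)).1) (0, m)) (Ψ b u)
    rw [hgi b hb u hu]
  · obtain ⟨m, hm⟩ := hspan Z hZ
    refine ⟨m, ?_⟩
    rw [hm, ← hd0 m]
    have h1 := A.mder_param 1 0 y m
    have h2 : Ψ b₀ 0 ∈ V := (hin b₀ hbQ 0 (Metric.mem_ball_self hε)).2
    have h3 := hDcomb m _ h2
    have h4 : a (Ψ b₀ 0) = A.R 1 0 y := by
      change A.R 1 (g (Ψ b₀ 0)).2 (ι (g (Ψ b₀ 0)).1) = _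
      rw [hgi b₀ hbQ 0 (Metric.mem_ball_self hε)]
    rw [h4] at h3
    have h5 : Ψ b₀ 0 = y := hΨ0 b₀
    exact h1.trans (h3.symm.trans (congrArg (combVF D m) h5))

end Splitting

section Projection

variable {E : Type*} [NormedAddCommGroup E] [NormedSpace ℝ E]
  {M : Type*} [TopologicalSpace M] [ChartedSpace E M] [IsManifold 𝓘(ℝ, E) ∞ M]
  {E' : Type*} [NormedAddCommGroup E'] [NormedSpace ℝ E']
  {B : Type*} [TopologicalSpace B] [ChartedSpace E' B] [IsManifold 𝓘(ℝ, E') ∞ B]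
  {F : SingularFoliation E M} {ι : B → M} {b₀ : B}

namespace Splitting

theorem zero_mem_ball (A : Splitting E' F ι b₀) : (0 : Fin A.k → ℝ) ∈ Metric.ball 0 A.ε :=
  Metric.mem_ball_self A.ε_pos

theorem ι_mem (A : Splitting E' F ι b₀) {b : B} (hb : b ∈ A.Q) : ι b ∈ A.O :=
  A.Ψ_zero b ▸ A.Ψ_mem b hb 0 A.zero_mem_ball

theorem base_mem_O (A : Splitting E' F ι b₀) : ι b₀ ∈ A.O := A.ι_mem A.base_mem

theorem π_ι (A : Splitting E' F ι b₀) {b : B} (hb : b ∈ A.Q) : A.π (ι b) = b := by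
  rw [← A.Ψ_zero b, A.π_Ψ b hb 0 A.zero_mem_ball]

theorem υ_ι (A : Splitting E' F ι b₀) {b : B} (hb : b ∈ A.Q) : A.υ (ι b) = 0 := by
  rw [← A.Ψ_zero b, A.υ_Ψ b hb 0 A.zero_mem_ball]

theorem ι_smooth (A : Splitting E' F ι b₀) : ContMDiff 𝓘(ℝ, E') 𝓘(ℝ, E) ∞ ι := by
  have h : ContMDiff 𝓘(ℝ, E') 𝓘(ℝ, E) ∞ (fun b => A.Ψ b 0) :=
    A.Ψ_smooth.comp (contMDiff_id.prodMk contMDiff_const)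
  rwa [funext A.Ψ_zero] at h

theorem Ψ_smooth_right (A : Splitting E' F ι b₀) (b : B) :
    ContMDiff 𝓘(ℝ, Fin A.k → ℝ) 𝓘(ℝ, E) ∞ (A.Ψ b) :=
  A.Ψ_smooth.comp (contMDiff_const.prodMk contMDiff_id)

theorem π_contMDiffAt (A : Splitting E' F ι b₀) {x : M} (hx : x ∈ A.O) :
    ContMDiffAt 𝓘(ℝ, E) 𝓘(ℝ, E') ∞ A.π x := A.π_smooth.contMDiffAt (A.O.isOpen.mem_nhds hx)

theorem υ_contMDiffAt (A : Splitting E' F ι b₀) {x : M} (hx : x ∈ A.O) :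
    ContMDiffAt 𝓘(ℝ, E) 𝓘(ℝ, Fin A.k → ℝ) ∞ A.υ x :=
  A.υ_smooth.contMDiffAt (A.O.isOpen.mem_nhds hx)

theorem π_mdifferentiableAt (A : Splitting E' F ι b₀) {x : M} (hx : x ∈ A.O) :
    MDifferentiableAt 𝓘(ℝ, E) 𝓘(ℝ, E') A.π x := (A.π_contMDiffAt hx).mdifferentiableAt (by simp)

theorem υ_mdifferentiableAt (A : Splitting E' F ι b₀) {x : M} (hx : x ∈ A.O) :
    MDifferentiableAt 𝓘(ℝ, E) 𝓘(ℝ, Fin A.k → ℝ) A.υ x :=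
  (A.υ_contMDiffAt hx).mdifferentiableAt (by simp)

theorem mder_π_ι (A : Splitting E' F ι b₀) {b : B} (hb : b ∈ A.Q) (v : E') :
    mder (E := E) (E' := E') A.π (ι b) (mder (E := E') (E' := E) ι b v) = v := by
  rw [← mder_comp (A.π_mdifferentiableAt (A.ι_mem hb)) (A.ι_smooth.mdifferentiableAt (by simp)),
    mder_congr (g := fun z => z) ?_, mder_id]
  filter_upwards [A.Q.isOpen.mem_nhds hb] with z hz using A.π_ι hz

theorem decomp (A : Splitting E' F ι b₀) {b : B} (hb : b ∈ A.Q) (w : E) :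
    w = mder (E := E') (E' := E) ι b (mder (E := E) (E' := E') A.π (ι b) w) +
      combVF A.D (mder (E := E) (E' := Fin A.k → ℝ) A.υ (ι b) w) (ι b) := by
  have hO := A.ι_mem hb
  have h1 : MDifferentiableAt 𝓘(ℝ, E) (𝓘(ℝ, E').prod 𝓘(ℝ, Fin A.k → ℝ))
      (fun x => (A.π x, A.υ x)) (ι b) := (A.π_mdifferentiableAt hO).prodMk (A.υ_mdifferentiableAt hO)
  have h2 : MDifferentiableAt (𝓘(ℝ, E').prod 𝓘(ℝ, Fin A.k → ℝ)) 𝓘(ℝ, E)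
      (fun z : B × (Fin A.k → ℝ) => A.Ψ z.1 z.2) (A.π (ι b), A.υ (ι b)) :=
    A.Ψ_smooth.mdifferentiableAt (by simp)
  have h3 := mfderiv_comp (ι b) h2 h1
  have h4 : mder (E := E) (E' := E) (fun x => A.Ψ (A.π x) (A.υ x)) (ι b) w = w := by
    rw [mder_congr (g := fun z => z) ?_, mder_id]
    filter_upwards [A.O.isOpen.mem_nhds hO] with z hz using A.Ψ_π z hz
  have h5 : (mfderiv 𝓘(ℝ, E) (𝓘(ℝ, E').prod 𝓘(ℝ, Fin A.k → ℝ)) (fun x => (A.π x, A.υ x)) (ι b) :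
      E →L[ℝ] E' × (Fin A.k → ℝ)) w = (mder (E := E) (E' := E') A.π (ι b) w,
        mder (E := E) (E' := Fin A.k → ℝ) A.υ (ι b) w) :=
    DFunLike.congr_fun ((A.π_mdifferentiableAt hO).mfderiv_prod (A.υ_mdifferentiableAt hO)) w
  have h6 := DFunLike.congr_fun h3 w
  refine h4.symm.trans (h6.trans ?_)
  refine (congrArg (mfderiv (𝓘(ℝ, E').prod 𝓘(ℝ, Fin A.k → ℝ)) 𝓘(ℝ, E)
    (fun z : B × (Fin A.k → ℝ) => A.Ψ z.1 z.2) (A.π (ι b), A.υ (ι b)) :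
      E' × (Fin A.k → ℝ) →L[ℝ] E) h5).trans ?_
  refine (mder_prod A.Ψ_smooth _ _ _ _).trans ?_
  rw [A.π_ι hb, A.υ_ι hb, A.Ψ_deriv b hb 0 A.zero_mem_ball, A.Ψ_zero, funext A.Ψ_zero]

theorem mder_π_leaf (A : Splitting E' F ι b₀) {X : VF E M} (hX : F.Sec ⊤ X) :
    mder (E := E) (E' := E') A.π (ι b₀) (vfVal X (ι b₀)) = 0 := by
  obtain ⟨m, hm⟩ := A.leaf X hX
  rw [hm, ← A.Ψ_zero b₀, ← A.Ψ_deriv b₀ A.base_mem 0 A.zero_mem_ball,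
    ← mder_comp (A.π_mdifferentiableAt (A.Ψ_mem _ A.base_mem _ A.zero_mem_ball))
      ((A.Ψ_smooth_right b₀).mdifferentiableAt (by simp)), mder_congr (g := fun _ => b₀) ?_,
    mder_const]
  filter_upwards [Metric.ball_mem_nhds 0 A.ε_pos] with u hu using A.π_Ψ b₀ A.base_mem u hu

theorem exists_of_mder_π_eq_zero (A : Splitting E' F ι b₀) {w : E}
    (hw : mder (E := E) (E' := E') A.π (ι b₀) w = 0) : ∃ X, F.Sec ⊤ X ∧ vfVal X (ι b₀) = w := by
  refine ⟨lcVF A.D fun i _ => mder (E := E) (E' := Fin A.k → ℝ) A.υ (ι b₀) w i,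
    F.sec_lcVF A.D_sec fun i => contMDiffOn_const, ?_⟩
  have h := A.decomp A.base_mem w
  rw [hw, map_zero, zero_add] at h
  exact h.symm

/-- The motion along the fibres of the projection. -/
theorem hasMFDerivAt_line (A : Splitting E' F ι b₀) {b : B} (hb : b ∈ A.Q) {u m : Fin A.k → ℝ}
    {t : ℝ} (ht : u + t • m ∈ Metric.ball 0 A.ε) :
    HasMFDerivAt 𝓘(ℝ, ℝ) 𝓘(ℝ, E) (fun τ : ℝ => A.Ψ b (u + τ • m)) t
      ((1 : ℝ →L[ℝ] ℝ).smulRight (combVF (E := E) A.D m (A.Ψ b (u + t • m)))) := by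
  rw [← A.Ψ_deriv b hb _ ht]
  exact HasMFDerivAt.map_curve (E := Fin A.k → ℝ) (E' := E) (g := A.Ψ b)
    ((A.Ψ_smooth_right b).mdifferentiableAt (by simp)) (SingFol.hasMFDerivAt_line u m t)

theorem lin_plot (A : Splitting E' F ι b₀) :
    F.IsPlotOn univ (fun u : Fin A.k → ℝ => lcVF A.D fun i _ => u i) :=
  F.isPlotOn_lcVF A.D_sec (c := fun i (z : (Fin A.k → ℝ) × M) => z.1 i) fun i =>
    (contMDiff_pi_space.1 (contMDiff_fst (I := 𝓘(ℝ, Fin A.k → ℝ)) (J := 𝓘(ℝ, E))) i).contMDiffOn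

theorem exists_flow_fibre [T2Space M] (A : Splitting E' F ι b₀)
    (D : FlowData F {ι b₀} (0 : Fin A.k → ℝ) (fun u : Fin A.k → ℝ => lcVF A.D fun i _ => u i)) :
    ∃ (O : Opens M) (δ : ℝ), 0 < δ ∧ ι b₀ ∈ O ∧ O ≤ A.O ∧ (∀ x ∈ O, A.υ x ∈ Metric.ball 0 δ) ∧
      ∀ x ∈ O, ∀ m ∈ Metric.ball 0 δ, A.υ x + m ∈ Metric.ball 0 A.ε ∧
        D.Φ 1 m x = A.Ψ (A.π x) (A.υ x + m) := by
  have hfl := D.isFlowOf A.lin_plot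
  have hsm : ∀ᶠ z in 𝓝 (b₀, (0 : Fin A.k → ℝ)), z.1 ∈ A.Q ∧ A.Ψ z.1 z.2 ∈ D.O := by
    refine Filter.Eventually.and (continuous_fst.continuousAt.eventually
      (p := fun b => b ∈ A.Q) (A.Q.isOpen.mem_nhds A.base_mem))
      (A.Ψ_smooth.continuous.continuousAt.eventually (p := fun x => x ∈ D.O) ?_)
    simp only [A.Ψ_zero]
    exact D.O.isOpen.mem_nhds (D.subset rfl)
  obtain ⟨Q, T, hQ, hbQ, hT, h0T, hQT⟩ := mem_nhds_prod_iff'.1 hsm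
  obtain ⟨ε', hε', hεT⟩ := Metric.isOpen_iff.1 hT 0 h0T
  set η := min ε' A.ε with hη
  have hηp : 0 < η := lt_min hε' A.ε_pos
  have hO1 : IsOpen ((A.O : Set M) ∩ A.π ⁻¹' Q) :=
    A.π_smooth.continuousOn.isOpen_inter_preimage A.O.isOpen hQ
  have hO2 : IsOpen ((A.O : Set M) ∩ A.υ ⁻¹' Metric.ball 0 (η / 3)) :=
    A.υ_smooth.continuousOn.isOpen_inter_preimage A.O.isOpen Metric.isOpen_ball
  refine ⟨⟨_, hO1.inter hO2⟩, η / 3, by positivity, ⟨⟨A.base_mem_O, ?_⟩, A.base_mem_O, ?_⟩,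
    fun x hx => hx.1.1, fun x hx => hx.2.2, fun x hx m hm => ?_⟩
  · rw [mem_preimage, A.π_ι A.base_mem]
    exact hbQ
  · rw [mem_preimage, A.υ_ι A.base_mem]
    exact Metric.mem_ball_self (by positivity)
  · have hu : ‖A.υ x‖ < η / 3 := by simpa using hx.2.2
    have hm' : ‖m‖ < η / 3 := by simpa using hm
    have hball : ∀ t ∈ Ioo (-1 : ℝ) 2, A.υ x + t • m ∈ Metric.ball 0 η := by
      intro t ht
      rw [mem_ball_zero_iff]
      have h1 : ‖t • m‖ ≤ 2 * ‖m‖ := by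
        rw [norm_smul]
        refine mul_le_mul_of_nonneg_right ?_ (norm_nonneg _)
        rw [Real.norm_eq_abs, abs_le]
        exact ⟨by linarith [ht.1], ht.2.le⟩
      linarith [norm_add_le (A.υ x) (t • m)]
    have hA : Metric.ball (0 : Fin A.k → ℝ) η ⊆ Metric.ball 0 A.ε :=
      Metric.ball_subset_ball (min_le_right _ _)
    have hε'b : Metric.ball (0 : Fin A.k → ℝ) η ⊆ Metric.ball 0 ε' :=
      Metric.ball_subset_ball (min_le_left _ _)
    have h1 := hball 1 (by norm_num)
    rw [one_smul] at h1
    refine ⟨hA h1, ?_⟩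
    have h2 := hfl.eq_of_hasMFDerivAt (p := m) (γ := fun τ => A.Ψ (A.π x) (A.υ x + τ • m))
      (a := -1) (b := 2) (t := 1) (fun t ht => ?_) (by norm_num) (by norm_num)
    · simpa only [zero_smul, add_zero, one_smul, A.Ψ_π x hx.1.1] using h2
    · have h3 := A.hasMFDerivAt_line (hQT (mk_mem_prod hx.1.2 (hεT (hε'b (hball t ht))))).1
        (hA (hball t ht))
      have h4 : vfVal (cut D.χ (fun u : Fin A.k → ℝ => lcVF A.D fun i _ => u i) (m + t • 0))
          (A.Ψ (A.π x) (A.υ x + t • m)) = combVF A.D m (A.Ψ (A.π x) (A.υ x + t • m)) := by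
        change D.χ _ • combVF A.D (m + t • 0) _ = _
        rw [D.one _ (hQT (mk_mem_prod hx.1.2 (hεT (hε'b (hball t ht))))).2, one_smul, smul_zero,
          add_zero]
      rw [← h4] at h3
      exact h3

/-- The projection maps the foliation of `M` to the induced foliation of the transversal. -/
theorem exists_proj [FiniteDimensional ℝ E] [T2Space M] [SecondCountableTopology M]
    (A : Splitting E' F ι b₀) :
    ∃ (n : ℕ) (H : Fin n → VF E' B), (∀ l, (F.toVFModule.pullback ι).Sec A.Q (H l)) ∧
      ∀ G, F.Sec ⊤ G → ∃ O : Opens M, ι b₀ ∈ O ∧ O ≤ A.O ∧ ∃ e : Fin n → M → ℝ,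
        (∀ l, ContMDiffOn 𝓘(ℝ, E) 𝓘(ℝ, ℝ) ∞ (e l) O) ∧
        ∀ x ∈ O, mder (E := E) (E' := E') A.π x (vfVal G x) = combVF H (fun l => e l x) (A.π x) := by
  obtain ⟨D⟩ := exists_flowData (isCompact_singleton (x := ι b₀)) 0 A.lin_plot
  have hfl := D.isFlowOf A.lin_plot
  obtain ⟨O, δ, hδ, hbO, hOA, hOδ, hO⟩ := A.exists_flow_fibre D
  have hGs : ∀ l, ContMDiff 𝓘(ℝ, E') 𝓘(ℝ, E).tangent ∞
      (fun b => tmk 𝓘(ℝ, E) (ι b) (vfVal (D.G l) (ι b))) := fun l =>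
    (contMDiffOn_univ.1 (D.smoothVF l)).comp A.ι_smooth
  refine ⟨D.n, fun l b => (mder (E := E) (E' := E') A.π (ι b) (vfVal (D.G l) (ι b)) : E'),
    fun l => ⟨?_, fun b hb => ⟨A.Q, hb, le_rfl, A.k + 1,
      Fin.cons (fun _ => 1) (fun i b =>
        -(mder (E := E) (E' := Fin A.k → ℝ) A.υ (ι b) (vfVal (D.G l) (ι b)) i)),
      Fin.cons (D.G l) A.D, fun i => ?_, fun z hz => ?_⟩⟩, fun G hG => ?_⟩
  · have h1 := contMDiffOn_tangent_push A.O.isOpen A.π_smooth (hGs l).contMDiffOn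
      (fun b (hb : b ∈ A.Q) => A.ι_mem hb)
    refine ContMDiffOn.congr h1 fun b hb => ?_
    change tmk 𝓘(ℝ, E') b (mder (E := E) (E' := E') A.π (ι b) (vfVal (D.G l) (ι b))) =
      tmk 𝓘(ℝ, E') (A.π (ι b)) (mder (E := E) (E' := E') A.π (ι b) (vfVal (D.G l) (ι b)))
    rw [A.π_ι hb]
  · refine Fin.cases ⟨contMDiffOn_const, D.sec l⟩ (fun i => ⟨?_, A.D_sec i⟩) i
    have h1 := contMDiffOn_tangent_push A.O.isOpen A.υ_smooth (hGs l).contMDiffOn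
      (fun b (hb : b ∈ A.Q) => A.ι_mem hb)
    exact (contMDiffOn_pi_space.1 (contMDiffOn_snd_of_tangent h1) i).neg
  · rw [Fin.sum_univ_succ]
    simp only [Fin.cons_zero, Fin.cons_succ, one_smul, neg_smul, Finset.sum_neg_distrib]
    have h1 := A.decomp hz (vfVal (D.G l) (ι z))
    exact eq_add_neg_of_add_eq h1.symm
  · obtain ⟨V, hV, -, c, hc, hGc⟩ := D.gen_of_mem (D.subset rfl) ⊤ trivial G hG
    have hOs : ∀ x ∈ O, -A.υ x ∈ Metric.ball 0 δ := fun x hx => by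
      simpa using hOδ x hx
    refine ⟨O ⊓ V, ⟨hbO, hV⟩, inf_le_left.trans hOA,
      fun l x => D.R 1 (-A.υ x) x (fun i => c i x, 0) l, fun l => ?_, fun x hx => ?_⟩
    · have h1 : ContMDiffOn 𝓘(ℝ, E) 𝓘(ℝ, ((Fin D.n → ℝ) × (Fin A.k → ℝ)) →L[ℝ] (Fin D.n → ℝ)) ∞
          (fun x => D.R 1 (-A.υ x) x) (O ∩ V) :=
        D.R_smooth.comp_contMDiffOn (contMDiffOn_const.prodMk
          ((A.υ_smooth.mono (inter_subset_left.trans hOA)).neg.prodMk contMDiffOn_id))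
      have h2 : ContMDiffOn 𝓘(ℝ, E) 𝓘(ℝ, (Fin D.n → ℝ) × (Fin A.k → ℝ)) ∞
          (fun x => ((fun i => c i x, 0) : (Fin D.n → ℝ) × (Fin A.k → ℝ))) (O ∩ V) := by
        refine ContMDiffOn.prodMk_space ?_ contMDiffOn_const
        rw [contMDiffOn_pi_space]
        exact fun i => (hc i).mono inter_subset_right
      exact contMDiffOn_pi_space.1 (h1.clm_apply h2) l
    · have hQ : A.π x ∈ A.Q := A.π_mem x (hOA hx.1)
      have h1 : D.Φ 1 (-A.υ x) x = ι (A.π x) := by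
        rw [(hO x hx.1 _ (hOs x hx.1)).2, add_neg_cancel, A.Ψ_zero]
      have h2 : A.π =ᶠ[𝓝 x] fun z => A.π (D.Φ 1 (-A.υ x) z) := by
        filter_upwards [O.isOpen.mem_nhds hx.1] with z hz
        have h3 := hO z hz _ (hOs x hx.1)
        rw [h3.2, A.π_Ψ _ (A.π_mem z (hOA hz)) _ h3.1]
      have h3 : vfVal G x = combVF D.G (fun i => c i x) x := hGc x hx.2
      have h4 : MDifferentiableAt 𝓘(ℝ, E) 𝓘(ℝ, E') A.π (D.Φ 1 (-A.υ x) x) := by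
        rw [h1]
        exact A.π_mdifferentiableAt (A.ι_mem hQ)
      rw [h3, mder_congr h2, mder_comp h4 ((hfl.contMDiff _ _).mdifferentiableAt (by simp)),
        D.mder_comb, h1]
      unfold combVF
      rw [map_sum]
      refine Finset.sum_congr rfl fun l _ => ?_
      rw [map_smul]
      rfl

end Splitting

end Projection

section Transverse

variable {E : Type*} [NormedAddCommGroup E] [NormedSpace ℝ E]
  {M : Type*} [TopologicalSpace M] [ChartedSpace E M] [IsManifold 𝓘(ℝ, E) ∞ M]
  {E' : Type*} [NormedAddCommGroup E'] [NormedSpace ℝ E']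
  {B : Type*} [TopologicalSpace B] [ChartedSpace E' B] [IsManifold 𝓘(ℝ, E') ∞ B]
  {E'' : Type*} [NormedAddCommGroup E''] [NormedSpace ℝ E'']
  {B' : Type*} [TopologicalSpace B'] [ChartedSpace E'' B'] [IsManifold 𝓘(ℝ, E'') ∞ B']
  {F : SingularFoliation E M} {ι : B → M} {b₀ : B} {ι' : B' → M} {b₀' : B'}
  {P : Type*} [NormedAddCommGroup P] [NormedSpace ℝ P]

theorem FlowData.leaf_push {K : Set M} {e : P} {X : P → VF E M} (D : FlowData F K e X) (t : ℝ)
    (p : P) {x : M} (hx : x ∈ D.O) {Y : VF E M} (hY : F.Sec ⊤ Y) :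
    ∃ Y', F.Sec ⊤ Y' ∧ mder (E' := E) (D.Φ t p) x (vfVal Y x) = vfVal Y' (D.Φ t p x) := by
  obtain ⟨V, hV, -, c, hc, hYc⟩ := D.gen_of_mem hx ⊤ trivial Y hY
  have h1 : vfVal Y x = combVF D.G (fun i => c i x) x := hYc x hV
  refine ⟨lcVF D.G fun i _ => D.R t p x (fun i => c i x, 0) i,
    F.sec_lcVF D.sec fun i => contMDiffOn_const, ?_⟩
  rw [h1, D.mder_comb]
  rfl

theorem FlowData.transverse_bijective [T2Space M] {K : Set M} {e : P} {X : P → VF E M}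
    (hX : F.IsPlotOn univ X) (D : FlowData F K e X) (A : Splitting E' F ι b₀)
    (A' : Splitting E'' F ι' b₀') {t : ℝ} {p : P} (h : D.Φ t p (ι b₀) = ι' b₀') (h₀ : ι b₀ ∈ D.O)
    (h₁ : ι' b₀' ∈ D.O) :
    Function.Bijective (mder (E := E') (E' := E'') (fun b => A'.π (D.Φ t p (ι b))) b₀) := by
  have hfl := D.isFlowOf hX
  have hd : ∀ t p x, MDifferentiableAt 𝓘(ℝ, E) 𝓘(ℝ, E) (D.Φ t p) x := fun t p x =>
    (hfl.contMDiff t p).mdifferentiableAt (by simp)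
  have hback : D.Φ (-t) (p + t • e) (ι' b₀') = ι b₀ := by rw [← h, hfl.left_inv]
  have h1 : ∀ w, mder (E' := E) (D.Φ (-t) (p + t • e)) (ι' b₀')
      (mder (E' := E) (D.Φ t p) (ι b₀) w) = w := by
    intro w
    rw [← h, ← mder_comp (hd _ _ _) (hd _ _ _), funext (hfl.left_inv t p), mder_id]
  have h2 : ∀ w, mder (E' := E) (D.Φ t p) (ι b₀)
      (mder (E' := E) (D.Φ (-t) (p + t • e)) (ι' b₀') w) = w := by
    intro w
    rw [← hback, ← mder_comp (hd _ _ _) (hd _ _ _), funext (hfl.right_inv t p), mder_id]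
  have hπ' : MDifferentiableAt 𝓘(ℝ, E) 𝓘(ℝ, E'') A'.π (D.Φ t p (ι b₀)) := by
    rw [h]
    exact A'.π_mdifferentiableAt A'.base_mem_O
  have hc : ∀ v, mder (E := E') (E' := E'') (fun b => A'.π (D.Φ t p (ι b))) b₀ v =
      mder (E := E) (E' := E'') A'.π (ι' b₀') (mder (E' := E) (D.Φ t p) (ι b₀)
        (mder (E := E') (E' := E) ι b₀ v)) := by
    intro v
    rw [← mder_comp (hd t p _) (A.ι_smooth.mdifferentiableAt (by simp)), ← h]
    exact mder_comp (f := fun b => D.Φ t p (ι b)) hπ' ((hd t p _).comp b₀ (A.ι_smooth.mdifferentiableAt (by simp))) v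
  constructor
  · refine (injective_iff_map_eq_zero _).2 fun v hv => ?_
    rw [hc] at hv
    obtain ⟨Y, hY, hYv⟩ := A'.exists_of_mder_π_eq_zero hv
    obtain ⟨Y', hY', hYv'⟩ := D.leaf_push (-t) (p + t • e) h₁ hY
    rw [hYv, h1, hback] at hYv'
    rw [← A.mder_π_ι A.base_mem v, hYv', A.mder_π_leaf hY']
  · intro v'
    set w := mder (E' := E) (D.Φ (-t) (p + t • e)) (ι' b₀') (mder (E := E'') (E' := E) ι' b₀' v')
      with hw
    refine ⟨mder (E := E) (E' := E') A.π (ι b₀) w, ?_⟩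
    have h3 := A.decomp A.base_mem w
    obtain ⟨Y', hY', hYv'⟩ := D.leaf_push t p h₀ (Y := lcVF A.D fun i _ =>
      mder (E := E) (E' := Fin A.k → ℝ) A.υ (ι b₀) w i)
      (F.sec_lcVF A.D_sec fun i => contMDiffOn_const)
    have h4 := congrArg (mder (E' := E) (D.Φ t p) (ι b₀)) h3
    rw [map_add, hw, h2, ← hw] at h4
    have h5 := congrArg (mder (E := E) (E' := E'') A'.π (ι' b₀')) h4
    rw [A'.mder_π_ι A'.base_mem, map_add] at h5
    rw [hc, h5]
    symm
    refine (congrArg (fun z => _ + z) ?_).trans (add_zero _)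
    have h6 : mder (E' := E) (D.Φ t p) (ι b₀) (combVF A.D
        (mder (E := E) (E' := Fin A.k → ℝ) A.υ (ι b₀) w) (ι b₀)) = vfVal Y' (ι' b₀') := by
      rw [← h]
      exact hYv'
    rw [h6, A'.mder_π_leaf hY']

variable [FiniteDimensional ℝ E] [FiniteDimensional ℝ E'] [T2Space M] [SecondCountableTopology M]
  [T2Space B]

/-- The projection of the flow of a time-dependent element of the ideal is the flow of a
time-dependent element of the ideal of the transversal. -/
theorem Splitting.inExp (A : Splitting E' F ι b₀) {Z : ℝ → VF E M}
    (hZ : F.IsPlotOn (Icc 0 1) Z) (hI : ∀ t ∈ Icc (0 : ℝ) 1, F.IdealSec (ι b₀) ⊤ (Z t)) {h : B → B}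
    (hh : ∀ᶠ b in 𝓝 b₀, ∃ x, FlowsTo Z 1 (ι b) x ∧ h b = A.π x) :
    (F.toVFModule.pullback (E' := E') ι).InExp b₀ h := by
  obtain ⟨D⟩ := exists_flowData (isCompact_singleton (x := ι b₀)) (1 : ℝ) hZ.hat
  have hfl := D.isFlowOf hZ.hat
  have hbD : ι b₀ ∈ D.O := D.subset rfl
  have hcurve : IsIntegralCurve Z (fun _ => ι b₀) 1 := fun t ht =>
    (hasMFDerivAt_const_zero ((hI t ht).eq_zero trivial) t).hasMFDerivWithinAt
  have hfix : ∀ t, D.Φ t 0 (ι b₀) = ι b₀ := by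
    intro t
    have := hfl.eq_integralCurve hcurve (fun t _ => D.one _ hbD) 0 t
    rwa [sub_zero] at this
  have hflow : ∀ᶠ x in 𝓝 (ι b₀), FlowsTo Z 1 x (D.Φ 1 0 x) := by
    filter_upwards [hfl.eventually_isIntegralCurve hZ D.O.isOpen D.one hcurve (fun _ _ => hbD) 0]
      with x hx
    refine ⟨_, hx.1, ?_, ?_⟩
    · have := waveInv_wave (t := 0) (by simp)
      rw [wave_zero] at this
      simp only [this, sub_zero, hfl.zero]
    · have := waveInv_wave (t := 1) (by simp)
      rw [wave_one] at this
      simp only [this, sub_zero]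
  have hh' : ∀ᶠ b in 𝓝 b₀, h b = A.π (D.Φ 1 0 (ι b)) := by
    filter_upwards [hh, A.ι_smooth.continuous.continuousAt.eventually hflow] with b hb hb'
    obtain ⟨x, hx, hbx⟩ := hb
    rw [hbx, hx.unique hZ hb']
  obtain ⟨n, H, hH, hproj⟩ := A.exists_proj
  choose O₁ hbO₁ hO₁A e he hGe using fun j => hproj (D.G j) (D.sec j)
  let Os : Set M := D.O ∩ (A.O ∩ ⋂ j, (O₁ j : Set M))
  have hOs : IsOpen Os := D.O.isOpen.inter (A.O.isOpen.inter
    (isOpen_iInter_of_finite fun j => (O₁ j).isOpen))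
  have hbOs : ι b₀ ∈ Os := ⟨hbD, A.base_mem_O, mem_iInter.2 hbO₁⟩
  let x : ℝ × B → M := fun z => D.Φ z.1 0 (ι z.2)
  have hx : ContMDiff (𝓘(ℝ, ℝ).prod 𝓘(ℝ, E')) 𝓘(ℝ, E) ∞ x :=
    D.Φ_smooth.comp (contMDiff_fst.prodMk (contMDiff_const.prodMk (A.ι_smooth.comp contMDiff_snd)))
  let U : Set (ℝ × B) := x ⁻¹' Os
  have hU : IsOpen U := hOs.preimage hx.continuous
  have hψs : ContMDiffOn (𝓘(ℝ, ℝ).prod 𝓘(ℝ, E')) 𝓘(ℝ, E') ∞ (fun z => A.π (x z)) U :=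
    A.π_smooth.comp hx.contMDiffOn fun z hz => hz.2.1
  let Θ : ℝ × B → ℝ × B := fun z => (z.1, A.π (x z))
  have hΘ : ContMDiffOn (𝓘(ℝ, ℝ).prod 𝓘(ℝ, E')) (𝓘(ℝ, ℝ).prod 𝓘(ℝ, E')) ∞ Θ U :=
    contMDiffOn_fst.prodMk hψs
  have hKU : Icc (0 : ℝ) 1 ×ˢ {b₀} ⊆ U := by
    rintro ⟨t, b⟩ ⟨-, rfl⟩
    change D.Φ t 0 (ι b) ∈ Os
    rwa [hfix]
  have hbij : ∀ z ∈ Icc (0 : ℝ) 1 ×ˢ {b₀}, Function.Bijective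
      (mfderiv (𝓘(ℝ, ℝ).prod 𝓘(ℝ, E')) (𝓘(ℝ, ℝ).prod 𝓘(ℝ, E')) Θ z) := by
    rintro ⟨t, b⟩ hz
    have hzU := hKU hz
    obtain ⟨-, rfl⟩ := hz
    have hψd : MDifferentiableAt (𝓘(ℝ, ℝ).prod 𝓘(ℝ, E')) 𝓘(ℝ, E') (fun z => A.π (x z)) (t, b) :=
      (hψs.contMDiffAt (hU.mem_nhds hzU)).mdifferentiableAt (by simp)
    let N := mder (E := E') (E' := E') (fun b => A.π (D.Φ t 0 (ι b))) b
    have hN : Function.Bijective N := D.transverse_bijective hZ.hat A A (hfix t) hbD hbD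
    let L := mder (E := ℝ) (E' := E') (fun τ => A.π (D.Φ τ 0 (ι b))) t
    let T : ℝ × E' →L[ℝ] ℝ × E' :=
      mfderiv (𝓘(ℝ, ℝ).prod 𝓘(ℝ, E')) (𝓘(ℝ, ℝ).prod 𝓘(ℝ, E')) Θ (t, b)
    have hT : ∀ s v, T (s, v) = (s, L s + N v) := by
      intro s v
      have h1 := DFunLike.congr_fun ((mdifferentiableAt_fst (I := 𝓘(ℝ, ℝ)) (I' := 𝓘(ℝ, E'))
        (x := (t, b))).mfderiv_prod hψd) ((s, v) : ℝ × E')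
      refine h1.trans (Prod.ext ?_ ?_)
      · exact DFunLike.congr_fun (mfderiv_fst (I := 𝓘(ℝ, ℝ)) (I' := 𝓘(ℝ, E')) (x := (t, b)))
          ((s, v) : ℝ × E')
      · exact mfderiv_prod_eq_add_apply (v := ((s, v) : ℝ × E')) hψd
    suffices h : Function.Bijective T from h
    constructor
    · refine (injective_iff_map_eq_zero T).2 ?_
      rintro ⟨s, v⟩ h0
      rw [hT] at h0
      have h1 : s = 0 := congrArg Prod.fst h0
      have h2 : L s + N v = 0 := congrArg Prod.snd h0
      rw [h1, map_zero, zero_add] at h2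
      rw [h1, hN.1 (h2.trans (map_zero N).symm)]
      rfl
    · rintro ⟨s, v⟩
      obtain ⟨v', hv'⟩ := hN.2 (v - L s)
      exact ⟨(s, v'), by rw [hT, hv']; simp⟩
  have hπb : A.π (ι b₀) = b₀ := A.π_ι A.base_mem
  have hΘb : ∀ t, Θ (t, b₀) = (t, b₀) := fun t => by
    change (t, A.π (D.Φ t 0 (ι b₀))) = _
    rw [hfix, hπb]
  have : Nonempty (ℝ × B) := ⟨(0, b₀)⟩
  obtain ⟨O, O', g, hO, hKO, hOU, hO', hm, hm', hg, hgl, hgr⟩ :=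
    exists_smooth_inverse_near hU hΘ (isCompact_Icc.prod isCompact_singleton) hKU (by
      rintro ⟨t, b⟩ ⟨-, rfl⟩ ⟨t', b'⟩ ⟨-, rfl⟩ hz
      have h1 : t = t' := congrArg Prod.fst hz
      exact Prod.ext h1 rfl) hbij
  have hg1 : ∀ z ∈ O', (g z).1 = z.1 := fun z hz =>
    (congrArg Prod.fst (hgr z hz) : (Θ (g z)).1 = z.1)
  have hg2 : ∀ z ∈ O', A.π (x (g z)) = z.2 := fun z hz =>
    (congrArg Prod.snd (hgr z hz) : (Θ (g z)).2 = z.2)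
  have hKO' : Icc (0 : ℝ) 1 ×ˢ {b₀} ⊆ O' := by
    rintro ⟨t, b⟩ hz
    have := hm (hKO hz)
    obtain ⟨-, rfl⟩ := hz
    rwa [hΘb] at this
  have hgb : ∀ t ∈ Icc (0 : ℝ) 1, g (t, b₀) = (t, b₀) := fun t ht => by
    have := hgl _ (hKO (mk_mem_prod ht rfl))
    rwa [hΘb] at this
  -- the coefficients of the velocity of the projected flow
  let κ : Fin n → ℝ × B → ℝ := fun l z => ∑ j, D.c j (z.1, x z) * e j l (x z)
  have hκ : ∀ l, ContMDiffOn (𝓘(ℝ, ℝ).prod 𝓘(ℝ, E')) 𝓘(ℝ, ℝ) ∞ (κ l) U := by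
    intro l
    refine contMDiffOn_finsetSum fun j _ => ContMDiffOn.mul ?_ ?_
    · exact ((D.c_smooth j).comp (contMDiff_fst.prodMk hx)).contMDiffOn
    · exact (he j l).comp hx.contMDiffOn fun z hz => mem_iInter.1 hz.2.2 j
  have hcomb : ∀ (f : Fin D.n → ℝ) (w : M), w ∈ Os →
      mder (E := E) (E' := E') A.π w (combVF D.G f w) =
        combVF H (fun l => ∑ j, f j * e j l w) (A.π w) := by
    intro f w hw
    have h1 : (fun l => ∑ j, f j * e j l w) = ∑ j, f j • fun l => e j l w := by
      funext l
      simp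
    rw [h1, combVF_sum]
    unfold combVF
    rw [map_sum]
    refine Finset.sum_congr rfl fun j _ => ?_
    rw [map_smul, hGe j w (mem_iInter.1 hw.2.2 j)]
    exact (combVF_smul H (f j) (fun l => e j l w) (A.π w)).symm
  have hvel : ∀ z ∈ U, HasMFDerivAt 𝓘(ℝ, ℝ) 𝓘(ℝ, E') (fun τ => A.π (x (τ, z.2))) z.1
      ((1 : ℝ →L[ℝ] ℝ).smulRight (combVF (E := E') H (fun l => κ l z) (A.π (x z)))) := by
    intro z hz
    have h1 := D.Φ_deriv z.1 0 (ι z.2)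
    have h2 := HasMFDerivAt.map_curve (E := E) (E' := E') (g := A.π)
      (γ := fun τ => D.Φ τ 0 (ι z.2)) (w := vfVal (fun y => D.χ y • hat Z (0 + z.1 • 1) y) (x z))
      (A.π_mdifferentiableAt hz.2.1) h1
    have h3 : vfVal (fun y => D.χ y • hat Z (0 + z.1 • 1) y) (x z) =
        combVF D.G (fun j => D.c j (z.1, x z)) (x z) := by
      have : (0 : ℝ) + z.1 • 1 = z.1 := by simp
      rw [this]
      exact D.c_eq z.1 (x z)
    rw [h3] at h2
    have h4 : mder (E := E) (E' := E') A.π (D.Φ z.1 0 (ι z.2))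
        (combVF D.G (fun j => D.c j (z.1, x z)) (x z)) =
        combVF H (fun l => κ l z) (A.π (x z)) := hcomb _ _ hz
    rw [h4] at h2
    exact h2
  obtain ⟨I', N, hI', hN, hII', hbN, hIN⟩ := generalized_tube_lemma isCompact_Icc
    (isCompact_singleton (x := b₀)) hO' hKO'
  have hbN' : b₀ ∈ N ∩ A.Q := ⟨hbN rfl, A.base_mem⟩
  obtain ⟨ρ, r1, -, r3, N₁, r4, -, r6⟩ := exists_bump (E := E')
    ((hN.inter A.Q.isOpen).mem_nhds hbN')
  let H' : Fin n → VF E' B := fun l b => ρ b • H l b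
  have hH' : ∀ l, (F.toVFModule.pullback (E' := E') ι).Sec ⊤ (H' l) := fun l =>
    (F.toVFModule.pullback (E' := E') ι).sec_top_of_tsupport (hH l) r1 fun b hb => (r3 hb).2
  have hcH : ∀ (f : Fin n → ℝ), ∀ b ∈ N₁, combVF H' f b = combVF H f b := by
    intro f b hb
    refine Finset.sum_congr rfl fun l _ => ?_
    change f l • ρ b • vfVal (H l) b = _
    rw [r6 b hb, one_smul]
  let ζ : ℝ → VF E' B := fun t => lcVF H' fun l b => ρ b * κ l (g (t, b))
  have hζ : (F.toVFModule.pullback (E' := E') ι).IsPlotOn (Icc 0 1) ζ := by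
    refine VFModule.isPlotOn_lcVF _ hH' (c := fun l z => ρ z.2 * κ l (g z)) fun l => ?_
    rintro ⟨t, b⟩ ⟨ht, -⟩
    by_cases hb : b ∈ N
    · have h1 : (t, b) ∈ O' := hIN (mk_mem_prod (hII' ht) hb)
      have h2 : ContMDiffOn (𝓘(ℝ, ℝ).prod 𝓘(ℝ, E')) 𝓘(ℝ, ℝ) ∞ (fun z => κ l (g z)) O' :=
        (hκ l).comp hg fun z hz => hOU (hm' hz)
      exact ((r1.comp contMDiff_snd).contMDiffAt.mul
        (h2.contMDiffAt (hO'.mem_nhds h1))).contMDiffWithinAt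
    · refine ContMDiffAt.contMDiffWithinAt
        ((contMDiffAt_const (c := (0 : ℝ))).congr_of_eventuallyEq ?_)
      have h1 : ∀ᶠ z : ℝ × B in 𝓝 (t, b), z.2 ∈ (tsupport ρ)ᶜ :=
        continuous_snd.continuousAt.eventually
          ((isClosed_tsupport ρ).isOpen_compl.mem_nhds fun h => hb (r3 h).1)
      filter_upwards [h1] with z hz
      rw [image_eq_zero_of_notMem_tsupport hz, zero_mul]
  refine VFModule.InExp.flow ζ hζ (fun t ht => ?_) h ?_
  · have hsm : F.IdealSec (ι b₀) ⊤ (hat Z t) :=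
      (hI _ (wave_mem t)).smul (a := fun _ => deriv wave t) contMDiffOn_const
    obtain ⟨V₁, hbV₁, -, f, hf, hZf⟩ := hsm.exists_comb trivial (D.gen_of_mem hbD)
    have hgt : ContMDiffOn 𝓘(ℝ, E') (𝓘(ℝ, ℝ).prod 𝓘(ℝ, E')) ∞ (fun b => g (t, b))
        {b | (t, b) ∈ O'} :=
      hg.comp (contMDiff_const.prodMk contMDiff_id).contMDiffOn fun b hb => hb
    have hxt : ContMDiffOn 𝓘(ℝ, E') 𝓘(ℝ, E) ∞ (fun b => x (g (t, b))) {b | (t, b) ∈ O'} :=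
      hx.comp_contMDiffOn hgt
    have hopen : IsOpen {b | (t, b) ∈ O'} := hO'.preimage (by fun_prop)
    have hxb : x (g (t, b₀)) = ι b₀ := by
      rw [hgb t ht]
      exact hfix t
    refine VFModule.IdealSec.of_local (V := N₁ ⊓ ⟨{b | (t, b) ∈ O'} ∩
      (fun b => x (g (t, b))) ⁻¹' V₁, hxt.continuousOn.isOpen_inter_preimage hopen V₁.isOpen⟩)
      (VFModule.idealSec_of_comb hH'
        (g := fun l b => ∑ j, f j (x (g (t, b))) * e j l (x (g (t, b)))) (fun l => ⟨?_, ?_⟩)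
        fun b hb => ?_) ⟨r4, hKO' (mk_mem_prod ht rfl), ?_⟩ (hζ.1 t ht)
    · refine contMDiffOn_finsetSum fun j _ => ContMDiffOn.mul ?_ ?_
      · exact (hf j).1.comp (hxt.mono fun b hb => hb.2.1) fun b hb => hb.2.2
      · exact (he j l).comp (hxt.mono fun b hb => hb.2.1) fun b hb =>
          mem_iInter.1 (hOU (hm' hb.2.1)).2.2 j
    · simp only [hxb, (hf _).2, zero_mul, Finset.sum_const_zero]
    · have hbO' : (t, b) ∈ O' := hb.2.1
      have hU' : g (t, b) ∈ U := hOU (hm' hbO')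
      have e1 : vfVal (ζ t) b = combVF H (fun l => κ l (g (t, b))) b := by
        refine Eq.trans ?_ (hcH _ b hb.1)
        change combVF H' (fun l => ρ b * κ l (g (t, b))) b = _
        simp only [r6 b hb.1, one_mul]
      have e2 : combVF D.G (fun j => D.c j ((g (t, b)).1, x (g (t, b)))) (x (g (t, b))) =
          combVF D.G (fun j => f j (x (g (t, b)))) (x (g (t, b))) := by
        rw [hg1 _ hbO']
        refine Eq.trans ?_ (hZf _ hb.2.2)
        refine Eq.trans (D.c_eq t (x (g (t, b)))).symm ?_
        rw [D.one _ hU'.1, one_smul]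
        rfl
      have e3 := hcomb (fun j => D.c j ((g (t, b)).1, x (g (t, b)))) _ hU'
      rw [e2, hcomb _ _ hU', hg2 _ hbO'] at e3
      rw [e1, hcH _ b hb.1]
      exact e3.symm
    · change x (g (t, b₀)) ∈ V₁
      rwa [hxb]
  · have hopen : IsOpen (O ∩ Θ ⁻¹' (Prod.snd ⁻¹' (N₁ : Set B))) :=
      (hΘ.continuousOn.mono hOU).isOpen_inter_preimage hO (N₁.isOpen.preimage continuous_snd)
    have hKs : Icc (0 : ℝ) 1 ×ˢ {b₀} ⊆ O ∩ Θ ⁻¹' (Prod.snd ⁻¹' (N₁ : Set B)) := by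
      rintro ⟨t, b⟩ hz
      refine ⟨hKO hz, ?_⟩
      obtain ⟨-, rfl⟩ := hz
      rw [mem_preimage, hΘb]
      exact r4
    obtain ⟨I₂, N₂, -, hN₂, hII₂, hbN₂, hIN₂⟩ := generalized_tube_lemma isCompact_Icc
      (isCompact_singleton (x := b₀)) hopen hKs
    filter_upwards [hN₂.mem_nhds (hbN₂ rfl), hh', A.Q.isOpen.mem_nhds A.base_mem] with b hb hbh hbQ
    refine ⟨fun t => A.π (x (t, b)), fun t ht => ?_, ?_, hbh.symm⟩
    · have h1 := hIN₂ (mk_mem_prod (hII₂ ht) hb)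
      have h2 := hvel (t, b) (hOU h1.1)
      have h3 : vfVal (ζ t) (A.π (x (t, b))) =
          combVF H (fun l => κ l (t, b)) (A.π (x (t, b))) := by
        refine Eq.trans ?_ (hcH _ _ h1.2)
        change combVF H' (fun l => ρ (A.π (x (t, b))) * κ l (g (Θ (t, b)))) _ = _
        have h4 : ρ (A.π (x (t, b))) = 1 := r6 _ h1.2
        simp only [h4, one_mul, hgl _ h1.1]
      rw [← h3] at h2
      exact h2.hasMFDerivWithinAt
    · change A.π (D.Φ 0 0 (ι b)) = b
      rw [hfl.zero, A.π_ι hbQ]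

end Transverse

section IdealFlow

variable {E : Type*} [NormedAddCommGroup E] [NormedSpace ℝ E]
  {M : Type*} [TopologicalSpace M] [ChartedSpace E M] [IsManifold 𝓘(ℝ, E) ∞ M]
  {F : SingularFoliation E M}

theorem wave_neg (t : ℝ) : wave (-t) = wave t := by
  simp [wave]

theorem wave_two_sub (t : ℝ) : wave (2 - t) = wave t := by
  have : Real.pi * (2 - t) = 2 * Real.pi - Real.pi * t := by ring
  simp [wave, this, Real.cos_two_pi_sub]

theorem IsFlowOf.eq_of_wave_eq [T2Space M] {X : ℝ → ℝ → VF E M} {χ : M → ℝ}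
    {Φ : ℝ → ℝ × ℝ → M → M} (h : IsFlowOf ((1, 0) : ℝ × ℝ) (cut χ (hatTwo X)) Φ) {σ σ' : ℝ}
    (hσ : wave σ = wave σ') (t : ℝ) (x : M) : Φ t (0, σ) x = Φ t (0, σ') x := by
  have h1 := h.eq_of_hasMFDerivAt (p := ((0, σ) : ℝ × ℝ)) (γ := fun τ => Φ τ (0, σ') x)
    (a := -|t| - 1) (b := |t| + 1) (fun τ _ => ?_)
    ⟨by linarith [abs_nonneg t], by linarith [abs_nonneg t]⟩
    (t := t) ⟨by linarith [neg_abs_le t], by linarith [le_abs_self t]⟩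
  · rwa [h.zero] at h1
  · have h2 := h.ode τ (0, σ') x
    have h3 : cut χ (hatTwo X) ((0, σ) + τ • ((1, 0) : ℝ × ℝ)) =
        cut χ (hatTwo X) ((0, σ') + τ • ((1, 0) : ℝ × ℝ)) := by
      have h4 : hatTwo X ((0, σ) + τ • ((1, 0) : ℝ × ℝ)) = hatTwo X ((0, σ') + τ • ((1, 0) : ℝ × ℝ)) := by
        simp [hatTwo, hσ]
      funext y
      simp only [cut, h4]
    rwa [h3]

theorem eq_zero_of_symm {γ : ℝ → M} {a : ℝ} {w : E}
    (h : HasMFDerivAt 𝓘(ℝ, ℝ) 𝓘(ℝ, E) γ a ((1 : ℝ →L[ℝ] ℝ).smulRight w))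
    (hs : ∀ t, γ (2 * a - t) = γ t) : w = 0 := by
  have e : 2 * a - a = a := by ring
  have h1 := hasMFDerivAt_comp_hasDerivAt (γ := γ) (ψ := fun t => 2 * a - t) (d := -1) (t := a)
    (w := w) (by rw [e]; exact h) (by simpa using (hasDerivAt_id a).const_sub (2 * a))
  rw [funext hs] at h1
  have h2 := hasMFDerivAt_unique h h1
  rw [neg_one_smul] at h2
  have h3 : (2 : ℝ) • w = 0 := by
    rw [two_smul]
    exact (congrArg (fun z => w + z) h2).trans (add_neg_cancel w)
  exact (smul_eq_zero.1 h3).resolve_left two_ne_zero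

variable [FiniteDimensional ℝ E] [T2Space M] [SecondCountableTopology M]

/-- The flows of homotopic paths differ by the flow of a time-dependent element of the ideal. -/
theorem FHomotopic.exists_ideal {P₀ P₁ : FPath F} (h : FHomotopic P₀ P₁) :
    ∃ Z : ℝ → VF E M, F.IsPlotOn (Icc 0 1) Z ∧
      (∀ t ∈ Icc (0 : ℝ) 1, F.IdealSec (P₀.p 1) ⊤ (Z t)) ∧
      ∀ᶠ x in 𝓝 (P₀.p 0), ∃ x' x'', FlowsTo P₀.X 1 x x' ∧ FlowsTo P₁.X 1 x x'' ∧
        FlowsTo Z 1 x' x'' := by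
  obtain ⟨X, p, hX, e0, e1, hI⟩ := h
  have hp1 : ∀ s ∈ Icc (0 : ℝ) 1, p 1 s = P₀.p 1 := by
    intro s hs
    rw [← (e0 1 (by simp)).2]
    refine hX.target_eq (fun s hs => ?_) s hs
    obtain ⟨V, hV, h5⟩ := hI s hs
    exact h5.eq_zero hV
  have hp0 : p 0 0 = P₀.p 0 := (e0 0 (by simp)).2
  obtain ⟨D⟩ := exists_flowData (F := F)
    ((isCompact_Icc.prod isCompact_Icc).image_of_continuousOn hX.smooth.continuousOn)
    ((1, 0) : ℝ × ℝ) hX.plot.hatTwo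
  have hfl := D.isFlowOf hX.plot.hatTwo
  obtain ⟨v1, v2⟩ := hfl.eventually_variation hX.plot D.O.isOpen D.one
    (fun s hs => ⟨hX.integral s hs, hX.base s hs⟩)
    (fun t ht s hs => D.subset ⟨(t, s), ⟨ht, hs⟩, rfl⟩)
  have ew : ∀ σ : ℝ, ((1, σ) : ℝ × ℝ) = (0, σ) + (1 : ℝ) • ((1, 0) : ℝ × ℝ) := fun σ => by simp
  let φ : ℝ → M → M := fun σ x => D.Φ 1 (0, σ) x
  let φ' : ℝ → M → M := fun σ x => D.Φ (-1) (1, σ) x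
  have hli : ∀ σ x, φ' σ (φ σ x) = x := fun σ x => by
    have := hfl.left_inv 1 (0, σ) x
    rwa [← ew] at this
  have hri : ∀ σ x, φ σ (φ' σ x) = x := fun σ x => by
    have := hfl.right_inv 1 (0, σ) x
    rwa [← ew] at this
  have hflow : ∀ᶠ x in 𝓝 (p 0 0), ∀ σ ∈ Icc (0 : ℝ) 1,
      FlowsTo (fun t => X t (wave σ)) 1 x (φ σ x) := by
    filter_upwards [v2] with x hx σ hσ
    exact ⟨_, hx σ hσ, by simp only [waveInv_zero, hfl.zero], by simp only [waveInv_one]; rfl⟩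
  let Z : ℝ → VF E M := fun σ => lcVF D.G fun i w => D.R 1 (0, σ) (φ' σ w) (0, (0, 1)) i
  have hder : ∀ σ x, HasMFDerivAt 𝓘(ℝ, ℝ) 𝓘(ℝ, E) (fun σ => φ σ x) σ
      ((1 : ℝ →L[ℝ] ℝ).smulRight (vfVal (E := E) (Z σ) (φ σ x))) := by
    intro σ x
    have e : ∀ τ : ℝ, ((0, τ) : ℝ × ℝ) = ((0, 0) : ℝ × ℝ) + τ • ((0, 1) : ℝ × ℝ) := fun τ => by simp
    have h1 := (hasMFDerivAt_line ((0, 0) : ℝ × ℝ) ((0, 1) : ℝ × ℝ) σ).congr_of_eventuallyEq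
      (Eventually.of_forall e)
    have h2 : MDifferentiableAt 𝓘(ℝ, ℝ × ℝ) 𝓘(ℝ, E) (fun q : ℝ × ℝ => D.Φ 1 q x) (0, σ) :=
      ContMDiffAt.mdifferentiableAt (n := ∞) (D.Φ_smooth.comp (contMDiff_const.prodMk
        (contMDiff_id.prodMk contMDiff_const))).contMDiffAt (by simp)
    have h3 := HasMFDerivAt.map_curve (γ := fun τ : ℝ => ((0, τ) : ℝ × ℝ)) h2 h1
    rw [D.mder_param] at h3
    have h4 : vfVal (Z σ) (φ σ x) = combVF D.G (D.R 1 (0, σ) x (0, (0, 1))) (D.Φ 1 (0, σ) x) := by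
      change combVF D.G (D.R 1 (0, σ) (φ' σ (φ σ x)) (0, (0, 1))) _ = _
      rw [hli]
    rw [h4]
    exact h3
  have hZ : F.IsPlotOn univ Z := by
    refine F.isPlotOn_lcVF (c := fun i z => D.R 1 (0, z.1) (φ' z.1 z.2) (0, (0, 1)) i) D.sec
      fun i => ContMDiff.contMDiffOn ?_
    have h1 : ContMDiff (𝓘(ℝ, ℝ).prod 𝓘(ℝ, E)) 𝓘(ℝ, E) ∞
        (fun z : ℝ × M => D.Φ (-1) (1, z.1) z.2) :=
      D.Φ_smooth.comp (contMDiff_const.prodMk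
        ((contMDiff_const.prodMk_space contMDiff_fst).prodMk contMDiff_snd))
    have h2 : ContMDiff (𝓘(ℝ, ℝ).prod 𝓘(ℝ, E)) 𝓘(ℝ, ((Fin D.n → ℝ) × (ℝ × ℝ)) →L[ℝ] (Fin D.n → ℝ)) ∞
        (fun z : ℝ × M => D.R 1 (0, z.1) (D.Φ (-1) (1, z.1) z.2)) :=
      D.R_smooth.comp (contMDiff_const.prodMk
        ((contMDiff_const.prodMk_space contMDiff_fst).prodMk h1))
    exact (contMDiff_pi_space.1 (h2.clm_apply contMDiff_const)) i
  refine ⟨Z, hZ.comp (g := id) contDiffOn_id fun _ _ => trivial, fun σ hσ => ?_, ?_⟩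
  · have hzero : ∀ σ, (∀ τ, wave (2 * σ - τ) = wave τ) → F.IdealSec (P₀.p 1) ⊤ (Z σ) := by
      intro σ hσ
      have : Z σ = 0 := by
        funext w
        have h1 := hder σ (φ' σ w)
        have h2 := eq_zero_of_symm h1 fun t => hfl.eq_of_wave_eq (hσ t) 1 _
        rw [hri] at h2
        exact h2
      rw [this]
      exact F.idealSec_zero _ _
    rcases eq_or_lt_of_le hσ.1 with h0 | h0
    · exact hzero σ fun τ => by rw [← h0, mul_zero, zero_sub, wave_neg]
    rcases eq_or_lt_of_le hσ.2 with h1 | h1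
    · exact hzero σ fun τ => by rw [h1, mul_one, wave_two_sub]
    have hs : wave σ ∈ Icc (0 : ℝ) 1 := wave_mem σ
    obtain ⟨V, hV, hI'⟩ := hI _ hs
    have hy : p 1 (wave σ) = P₀.p 1 := hp1 _ hs
    have hx0 : φ σ (p 0 0) = P₀.p 1 := by
      have := v1 1 σ
      rwa [wave_one, hy] at this
    have ht : Tendsto (φ' σ) (𝓝 (P₀.p 1)) (𝓝 (p 0 0)) := by
      have := (hfl.contMDiff (-1) (1, σ)).continuous.tendsto (P₀.p 1)
      rw [← hx0] at this ⊢
      change Tendsto (φ' σ) _ (𝓝 (φ' σ (φ σ (p 0 0)))) at this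
      rwa [hli] at this
    rw [hy] at hV hI'
    have key : ∀ᶠ w in 𝓝 (P₀.p 1), vfVal (Z σ) w =
        vfVal (fun w => deriv wave σ • complement X 1 (wave σ) w) w := by
      filter_upwards [ht.eventually hflow] with w hw
      have hwI : waveInv (wave σ) = σ := waveInv_wave hσ
      have h2 := complement_eq (F := F) hs hX.plot (x := φ' σ w)
        (f := fun u => φ (waveInv u) (φ' σ w)) (by
          filter_upwards [self_mem_nhdsWithin] with u hu
          have := hw _ (waveInv_mem u)
          rwa [wave_waveInv hu] at this)
      have hwo : wave σ ∈ Ioo (0 : ℝ) 1 := by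
        refine ⟨lt_of_le_of_ne hs.1 fun hc => ?_, lt_of_le_of_ne hs.2 fun hc => ?_⟩
        · rw [← hc, waveInv_zero] at hwI; linarith
        · rw [hc, waveInv_one] at hwI; linarith
      have h3 := hasMFDerivAt_comp_hasDerivAt (γ := fun τ => φ τ (φ' σ w)) (ψ := waveInv)
        (t := wave σ) (w := vfVal (Z σ) w)
        (by rw [hwI]; simpa only [hri] using hder σ (φ' σ w)) (hasDerivAt_waveInv hwo)
      have h4 := velIcc_eq hs h3.hasMFDerivWithinAt
      have hpos := deriv_wave_pos ⟨h0, h1⟩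
      have h5 := h2.trans h4
      simp only [hwI, hri] at h5
      change _ = deriv wave σ • vfVal (complement X 1 (wave σ)) w
      rw [h5, smul_smul, mul_inv_cancel₀ hpos.ne', one_smul]
    obtain ⟨V', hV', hI''⟩ := (hI'.smul (a := fun _ => deriv wave σ)
      contMDiffOn_const).congr_eventually hV key
    exact hI''.of_local hV' (hZ.1 σ trivial)
  · rw [← hp0]
    filter_upwards [hflow] with x hx
    refine ⟨φ 0 x, φ 1 x, ?_, ?_, fun σ => φ σ x, fun σ _ => (hder σ x).hasMFDerivWithinAt, rfl,
      rfl⟩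
    · refine (hx 0 (by simp)).congr fun t ht => ?_
      rw [wave_zero]
      exact (e0 t ht).1
    · refine (hx 1 (by simp)).congr fun t ht => ?_
      rw [wave_one]
      exact (e1 t ht).1

end IdealFlow

section IdealFlow

variable {E : Type*} [NormedAddCommGroup E] [NormedSpace ℝ E]
  {M : Type*} [TopologicalSpace M] [ChartedSpace E M] [IsManifold 𝓘(ℝ, E) ∞ M]
  {F : SingularFoliation E M}

/-- `f` represents the germ at `P.p 0` of the flow of `P.X`. -/
def FPath.HasFlow (P : FPath F) (f : M → M) : Prop :=
  ∀ᶠ x in 𝓝 (P.p 0), FlowsTo P.X 1 x (f x)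

/-- `g` represents the germ at `y` of the flow of a time-dependent element of `I_y 𝓕`. -/
def IsIdealFlow (F : SingularFoliation E M) (y : M) (g : M → M) : Prop :=
  ∃ Z : ℝ → VF E M, F.IsPlotOn (Icc 0 1) Z ∧ (∀ t ∈ Icc (0 : ℝ) 1, F.IdealSec y ⊤ (Z t)) ∧
    ∀ᶠ x in 𝓝 y, FlowsTo Z 1 x (g x)

/-- A time-dependent element of `I_y 𝓕`, with the constant curve at `y`. -/
def FPath.ofIdeal (y : M) (Z : ℝ → VF E M) (hZ : F.IsPlotOn (Icc 0 1) Z)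
    (hI : ∀ t ∈ Icc (0 : ℝ) 1, F.IdealSec y ⊤ (Z t)) : FPath F where
  X t := Z (max 0 (min t 1))
  p _ := y
  plot := hZ.congr fun t ht => by rw [min_eq_left ht.2, max_eq_right ht.1]
  smooth := contMDiffOn_const
  integral t ht := by
    have h : Z (max 0 (min t 1)) y = 0 := by
      rw [min_eq_left ht.2, max_eq_right ht.1]
      exact (hI t ht).eq_zero trivial
    exact (hasMFDerivAt_const_zero h t).hasMFDerivWithinAt
  X_left t ht := by
    rw [min_eq_left (ht.trans zero_le_one), max_eq_left ht, min_eq_left zero_le_one, max_self]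
  X_right t ht := by rw [min_eq_right ht, min_self]
  p_left _ _ := rfl
  p_right _ _ := rfl

theorem FPath.ofIdeal_X {y : M} {Z : ℝ → VF E M} (hZ : F.IsPlotOn (Icc 0 1) Z)
    (hI : ∀ t ∈ Icc (0 : ℝ) 1, F.IdealSec y ⊤ (Z t)) {t : ℝ} (ht : t ∈ Icc (0 : ℝ) 1) :
    (FPath.ofIdeal y Z hZ hI).X t = Z t := by
  change Z (max 0 (min t 1)) = Z t
  rw [min_eq_left ht.2, max_eq_right ht.1]

theorem FPath.isIdeal_ofIdeal {y : M} {Z : ℝ → VF E M} (hZ : F.IsPlotOn (Icc 0 1) Z)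
    (hI : ∀ t ∈ Icc (0 : ℝ) 1, F.IdealSec y ⊤ (Z t)) : (FPath.ofIdeal y Z hZ hI).IsIdeal y :=
  ⟨fun _ => rfl, fun t ht => by rw [FPath.ofIdeal_X hZ hI ht]; exact hI t ht⟩

theorem FPath.IsIdeal.isIdealFlow {P : FPath F} {y : M} (h : P.IsIdeal y) {g : M → M}
    (hg : P.HasFlow g) : IsIdealFlow F y g :=
  ⟨P.X, P.plot, h.2, by rw [FPath.HasFlow, h.1] at hg; exact hg⟩

theorem IsIdealFlow.exists_path {y : M} {g : M → M} (h : IsIdealFlow F y g) :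
    ∃ P : FPath F, P.IsIdeal y ∧ P.HasFlow g := by
  obtain ⟨Z, hZ, hI, hg⟩ := h
  refine ⟨FPath.ofIdeal y Z hZ hI, FPath.isIdeal_ofIdeal hZ hI, ?_⟩
  filter_upwards [hg] with x hx
  exact hx.congr fun t ht => (FPath.ofIdeal_X hZ hI ht).symm

theorem FPath.IsIdeal.concat (r : Reparam) {P Q : FPath F} {y : M} (hP : P.IsIdeal y)
    (hQ : Q.IsIdeal y) (h : P.p 1 = Q.p 0) : (FPath.concat r Q P h).IsIdeal y := by
  refine ⟨fun t => ?_, fun t _ => ?_⟩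
  · change FPath.concatCurve r Q P t = y
    rw [FPath.concatCurve]
    split_ifs
    exacts [hP.1 _, hQ.1 _]
  · change F.IdealSec y ⊤ (FPath.concatX r Q P t)
    rw [FPath.concatX]
    split_ifs
    · exact (hP.2 _ (r.mem _)).smul (a := fun _ => _) contMDiffOn_const
    · exact (hQ.2 _ (r.mem _)).smul (a := fun _ => _) contMDiffOn_const

theorem FPath.IsIdeal.reverse (r : Reparam) {P : FPath F} {y : M} (hP : P.IsIdeal y) :
    (P.reverse r).IsIdeal y :=
  ⟨fun _ => hP.1 _, fun t _ => (hP.2 (1 - r.toFun t)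
    ⟨by linarith [(r.mem t).2], by linarith [(r.mem t).1]⟩).smul (a := fun _ => _)
      contMDiffOn_const⟩

theorem IsIdealFlow.id (F : SingularFoliation E M) (y : M) : IsIdealFlow F y id :=
  ⟨fun _ => 0, isPlotOn_zero _ _, fun _ _ => F.idealSec_zero _ _,
    Eventually.of_forall fun x => ⟨fun _ => x, (FPath.const F x).integral, rfl, rfl⟩⟩

theorem FPath.HasFlow.of_reverse (r : Reparam) {P : FPath F} {x y : M} (h : FlowsTo P.X 1 x y) :
    FlowsTo (P.reverse r).X 1 y x := by
  obtain ⟨γ, hγ, h0, h1⟩ := h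
  have := hγ.flowsTo_reparam (ψ := fun t => 1 - r.toFun t)
    ((contDiff_const.sub r.smooth).differentiable (by simp))
    (fun t _ => ⟨by linarith [(r.mem t).2], by linarith [(r.mem t).1]⟩)
  simp only [r.zero, r.one, sub_zero, sub_self, h0, h1] at this
  exact this

variable [FiniteDimensional ℝ E] [T2Space M] [SecondCountableTopology M]

theorem FPath.exists_hasFlow (P : FPath F) : ∃ f : M → M, P.HasFlow f := by
  obtain ⟨D⟩ := P.exists_flowData
  exact ⟨_, (FPath.flowData_flowsTo D).2⟩

theorem FPath.HasFlow.eventuallyEq {P : FPath F} {f f' : M → M} (h : P.HasFlow f)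
    (h' : P.HasFlow f') : f =ᶠ[𝓝 (P.p 0)] f' := by
  filter_upwards [h, h'] with x hx hx' using hx.unique P.plot hx'

theorem FPath.HasFlow.tendsto {P : FPath F} {f : M → M} (h : P.HasFlow f) :
    Tendsto f (𝓝 (P.p 0)) (𝓝 (P.p 1)) := by
  obtain ⟨D⟩ := P.exists_flowData
  obtain ⟨h1, h2⟩ := FPath.flowData_flowsTo D
  have h3 := ((D.isFlowOf P.plot.hat).contMDiff 1 0).continuous.tendsto (P.p 0)
  rw [h1] at h3
  exact h3.congr' (FPath.HasFlow.eventuallyEq (P := P) h2 h)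

theorem FPath.HasFlow.concat (r : Reparam) {P Q : FPath F} {f g : M → M} (hf : P.HasFlow f)
    (hg : Q.HasFlow g) (h : P.p 1 = Q.p 0) : (FPath.concat r Q P h).HasFlow (g ∘ f) := by
  have h0 : (FPath.concat r Q P h).p 0 = P.p 0 := FPath.concat_zero r Q P h
  rw [FPath.HasFlow, h0]
  have ht := hf.tendsto
  rw [h] at ht
  filter_upwards [hf, ht.eventually hg] with x hx hx'
  exact FlowsTo.join r hx hx'

theorem IsIdealFlow.tendsto {y : M} {g : M → M} (h : IsIdealFlow F y g) :
    Tendsto g (𝓝 y) (𝓝 y) := by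
  obtain ⟨P, hP, hg⟩ := h.exists_path
  have := hg.tendsto
  rwa [hP.1, hP.1] at this

theorem IsIdealFlow.comp (r : Reparam) {y : M} {g g' : M → M} (h : IsIdealFlow F y g)
    (h' : IsIdealFlow F y g') : IsIdealFlow F y (g ∘ g') := by
  obtain ⟨P, hP, hg⟩ := h.exists_path
  obtain ⟨P', hP', hg'⟩ := h'.exists_path
  have e : P'.p 1 = P.p 0 := by rw [hP.1, hP'.1]
  exact (FPath.IsIdeal.concat r hP' hP e).isIdealFlow (FPath.HasFlow.concat r hg' hg e)

theorem IsIdealFlow.exists_inv (r : Reparam) {y : M} {g : M → M} (h : IsIdealFlow F y g) :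
    ∃ g', IsIdealFlow F y g' ∧ (∀ᶠ x in 𝓝 y, g' (g x) = x) ∧ ∀ᶠ x in 𝓝 y, g (g' x) = x := by
  obtain ⟨P, hP, hg⟩ := h.exists_path
  obtain ⟨g', hg'⟩ := (P.reverse r).exists_hasFlow
  have hI := (hP.reverse r).isIdealFlow hg'
  rw [FPath.HasFlow, hP.1] at hg
  rw [FPath.HasFlow, (hP.reverse r).1] at hg'
  refine ⟨g', hI, ?_, ?_⟩
  · filter_upwards [hg, h.tendsto.eventually hg'] with x hx hx'
    exact hx'.unique (P.reverse r).plot (FPath.HasFlow.of_reverse r hx)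
  · filter_upwards [hg', hI.tendsto.eventually hg] with x hx hx'
    exact (FPath.HasFlow.of_reverse r hx').unique_left (P.reverse r).plot hx

theorem FHomotopic.exists_isIdealFlow {P₀ P₁ : FPath F} (h : FHomotopic P₀ P₁) {f₀ f₁ : M → M}
    (h₀ : P₀.HasFlow f₀) (h₁ : P₁.HasFlow f₁) :
    ∃ g, IsIdealFlow F (P₀.p 1) g ∧ ∀ᶠ x in 𝓝 (P₀.p 0), f₁ x = g (f₀ x) := by
  have h1 := h₁
  rw [FPath.HasFlow, ← h.source_eq] at h1
  obtain ⟨Z, hZ, hI, hf⟩ := h.exists_ideal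
  obtain ⟨g, hg⟩ := (FPath.ofIdeal _ Z hZ hI).exists_hasFlow
  refine ⟨g, (FPath.isIdeal_ofIdeal hZ hI).isIdealFlow hg, ?_⟩
  filter_upwards [hf, h₀, h1, h₀.tendsto.eventually hg] with x hx hx₀ hx₁ hxg
  obtain ⟨x', x'', hx', hx'', hZx⟩ := hx
  rw [hx₁.unique P₁.plot hx'']
  rw [← hx₀.unique P₀.plot hx'] at hZx
  exact hZx.unique hZ (hxg.congr fun t ht => FPath.ofIdeal_X hZ hI ht)

/-- The flow of a path conjugates flows of elements of the ideals at its end points. -/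
theorem FPath.HasFlow.conj (r : Reparam) {Q : FPath F} {f : M → M} (hf : Q.HasFlow f) {g : M → M}
    (hg : IsIdealFlow F (Q.p 0) g) :
    ∃ g', IsIdealFlow F (Q.p 1) g' ∧ ∀ᶠ x in 𝓝 (Q.p 0), f (g x) = g' (f x) := by
  obtain ⟨P, hP, hPg⟩ := hg.exists_path
  have h0 : (FPath.const F (Q.p 0)).p 1 = Q.p 0 := rfl
  have hc : (FPath.const F (Q.p 0)).HasFlow _root_.id :=
    Eventually.of_forall fun x => ⟨fun _ => x, (FPath.const F x).integral, rfl, rfl⟩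
  have h := FHomotopic.concat_right r hP.fHomotopic Q h0 (hP.1 1)
  have h2 := h.exists_isIdealFlow (hc.concat r hf h0) (hPg.concat r hf (hP.1 1))
  rw [FPath.concat_zero, FPath.concat_one] at h2
  exact h2

end IdealFlow

section Exp

variable {E : Type*} [NormedAddCommGroup E] [NormedSpace ℝ E]
  {N : Type*} [TopologicalSpace N] [ChartedSpace E N] [IsManifold 𝓘(ℝ, E) ∞ N]
  {F : VFModule E N} {y : N}

theorem VFModule.InExp.id (F : VFModule E N) (y : N) : F.InExp y id :=
  .flow (fun _ => 0) (isPlotOn_zero _ _) (fun _ _ => F.idealSec_zero _ _) _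
    (Eventually.of_forall fun x => ⟨fun _ => x, fun t _ =>
      (hasMFDerivAt_const_zero rfl t).hasMFDerivWithinAt, rfl, rfl⟩)

variable [FiniteDimensional ℝ E] [T2Space N] [SecondCountableTopology N]

theorem VFModule.exists_flow_near {Z : ℝ → VF E N} (hZ : F.IsPlotOn (Icc 0 1) Z)
    (hI : ∀ t ∈ Icc (0 : ℝ) 1, F.IdealSec y ⊤ (Z t)) :
    ∃ φ : N ≃ₜ N, φ y = y ∧ ∀ᶠ x in 𝓝 y, FlowsTo Z 1 x (φ x) := by
  obtain ⟨χ, O, g1, g2, g3, g4, g5, -⟩ := exists_cutoff (E := E) (isCompact_singleton (x := y))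
    isOpen_univ (subset_univ _)
  have hy : y ∈ O := g3 rfl
  obtain ⟨Φ, hΦ⟩ := exists_isFlowOf hZ.hat (1 : ℝ) g1 g5
  have hcurve : IsIntegralCurve Z (fun _ => y) 1 := fun t ht =>
    (hasMFDerivAt_const_zero ((hI t ht).eq_zero trivial) t).hasMFDerivWithinAt
  have e1 : (1 : ℝ) = 0 + (1 : ℝ) • (1 : ℝ) := by simp
  refine ⟨⟨⟨Φ 1 0, Φ (-1) 1, fun x => ?_, fun x => ?_⟩, (hΦ.contMDiff _ _).continuous,
    (hΦ.contMDiff _ _).continuous⟩, ?_, ?_⟩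
  · have := hΦ.left_inv 1 0 x
    rwa [← e1] at this
  · have := hΦ.right_inv 1 0 x
    rwa [← e1] at this
  · have := hΦ.eq_integralCurve hcurve (fun t _ => g4 _ hy) 0 1
    rwa [sub_zero] at this
  · filter_upwards [hΦ.eventually_isIntegralCurve hZ g2 g4 hcurve (fun _ _ => hy) 0] with x hx
    exact ⟨_, hx.1, by simp [hΦ.zero], by simp⟩

theorem VFModule.InExp.map_nhds {f : N → N} (h : F.InExp y f) :
    map f (𝓝 y) = 𝓝 y ∧ ∃ g : N → N, ∀ᶠ x in 𝓝 y, g (f x) = x := by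
  induction h with
  | flow Z hZ hI f hf =>
    obtain ⟨φ, hy, hφ⟩ := VFModule.exists_flow_near hZ hI
    have e : f =ᶠ[𝓝 y] φ := by
      filter_upwards [hf, hφ] with x hx hx' using hx.unique hZ hx'
    refine ⟨?_, φ.symm, ?_⟩
    · rw [Filter.map_congr e, φ.map_nhds_eq, hy]
    · filter_upwards [e] with x hx
      rw [hx, φ.symm_apply_apply]
  | comp f g _ _ hf hg =>
    obtain ⟨hf, f', hf'⟩ := hf
    obtain ⟨hg, g', hg'⟩ := hg
    refine ⟨by rw [← Filter.map_map, hg, hf], g' ∘ f', ?_⟩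
    rw [← hg] at hf'
    filter_upwards [hg', eventually_map.1 hf'] with x hx hx'
    simp only [Function.comp_apply, hx', hx]
  | inv f g _ hfg hf =>
    have h1 : map g (𝓝 y) = 𝓝 y := by
      conv_lhs => rw [← hf.1, Filter.map_map]
      exact (Filter.map_congr (m₂ := _root_.id) hfg).trans Filter.map_id
    refine ⟨h1, f, ?_⟩
    rw [← hf.1]
    refine eventually_map.2 ?_
    filter_upwards [hfg] with x hx
    rw [hx]

theorem VFModule.InExp.tendsto {f : N → N} (h : F.InExp y f) : Tendsto f (𝓝 y) (𝓝 y) :=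
  h.map_nhds.1.le

theorem VFModule.InExp.exists_inv {f : N → N} (h : F.InExp y f) :
    ∃ g, F.InExp y g ∧ (∀ᶠ x in 𝓝 y, g (f x) = x) ∧ ∀ᶠ x in 𝓝 y, f (g x) = x := by
  obtain ⟨h1, g, hg⟩ := h.map_nhds
  refine ⟨g, .inv f g h hg, hg, ?_⟩
  rw [← h1]
  refine eventually_map.2 ?_
  filter_upwards [hg] with x hx
  rw [hx]

theorem VFModule.InExp.congr {f f' : N → N} (h : F.InExp y f) (e : f =ᶠ[𝓝 y] f') :
    F.InExp y f' := by
  obtain ⟨g, hg, -, h1⟩ := h.exists_inv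
  refine .inv g f' hg ?_
  filter_upwards [h1, hg.tendsto.eventually e] with x hx hx'
  rw [← hx', hx]

end Exp

section Transport

variable {E : Type*} [NormedAddCommGroup E] [NormedSpace ℝ E]
  {B : Type*} [TopologicalSpace B] [ChartedSpace E B]
  {E' : Type*} [NormedAddCommGroup E'] [NormedSpace ℝ E']
  {B' : Type*} [TopologicalSpace B'] [ChartedSpace E' B']

theorem PartialDiffeomorph.mder_symm_mder (Φ : PartialDiffeomorph 𝓘(ℝ, E) 𝓘(ℝ, E') B B' ∞) {b : B}
    (hb : b ∈ Φ.source) (v : E) :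
    mder (E := E') (E' := E) Φ.symm (Φ b) (mder (E := E) (E' := E') Φ b v) = v := by
  have h1 : MDifferentiableAt 𝓘(ℝ, E) 𝓘(ℝ, E') Φ b := Φ.mdifferentiableAt (by simp) hb
  have h2 : MDifferentiableAt 𝓘(ℝ, E') 𝓘(ℝ, E) Φ.symm (Φ b) :=
    Φ.symm.mdifferentiableAt (by simp) (Φ.map_source hb)
  rw [← mder_comp h2 h1]
  have : (fun z => Φ.symm (Φ z)) =ᶠ[𝓝 b] fun z => z := by
    filter_upwards [Φ.open_source.mem_nhds hb] with z hz using Φ.left_inv hz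
  rw [mder_congr this, mder_id]

theorem PartialDiffeomorph.mder_mder_symm (Φ : PartialDiffeomorph 𝓘(ℝ, E) 𝓘(ℝ, E') B B' ∞) {b : B}
    (hb : b ∈ Φ.source) (v : E') :
    mder (E := E) (E' := E') Φ b (mder (E := E') (E' := E) Φ.symm (Φ b) v) = v := by
  have h := PartialDiffeomorph.mder_symm_mder Φ.symm (Φ.map_source hb) v
  have e : Φ.symm.symm (Φ.symm (Φ b)) = Φ b := Φ.right_inv (Φ.map_source hb)
  have e' : Φ.symm (Φ b) = b := Φ.left_inv hb
  rw [e'] at h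
  exact h

theorem PartialDiffeomorph.mpullback_eq (Φ : PartialDiffeomorph 𝓘(ℝ, E) 𝓘(ℝ, E') B B' ∞) {b : B}
    (hb : b ∈ Φ.source) (Y : VF E' B') :
    vfVal (I := 𝓘(ℝ, E)) (VectorField.mpullback 𝓘(ℝ, E) 𝓘(ℝ, E') Φ Y) b =
      mder (E := E') (E' := E) Φ.symm (Φ b) (vfVal Y (Φ b)) := by
  let e : E ≃L[ℝ] E' := ContinuousLinearEquiv.equivOfInverse (mder (E := E) (E' := E') Φ b)
    (mder (E := E') (E' := E) Φ.symm (Φ b)) (PartialDiffeomorph.mder_symm_mder Φ hb)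
    (PartialDiffeomorph.mder_mder_symm Φ hb)
  have h1 : ContinuousLinearMap.inverse (e : E →L[ℝ] E') = (e.symm : E' →L[ℝ] E) :=
    ContinuousLinearMap.inverse_equiv e
  exact DFunLike.congr_fun h1 (vfVal Y (Φ b))

/-- The image of a vector field under a diffeomorphism. -/
def pushVF (Φ : PartialDiffeomorph 𝓘(ℝ, E) 𝓘(ℝ, E') B B' ∞) (Y : VF E B) : VF E' B' := fun b =>
  (mder (E := E) (E' := E') Φ (Φ.symm b) (vfVal Y (Φ.symm b)) : E')

/-- A diffeomorphism which identifies two modules of vector fields. -/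
def PreservesVF [IsManifold 𝓘(ℝ, E) ∞ B] [IsManifold 𝓘(ℝ, E') ∞ B']
    (Φ : PartialDiffeomorph 𝓘(ℝ, E) 𝓘(ℝ, E') B B' ∞) (F : VFModule E B)
    (F' : VFModule E' B') : Prop :=
  ∀ (U : Opens B) (W : Opens B'), (W : Set B') ⊆ Φ.target →
    (U : Set B) = Φ.source ∩ Φ ⁻¹' W →
    ∀ Y : VF E' B', F'.Sec W Y ↔ F.Sec U (VectorField.mpullback 𝓘(ℝ, E) 𝓘(ℝ, E') Φ Y)

variable [IsManifold 𝓘(ℝ, E) ∞ B] [IsManifold 𝓘(ℝ, E') ∞ B']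
  {F : VFModule E B} {F' : VFModule E' B'} {Φ : PartialDiffeomorph 𝓘(ℝ, E) 𝓘(ℝ, E') B B' ∞}

theorem PreservesVF.push (h : PreservesVF Φ F F') {U : Opens B} (hU : (U : Set B) ⊆ Φ.source)
    {W : Opens B'} (hW : (W : Set B') ⊆ Φ.target ∩ Φ.symm ⁻¹' U) {Y : VF E B} (hY : F.Sec U Y) :
    F'.Sec W (pushVF Φ Y) := by
  let U' : Opens B := ⟨Φ.source ∩ Φ ⁻¹' W,
    Φ.contMDiffOn.continuousOn.isOpen_inter_preimage Φ.open_source W.isOpen⟩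
  refine (h U' W (hW.trans inter_subset_left) rfl _).2 ?_
  have hle : U' ≤ U := fun b hb => by
    have h1 : Φ.symm (Φ b) ∈ U := (hW hb.2).2
    have h2 : Φ.symm (Φ b) = b := Φ.left_inv hb.1
    rwa [h2] at h1
  refine F.congr (fun b hb => ?_) (F.restrict hle hY)
  have h2 : Φ.symm (Φ b) = b := Φ.left_inv hb.1
  refine Eq.symm (Eq.trans (PartialDiffeomorph.mpullback_eq Φ hb.1 _) ?_)
  change mder (E := E') (E' := E) Φ.symm (Φ b)
    (mder (E := E) (E' := E') Φ (Φ.symm (Φ b)) (vfVal Y (Φ.symm (Φ b)))) = vfVal Y b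
  rw [h2, PartialDiffeomorph.mder_symm_mder Φ hb.1]

theorem pushVF_sum {n : ℕ} {Y : VF E B} {G : Fin n → VF E B} {c : Fin n → B → ℝ} {b : B'}
    (h : Y (Φ.symm b) = ∑ i, c i (Φ.symm b) • G i (Φ.symm b)) :
    pushVF Φ Y b = ∑ i, c i (Φ.symm b) • pushVF Φ (G i) b := by
  have h1 : vfVal Y (Φ.symm b) = ∑ i, c i (Φ.symm b) • vfVal (G i) (Φ.symm b) := h
  have h2 := congrArg (mder (E := E) (E' := E') Φ (Φ.symm b)) h1
  rw [map_sum] at h2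
  refine Eq.trans h2 (Finset.sum_congr rfl fun i _ => ?_)
  exact map_smul (mder (E := E) (E' := E') Φ (Φ.symm b)) _ _

variable [FiniteDimensional ℝ E] [T2Space B] [SecondCountableTopology B] [FiniteDimensional ℝ E']
  [T2Space B']

theorem PreservesVF.exists_conj_flow (h : PreservesVF Φ F F') {b₀ : B} (hb₀ : b₀ ∈ Φ.source)
    {Z : ℝ → VF E B} (hZ : F.IsPlotOn (Icc 0 1) Z)
    (hI : ∀ t ∈ Icc (0 : ℝ) 1, F.IdealSec b₀ ⊤ (Z t)) {f : B → B}
    (hf : ∀ᶠ x in 𝓝 b₀, FlowsTo Z 1 x (f x)) :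
    F'.InExp (Φ b₀) (fun b => Φ (f (Φ.symm b))) := by
  have hs : Φ.symm (Φ b₀) = b₀ := Φ.left_inv hb₀
  have hbt : Φ b₀ ∈ Φ.target := Φ.map_source hb₀
  obtain ⟨ρ, r1, -, r3, V, hV, hVt, r4⟩ := exists_bump (E := E') (Φ.open_target.mem_nhds hbt)
  let T : Opens B' := ⟨Φ.target, Φ.open_target⟩
  let S : Opens B := ⟨Φ.source, Φ.open_source⟩
  have hsym : ContMDiffOn 𝓘(ℝ, E') 𝓘(ℝ, E) ∞ Φ.symm Φ.target := Φ.contMDiffOn_invFun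
  have hpush : ∀ {Y}, F.Sec ⊤ Y → F'.Sec T (pushVF Φ Y) := fun hY =>
    h.push (U := S) subset_rfl (W := T) (fun b hb => ⟨hb, Φ.symm.map_source hb⟩)
      (F.restrict le_top hY)
  have hsec : ∀ t ∈ Icc (0 : ℝ) 1, F'.Sec ⊤ (fun b => ρ b • pushVF Φ (Z t) b) := fun t ht =>
    F'.sec_top_of_tsupport (hpush (hZ.1 t ht)) r1 r3
  refine .flow (fun t b => ρ b • pushVF Φ (Z t) b) ⟨hsec, fun t₀ ht₀ b => ?_⟩ (fun t ht => ?_) _ ?_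
  · by_cases hb : b ∈ Φ.target
    · obtain ⟨U', V', h1, h2, h3, n, c, G, h4, h5, h6⟩ := hZ.2 t₀ ht₀ (Φ.symm b)
      let W : Opens B' := ⟨Φ.target ∩ Φ.symm ⁻¹' (V' : Set B),
        hsym.continuousOn.isOpen_inter_preimage Φ.open_target V'.isOpen⟩
      refine ⟨U', W, h1, h2, ⟨hb, h3⟩, n, fun i z => ρ z.2 * c i (z.1, Φ.symm z.2),
        fun i => pushVF Φ (G i), fun i => ?_, fun i => ?_, fun t ht x hx => ?_⟩
      · refine ((r1.comp contMDiff_snd).contMDiffOn).mul ?_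
        refine (h4 i).comp (f := fun z : ℝ × B' => (z.1, Φ.symm z.2))
          (contMDiffOn_fst.prodMk (hsym.comp contMDiffOn_snd fun z hz => hz.2.1))
          fun z hz => ⟨hz.1, hz.2.2⟩
      · refine h.push (U := V' ⊓ S) inter_subset_right (W := W) (fun x hx => ⟨hx.1, hx.2,
          Φ.symm.map_source hx.1⟩) (F.restrict inf_le_left (h5 i))
      · have := pushVF_sum (Φ := Φ) (b := x) (c := fun i b => c i (t, b)) (h6 t ht _ hx.2)
        change ρ x • pushVF Φ (Z t) x = _
        rw [this, Finset.smul_sum]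
        simp only [smul_smul]
    · refine ⟨univ, ⟨(tsupport ρ)ᶜ, (isClosed_tsupport ρ).isOpen_compl⟩, isOpen_univ, trivial,
        fun hc => hb (r3 hc), 0, Fin.elim0, Fin.elim0, fun i => i.elim0, fun i => i.elim0,
        fun t _ x hx => ?_⟩
      have : ρ x = 0 := image_eq_zero_of_notMem_tsupport hx
      simp [this]
  · obtain ⟨n, g, G, hg, hZg⟩ := hI t ht
    refine VFModule.IdealSec.of_local (V := T) ⟨n, fun i b => ρ b * g i (Φ.symm b),
      fun i => pushVF Φ (G i), fun i => ⟨?_, ?_, hpush (hg i).2.2⟩, fun b hb => ?_⟩ hbt (hsec t ht)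
    · exact r1.contMDiffOn.mul ((hg i).1.comp hsym fun _ _ => trivial)
    · change ρ (Φ b₀) * g i (Φ.symm (Φ b₀)) = 0
      rw [hs, (hg i).2.1, mul_zero]
    · have := pushVF_sum (Φ := Φ) (b := b) (c := g) (hZg _ trivial)
      change ρ b • pushVF Φ (Z t) b = ∑ i, (ρ b * g i (Φ.symm b)) • pushVF Φ (G i) b
      rw [this, Finset.smul_sum]
      simp only [smul_smul]
  · have hcurve : IsIntegralCurve Z (fun _ => b₀) 1 := fun t ht =>
      (hasMFDerivAt_const_zero ((hI t ht).eq_zero trivial) t).hasMFDerivWithinAt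
    have hO : IsOpen (Φ.source ∩ Φ ⁻¹' (V : Set B')) :=
      Φ.contMDiffOn.continuousOn.isOpen_inter_preimage Φ.open_source V.isOpen
    have h1 := hcurve.eventually_exists hZ hO (fun _ _ => ⟨hb₀, hV⟩) (t₀ := 0) (by simp)
    have ht : Tendsto Φ.symm (𝓝 (Φ b₀)) (𝓝 b₀) := by
      have := (hsym.contMDiffAt (Φ.open_target.mem_nhds hbt)).continuousAt
      rwa [ContinuousAt, hs] at this
    filter_upwards [ht.eventually (h1.and hf), Φ.open_target.mem_nhds hbt] with b hb hbT
    obtain ⟨⟨γ, hγ, hγ0, hγO⟩, hfb⟩ := hb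
    have hγ1 : γ 1 = f (Φ.symm b) := FlowsTo.unique hZ ⟨γ, hγ, hγ0, rfl⟩ hfb
    refine ⟨fun t => Φ (γ t), fun t ht => ?_, ?_, ?_⟩
    · have h2 := hγO t ht
      have h3 : MDifferentiableAt 𝓘(ℝ, E) 𝓘(ℝ, E') Φ (γ t) := Φ.mdifferentiableAt (by simp) h2.1
      have h4 := h3.hasMFDerivAt.comp_hasMFDerivWithinAt t (hγ t ht)
      refine h4.congr_mfderiv ?_
      have e1 : Φ.symm (Φ (γ t)) = γ t := Φ.left_inv h2.1
      have e2 : vfVal (I := 𝓘(ℝ, E')) (fun b => ρ b • pushVF Φ (Z t) b) (Φ (γ t)) =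
          mder (E := E) (E' := E') Φ (γ t) (vfVal (Z t) (γ t)) := by
        change ρ (Φ (γ t)) • mder (E := E) (E' := E') Φ (Φ.symm (Φ (γ t)))
          (vfVal (Z t) (Φ.symm (Φ (γ t)))) = _
        rw [r4 _ h2.2, one_smul, e1]
      have e3 : (mder (E := E) (E' := E') Φ (γ t)).comp
          ((1 : ℝ →L[ℝ] ℝ).smulRight (vfVal (Z t) (γ t))) =
          (1 : ℝ →L[ℝ] ℝ).smulRight
            (vfVal (I := 𝓘(ℝ, E')) (fun b => ρ b • pushVF Φ (Z t) b) (Φ (γ t))) := by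
        rw [e2]
        ext
        simp
      exact e3
    · change Φ (γ 0) = b
      rw [hγ0]
      exact Φ.right_inv hbT
    · change Φ (γ 1) = _
      rw [hγ1]

/-- Conjugation by a foliation preserving diffeomorphism maps `exp(I𝓕)` to `exp(I𝓕')`. -/
theorem PreservesVF.conj [SecondCountableTopology B'] (h : PreservesVF Φ F F') {b₀ : B}
    (hb₀ : b₀ ∈ Φ.source) {f : B → B} (hf : F.InExp b₀ f) :
    F'.InExp (Φ b₀) (fun b => Φ (f (Φ.symm b))) := by
  have hs : Φ.symm (Φ b₀) = b₀ := Φ.left_inv hb₀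
  have hbt : Φ b₀ ∈ Φ.target := Φ.map_source hb₀
  have ht : Tendsto Φ.symm (𝓝 (Φ b₀)) (𝓝 b₀) := by
    have := ((show ContMDiffOn 𝓘(ℝ, E') 𝓘(ℝ, E) ∞ Φ.symm Φ.target from
      Φ.contMDiffOn_invFun).contMDiffAt (Φ.open_target.mem_nhds hbt)).continuousAt
    rwa [ContinuousAt, hs] at this
  have hsrc : ∀ᶠ b in 𝓝 b₀, b ∈ Φ.source := Φ.open_source.mem_nhds hb₀
  induction hf with
  | flow Z hZ hI f hf => exact h.exists_conj_flow hb₀ hZ hI hf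
  | comp f g _ hg ihf ihg =>
    refine (VFModule.InExp.comp _ _ ihf ihg).congr ?_
    filter_upwards [ht.eventually (hg.tendsto.eventually hsrc)] with b hb
    have : Φ.symm (Φ (g (Φ.symm b))) = g (Φ.symm b) := Φ.left_inv hb
    simp only [Function.comp_apply, this]
  | inv f g hf hfg ihf =>
    refine .inv _ _ ihf ?_
    filter_upwards [ht.eventually ((hf.tendsto.eventually hsrc).and hfg),
      Φ.open_target.mem_nhds hbt] with b hb hbT
    have : Φ.symm (Φ (f (Φ.symm b))) = f (Φ.symm b) := Φ.left_inv hb.1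
    rw [this, hb.2]
    exact Φ.right_inv hbT

end Transport

section Pullback

variable {E : Type*} [NormedAddCommGroup E] [NormedSpace ℝ E]
  {M : Type*} [TopologicalSpace M] [ChartedSpace E M] [IsManifold 𝓘(ℝ, E) ∞ M]
  {E' : Type*} [NormedAddCommGroup E'] [NormedSpace ℝ E']
  {B : Type*} [TopologicalSpace B] [ChartedSpace E' B] [IsManifold 𝓘(ℝ, E') ∞ B]
  {E'' : Type*} [NormedAddCommGroup E''] [NormedSpace ℝ E'']
  {B' : Type*} [TopologicalSpace B'] [ChartedSpace E'' B'] [IsManifold 𝓘(ℝ, E'') ∞ B']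
  {F : SingularFoliation E M} {ι : B → M} {ι' : B' → M}

/-- The differential of `k` maps elements of `𝓕`, near the points of `S`, to combinations of
elements of `𝓕`. -/
def PushesNear (F : SingularFoliation E M) (k : M → M) (S : Set M) : Prop :=
  ∃ (n : ℕ) (H : Fin n → VF E M), (∀ l, F.Sec ⊤ (H l)) ∧ ∀ G, F.Sec ⊤ G → ∀ z ∈ S,
    ∃ V : Opens M, z ∈ V ∧ ∃ c : Fin n → M → ℝ, (∀ l, ContMDiffOn 𝓘(ℝ, E) 𝓘(ℝ, ℝ) ∞ (c l) V) ∧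
      ∀ w ∈ V, mder (E' := E) k w (vfVal G w) = combVF H (fun l => c l w) (k w)

theorem PushesNear.mono {k : M → M} {S S' : Set M} (h : PushesNear F k S) (hS : S' ⊆ S) :
    PushesNear F k S' := by
  obtain ⟨n, H, hH, h⟩ := h
  exact ⟨n, H, hH, fun G hG z hz => h G hG z (hS hz)⟩

theorem FlowData.pushesNear {P : Type*} [NormedAddCommGroup P] [NormedSpace ℝ P] {K : Set M}
    {e : P} {X : P → VF E M} (D : FlowData F K e X) (t : ℝ) (p : P) :
    PushesNear F (D.Φ t p) D.O := by
  refine ⟨D.n, D.G, D.sec, fun G hG z hz => ?_⟩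
  obtain ⟨V, hV, -, c, hc, hGc⟩ := D.gen_of_mem hz ⊤ trivial G hG
  refine ⟨V, hV, fun l w => D.R t p w (fun i => c i w, 0) l, fun l => ?_, fun w hw => ?_⟩
  · have h1 : ContMDiff 𝓘(ℝ, E) 𝓘(ℝ, ((Fin D.n → ℝ) × P) →L[ℝ] (Fin D.n → ℝ)) ∞
        (fun w => D.R t p w) :=
      D.R_smooth.comp (contMDiff_const.prodMk (contMDiff_const.prodMk contMDiff_id))
    have h2 : ContMDiffOn 𝓘(ℝ, E) 𝓘(ℝ, (Fin D.n → ℝ) × P) ∞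
        (fun w => ((fun i => c i w, 0) : (Fin D.n → ℝ) × P)) V :=
      (contMDiffOn_pi_space.2 hc).prodMk_space contMDiffOn_const
    exact (contMDiffOn_pi_space.1 (h1.contMDiffOn.clm_apply h2)) l
  · have h1 : vfVal G w = combVF D.G (fun i => c i w) w := hGc w hw
    rw [h1, D.mder_comb]

theorem pullback_sec_push {Φ : PartialDiffeomorph 𝓘(ℝ, E') 𝓘(ℝ, E'') B B' ∞} {k : M → M}
    (hι : ContMDiff 𝓘(ℝ, E') 𝓘(ℝ, E) ∞ ι) (hι' : ContMDiff 𝓘(ℝ, E'') 𝓘(ℝ, E) ∞ ι')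
    (hk : ContMDiff 𝓘(ℝ, E) 𝓘(ℝ, E) ∞ k) (hkι : ∀ b ∈ Φ.source, ι' (Φ b) = k (ι b))
    (hp : PushesNear F k (ι '' Φ.source)) {U : Opens B} (hU : (U : Set B) ⊆ Φ.source)
    {W : Opens B'} (hW : (W : Set B') ⊆ Φ.target ∩ Φ.symm ⁻¹' U) {Y : VF E' B}
    (hY : (F.toVFModule.pullback ι).Sec U Y) :
    (F.toVFModule.pullback ι').Sec W (pushVF Φ Y) := by
  have hsym : ContMDiffOn 𝓘(ℝ, E'') 𝓘(ℝ, E') ∞ Φ.symm Φ.target := Φ.contMDiffOn_invFun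
  have hri : ∀ b ∈ W, Φ (Φ.symm b) = b := fun b hb => Φ.right_inv (hW hb).1
  obtain ⟨n, H, hH, hp⟩ := hp
  refine ⟨?_, fun b hb => ?_⟩
  · have h1 : ContMDiffOn 𝓘(ℝ, E') 𝓘(ℝ, E').tangent ∞
      (fun x => tmk 𝓘(ℝ, E') x (vfVal Y x)) U := hY.1
    have h2 := contMDiffOn_tangent_push (J := 𝓘(ℝ, E'')) Φ.open_source Φ.contMDiffOn
      (h1.comp (hsym.mono fun b hb => (hW hb).1) fun b hb => (hW hb).2)
      (fun b hb => hU (hW hb).2)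
    refine ContMDiffOn.congr h2 fun b hb => ?_
    have h3 : tmk 𝓘(ℝ, E'') (Φ (Φ.symm b))
        (mder (E := E') (E' := E'') Φ (Φ.symm b) (vfVal Y (Φ.symm b))) =
        tmk 𝓘(ℝ, E'') b (mder (E := E') (E' := E'') Φ (Φ.symm b) (vfVal Y (Φ.symm b))) := by
      rw [hri b hb]
    exact h3.symm
  · obtain ⟨V₀, hV₀, hV₀U, m, f, G, hf, hYf⟩ := hY.2 (Φ.symm b) (hW hb).2
    choose V hV c hc hVc using fun i => hp (G i) (hf i).2 (ι (Φ.symm b)) ⟨_, hU (hW hb).2, rfl⟩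
    let O : Set B := V₀ ∩ ι ⁻¹' ⋂ i, (V i : Set M)
    have hO : IsOpen O := V₀.isOpen.inter
      ((isOpen_iInter_of_finite fun i => (V i).isOpen).preimage hι.continuous)
    have hcont : ContMDiffOn 𝓘(ℝ, E'') 𝓘(ℝ, E') ∞ Φ.symm W := hsym.mono fun b hb => (hW hb).1
    refine ⟨⟨W ∩ Φ.symm ⁻¹' O, hcont.continuousOn.isOpen_inter_preimage W.isOpen hO⟩,
      ⟨hb, hV₀, mem_iInter.2 hV⟩, fun z hz => hz.1, n,
      fun l z => ∑ i, f i (Φ.symm z) * c i l (ι (Φ.symm z)), H, fun l => ⟨?_, hH l⟩,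
      fun z hz => ?_⟩
    · refine contMDiffOn_finsetSum fun i _ => ContMDiffOn.mul ?_ ?_
      · exact (hf i).1.comp (hcont.mono inter_subset_left) fun z hz => hz.2.1
      · exact (hc i l).comp (hι.comp_contMDiffOn (hcont.mono inter_subset_left))
          fun z hz => mem_iInter.1 hz.2.2 i
    · have hx : Φ.symm z ∈ Φ.source := hU (hW hz.1).2
      set x := Φ.symm z with hxd
      have hzx : Φ x = z := hri z hz.1
      have d1 : MDifferentiableAt 𝓘(ℝ, E') 𝓘(ℝ, E'') Φ x := Φ.mdifferentiableAt (by simp) hx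
      have d2 : ∀ b, MDifferentiableAt 𝓘(ℝ, E'') 𝓘(ℝ, E) ι' b := fun b =>
        hι'.mdifferentiableAt (by simp)
      have d3 : MDifferentiableAt 𝓘(ℝ, E') 𝓘(ℝ, E) ι x := hι.mdifferentiableAt (by simp)
      have d4 : ∀ w, MDifferentiableAt 𝓘(ℝ, E) 𝓘(ℝ, E) k w := fun w =>
        hk.mdifferentiableAt (by simp)
      have e1 : (fun b => ι' (Φ b)) =ᶠ[𝓝 x] fun b => k (ι b) := by
        filter_upwards [Φ.open_source.mem_nhds hx] with b hb using hkι b hb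
      have e2 : mder (E := E'') (E' := E) ι' z (mder (E := E') (E' := E'') Φ x (vfVal Y x)) =
          mder (E' := E) k (ι x) (mder (E := E') (E' := E) ι x (vfVal Y x)) := by
        rw [← mder_comp (d4 _) d3, ← mder_congr e1, ← hzx, ← mder_comp (d2 _) d1]
      have e3 : mder (E := E') (E' := E) ι x (vfVal Y x) = ∑ i, f i x • vfVal (G i) (ι x) :=
        hYf x hz.2.1
      rw [e3, map_sum] at e2
      refine Eq.trans e2 ?_
      have hkz : k (ι x) = ι' z := by rw [← hkι x hx, hzx]
      have e4 : ∀ i, mder (E' := E) k (ι x) (f i x • vfVal (G i) (ι x)) =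
          combVF H (f i x • fun l => c i l (ι x)) (ι' z) := fun i => by
        rw [map_smul, hVc i (ι x) (mem_iInter.1 hz.2.2 i), combVF_smul, hkz]
      rw [Finset.sum_congr rfl fun i _ => e4 i, ← combVF_sum]
      change combVF H _ (ι' z) = combVF H _ (ι' z)
      congr 1
      funext l
      simp only [Finset.sum_apply, Pi.smul_apply, smul_eq_mul]
      rfl

theorem preservesVF_of_intertwines {Φ : PartialDiffeomorph 𝓘(ℝ, E') 𝓘(ℝ, E'') B B' ∞}
    {k k' : M → M} (hι : ContMDiff 𝓘(ℝ, E') 𝓘(ℝ, E) ∞ ι)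
    (hι' : ContMDiff 𝓘(ℝ, E'') 𝓘(ℝ, E) ∞ ι') (hk : ContMDiff 𝓘(ℝ, E) 𝓘(ℝ, E) ∞ k)
    (hk' : ContMDiff 𝓘(ℝ, E) 𝓘(ℝ, E) ∞ k') (hkι : ∀ b ∈ Φ.source, ι' (Φ b) = k (ι b))
    (hkk : ∀ x, k' (k x) = x) (hp : PushesNear F k (ι '' Φ.source))
    (hp' : PushesNear F k' (ι' '' Φ.target)) :
    PreservesVF Φ (F.toVFModule.pullback ι) (F.toVFModule.pullback ι') := by
  intro U W hW hU Y
  constructor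
  · intro hY
    have h1 := pullback_sec_push (F := F) (Φ := Φ.symm) (k := k') hι' hι hk' (fun b hb => by
        have h2 : Φ (Φ.symm b) = b := Φ.right_inv hb
        rw [← h2, hkι _ (Φ.symm.map_source hb), hkk, h2]) hp' (U := W) hW (W := U)
      (fun b hb => by
        have hb' : b ∈ Φ.source ∩ Φ ⁻¹' W := hU ▸ hb
        exact ⟨hb'.1, hb'.2⟩) hY
    refine VFModule.congr _ (fun b hb => ?_) h1
    have hb' : b ∈ Φ.source ∩ Φ ⁻¹' W := hU ▸ hb
    exact (PartialDiffeomorph.mpullback_eq Φ hb'.1 Y).symm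
  · intro hY
    have hUs : (U : Set B) ⊆ Φ.source := hU ▸ inter_subset_left
    have hWU : (W : Set B') ⊆ Φ.target ∩ Φ.symm ⁻¹' U := fun b hb => by
      refine ⟨hW hb, ?_⟩
      rw [mem_preimage, hU]
      refine ⟨Φ.symm.map_source (hW hb), ?_⟩
      have h2 : Φ (Φ.symm b) = b := Φ.right_inv (hW hb)
      rw [mem_preimage, h2]
      exact hb
    have h1 := pullback_sec_push (F := F) (Φ := Φ) hι hι' hk hkι hp hUs hWU hY
    refine VFModule.congr _ (fun b hb => ?_) h1
    have h2 : Φ (Φ.symm b) = b := Φ.right_inv (hW hb)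
    have h3 : Φ.symm b ∈ Φ.source := hUs (hWU hb).2
    have h4 := PartialDiffeomorph.mder_mder_symm Φ h3 (vfVal Y (Φ (Φ.symm b)))
    rw [← PartialDiffeomorph.mpullback_eq Φ h3] at h4
    refine Eq.trans h4 ?_
    change vfVal Y (Φ (Φ.symm b)) = vfVal Y b
    rw [h2]

variable [FiniteDimensional ℝ E] [FiniteDimensional ℝ E'] [FiniteDimensional ℝ E''] [T2Space M]
  [SecondCountableTopology M] [T2Space B']

/-- The flow of a path, corrected by the flow of an element of the ideal at its target, maps a
transversal at the source to a transversal at the target. -/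
theorem Splitting.exists_holonomy {b₀ : B} {b₀' : B'} (r : Reparam) (A : Splitting E' F ι b₀)
    (A' : Splitting E'' F ι' b₀') (P : FPath F) (h₀ : P.p 0 = ι b₀) (h₁ : P.p 1 = ι' b₀') :
    ∃ Φ : PartialDiffeomorph 𝓘(ℝ, E') 𝓘(ℝ, E'') B B' ∞, b₀ ∈ Φ.source ∧ Φ b₀ = b₀' ∧
      PreservesVF Φ (F.toVFModule.pullback ι) (F.toVFModule.pullback ι') ∧
      ∃ Z : ℝ → VF E M, F.IsPlotOn (Icc 0 1) Z ∧
        (∀ t ∈ Icc (0 : ℝ) 1, F.IdealSec (ι' b₀') ⊤ (Z t)) ∧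
        ∀ᶠ b in 𝓝 b₀, ∃ y, FlowsTo P.X 1 (ι b) y ∧ FlowsTo Z 1 y (ι' (Φ b)) := by
  obtain ⟨D⟩ := P.exists_flowData
  obtain ⟨hD1, hD2⟩ := FPath.flowData_flowsTo D
  have hfl := D.isFlowOf P.plot.hat
  let f : M → M := D.Φ 1 0
  have hf : ContMDiff 𝓘(ℝ, E) 𝓘(ℝ, E) ∞ f := hfl.contMDiff 1 0
  have hfb : f (ι b₀) = ι' b₀' := by rw [← h₀, ← h₁]; exact hD1
  rw [h₀] at hD2
  have hbD : ι b₀ ∈ D.O := D.subset ⟨0, by simp, h₀⟩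
  have hbD' : ι' b₀' ∈ D.O := D.subset ⟨1, by simp, h₁⟩
  let φ : B → B' := fun b => A'.π (f (ι b))
  have hfι : ContMDiff 𝓘(ℝ, E') 𝓘(ℝ, E) ∞ (fun b => f (ι b)) := hf.comp A.ι_smooth
  let U : Set B := (fun b => f (ι b)) ⁻¹' A'.O
  have hU : IsOpen U := A'.O.isOpen.preimage hfι.continuous
  have hbU : b₀ ∈ U := by
    change f (ι b₀) ∈ A'.O
    rw [hfb]
    exact A'.base_mem_O
  have hφ : ContMDiffOn 𝓘(ℝ, E') 𝓘(ℝ, E'') ∞ φ U :=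
    A'.π_smooth.comp hfι.contMDiffOn fun b hb => hb
  have hbij := FlowData.transverse_bijective P.plot.hat D A A' (t := 1) (p := 0) hfb hbD hbD'
  have hφb : φ b₀ = b₀' := by
    change A'.π (f (ι b₀)) = b₀'
    rw [hfb, A'.π_ι A'.base_mem]
  have : Nonempty B := ⟨b₀⟩
  obtain ⟨O, O', g, hO, hKO, hOU, hO', hm, hm', hg, hgl, hgr⟩ := exists_smooth_inverse_near hU hφ
    (isCompact_singleton (x := b₀)) (singleton_subset_iff.2 hbU)
    (injOn_singleton φ b₀) (by
      rintro _ rfl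
      exact hbij)
  have hbO : b₀ ∈ O := hKO rfl
  have hbO' : b₀' ∈ O' := hφb ▸ hm hbO
  have hgb : g b₀' = b₀ := by rw [← hφb, hgl _ hbO]
  let υ₀ : B' → Fin A'.k → ℝ := fun b => A'.υ (f (ι (g b)))
  have hυ₀ : ContMDiffOn 𝓘(ℝ, E'') 𝓘(ℝ, Fin A'.k → ℝ) ∞ υ₀ O' :=
    A'.υ_smooth.comp (hfι.comp_contMDiffOn hg) fun b hb => hOU (hm' hb)
  have hυb : υ₀ b₀' = 0 := by
    change A'.υ (f (ι (g b₀'))) = 0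
    rw [hgb, hfb, A'.υ_ι A'.base_mem]
  have hN : IsOpen ((A'.O : Set M) ∩ A'.π ⁻¹' O') :=
    A'.π_smooth.continuousOn.isOpen_inter_preimage A'.O.isOpen hO'
  have hbN : ι' b₀' ∈ (A'.O : Set M) ∩ A'.π ⁻¹' O' := by
    refine ⟨A'.base_mem_O, ?_⟩
    rw [mem_preimage, A'.π_ι A'.base_mem]
    exact hbO'
  obtain ⟨ρ, r1, -, r3, V, hV, hVN, r4⟩ := exists_bump (E := E) (hN.mem_nhds hbN)
  let c : Fin A'.k → M → ℝ := fun i x => ρ x * -(υ₀ (A'.π x) i)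
  have hc : ∀ i, ContMDiff 𝓘(ℝ, E) 𝓘(ℝ, ℝ) ∞ (c i) := fun i => by
    refine contMDiff_cutoff r1 hN r3 (ContMDiffOn.neg ?_)
    exact (contMDiffOn_pi_space.1 hυ₀ i).comp (A'.π_smooth.mono inter_subset_left)
      fun x hx => hx.2
  have hcb : ∀ i, c i (ι' b₀') = 0 := fun i => by
    change ρ _ * -(υ₀ (A'.π (ι' b₀')) i) = 0
    rw [A'.π_ι A'.base_mem, hυb]
    simp
  let Z : ℝ → VF E M := fun _ => lcVF A'.D c
  have hZ : F.IsPlotOn (Icc 0 1) Z := F.isPlotOn_lcVF (c := fun i z => c i z.2) A'.D_sec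
    fun i => ((hc i).comp contMDiff_snd).contMDiffOn
  have hI : ∀ t ∈ Icc (0 : ℝ) 1, F.IdealSec (ι' b₀') ⊤ (Z t) := fun t _ =>
    VFModule.idealSec_of_comb A'.D_sec (g := c) (fun i => ⟨(hc i).contMDiffOn, hcb i⟩)
      fun _ _ => rfl
  have hZf : ∀ᶠ b in 𝓝 b₀, FlowsTo Z 1 (f (ι b)) (ι' (φ b)) := by
    have hΨ : ∀ᶠ z : B' × (Fin A'.k → ℝ) in 𝓝 (b₀', 0), A'.Ψ z.1 z.2 ∈ (V : Set M) := by
      refine A'.Ψ_smooth.continuous.continuousAt.eventually (V.isOpen.mem_nhds ?_)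
      change A'.Ψ b₀' 0 ∈ V
      rw [A'.Ψ_zero]
      exact hV
    rw [nhds_prod_eq] at hΨ
    obtain ⟨p, hp, q, hq, hpq⟩ := eventually_prod_iff.1 hΨ
    obtain ⟨δ, hδ, hδq⟩ := Metric.eventually_nhds_iff_ball.1 hq
    have t1 : Tendsto φ (𝓝 b₀) (𝓝 b₀') := by
      have := (hφ.contMDiffAt (hU.mem_nhds hbU)).continuousAt
      rwa [ContinuousAt, hφb] at this
    have t2 : Tendsto (fun b => A'.υ (f (ι b))) (𝓝 b₀) (𝓝 0) := by
      have h1 : ContinuousAt A'.υ (f (ι b₀)) := (A'.υ_contMDiffAt hbU).continuousAt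
      have h2 : ContinuousAt (fun b => A'.υ (f (ι b))) b₀ := h1.comp (f := fun b => f (ι b))
        hfι.continuous.continuousAt
      rwa [ContinuousAt, hfb, A'.υ_ι A'.base_mem] at h2
    filter_upwards [t1.eventually hp, t2.eventually (Metric.ball_mem_nhds 0 hδ),
      t2.eventually (Metric.ball_mem_nhds 0 A'.ε_pos), hO.mem_nhds hbO] with b h1 h2 h3 hb
    set m := A'.υ (f (ι b)) with hm_def
    have hfO : f (ι b) ∈ A'.O := hOU hb
    have hυφ : υ₀ (φ b) = m := by
      change A'.υ (f (ι (g (φ b)))) = m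
      rw [hgl _ hb]
    have hball : ∀ s > 0, m ∈ Metric.ball 0 s → ∀ t ∈ Icc (0 : ℝ) 1,
        m + t • (-m) ∈ Metric.ball 0 s := by
      intro s _ hs t ht
      have e : m + t • (-m) = (1 - t) • m := by rw [sub_smul, one_smul, smul_neg, sub_eq_add_neg]
      rw [mem_ball_zero_iff] at hs ⊢
      rw [e, norm_smul, Real.norm_of_nonneg (by linarith [ht.2])]
      nlinarith [norm_nonneg m, ht.1, ht.2]
    refine ⟨fun t => A'.Ψ (φ b) (m + t • (-m)), fun t ht => ?_, ?_, ?_⟩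
    · have hb1 := hball _ A'.ε_pos h3 t ht
      have hl := A'.hasMFDerivAt_line (A'.π_mem _ hfO) hb1
      have hVm : A'.Ψ (φ b) (m + t • (-m)) ∈ V := hpq h1 (hδq _ (hball δ hδ h2 t ht))
      have e : vfVal (Z t) (A'.Ψ (φ b) (m + t • (-m))) =
          combVF A'.D (-m) (A'.Ψ (φ b) (m + t • (-m))) := by
        change combVF A'.D (fun i => ρ _ * -(υ₀ (A'.π _) i)) _ = _
        rw [r4 _ hVm, A'.π_Ψ _ (A'.π_mem _ hfO) _ hb1, hυφ]
        congr 1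
        funext i
        simp
      rw [← e] at hl
      exact hl.hasMFDerivWithinAt
    · change A'.Ψ (φ b) (m + (0 : ℝ) • (-m)) = f (ι b)
      rw [zero_smul, add_zero]
      exact A'.Ψ_π _ hfO
    · change A'.Ψ (φ b) (m + (1 : ℝ) • (-m)) = ι' (φ b)
      rw [one_smul, add_neg_cancel, A'.Ψ_zero]
  have hPf : ∀ᶠ b in 𝓝 b₀, FlowsTo P.X 1 (ι b) (f (ι b)) :=
    A.ι_smooth.continuous.continuousAt.eventually hD2
  let P' : FPath F := FPath.concat r (FPath.ofIdeal _ Z hZ hI) P h₁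
  have hP0 : P'.p 0 = ι b₀ := (FPath.concat_zero r _ P h₁).trans h₀
  have hP1 : P'.p 1 = ι' b₀' := FPath.concat_one r _ P h₁
  obtain ⟨D'⟩ := P'.exists_flowData
  have hfl' := D'.isFlowOf P'.plot.hat
  obtain ⟨-, hD2'⟩ := FPath.flowData_flowsTo D'
  rw [hP0] at hD2'
  let k : M → M := D'.Φ 1 0
  let k' : M → M := D'.Φ (-1) 1
  have hkk : ∀ x, k' (k x) = x := fun x => by
    have := hfl'.left_inv 1 0 x
    rwa [show (0 : ℝ) + (1 : ℝ) • (1 : ℝ) = 1 by simp] at this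
  have hkφ : ∀ᶠ b in 𝓝 b₀, ι' (φ b) = k (ι b) := by
    filter_upwards [hZf, hPf, A.ι_smooth.continuous.continuousAt.eventually hD2'] with b h1 h2 h3
    have h4 : FlowsTo P'.X 1 (ι b) (ι' (φ b)) := FlowsTo.join r h2
      (h1.congr fun t ht => (FPath.ofIdeal_X hZ hI ht).symm)
    exact h4.unique P'.plot h3
  have hbD0 : ι b₀ ∈ D'.O := D'.subset ⟨0, by simp, hP0⟩
  have hbD1 : ι' b₀' ∈ D'.O := D'.subset ⟨1, by simp, hP1⟩
  have hφc : ContinuousAt φ b₀ := (hφ.contMDiffAt (hU.mem_nhds hbU)).continuousAt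
  have hall : ∀ᶠ b in 𝓝 b₀, b ∈ O ∧ ι' (φ b) = k (ι b) ∧ ι b ∈ D'.O ∧ ι' (φ b) ∈ D'.O := by
    have h1 : ∀ᶠ b in 𝓝 b₀, ι b ∈ D'.O :=
      A.ι_smooth.continuous.continuousAt.eventually (D'.O.isOpen.mem_nhds hbD0)
    have h2 : ∀ᶠ b in 𝓝 b₀, ι' (φ b) ∈ D'.O := by
      refine (A'.ι_smooth.continuous.continuousAt.comp hφc).eventually (D'.O.isOpen.mem_nhds ?_)
      change ι' (φ b₀) ∈ D'.O
      rwa [hφb]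
    filter_upwards [hO.mem_nhds hbO, hkφ, h1, h2] with b a1 a2 a3 a4 using ⟨a1, a2, a3, a4⟩
  obtain ⟨O₁, hO₁, hO₁o, hbO₁⟩ := eventually_nhds_iff.1 hall
  let Φ : PartialDiffeomorph 𝓘(ℝ, E') 𝓘(ℝ, E'') B B' ∞ :=
    { toFun := φ
      invFun := g
      source := O₁
      target := O' ∩ g ⁻¹' O₁
      map_source' := fun b hb => ⟨hm (hO₁ b hb).1, by
        rw [mem_preimage, hgl _ (hO₁ b hb).1]
        exact hb⟩
      map_target' := fun b hb => hb.2
      left_inv' := fun b hb => hgl _ (hO₁ b hb).1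
      right_inv' := fun b hb => hgr _ hb.1
      open_source := hO₁o
      open_target := hg.continuousOn.isOpen_inter_preimage hO' hO₁o
      contMDiffOn_toFun := hφ.mono fun b hb => hOU (hO₁ b hb).1
      contMDiffOn_invFun := hg.mono inter_subset_left }
  refine ⟨Φ, hbO₁, hφb, ?_, Z, hZ, hI, ?_⟩
  · refine preservesVF_of_intertwines (k := k) (k' := k') A.ι_smooth A'.ι_smooth (hfl'.contMDiff _ _)
      (hfl'.contMDiff _ _) (fun b hb => (hO₁ b hb).2.1) hkk
      ((D'.pushesNear 1 0).mono ?_) ((D'.pushesNear (-1) 1).mono ?_)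
    · rintro _ ⟨b, hb, rfl⟩
      exact (hO₁ b hb).2.2.1
    · rintro _ ⟨b, hb, rfl⟩
      have h1 := (hO₁ _ hb.2).2.2.2
      rwa [hgr _ hb.1] at h1
  · filter_upwards [hPf, hZf] with b h1 h2
    exact ⟨_, h1, h2⟩

end Pullback

section Holonomy

variable {E : Type*} [NormedAddCommGroup E] [NormedSpace ℝ E] [FiniteDimensional ℝ E]
  {M : Type*} [TopologicalSpace M] [T2Space M] [SecondCountableTopology M] [ChartedSpace E M]
  [IsManifold 𝓘(ℝ, E) ∞ M] {F : SingularFoliation E M} {x y z : M}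

theorem Slice.exists_splitting (A : Slice F x) :
    Nonempty (Splitting (EuclideanSpace ℝ (Fin A.dim)) F (Subtype.val : A.carrier → M) A.pt) := by
  refine SingFol.exists_splitting F A.embedded.contMDiff
    (mfderiv_injective_of_isImmersionAt (A.embedded.isImmersion.isImmersionAt A.pt))
    (fun w => ?_) fun v X hX hv => ?_
  · have h := (A.transverse A.pt).ge (x := w) trivial
    obtain ⟨_, ⟨v, rfl⟩, _, ⟨X, hX, rfl⟩, e⟩ := Submodule.mem_sup.1 h
    exact ⟨v, X, hX, e.symm⟩
  · have h : mfderiv (𝓡 A.dim) 𝓘(ℝ, E) (Subtype.val : A.carrier → M) A.pt v ∈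
        (mfderiv (𝓡 A.dim) 𝓘(ℝ, E) (Subtype.val : A.carrier → M) ⟨x, A.mem⟩).range ⊓
          F.leafTangent x := ⟨⟨v, rfl⟩, X, hX, hv.symm⟩
    rw [A.disjoint] at h
    exact h

/-- `φ` represents the holonomy of `P` as a germ of a map between slices. -/
def IsHol (P : FPath F) (A : Slice F x) (B : Slice F y) (φ : A.carrier → B.carrier) : Prop :=
  P.p 0 = x ∧ P.p 1 = y ∧ ∃ f g : M → M, P.HasFlow f ∧ IsIdealFlow F y g ∧
    ∀ᶠ a : A.carrier in 𝓝 A.pt, (φ a : M) = g (f a)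

theorem Slice.tendsto_val (A : Slice F x) : Tendsto (Subtype.val : A.carrier → M) (𝓝 A.pt) (𝓝 x) :=
  continuous_subtype_val.tendsto A.pt

variable {A : Slice F x} {B : Slice F y} {C : Slice F z}

theorem Slice.tendsto_of_val {φ : A.carrier → B.carrier} {f : M → M} (hf : Tendsto f (𝓝 x) (𝓝 y))
    (h : ∀ᶠ a : A.carrier in 𝓝 A.pt, (φ a : M) = f a) : Tendsto φ (𝓝 A.pt) (𝓝 B.pt) :=
  tendsto_subtype_rng.2 ((hf.comp A.tendsto_val).congr' (by
    filter_upwards [h] with a ha using ha.symm))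

theorem IsHol.tendsto {P : FPath F} {φ : A.carrier → B.carrier} (h : IsHol P A B φ) :
    Tendsto φ (𝓝 A.pt) (𝓝 B.pt) := by
  obtain ⟨rfl, rfl, f, g, hf, hg, hφ⟩ := h
  exact Slice.tendsto_of_val (hg.tendsto.comp hf.tendsto) hφ

theorem exists_inExp_of_eq (r : Reparam) {φ φ' : A.carrier → B.carrier} {f g g' : M → M}
    (hf : Tendsto f (𝓝 x) (𝓝 y)) (hg : IsIdealFlow F y g) (hg' : IsIdealFlow F y g')
    (h : ∀ᶠ a : A.carrier in 𝓝 A.pt, (φ a : M) = g (f a))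
    (h' : ∀ᶠ a : A.carrier in 𝓝 A.pt, (φ' a : M) = g' (f a)) :
    ∃ k, B.fol.InExp B.pt k ∧ φ' =ᶠ[𝓝 A.pt] k ∘ φ := by
  obtain ⟨T⟩ := B.exists_splitting
  obtain ⟨g₁, hg₁, hinv, -⟩ := hg.exists_inv r
  obtain ⟨Z, hZ, hI, hZk⟩ := hg'.comp r hg₁
  refine ⟨fun b => T.π (g' (g₁ b)), T.inExp hZ hI ?_, ?_⟩
  · filter_upwards [B.tendsto_val.eventually hZk] with b hb
    exact ⟨_, hb, rfl⟩
  · filter_upwards [h, h', A.tendsto_val.eventually (hf.eventually hinv),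
      (Slice.tendsto_of_val (hg'.tendsto.comp hf) h').eventually (T.Q.isOpen.mem_nhds T.base_mem)]
      with a h1 h2 h3 h4
    simp only [Function.comp_apply, h1, h3, ← h2]
    exact (T.π_ι h4).symm

theorem IsHol.exists_inExp (r : Reparam) {P P' : FPath F} {φ φ' : A.carrier → B.carrier}
    (h : IsHol P A B φ) (h' : IsHol P' A B φ')
    (hk : ∀ f f', P.HasFlow f → P'.HasFlow f' →
      ∃ k, IsIdealFlow F y k ∧ ∀ᶠ a in 𝓝 x, f' a = k (f a)) :
    ∃ k, B.fol.InExp B.pt k ∧ φ' =ᶠ[𝓝 A.pt] k ∘ φ := by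
  obtain ⟨rfl, rfl, f, g, hf, hg, hφ⟩ := h
  obtain ⟨-, -, f', g', hf', hg', hφ'⟩ := h'
  obtain ⟨k, hk, hkf⟩ := hk f f' hf hf'
  refine exists_inExp_of_eq r hf.tendsto hg (hg'.comp r hk) hφ ?_
  filter_upwards [hφ', A.tendsto_val.eventually hkf] with a h1 h2
  rw [h1, h2, Function.comp_apply]

theorem IsHol.exists_inExp_self (r : Reparam) {P : FPath F} {φ φ' : A.carrier → B.carrier}
    (h : IsHol P A B φ) (h' : IsHol P A B φ') :
    ∃ k, B.fol.InExp B.pt k ∧ φ' =ᶠ[𝓝 A.pt] k ∘ φ :=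
  h.exists_inExp r h' fun _ _ hf hf' =>
    ⟨id, IsIdealFlow.id F y, by rw [← h.1]; exact hf'.eventuallyEq hf⟩

theorem IsHol.comp (r : Reparam) {P Q : FPath F} (h : P.p 1 = Q.p 0) {φ : A.carrier → B.carrier}
    {ψ : B.carrier → C.carrier} (hφ : IsHol P A B φ) (hψ : IsHol Q B C ψ) :
    IsHol (FPath.concat r Q P h) A C (ψ ∘ φ) := by
  have ht := hφ.tendsto
  obtain ⟨rfl, rfl, f, g, hf, hg, hφ⟩ := hφ
  obtain ⟨h0, rfl, f', g', hf', hg', hψ⟩ := hψ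
  rw [← h0] at hg
  obtain ⟨g₁, hg₁, hfg⟩ := hf'.conj r hg
  refine ⟨FPath.concat_zero r Q P h, FPath.concat_one r Q P h, f' ∘ f, g' ∘ g₁, hf.concat r hf' h,
    hg'.comp r hg₁, ?_⟩
  rw [h0] at hfg
  filter_upwards [hφ, ht.eventually hψ, A.tendsto_val.eventually (hf.tendsto.eventually hfg)]
    with a h1 h2 h3
  simp only [Function.comp_apply, h2, h1, h3]

variable {S : ∀ x : M, Slice F x} {P P' : FPath F}

theorem isHol_of_flowsTo {φ : A.carrier → B.carrier} (h0 : P.p 0 = x) (h1 : P.p 1 = y)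
    {Z : ℝ → VF E M} (hZ : F.IsPlotOn (Icc 0 1) Z)
    (hI : ∀ t ∈ Icc (0 : ℝ) 1, F.IdealSec y ⊤ (Z t))
    (h : ∀ᶠ a : A.carrier in 𝓝 A.pt, ∃ w : M, FlowsTo P.X 1 (a : M) w ∧ FlowsTo Z 1 w (φ a)) :
    IsHol P A B φ := by
  obtain ⟨f, hf⟩ := P.exists_hasFlow
  obtain ⟨g, hg⟩ := (FPath.ofIdeal _ Z hZ hI).exists_hasFlow
  refine ⟨h0, h1, f, g, hf, (FPath.isIdeal_ofIdeal hZ hI).isIdealFlow hg, ?_⟩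
  subst h0 h1
  filter_upwards [h, A.tendsto_val.eventually hf,
    A.tendsto_val.eventually (hf.tendsto.eventually hg)] with a ⟨w, hw, hw'⟩ h2 h3
  have e := h2.unique P.plot hw
  rw [← e] at hw'
  exact hw'.unique hZ (h3.congr fun t ht => FPath.ofIdeal_X hZ hI ht)

theorem IsHolonomy.exists_isHol {c : HT S} (h : IsHolonomy S P c) (h0 : P.p 0 = x)
    (h1 : P.p 1 = y) : ∃ (φ : (S x).carrier → (S y).carrier) (f : SliceDiff (S x) (S y)),
      IsHol P (S x) (S y) φ ∧ f.1 = (φ : Germ _ _) ∧ c = ⟨(x, y), Quot.mk _ f⟩ := by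
  subst h0 h1
  obtain ⟨Z, hZ, hI, φ, f, hφ, hf, hc⟩ := h
  exact ⟨φ, f, isHol_of_flowsTo rfl rfl hZ hI hφ, hf, hc⟩

theorem exists_isHolonomy (r : Reparam) (S : ∀ x : M, Slice F x) (P : FPath F) :
    ∃ c : HT S, IsHolonomy S P c := by
  obtain ⟨T⟩ := (S (P.p 0)).exists_splitting
  obtain ⟨T'⟩ := (S (P.p 1)).exists_splitting
  obtain ⟨Φ, h1, h2, h3, Z, hZ, hI, h4⟩ := T.exists_holonomy r T' P rfl rfl
  exact ⟨_, Z, hZ, hI, Φ, ⟨(Φ : Germ _ _), Φ, h1, h2, rfl, h3⟩, h4, rfl, rfl⟩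

theorem IsHolonomy.eq_of_inExp {c c' : HT S} (h : IsHolonomy S P c) (h' : IsHolonomy S P' c')
    (e0 : P.p 0 = P'.p 0) (e1 : P.p 1 = P'.p 1)
    (hk : ∀ φ φ' : (S (P.p 0)).carrier → (S (P.p 1)).carrier, IsHol P (S (P.p 0)) (S (P.p 1)) φ →
      IsHol P' (S (P.p 0)) (S (P.p 1)) φ' →
      ∃ k, (S (P.p 1)).fol.InExp (S (P.p 1)).pt k ∧ φ' =ᶠ[𝓝 (S (P.p 0)).pt] k ∘ φ) : c = c' := by
  obtain ⟨φ, f, hφ, hf, rfl⟩ := h.exists_isHol rfl rfl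
  obtain ⟨φ', f', hφ', hf', rfl⟩ := h'.exists_isHol e0.symm e1.symm
  obtain ⟨k, hk, e⟩ := hk φ φ' hφ hφ'
  refine congrArg (Sigma.mk (P.p 0, P.p 1)) (Quot.sound ⟨k, hk, ?_⟩)
  rw [hf, hf', Germ.map_coe]
  exact Germ.coe_eq.2 e

theorem existsUnique_isHolonomy (r : Reparam) (S : ∀ x : M, Slice F x) (P : FPath F) :
    ∃! c : HT S, IsHolonomy S P c := by
  obtain ⟨c, hc⟩ := exists_isHolonomy r S P
  exact ⟨c, hc, fun c' hc' => hc'.eq_of_inExp hc rfl rfl fun _ _ h h' => h.exists_inExp_self r h'⟩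

theorem FHomotopic.holonomy_eq (r : Reparam) (h : FHomotopic P P') {c c' : HT S}
    (hc : IsHolonomy S P c) (hc' : IsHolonomy S P' c') : c = c' :=
  hc.eq_of_inExp hc' h.source_eq h.target_eq fun _ _ hφ hφ' =>
    hφ.exists_inExp r hφ' fun _ _ hf hf' => h.exists_isIdealFlow hf hf'

theorem SliceDiff.exists_preservesVF (f : SliceDiff A B) :
    ∃ Φ : PartialDiffeomorph (𝓡 A.dim) (𝓡 B.dim) A.carrier B.carrier ∞, A.pt ∈ Φ.source ∧
      Φ A.pt = B.pt ∧ f.1 = ((Φ : A.carrier → B.carrier) : Germ _ _) ∧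
      PreservesVF Φ A.fol B.fol := f.2

theorem SliceDiff.expRel_equivalence : Equivalence (SliceDiff.ExpRel (A := A) (B := B)) where
  refl f := ⟨id, VFModule.InExp.id _ _, (congrFun Germ.map_id f.1).symm⟩
  symm := by
    rintro f g ⟨h, hh, e⟩
    obtain ⟨k, hk, hkh, -⟩ := hh.exists_inv
    refine ⟨k, hk, ?_⟩
    obtain ⟨Φ, h1, h2, h3, -⟩ := f.exists_preservesVF
    rw [e, h3, Germ.map_coe, Germ.map_coe]
    have ht : Tendsto Φ (𝓝 A.pt) (𝓝 B.pt) := by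
      have := (Φ.contMDiffOn.contMDiffAt (Φ.open_source.mem_nhds h1)).continuousAt
      rwa [ContinuousAt, h2] at this
    refine Germ.coe_eq.2 ?_
    filter_upwards [ht.eventually hkh] with a ha
    exact ha.symm
  trans := by
    rintro f g h ⟨k, hk, e⟩ ⟨l, hl, e'⟩
    exact ⟨l ∘ k, .comp _ _ hl hk, by rw [e', e, Germ.map_map]⟩

theorem SameHolonomy.source_eq (h : SameHolonomy S P P') : P.p 0 = P'.p 0 := by
  obtain ⟨c, h1, h2⟩ := h
  obtain ⟨φ, f, -, -, e⟩ := h1.exists_isHol rfl rfl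
  obtain ⟨φ', f', -, -, e'⟩ := h2.exists_isHol rfl rfl
  exact congrArg (fun c : HT S => c.1.1) (e.symm.trans e')

theorem SameHolonomy.target_eq (h : SameHolonomy S P P') : P.p 1 = P'.p 1 := by
  obtain ⟨c, h1, h2⟩ := h
  obtain ⟨φ, f, -, -, e⟩ := h1.exists_isHol rfl rfl
  obtain ⟨φ', f', -, -, e'⟩ := h2.exists_isHol rfl rfl
  exact congrArg (fun c : HT S => c.1.2) (e.symm.trans e')

theorem SameHolonomy.exists_inExp (h : SameHolonomy S P P') (h0 : P.p 0 = x) (h1 : P.p 1 = y) :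
    ∃ (φ φ' : (S x).carrier → (S y).carrier) (f : SliceDiff (S x) (S y)), IsHol P (S x) (S y) φ ∧
      IsHol P' (S x) (S y) φ' ∧ f.1 = (φ : Germ _ _) ∧
      ∃ k, (S y).fol.InExp (S y).pt k ∧ φ' =ᶠ[𝓝 (S x).pt] k ∘ φ := by
  have e0 := h.source_eq
  have e1 := h.target_eq
  obtain ⟨c, hc, hc'⟩ := h
  obtain ⟨φ, f, hφ, hf, e⟩ := hc.exists_isHol h0 h1
  obtain ⟨φ', f', hφ', hf', e'⟩ := hc'.exists_isHol (e0.symm.trans h0) (e1.symm.trans h1)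
  have h2 : Quot.mk _ f = Quot.mk _ f' := eq_of_heq (Sigma.mk.inj (e.symm.trans e')).2
  obtain ⟨k, hk, hkf⟩ := (SliceDiff.expRel_equivalence.eqvGen_iff).1 (Quot.eqvGen_exact h2)
  refine ⟨φ, φ', f, hφ, hφ', hf, k, hk, ?_⟩
  rw [hf, hf', Germ.map_coe] at hkf
  exact Germ.coe_eq.1 hkf

theorem SameHolonomy.equivalence (r : Reparam) (S : ∀ x : M, Slice F x) :
    Equivalence (SameHolonomy S) where
  refl P := by
    obtain ⟨c, hc⟩ := exists_isHolonomy r S P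
    exact ⟨c, hc, hc⟩
  symm := fun ⟨c, h, h'⟩ => ⟨c, h', h⟩
  trans := by
    rintro P Q R ⟨c, h, h'⟩ ⟨d, h1, h2⟩
    rw [(existsUnique_isHolonomy r S Q).unique h1 h'] at h2
    exact ⟨c, h, h2⟩

theorem HolonomyGroupoid.mk_eq_mk (r : Reparam) :
    HolonomyGroupoid.mk S P = HolonomyGroupoid.mk S P' ↔ SameHolonomy S P P' :=
  ⟨fun h => (SameHolonomy.equivalence r S).eqvGen_iff.1 (Quot.eqvGen_exact h), Quot.sound⟩

theorem FHomotopic.sameHolonomy (r : Reparam) (h : FHomotopic P P') : SameHolonomy S P P' := by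
  obtain ⟨c, hc⟩ := exists_isHolonomy r S P
  obtain ⟨c', hc'⟩ := exists_isHolonomy r S P'
  exact ⟨c, hc, by rwa [h.holonomy_eq r hc hc']⟩

theorem SameHolonomy.concat (r : Reparam) {Q Q' : FPath F} (h : P.p 1 = Q.p 0)
    (h' : P'.p 1 = Q'.p 0) (hP : SameHolonomy S P P') (hQ : SameHolonomy S Q Q') :
    SameHolonomy S (FPath.concat r Q P h) (FPath.concat r Q' P' h') := by
  obtain ⟨c, hc⟩ := exists_isHolonomy r S (FPath.concat r Q P h)
  obtain ⟨c', hc'⟩ := exists_isHolonomy r S (FPath.concat r Q' P' h')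
  refine ⟨c, hc, ?_⟩
  rw [hc.eq_of_inExp hc' ?_ ?_ fun ψ ψ' hψ hψ' => ?_]
  · exact hc'
  · rw [FPath.concat_zero, FPath.concat_zero, hP.source_eq]
  · rw [FPath.concat_one, FPath.concat_one, hQ.target_eq]
  obtain ⟨φ, φ', -, hφ, hφ', -, k, hk, hkφ⟩ :=
    hP.exists_inExp (FPath.concat_zero r Q P h).symm rfl
  obtain ⟨χ, χ', f, hχ, hχ', hf, l, hl, hlχ⟩ :=
    hQ.exists_inExp h.symm (FPath.concat_one r Q P h).symm
  obtain ⟨Φ, hs, hpt, hΦ, hpres⟩ := f.exists_preservesVF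
  have hm := hpres.conj hs hk
  rw [hpt] at hm
  obtain ⟨a, ha, hae⟩ := hψ.exists_inExp_self r (hφ.comp r h hχ)
  obtain ⟨b, hb, hbe⟩ := (hφ'.comp r h' hχ').exists_inExp_self r hψ'
  have hχΦ : χ =ᶠ[𝓝 (S (P.p 1)).pt] Φ := Germ.coe_eq.1 (hf.symm.trans hΦ)
  refine ⟨_, .comp _ _ hb (.comp _ _ hl (.comp _ _ hm ha)), ?_⟩
  have hsrc : ∀ᶠ c in 𝓝 (S (P.p 1)).pt, c ∈ Φ.source := Φ.open_source.mem_nhds hs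
  filter_upwards [hae, hbe, hkφ, hφ.tendsto.eventually (hk.tendsto.eventually (hlχ.and hχΦ)),
    hφ.tendsto.eventually (hχΦ.and hsrc)] with p h1 h2 h3 h4 h5
  have e : Φ.symm (Φ (φ p)) = φ p := Φ.left_inv h5.2
  simp only [Function.comp_apply] at h1 h2 h3 h4 ⊢
  rw [h2, h3, h4.1, ← h1, h5.1, e, h4.2]

theorem HolonomyGroupoid.exists_groupoidOver (S : ∀ x : M, Slice F x) (r : Reparam) :
    ∃ ℋ : GroupoidOver M (HolonomyGroupoid S), ℋ.InheritedFrom (HolonomyGroupoid.mk S) r ∧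
      ∀ x, ℋ.one x = HolonomyGroupoid.mk S (FPath.const F x) :=
  SingFol.exists_groupoidOver Quot.mk_surjective r
    (fun _ _ h => ((HolonomyGroupoid.mk_eq_mk r).1 h).source_eq)
    (fun _ _ h => ((HolonomyGroupoid.mk_eq_mk r).1 h).target_eq)
    (fun _ _ _ _ h h' hP hQ => Quot.sound (SameHolonomy.concat r h h'
      ((HolonomyGroupoid.mk_eq_mk r).1 hP) ((HolonomyGroupoid.mk_eq_mk r).1 hQ)))
    (fun _ _ h => Quot.sound (h.sameHolonomy r))

/-- The diffeology of the maps whose composition with `q` is a plot. -/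
abbrev inducedDiffeology {B C : Type*} (q : B → C) (d : DiffeologicalSpace C) :
    DiffeologicalSpace B where
  plots n := {p | q ∘ p ∈ d.plots n}
  constant_plots x := d.constant_plots (q x)
  plot_reparam hp hf := d.plot_reparam hp hf
  locality hp := d.locality fun x => by
    obtain ⟨u, hu, hxu, h⟩ := hp x
    exact ⟨u, hu, hxu, fun hf hf' => h hf hf'⟩

/-- Quotient diffeologies can be taken in stages. -/
theorem quotientDiffeology_comp {A B C : Type*} [DiffeologicalSpace A] (π : A → B) (q : B → C) :
    quotientDiffeology (q ∘ π) = @quotientDiffeology B C (quotientDiffeology π) q := by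
  refine congrArg sInf (Set.ext fun d => ⟨fun h n p hp => ?_, fun h n p hp => ?_⟩)
  · exact DiffeologicalSpace.isPlot_sInf_iff.1 hp (inducedDiffeology q d) h
  · exact h n (π ∘ p) (DiffeologicalSpace.isPlot_sInf_iff.2 fun d' hd' => hd' n p hp)

end Holonomy

end SingFol

end

open SingFol in
/-- `𝓕`-homotopic `𝓕`-paths have the same (well-defined) holonomy, and the holonomy groupoid is a
quotient of the fundamental groupoid. -/
theorem mainTheorem3 {E : Type*} [NormedAddCommGroup E] [NormedSpace ℝ E] [FiniteDimensional ℝ E]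
    {M : Type*} [TopologicalSpace M] [T2Space M] [SecondCountableTopology M] [ChartedSpace E M]
    [IsManifold 𝓘(ℝ, E) ∞ M] (F : SingularFoliation E M) (S : ∀ x : M, Slice F x) (r : Reparam) :
    (∀ P : FPath F, ∃! c : HT S, IsHolonomy S P c) ∧
    (∀ P₀ P₁ : FPath F, FHomotopic P₀ P₁ →
      ∀ c₀ c₁ : HT S, IsHolonomy S P₀ c₀ → IsHolonomy S P₁ c₁ → c₀ = c₁) ∧
    ∃ (𝒢 : GroupoidOver M (MonGroupoid F)) (ℋ : GroupoidOver M (HolonomyGroupoid S))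
      (q : MonGroupoid F → HolonomyGroupoid S),
      𝒢.InheritedFrom MonGroupoid.mk r ∧
      ℋ.InheritedFrom (HolonomyGroupoid.mk S) r ∧
      (∀ P : FPath F, q (MonGroupoid.mk P) = HolonomyGroupoid.mk S P) ∧
      𝒢.IsHom ℋ q ∧ Function.Surjective q ∧
      HolonomyGroupoid.diffeology S = quotientDiffeology q := by
  refine ⟨existsUnique_isHolonomy r S, fun P₀ P₁ h c₀ c₁ h₀ h₁ => h.holonomy_eq r h₀ h₁, ?_⟩
  obtain ⟨𝒢, h𝒢, one𝒢⟩ := MonGroupoid.exists_groupoidOver F r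
  obtain ⟨ℋ, hℋ, oneℋ⟩ := HolonomyGroupoid.exists_groupoidOver S r
  let q : MonGroupoid F → HolonomyGroupoid S :=
    Quot.lift (HolonomyGroupoid.mk S) fun P P' h => Quot.sound (h.sameHolonomy r)
  refine ⟨𝒢, ℋ, q, h𝒢, hℋ, fun _ => rfl, ⟨?_, ?_, ?_, ?_⟩, ?_,
    quotientDiffeology_comp MonGroupoid.mk q⟩
  · rintro ⟨P⟩
    exact (hℋ.1 P).trans (h𝒢.1 P).symm
  · rintro ⟨P⟩
    exact (hℋ.2.1 P).trans (h𝒢.2.1 P).symm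
  · intro x
    rw [one𝒢, oneℋ]
    rfl
  · rintro ⟨Q⟩ ⟨P⟩ e e'
    have h : P.p 1 = Q.p 0 := (h𝒢.2.1 P).symm.trans (e.symm.trans (h𝒢.1 Q))
    exact (congrArg q (h𝒢.2.2 P Q h e)).trans (hℋ.2.2 P Q h e').symm
  · rintro ⟨P⟩
    exact ⟨MonGroupoid.mk P, rfl⟩
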